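/- For $t_1\in\mathbb R$, $S\in(0,\infty)$, $p\in[4,\infty)$, a function $u:\mathbb R^3\times[t_1,t_1+S]\to\mathbb R^3$ and $s\in[t_1,t_1+S]$, write $$D_{p}(s):=p\int_{t_1}^{s}\int_{\mathbb R^3}|\nabla u|^2|u|^{p-2}\,dx\,d\tau+\frac{4(p-2)}{p}\int_{t_1}^{s}\int_{\mathbb R^3}\big|\nabla|u|^{\frac p2}\big|^2\,dx\,d\tau ,$$ $$\mathcal E_{p,t_1}(S):=\sup_{t_1\le s\le t_1+S}\int_{\mathbb R^3}|u(x,s)|^p\,dx+D_p(t_1+S),\qquad \mathcal E'_{p,t_1}(S):=\sup_{t_1\le s\le t_1+S}\Big(\int_{\mathbb R^3}|u(x,s)|^p\,dx+D_p(s)\Big),$$ so that $\mathcal E'_{p,t_1}(S)\le\mathcal E_{p,t_1}(S)\le 2\,\mathcal E'_{p,t_1}(S)$. A smooth bounded weak Leray-Hopf solution to the Navier-Stokes equations $\partial_tu-\Delta u+u\cdot\nabla u+\nabla\pi=0$, $\nabla\cdot u=0$ on $\mathbb R^3\times[t_1,t_1+S]$ is a bounded function $u$ that is smooth on $\mathbb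 R^3\times[t_1,t_1+S]$, solves the equations in $\mathbb R^3\times(t_1,t_1+S)$ in the sense of distributions, takes values in $L^2(\mathbb R^3)$, is continuous in time with respect to the weak topology of $L^2(\mathbb R^3)$, and satisfies for all $t\in[t_1,t_1+S]$ the energy inequality $$\|u(\cdot,t)\|_{L^2(\mathbb R^3)}^2+2\int_{t_1}^t\int_{\mathbb R^3}|\nabla u|^2\,dx\,ds\le\|u(\cdot,t_1)\|_{L^2(\mathbb R^3)}^2 .$$ **Proposition.** There are constants $C_p\in(0,\infty)$, $p\in[4,\infty)$, depending only on $p$, such that $C_p\,p^{-3/2}$ converges to a positive real number as $p\to\infty$, and such that the following holds for all $t_1\in\mathbb R$, $S\in(0,\infty)$ and $p\in[4,\infty)$. Let $u$ be a smooth bounded weak Leray-Hopf solution to the Navier-Stokes equations on $\mathbb R^3\times[t_1,t_1+S]$ with initial data $u(\cdot,t_1)\in L^2(\mathbb R^3)\cap L^p(\mathbb R^3)$. Then $\|u\|_{L^5(\mathbb R^3\times(t_1,t_1+S))}$ and $\mathcal E_{p,t_1}(S)$ are finite, $$\mathcal E'_{p,t_1}(S)\le\|u(\cdot,t_1)\|_{L^p(\mathbb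 R^3)}^p+C_p\|u\|_{L^5(\mathbb R^3\times(t_1,t_1+S))}\,\mathcal E'_{p,t_1}(S),$$ and $$\mathcal E_{p,t_1}(S)\le 2\,\|u(\cdot,t_1)\|_{L^p(\mathbb R^3)}^p+C_p\|u\|_{L^5(\mathbb R^3\times(t_1,t_1+S))}\,\mathcal E_{p,t_1}(S).$$ -/

import Mathlib

open MeasureTheory Set Filter Asymptotics
open scoped ENNReal ContDiff

noncomputable section

namespace NavierStokes

/-- Three-dimensional Euclidean space; a time-dependent vector field is `u : ℝ → E3 → E3`,
with `u t x` the value at time `t` and position `x`. -/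
abbrev E3 : Type := EuclideanSpace ℝ (Fin 3)

/-- The partial derivative `∂ᵢ f (x)`. -/
def pd {F : Type*} [NormedAddCommGroup F] [NormedSpace ℝ F]
    (i : Fin 3) (f : E3 → F) (x : E3) : F :=
  fderiv ℝ f x (EuclideanSpace.single i 1)

/-- The squared (Euclidean, respectively Frobenius) norm `|∇f(x)|² = ∑ᵢ |∂ᵢf(x)|²`. -/
def gradSq {F : Type*} [NormedAddCommGroup F] [NormedSpace ℝ F]
    (f : E3 → F) (x : E3) : ℝ≥0∞ :=
  ∑ i : Fin 3, ‖pd i f x‖ₑ ^ 2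

/-- The divergence of a vector field. -/
def divergence (v : E3 → E3) (x : E3) : ℝ :=
  ∑ i : Fin 3, pd i v x i

/-- Smooth functions on space-time with compact support in `(a, b) × ℝ³`. -/
structure IsTest {F : Type*} [NormedAddCommGroup F] [NormedSpace ℝ F]
    (a b : ℝ) (φ : ℝ → E3 → F) : Prop where
  smooth : ContDiff ℝ ∞ (fun z : ℝ × E3 => φ z.1 z.2)
  compact : HasCompactSupport (fun z : ℝ × E3 => φ z.1 z.2)
  support : tsupport (fun z : ℝ × E3 => φ z.1 z.2) ⊆ Ioo a b ×ˢ univ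

/-- `u` solves `∂ₜu - Δu + u·∇u + ∇π = 0`, `∇·u = 0` on `ℝ³ × (a, b)` in the sense of
distributions. The pressure is eliminated by testing the momentum equation (with
`u·∇u = ∇·(u ⊗ u)`) with divergence-free test fields. -/
structure IsDistribSolution (a b : ℝ) (u : ℝ → E3 → E3) : Prop where
  div_free : ∀ ψ : ℝ → E3 → ℝ, IsTest a b ψ →
    ∫ t in a..b, ∫ x, ∑ i : Fin 3, u t x i * pd i (ψ t) x = 0
  momentum : ∀ φ : ℝ → E3 → E3, IsTest a b φ → (∀ t x, divergence (φ t) x = 0) →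
    ∫ t in a..b, ∫ x,
      (inner ℝ (u t x) (deriv (fun s => φ s x) t)
        + inner ℝ (u t x) (Laplacian.laplacian (φ t) x)
        + ∑ i : Fin 3, ∑ j : Fin 3, u t x i * u t x j * pd i (φ t) x j) = 0

/-- A smooth bounded weak Leray-Hopf solution on `ℝ³ × [a, b]` with initial data `u a ∈ L²`:
a bounded function, smooth up to the boundary of the slab, that solves the Navier-Stokes equations
in the sense of distributions, is weakly continuous in time with values in `L²` and satisfies
the energy inequality. As `u` is smooth, its weak gradient is the classical one. -/
structure IsSmoothBoundedLerayHopf (a b : ℝ) (u : ℝ → E3 → E3) : Prop where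
  smooth : ContDiffOn ℝ ∞ (fun z : ℝ × E3 => u z.1 z.2) (Icc a b ×ˢ univ)
  bounded : ∃ M : ℝ, ∀ t ∈ Icc a b, ∀ x, ‖u t x‖ ≤ M
  memLp_two : ∀ t ∈ Icc a b, MemLp (u t) 2 volume
  weak_continuous : ∀ w : E3 → E3, MemLp w 2 volume →
    ContinuousOn (fun t => ∫ x, inner ℝ (u t x) (w x)) (Icc a b)
  equation : IsDistribSolution a b u
  energy : ∀ t ∈ Icc a b,
    (∫⁻ x, ‖u t x‖ₑ ^ 2) + 2 * ∫⁻ s in Ioo a t, ∫⁻ x, gradSq (u s) x ≤ ∫⁻ x, ‖u a x‖ₑ ^ 2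

/-- The dissipative part of the `L^p` energy on `ℝ³ × (a, b)`:
`p ∬ |∇u|² |u|^(p-2) + (4(p-2)/p) ∬ |∇|u|^(p/2)|²`. -/
def dissipation (p a b : ℝ) (u : ℝ → E3 → E3) : ℝ≥0∞ :=
  ENNReal.ofReal p * (∫⁻ s in Ioo a b, ∫⁻ x, gradSq (u s) x * ‖u s x‖ₑ ^ (p - 2))
  + ENNReal.ofReal (4 * (p - 2) / p) *
      (∫⁻ s in Ioo a b, ∫⁻ x, gradSq (fun y => ‖u s y‖ ^ (p / 2)) x)

/-- The `L^p` energy with the dissipation taken over the whole time interval `(a, a + S)`. -/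
def lpEnergy (p a S : ℝ) (u : ℝ → E3 → E3) : ℝ≥0∞ :=
  (⨆ s ∈ Icc a (a + S), ∫⁻ x, ‖u s x‖ₑ ^ p) + dissipation p a (a + S) u

/-- The `L^p` energy with the dissipation taken up to the running time `s`:
the supremum over `s` of the `L^p` norm at time `s` plus the dissipation on `(a, s)`. -/
def lpEnergyRunning (p a S : ℝ) (u : ℝ → E3 → E3) : ℝ≥0∞ :=
  ⨆ s ∈ Icc a (a + S), ((∫⁻ x, ‖u s x‖ₑ ^ p) + dissipation p a s u)

/-- The norm of `u` in `L⁵(ℝ³ × (a, a + S))`. -/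
def l5Norm (a S : ℝ) (u : ℝ → E3 → E3) : ℝ≥0∞ :=
  eLpNorm (fun z : ℝ × E3 => u z.1 z.2) 5 ((volume.restrict (Ioo a (a + S))).prod volume)

end NavierStokes

end

/-!
Let `Pₛ` be the heat semigroup. Formally the estimate comes from testing the equation with
`|u|^(p-2) u`: the viscous term produces the dissipation, and what has to be bounded is
`∬ ∇(|u|^(p-2) u) : (u ⊗ u)` together with the pressure term. Neither the decay of the derivatives
of `u` needed for this computation nor the Calderón–Zygmund estimate for the pressure is available,
so both are replaced.

*Mollification.* The field `v = P_ε u` satisfies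
`∂ₜ v = Δv - ∑ ∂ᵢ P_ε (uᵢ u) - ∫_ε^∞ ∑ ∇∂ᵢ∂ⱼ Pₛ (uᵢuⱼ) ds` (`IsFlow.sub_eq_integral`). This is
obtained from divergence-free test fields `∇∂ₖη - eₖ Δη`, with `η` a translate of the heat kernel at
time `s`: this gives an evolution equation for `Δ Pₛ u = ∂ₛ Pₛ u`, which is integrated over
`s ∈ (ε, ∞)`. In the outcome the pressure is expressed by the heat semigroup alone, and testing with
`|v|^(p-2) v` is legitimate (`IsFlow.energy_balance`).

*The pressure.* By `Pₛ = P_{s/2} P_{s/2}` the pressure term becomes a sum of integrals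
`∬ ∂ᵢ P_{s/2} (div (|v|^(p-2) v)) ∂ⱼ P_{s/2} (uᵢuⱼ) dx ds`, and these are controlled by
`∫₀^∞∫ |∂ₖ Pₛ f| |∂ₗ Pₛ g| dx ds ≤ 32 (‖f‖_q^q + ‖g‖_{q'}^{q'})`
(`lintegral_bilinear_heat_le`). The latter holds because there is a function `B(x, y)` on the
quadrant with `0 ≤ B ≤ 32 (x^q + y^{q'})` whose Hessian dominates
`P ξ² + 4 P⁻¹ η² ≥ 4 |ξη|` for some `P > 0` (`bell_hessian`, `bell_le`): the integral of `B(Pₛf, Pₛg)` over space decreases in `s` at least at the rate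
`4 ∫ |∂ₖ Pₛ f| |∂ₗ Pₛ g|`. The constant is uniform for `2 < q ≤ 5`.

*Hölder's inequality.* For `q = 5p/(p+3)`, which lies between `2` and `5`, Hölder's inequality in
space-time bounds the nonlinear term by `2400 (p-1) ‖u‖₅ ‖u‖_{5p/3}^{p/2}` times the square root of the dissipation
(`IsFlow.lintegral_nonlinearTerm_le`). As the energy `X` of `v` contains `p` times the dissipation,
`X ≤ A + B √X` with `A = ‖u(a)‖_p^p` and `B = 2400 p^(3/2) ‖u‖₅ ‖u‖_{5p/3}^{p/2}`, uniformly in `ε`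
(`IsFlow.mollEnergy_le_add_mul_rpow_half`). The power `3/2` arises here, from `p (p-1) / √p`.

*Conclusion.* The solutions of `x ≤ A + B √x` form an interval `[0, Y]`. So the bound by `Y` passes
to the limit `ε → 0` by Fatou's lemma and to the supremum over the final time, and the inequality
for the supremum `E'` is recovered (`IsSmoothBoundedLerayHopf.energy_le`). Sobolev's inequality for
`|u|^(p/2)` gives `‖u‖_{5p/3}^{p/2} ≤ K √E'`, whence `E' ≤ A + c p^(3/2) ‖u‖₅ E'`
(`exists_const_energy_le`). The inequality for `E` follows from `E' ≤ E ≤ 2 E'`, with twice the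
constant.
-/

set_option linter.unusedSectionVars false

namespace NavierStokes

/-! ### Partial derivatives and kernels of rapid decay -/

section PartialDerivatives

variable {F : Type*} [NormedAddCommGroup F] [NormedSpace ℝ F]

theorem fderiv_eq_sum_pd (f : E3 → F) (x h : E3) :
    fderiv ℝ f x h = ∑ i : Fin 3, h i • pd i f x := by
  conv_lhs => rw [show h = ∑ i : Fin 3, h i • EuclideanSpace.single i (1 : ℝ) by
    ext j; simp [Finset.sum_apply, Pi.single_apply]]
  simp [pd, map_sum]

theorem contDiff_pd {f : E3 → F} (hf : ContDiff ℝ ∞ f) (i : Fin 3) : ContDiff ℝ ∞ (pd i f) := by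
  have := (hf.fderiv_right (m := ∞) (by simp)).clm_apply
    (contDiff_const (c := (EuclideanSpace.single i (1 : ℝ) : E3)))
  exact this

theorem norm_iteratedFDeriv_pd_le {f : E3 → F} (hf : ContDiff ℝ ∞ f) (i : Fin 3) (n : ℕ) (x : E3) :
    ‖iteratedFDeriv ℝ n (pd i f) x‖ ≤ ‖iteratedFDeriv ℝ (n + 1) f x‖ := by
  have h := (ContinuousLinearMap.apply ℝ F
    (EuclideanSpace.single i (1 : ℝ) : E3)).norm_iteratedFDeriv_comp_left (f := fderiv ℝ f) (x := x)
    (N := ∞) (n := n) ((hf.fderiv_right (m := ∞) (by simp)).contDiffAt) (by exact_mod_cast le_top)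
  refine h.trans ?_
  rw [norm_iteratedFDeriv_fderiv]
  refine mul_le_of_le_one_left (norm_nonneg _) ?_
  refine ContinuousLinearMap.opNorm_le_bound _ zero_le_one fun A => ?_
  have := A.le_opNorm (EuclideanSpace.single i (1 : ℝ))
  simpa using this

theorem norm_fderiv_le_sum_pd (f : E3 → F) (x : E3) :
    ‖fderiv ℝ f x‖ ≤ ∑ i : Fin 3, ‖pd i f x‖ := by
  refine ContinuousLinearMap.opNorm_le_bound _ (by positivity) fun h => ?_
  rw [fderiv_eq_sum_pd, Finset.sum_mul]
  refine (norm_sum_le _ _).trans (Finset.sum_le_sum fun i _ => ?_)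
  rw [norm_smul, mul_comm]
  exact mul_le_mul_of_nonneg_left (PiLp.norm_apply_le h i) (norm_nonneg _)

theorem pd_sub {f g : E3 → F} {x : E3} (i : Fin 3) (hf : DifferentiableAt ℝ f x)
    (hg : DifferentiableAt ℝ g x) : pd i (fun y => f y - g y) x = pd i f x - pd i g x := by
  simp only [pd]; rw [fderiv_fun_sub hf hg]; rfl

theorem pd_sum {ι : Type*} (s : Finset ι) {f : ι → E3 → F} {x : E3} (i : Fin 3)
    (hf : ∀ k ∈ s, DifferentiableAt ℝ (f k) x) :
    pd i (fun y => ∑ k ∈ s, f k y) x = ∑ k ∈ s, pd i (f k) x := by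
  simp only [pd]; rw [fderiv_fun_sum hf]; simp

theorem pd_smul {f : E3 → ℝ} {g : E3 → F} {x : E3} (i : Fin 3) (hf : DifferentiableAt ℝ f x)
    (hg : DifferentiableAt ℝ g x) :
    pd i (fun y => f y • g y) x = pd i f x • g x + f x • pd i g x := by
  simp only [pd]; rw [fderiv_fun_smul hf hg]; simp [add_comm]

theorem pd_mul {f g : E3 → ℝ} {x : E3} (i : Fin 3) (hf : DifferentiableAt ℝ f x)
    (hg : DifferentiableAt ℝ g x) :
    pd i (fun y => f y * g y) x = pd i f x * g x + f x * pd i g x :=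
  pd_smul i hf hg

theorem pd_const_mul {f : E3 → ℝ} {x : E3} (i : Fin 3) (c : ℝ) (hf : DifferentiableAt ℝ f x) :
    pd i (fun y => c * f y) x = c * pd i f x := by
  simp only [pd]; rw [fderiv_const_mul hf]; simp

theorem pd_clm_comp {F' : Type*} [NormedAddCommGroup F'] [NormedSpace ℝ F'] (L : F →L[ℝ] F')
    {f : E3 → F} {x : E3} (i : Fin 3) (hf : DifferentiableAt ℝ f x) :
    pd i (fun y => L (f y)) x = L (pd i f x) := by
  simp only [pd]
  rw [show (fun y => L (f y)) = L ∘ f from rfl, (L.hasFDerivAt.comp x hf.hasFDerivAt).fderiv]; rfl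

theorem pd_apply {v : E3 → E3} {x : E3} (i k : Fin 3) (hv : DifferentiableAt ℝ v x) :
    pd i (fun y => v y k) x = pd i v x k :=
  pd_clm_comp (EuclideanSpace.proj k : E3 →L[ℝ] ℝ) i hv

theorem pd_comp_const_sub (f : E3 → F) (i : Fin 3) (a x : E3) :
    pd i (fun y => f (a - y)) x = - pd i f (a - x) := by
  simp only [pd]
  rw [show (fun y => f (a - y)) = fun y => f (-(y - a)) by ext; simp,
    fderiv_comp_sub (f := fun y => f (-y)), show (fun y => f (-y)) = fun y => f ((-1 : ℝ) • y)
      by ext; simp, fderiv_comp_smul]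
  simp

theorem pd_comp_smul (f : E3 → F) (i : Fin 3) (c : ℝ) (x : E3) :
    pd i (fun y => f (c • y)) x = c • pd i f (c • x) := by
  simp only [pd]; rw [fderiv_comp_smul]; rfl

theorem pd_comm {f : E3 → F} (hf : ContDiff ℝ ∞ f) (i j : Fin 3) (x : E3) :
    pd i (pd j f) x = pd j (pd i f) x := by
  have h1 : DifferentiableAt ℝ (fderiv ℝ f) x :=
    (hf.fderiv_right (m := ∞) (by simp)).differentiable (by simp) x
  have key : ∀ i j : Fin 3, pd i (pd j f) x =
      fderiv ℝ (fderiv ℝ f) x (EuclideanSpace.single i 1) (EuclideanSpace.single j 1) := by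
    intro i j
    exact pd_clm_comp (ContinuousLinearMap.apply ℝ F (EuclideanSpace.single j (1 : ℝ) : E3)) i h1
  rw [key, key]
  exact (hf.contDiffAt.isSymmSndFDerivAt (by simpa using ENat.LEInfty.out)) _ _

/-- A differentiable function with continuous partial derivatives is `C¹`. -/
theorem contDiff_one_of_pd {f : E3 → F} (hf : Differentiable ℝ f)
    (h : ∀ i, Continuous (pd i f)) : ContDiff ℝ 1 f := by
  rw [contDiff_one_iff_fderiv]
  refine ⟨hf, ?_⟩
  have : fderiv ℝ f = fun x => ∑ i : Fin 3,
      (EuclideanSpace.proj i : E3 →L[ℝ] ℝ).smulRight (pd i f x) := by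
    ext x v
    rw [fderiv_eq_sum_pd]; simp
  rw [this]
  refine continuous_finsetSum _ fun i _ => ?_
  exact (ContinuousLinearMap.smulRightL ℝ E3 F (EuclideanSpace.proj i : E3 →L[ℝ] ℝ)).continuous.comp
    (h i)

end PartialDerivatives

/-- The weight `(1 + |x|)⁻⁴`. The exponent exceeds the dimension, so the weight is integrable on
`ℝ³`; products of the weight with bounded functions are therefore integrable, too. -/
noncomputable def wt (x : E3) : ℝ := ((1 + ‖x‖) ^ 4)⁻¹

theorem wt_pos (x : E3) : 0 < wt x := by unfold wt; positivity

theorem integrable_wt : Integrable wt := by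
  have := integrable_one_add_norm (E := E3) (μ := volume) (r := 4) (by simp; norm_num)
  refine this.congr (ae_of_all _ fun x => ?_)
  simp only [wt]
  rw [Real.rpow_neg (by positivity)]
  norm_cast

theorem wt_sub_le (x y : E3) : wt (x - y) ≤ (1 + ‖x‖) ^ 4 * wt y := by
  unfold wt
  rw [← div_eq_mul_inv, inv_eq_one_div, div_le_div_iff₀ (by positivity) (by positivity), one_mul,
    ← mul_pow]
  refine pow_le_pow_left₀ (by positivity) ?_ 4
  have : ‖y‖ ≤ ‖x‖ + ‖x - y‖ := by
    have := norm_sub_norm_le y x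
    rw [norm_sub_rev] at this; linarith
  nlinarith [norm_nonneg x, norm_nonneg (x - y)]

/-- A smooth function on `ℝ³` all of whose derivatives are `O((1 + |x|)⁻⁴)`. -/
structure IsKernel (K : E3 → ℝ) : Prop where
  smooth : ContDiff ℝ ∞ K
  decay : ∀ n : ℕ, ∃ C, ∀ x, ‖iteratedFDeriv ℝ n K x‖ ≤ C * wt x

namespace IsKernel

variable {K : E3 → ℝ}

theorem exists_abs_le (hK : IsKernel K) : ∃ C, 0 ≤ C ∧ ∀ x, |K x| ≤ C * wt x := by
  obtain ⟨C, hC⟩ := hK.decay 0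
  refine ⟨|C|, abs_nonneg _, fun x => ?_⟩
  have := hC x
  rw [norm_iteratedFDeriv_zero, Real.norm_eq_abs] at this
  exact this.trans (mul_le_mul_of_nonneg_right (le_abs_self C) (wt_pos x).le)

theorem continuous (hK : IsKernel K) : Continuous K := hK.smooth.continuous

theorem differentiable (hK : IsKernel K) : Differentiable ℝ K :=
  hK.smooth.differentiable (by simp)

theorem integrable (hK : IsKernel K) : Integrable K := by
  obtain ⟨C, -, hC⟩ := hK.exists_abs_le
  exact (integrable_wt.const_mul C).mono' hK.continuous.aestronglyMeasurable (ae_of_all _ hC)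

theorem pd (hK : IsKernel K) (i : Fin 3) : IsKernel (pd i K) where
  smooth := contDiff_pd hK.smooth i
  decay n := by
    obtain ⟨C, hC⟩ := hK.decay (n + 1)
    exact ⟨C, fun x => (norm_iteratedFDeriv_pd_le hK.smooth i n x).trans (hC x)⟩

theorem comp_const_sub (hK : IsKernel K) (x : E3) : IsKernel (fun y => K (x - y)) where
  smooth := hK.smooth.comp (contDiff_const.sub contDiff_id)
  decay n := by
    obtain ⟨C, hC⟩ := hK.decay n
    refine ⟨|C| * (1 + ‖x‖) ^ 4, fun y => ?_⟩
    have h1 : ‖iteratedFDeriv ℝ n (fun y => K (x - y)) y‖ = ‖iteratedFDeriv ℝ n K (x - y)‖ := by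
      have := (LinearIsometryEquiv.neg ℝ (E := E3)).norm_iteratedFDeriv_comp_right
        (fun z => K (x + z)) y n
      rw [show (fun z => K (x + z)) ∘ (LinearIsometryEquiv.neg ℝ (E := E3)) = fun y => K (x - y) by
        ext z; simp [sub_eq_add_neg]] at this
      rw [this]
      rw [iteratedFDeriv_comp_add_left]
      simp [sub_eq_add_neg]
    rw [h1, mul_assoc]
    refine (hC _).trans ?_
    calc C * wt (x - y) ≤ |C| * wt (x - y) :=
          mul_le_mul_of_nonneg_right (le_abs_self C) (wt_pos _).le
      _ ≤ _ := mul_le_mul_of_nonneg_left (wt_sub_le x y) (abs_nonneg _)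

theorem add {L : E3 → ℝ} (hK : IsKernel K) (hL : IsKernel L) : IsKernel (fun y => K y + L y) where
  smooth := hK.smooth.add hL.smooth
  decay n := by
    obtain ⟨C, hC⟩ := hK.decay n
    obtain ⟨D, hD⟩ := hL.decay n
    refine ⟨C + D, fun x => ?_⟩
    rw [show (fun y => K y + L y) = K + L from rfl, iteratedFDeriv_add_apply
      (hK.smooth.contDiffAt.of_le (by exact_mod_cast le_top))
      (hL.smooth.contDiffAt.of_le (by exact_mod_cast le_top)), add_mul]
    exact (norm_add_le _ _).trans (add_le_add (hC x) (hD x))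

theorem zero : IsKernel (fun _ => 0) where
  smooth := contDiff_const
  decay n := ⟨0, fun x => by
    rw [iteratedFDeriv_fun_zero]; simp⟩

theorem sum {ι : Type*} (s : Finset ι) {L : ι → E3 → ℝ} (hL : ∀ i ∈ s, IsKernel (L i)) :
    IsKernel (fun y => ∑ i ∈ s, L i y) := by
  classical
  induction s using Finset.induction_on with
  | empty => simpa using zero
  | insert a s ha ih =>
    simp only [Finset.sum_insert ha]
    exact (hL a (Finset.mem_insert_self _ _)).add
      (ih fun i hi => hL i (Finset.mem_insert_of_mem hi))

end IsKernel

/-- Bounded continuous functions on `ℝ³`. -/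
structure IsBC {F : Type*} [NormedAddCommGroup F] (f : E3 → F) : Prop where
  continuous : Continuous f
  bounded : ∃ M, ∀ x, ‖f x‖ ≤ M

/-- The convolution `K * f`. -/
noncomputable def cv {F : Type*} [NormedAddCommGroup F] [NormedSpace ℝ F] (K : E3 → ℝ) (f : E3 → F) (x : E3) : F :=
  ∫ y, K (x - y) • f y

section Convolution

variable {F : Type*} [NormedAddCommGroup F] [NormedSpace ℝ F]
  {K : E3 → ℝ} {f g : E3 → F}

namespace IsBC

theorem exists_bound {f : E3 → F} (hf : IsBC f) : ∃ M, 0 ≤ M ∧ ∀ x, ‖f x‖ ≤ M := by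
  obtain ⟨M, hM⟩ := hf.bounded
  exact ⟨M, (norm_nonneg _).trans (hM 0), hM⟩

theorem add (hf : IsBC f) (hg : IsBC g) : IsBC (fun x => f x + g x) := by
  obtain ⟨M, hM⟩ := hf.bounded
  obtain ⟨N, hN⟩ := hg.bounded
  exact ⟨hf.continuous.add hg.continuous,
    M + N, fun x => (norm_add_le _ _).trans (add_le_add (hM x) (hN x))⟩

theorem neg (hf : IsBC f) : IsBC (fun x => - f x) := by
  obtain ⟨M, hM⟩ := hf.bounded
  exact ⟨hf.continuous.neg, M, fun x => by simpa using hM x⟩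

theorem sum {ι : Type*} (s : Finset ι) {f : ι → E3 → F} (hf : ∀ i ∈ s, IsBC (f i)) :
    IsBC (fun x => ∑ i ∈ s, f i x) := by
  classical
  induction s using Finset.induction_on with
  | empty => exact ⟨by simpa using continuous_const, 0, by simp⟩
  | insert a s ha ih =>
    simp only [Finset.sum_insert ha]
    exact (hf a (Finset.mem_insert_self _ _)).add
      (ih fun i hi => hf i (Finset.mem_insert_of_mem hi))

theorem smul {f : E3 → ℝ} (hf : IsBC f) (hg : IsBC g) : IsBC (fun x => f x • g x) := by
  obtain ⟨M, hM0, hM⟩ := hf.exists_bound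
  obtain ⟨N, hN⟩ := hg.bounded
  refine ⟨hf.continuous.smul hg.continuous, M * N, fun x => ?_⟩
  rw [norm_smul]
  exact mul_le_mul (hM x) (hN x) (norm_nonneg _) hM0

theorem mul {f g : E3 → ℝ} (hf : IsBC f) (hg : IsBC g) : IsBC (fun x => f x * g x) := hf.smul hg

theorem apply {v : E3 → E3} (hv : IsBC v) (k : Fin 3) : IsBC (fun x => v x k) := by
  obtain ⟨M, hM⟩ := hv.bounded
  refine ⟨?_, M, fun x => (PiLp.norm_apply_le (v x) k).trans (hM x)⟩
  exact (EuclideanSpace.proj k : E3 →L[ℝ] ℝ).continuous.comp hv.continuous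

/-- The product of an integrable function and a bounded continuous one is integrable. -/
theorem integrable_smul {A : E3 → ℝ} (hf : IsBC f) (hA : Integrable A) :
    Integrable (fun x => A x • f x) := by
  obtain ⟨M, hM⟩ := hf.bounded
  exact hA.smul_of_top_left
    (memLp_top_of_bound hf.continuous.aestronglyMeasurable M (ae_of_all _ hM))

theorem integrable_mul {A f : E3 → ℝ} (hf : IsBC f) (hA : Integrable A) :
    Integrable (fun x => A x * f x) := hf.integrable_smul hA

end IsBC

theorem cv_eq (K : E3 → ℝ) (f : E3 → F) (x : E3) : cv K f x = ∫ y, K y • f (x - y) := by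
  unfold cv
  rw [← integral_sub_left_eq_self (fun y => K (x - y) • f y) volume x]
  simp

theorem cv_apply [CompleteSpace F] {v : E3 → E3} {x : E3} (k : Fin 3)
    (h : Integrable fun y => K (x - y) • v y) :
    cv K v x k = cv K (fun y => v y k) x := by
  unfold cv
  have := (EuclideanSpace.proj k : E3 →L[ℝ] ℝ).integral_comp_comm h
  simpa using this.symm

theorem integrable_cv_integrand (hK : Integrable K) (hf : IsBC f) (x : E3) :
    Integrable fun y => K (x - y) • f y :=
  hf.integrable_smul (hK.comp_sub_left x)

theorem integrable_cv_integrand' (hK : Integrable K) (hf : IsBC f) (x : E3) :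
    Integrable fun y => K y • f (x - y) := by
  have h : IsBC fun y => f (x - y) := by
    obtain ⟨M, hM⟩ := hf.bounded
    exact ⟨hf.continuous.comp (continuous_const.sub continuous_id), M, fun y => hM _⟩
  exact h.integrable_smul hK

theorem norm_cv_le {M : ℝ} (hK : Integrable K) (hM : ∀ x, ‖f x‖ ≤ M) (x : E3) :
    ‖cv K f x‖ ≤ (∫ y, |K y|) * M := by
  rw [cv_eq, ← integral_mul_const]
  refine norm_integral_le_of_norm_le (hK.abs.mul_const M) (ae_of_all _ fun y => ?_)
  rw [norm_smul, Real.norm_eq_abs]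
  exact mul_le_mul_of_nonneg_left (hM _) (abs_nonneg _)

theorem IsBC.cv (hf : IsBC f) (hK : Integrable K) : IsBC (cv K f) := by
  obtain ⟨M, hM0, hM⟩ := hf.exists_bound
  refine ⟨?_, _, norm_cv_le hK hM⟩
  rw [funext (cv_eq K f)]
  refine continuous_of_dominated (bound := fun y => |K y| * M)
    (fun x => (integrable_cv_integrand' hK hf x).aestronglyMeasurable)
    (fun x => ae_of_all _ fun y => ?_) (hK.abs.mul_const M) (ae_of_all _ fun y => ?_)
  · rw [norm_smul, Real.norm_eq_abs]
    exact mul_le_mul_of_nonneg_left (hM _) (abs_nonneg _)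
  · exact continuous_const.smul (hf.continuous.comp (continuous_id.sub continuous_const))

theorem hasFDerivAt_cv [CompleteSpace F] (hK : IsKernel K) (hf : IsBC f) (x : E3) :
    HasFDerivAt (cv K f) (∫ y, (fderiv ℝ K (x - y)).smulRight (f y)) x := by
  obtain ⟨M, hM0, hM⟩ := hf.exists_bound
  obtain ⟨C, hC⟩ := hK.decay 1
  have hC0 : 0 ≤ C := by
    by_contra h
    have := (norm_nonneg _).trans (hC 0)
    have h2 := wt_pos 0
    nlinarith
  have hfd : Continuous (fderiv ℝ K) := hK.smooth.continuous_fderiv (by simp)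
  have : SecondCountableTopologyEither E3 (E3 →L[ℝ] F) := secondCountableTopologyEither_of_left _ _
  unfold cv
  refine hasFDerivAt_integral_of_dominated_of_fderiv_le (𝕜 := ℝ)
    (F' := fun z y => (fderiv ℝ K (z - y)).smulRight (f y)) (s := Metric.ball x 1)
    (bound := fun y => C * ((2 + ‖x‖) ^ 4 * wt y) * M)
    (Metric.ball_mem_nhds x one_pos)
    (Eventually.of_forall fun z => (integrable_cv_integrand hK.integrable hf z).aestronglyMeasurable)
    (integrable_cv_integrand hK.integrable hf x) ?_ ?_ ?_ ?_
  · refine Continuous.aestronglyMeasurable ?_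
    have h1 : Continuous fun y => fderiv ℝ K (x - y) :=
      hfd.comp (continuous_const.sub continuous_id)
    exact (by
      have h3 : Continuous fun y => ContinuousLinearMap.smulRightL ℝ E3 F (fderiv ℝ K (x - y)) :=
        (ContinuousLinearMap.smulRightL ℝ E3 F).continuous.comp h1
      exact h3.clm_apply hf.continuous)
  · refine ae_of_all _ fun y z hz => ?_
    rw [ContinuousLinearMap.norm_smulRight_apply]
    have h1 : ‖fderiv ℝ K (z - y)‖ ≤ C * wt (z - y) := by
      have := hC (z - y)
      rwa [← norm_iteratedFDeriv_fderiv, norm_iteratedFDeriv_zero] at this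
    have h2 : wt (z - y) ≤ (2 + ‖x‖) ^ 4 * wt y := by
      refine (wt_sub_le z y).trans (mul_le_mul_of_nonneg_right ?_ (wt_pos y).le)
      refine pow_le_pow_left₀ (by positivity) ?_ 4
      have : ‖z‖ ≤ ‖x‖ + 1 := by
        have := norm_sub_norm_le z x
        rw [Metric.mem_ball, dist_eq_norm] at hz; linarith
      linarith
    exact mul_le_mul (h1.trans (mul_le_mul_of_nonneg_left h2 hC0)) (hM y) (norm_nonneg _)
      (mul_nonneg hC0 (mul_nonneg (by positivity) (wt_pos y).le))
  · exact ((integrable_wt.const_mul _).const_mul C).mul_const M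
  · refine ae_of_all _ fun y z _ => ?_
    have h1 : HasFDerivAt (fun z => K (z - y)) (fderiv ℝ K (z - y)) z := by
      rw [hasFDerivAt_comp_sub]
      exact (hK.differentiable (z - y)).hasFDerivAt
    exact h1.smul_const (f y)

theorem differentiable_cv [CompleteSpace F] (hK : IsKernel K) (hf : IsBC f) :
    Differentiable ℝ (cv K f) := fun x => (hasFDerivAt_cv hK hf x).differentiableAt

theorem pd_cv [CompleteSpace F] (hK : IsKernel K) (hf : IsBC f) (i : Fin 3) :
    pd i (cv K f) = cv (pd i K) f := by
  ext1 x
  obtain ⟨M, hM0, hM⟩ := hf.exists_bound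
  obtain ⟨C, hC⟩ := hK.decay 1
  have hfd : Continuous (fderiv ℝ K) := hK.smooth.continuous_fderiv (by simp)
  have : SecondCountableTopologyEither E3 (E3 →L[ℝ] F) := secondCountableTopologyEither_of_left _ _
  have hint : Integrable fun y => (fderiv ℝ K (x - y)).smulRight (f y) := by
    have hb : Integrable fun y => C * wt (x - y) * M :=
      ((integrable_wt.comp_sub_left x).const_mul C).mul_const M
    refine hb.mono' ?_ (ae_of_all _ fun y => ?_)
    · have h1 : Continuous fun y => fderiv ℝ K (x - y) :=
        hfd.comp (continuous_const.sub continuous_id)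
      have h3 : Continuous fun y => ContinuousLinearMap.smulRightL ℝ E3 F (fderiv ℝ K (x - y)) :=
        (ContinuousLinearMap.smulRightL ℝ E3 F).continuous.comp h1
      exact (h3.clm_apply hf.continuous).aestronglyMeasurable
    · rw [ContinuousLinearMap.norm_smulRight_apply]
      have := hC (x - y)
      rw [← norm_iteratedFDeriv_fderiv, norm_iteratedFDeriv_zero] at this
      exact mul_le_mul this (hM y) (norm_nonneg _) ((norm_nonneg _).trans this)
  unfold NavierStokes.pd
  rw [(hasFDerivAt_cv hK hf x).fderiv, ContinuousLinearMap.integral_apply hint]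
  rfl

theorem contDiff_cv [CompleteSpace F] (hK : IsKernel K) (hf : IsBC f) : ContDiff ℝ 1 (cv K f) := by
  refine contDiff_one_of_pd (differentiable_cv hK hf) fun i => ?_
  rw [pd_cv hK hf]
  exact (hf.cv (hK.pd i).integrable).continuous

/-- Derivatives may be moved from the kernel to the function. -/
theorem cv_pd_of_integrable [CompleteSpace F] (hK : IsKernel K) (hf : Differentiable ℝ f)
    (i : Fin 3) (x : E3) (h0 : Integrable fun y => K (x - y) • f y)
    (h1 : Integrable fun y => pd i K (x - y) • f y)
    (h2 : Integrable fun y => K (x - y) • pd i f y) :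
    cv (pd i K) f x = cv K (pd i f) x := by
  unfold cv
  have hk := (hK.comp_const_sub x)
  have := integral_smul_fderiv_eq_neg_fderiv_smul_of_integrable (μ := volume)
    (f := fun y => K (x - y)) (g := f) (v := EuclideanSpace.single i (1 : ℝ)) ?_ h2 h0
    (fun y _ => hk.differentiable y) (fun y _ => hf y)
  · rw [show ∫ y, K (x - y) • pd i f y = ∫ y, K (x - y) • fderiv ℝ f y (EuclideanSpace.single i 1)
      from rfl, this, ← integral_neg]
    refine integral_congr_ae (ae_of_all _ fun y => ?_)
    have := pd_comp_const_sub K i x y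
    simp only [pd] at this ⊢
    rw [this]; simp
  · refine (h1.neg).congr (ae_of_all _ fun y => ?_)
    have := pd_comp_const_sub K i x y
    simp only [pd] at this ⊢
    rw [this]; simp

theorem pd_cv_right [CompleteSpace F] (hK : IsKernel K) (hf : IsBC f) (hfd : Differentiable ℝ f)
    {i : Fin 3} (hf' : IsBC (pd i f)) :
    pd i (cv K f) = cv K (pd i f) := by
  rw [pd_cv hK hf]
  ext1 x
  exact cv_pd_of_integrable hK hfd i x (integrable_cv_integrand hK.integrable hf x)
    (integrable_cv_integrand (hK.pd i).integrable hf x)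
    (integrable_cv_integrand hK.integrable hf' x)

end Convolution

/-! ### The heat kernel -/

/-- The Laplacian, as the sum of the second partial derivatives. -/
noncomputable def lap {F : Type*} [NormedAddCommGroup F] [NormedSpace ℝ F] (f : E3 → F) (x : E3) : F :=
  ∑ i : Fin 3, pd i (pd i f) x

/-- The heat kernel `(4πs)^(-3/2) exp(-|x|²/(4s))` of `ℝ³`. -/
noncomputable def heatKernel (s : ℝ) (x : E3) : ℝ :=
  (4 * Real.pi * s) ^ (-(3 / 2) : ℝ) * Real.exp (-‖x‖ ^ 2 / (4 * s))

theorem heatKernel_pos {s : ℝ} (hs : 0 < s) (x : E3) : 0 < heatKernel s x := by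
  unfold heatKernel; positivity

theorem heatKernel_neg (s : ℝ) (x : E3) : heatKernel s (-x) = heatKernel s x := by
  simp [heatKernel]

theorem integral_gauss {b : ℝ} (hb : 0 < b) :
    ∫ x : E3, Real.exp (-b * ‖x‖ ^ 2) = (Real.pi / b) ^ (3 / 2 : ℝ) := by
  rw [GaussianFourier.integral_rexp_neg_mul_sq_norm hb]; norm_num

theorem integral_heatKernel {s : ℝ} (hs : 0 < s) : ∫ x, heatKernel s x = 1 := by
  unfold heatKernel
  rw [integral_const_mul]
  have h := integral_gauss (b := 1 / (4 * s)) (by positivity)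
  rw [show (fun x : E3 => Real.exp (-‖x‖ ^ 2 / (4 * s))) =
    fun x : E3 => Real.exp (-(1 / (4 * s)) * ‖x‖ ^ 2) by ext x; congr 1; ring, h,
    show Real.pi / (1 / (4 * s)) = 4 * Real.pi * s by field_simp,
    ← Real.rpow_add (by positivity)]
  norm_num

theorem exp_neg_sq_decay {b : ℝ} (hb : 0 < b) (m : ℕ) :
    ∃ C, 0 ≤ C ∧ ∀ r : ℝ, 0 ≤ r → (1 + r) ^ m * Real.exp (-(b * r ^ 2)) ≤ C := by
  refine ⟨(2 / b) ^ m * m.factorial * Real.exp b, by positivity, fun r hr => ?_⟩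
  have h1 := Real.pow_div_factorial_le_exp (x := b * (1 + r ^ 2)) (by positivity) m
  have h2 : (1 + r) ^ m ≤ (2 / b) ^ m * (b * (1 + r ^ 2)) ^ m := by
    rw [← mul_pow]
    refine pow_le_pow_left₀ (by positivity) ?_ m
    rw [show 2 / b * (b * (1 + r ^ 2)) = 2 * (1 + r ^ 2) by field_simp]
    nlinarith [sq_nonneg (r - 1)]
  rw [div_le_iff₀ (by positivity)] at h1
  have h3 : Real.exp (b * (1 + r ^ 2)) * Real.exp (-(b * r ^ 2)) = Real.exp b := by
    rw [← Real.exp_add]; congr 1; ring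
  calc (1 + r) ^ m * Real.exp (-(b * r ^ 2))
      ≤ (2 / b) ^ m * (Real.exp (b * (1 + r ^ 2)) * m.factorial) * Real.exp (-(b * r ^ 2)) := by
        gcongr
        exact h2.trans (mul_le_mul_of_nonneg_left h1 (by positivity))
    _ = (2 / b) ^ m * m.factorial * (Real.exp (b * (1 + r ^ 2)) * Real.exp (-(b * r ^ 2))) := by ring
    _ = _ := by rw [h3]

theorem isKernel_heatKernel {s : ℝ} (hs : 0 < s) : IsKernel (heatKernel s) := by
  have hf : ContDiff ℝ ∞ (fun x : E3 => -‖x‖ ^ 2 / (4 * s)) := by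
    have := contDiff_norm_sq ℝ (E := E3) (n := ∞)
    exact this.neg.div_const _
  have he : ContDiff ℝ ∞ (Real.exp ∘ fun x : E3 => -‖x‖ ^ 2 / (4 * s)) :=
    Real.contDiff_exp.comp hf
  have hG : heatKernel s = (4 * Real.pi * s) ^ (-(3 / 2) : ℝ) •
      (Real.exp ∘ fun x : E3 => -‖x‖ ^ 2 / (4 * s)) := by
    ext x; simp [heatKernel]
  refine ⟨by rw [hG]; exact (contDiff_const (c := (4 * Real.pi * s) ^ (-(3 / 2) : ℝ))).smul he, fun n => ?_⟩
  have htg : (fun x : E3 => -‖x‖ ^ 2 / (4 * s)).HasTemperateGrowth := by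
    have h1 := Function.hasTemperateGrowth_norm_sq (H := E3)
    have h2 := (Function.HasTemperateGrowth.const (E := E3) (-(1 / (4 * s)) : ℝ)).mul h1
    rw [show (fun x : E3 => -‖x‖ ^ 2 / (4 * s)) = fun x => -(1 / (4 * s)) * ‖x‖ ^ 2 by ext x; ring]
    exact h2
  obtain ⟨k, C, hC0, hC⟩ := htg.norm_iteratedFDeriv_le_uniform n
  obtain ⟨B, hB0, hB⟩ := exp_neg_sq_decay (b := 1 / (4 * s)) (by positivity) (k * n + 4)
  set c := (4 * Real.pi * s) ^ (-(3 / 2) : ℝ) with hc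
  have hc0 : 0 ≤ c := by positivity
  refine ⟨c * (n.factorial * (1 + C) ^ n * B), fun x => ?_⟩
  have key := norm_iteratedFDeriv_comp_le (g := Real.exp) (f := fun x : E3 => -‖x‖ ^ 2 / (4 * s))
    (n := n) (N := ∞) Real.contDiff_exp hf (by exact_mod_cast le_top) x
    (C := Real.exp (-‖x‖ ^ 2 / (4 * s))) (D := (1 + C) * (1 + ‖x‖) ^ k) ?_ ?_
  · rw [hG, iteratedFDeriv_const_smul_apply (he.contDiffAt.of_le (by exact_mod_cast le_top)),
      norm_smul, Real.norm_eq_abs, abs_of_nonneg hc0, mul_assoc]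
    refine mul_le_mul_of_nonneg_left (key.trans ?_) hc0
    have h4 := hB ‖x‖ (norm_nonneg x)
    rw [show -(1 / (4 * s) * ‖x‖ ^ 2) = -‖x‖ ^ 2 / (4 * s) by ring] at h4
    have h5 : (1 + ‖x‖) ^ (k * n) * Real.exp (-‖x‖ ^ 2 / (4 * s)) ≤ B * wt x := by
      unfold wt
      rw [← div_eq_mul_inv, le_div_iff₀ (by positivity)]
      calc _ = (1 + ‖x‖) ^ (k * n + 4) * Real.exp (-‖x‖ ^ 2 / (4 * s)) := by rw [pow_add]; ring
        _ ≤ B := h4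
    calc (n.factorial : ℝ) * Real.exp (-‖x‖ ^ 2 / (4 * s)) * ((1 + C) * (1 + ‖x‖) ^ k) ^ n
        = n.factorial * (1 + C) ^ n *
          ((1 + ‖x‖) ^ (k * n) * Real.exp (-‖x‖ ^ 2 / (4 * s))) := by
          rw [mul_pow, ← pow_mul]; ring
      _ ≤ n.factorial * (1 + C) ^ n * (B * wt x) := by gcongr
      _ = _ := by ring
  · intro i _
    rw [norm_iteratedFDeriv_eq_norm_iteratedDeriv, iteratedDeriv_eq_iterate,
      Real.iter_deriv_exp, Real.norm_eq_abs, abs_of_pos (Real.exp_pos _)]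
  · intro i hi hin
    have h1 : (1 : ℝ) ≤ (1 + C) * (1 + ‖x‖) ^ k :=
      one_le_mul_of_one_le_of_one_le (by linarith) (one_le_pow₀ (by linarith [norm_nonneg x]))
    refine (hC i hin x).trans (le_trans ?_ (le_self_pow₀ h1 (by omega)))
    gcongr; linarith

theorem pd_norm_sq (i : Fin 3) (x : E3) : pd i (fun y : E3 => ‖y‖ ^ 2) x = 2 * x i := by
  simp only [pd]
  rw [fderiv_norm_sq_apply]
  simp [EuclideanSpace.inner_single_right]

theorem pd_heatKernel (s : ℝ) (i : Fin 3) (x : E3) :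
    pd i (heatKernel s) x = -(1 / (2 * s)) * (x i * heatKernel s x) := by
  have h1 : HasFDerivAt (fun y : E3 => -‖y‖ ^ 2 / (4 * s))
      ((-(1 / (4 * s))) • fderiv ℝ (fun y : E3 => ‖y‖ ^ 2) x) x := by
    have : DifferentiableAt ℝ (fun y : E3 => ‖y‖ ^ 2) x := differentiableAt_id.norm_sq ℝ
    refine (this.hasFDerivAt.const_smul (-(1 / (4 * s)))).congr_of_eventuallyEq
      (Eventually.of_forall fun y => ?_)
    simp; ring
  have h2 := (h1.exp.const_mul ((4 * Real.pi * s) ^ (-(3 / 2) : ℝ))).fderiv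
  have h3 := pd_norm_sq i x
  simp only [pd] at h3 ⊢
  unfold heatKernel
  rw [h2]
  simp only [FunLike.coe_smul, Pi.smul_apply, smul_eq_mul, h3]
  ring

theorem pd_coord (i j : Fin 3) (x : E3) : pd i (fun y : E3 => y j) x = if i = j then 1 else 0 := by
  have := pd_clm_comp (EuclideanSpace.proj j : E3 →L[ℝ] ℝ) (f := id) (x := x) i differentiableAt_id
  simp only [pd, fderiv_id] at this ⊢
  rw [show (fun y : E3 => y j) = fun y => (EuclideanSpace.proj j : E3 →L[ℝ] ℝ) (id y) from rfl, this]
  simp [eq_comm]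

theorem lap_heatKernel {s : ℝ} (hs : 0 < s) (x : E3) :
    lap (heatKernel s) x = (‖x‖ ^ 2 / (4 * s ^ 2) - 3 / (2 * s)) * heatKernel s x := by
  have hd : Differentiable ℝ (heatKernel s) := (isKernel_heatKernel hs).differentiable
  have h : ∀ i : Fin 3, pd i (pd i (heatKernel s)) x =
      (x i ^ 2 / (4 * s ^ 2) - 1 / (2 * s)) * heatKernel s x := by
    intro i
    have hc : DifferentiableAt ℝ (fun y : E3 => y i) x :=
      (EuclideanSpace.proj i : E3 →L[ℝ] ℝ).differentiableAt
    rw [funext (pd_heatKernel s i), pd_const_mul i _ (hc.fun_mul (hd x)), pd_mul i hc (hd x), pd_coord,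
      pd_heatKernel]
    simp only [if_true]
    field_simp
    ring
  simp only [lap, h]
  rw [← Finset.sum_mul, EuclideanSpace.norm_sq_eq]
  congr 1
  simp [Fin.sum_univ_three]
  ring

theorem hasDerivAt_heatKernel {s : ℝ} (hs : 0 < s) (x : E3) :
    HasDerivAt (fun s => heatKernel s x) (lap (heatKernel s) x) s := by
  rw [lap_heatKernel hs]
  unfold heatKernel
  have h1 : HasDerivAt (fun s : ℝ => (4 * Real.pi * s) ^ (-(3 / 2) : ℝ))
      (4 * Real.pi * (-(3 / 2)) * (4 * Real.pi * s) ^ (-(3 / 2) - 1 : ℝ)) s := by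
    have := ((hasDerivAt_id s).const_mul (4 * Real.pi)).rpow_const (p := (-(3 / 2) : ℝ))
      (Or.inl (by simp [Real.pi_ne_zero, hs.ne']))
    simpa using this
  have h2 : HasDerivAt (fun s : ℝ => Real.exp (-‖x‖ ^ 2 / (4 * s)))
      (Real.exp (-‖x‖ ^ 2 / (4 * s)) * (‖x‖ ^ 2 / (4 * s ^ 2))) s := by
    have h3 : HasDerivAt (fun s : ℝ => -‖x‖ ^ 2 / (4 * s)) (‖x‖ ^ 2 / (4 * s ^ 2)) s := by
      have := (hasDerivAt_inv hs.ne').const_mul (-‖x‖ ^ 2 / 4)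
      refine (this.congr_of_eventuallyEq (Eventually.of_forall fun y => ?_)).congr_deriv ?_
      · simp only; rw [← div_eq_mul_inv, div_div]
      · field_simp
    exact h3.exp
  refine (h1.mul h2).congr_deriv ?_
  have h4 : (4 * Real.pi * s) ^ (-(3 / 2) - 1 : ℝ) =
      (4 * Real.pi * s) ^ (-(3 / 2) : ℝ) / (4 * Real.pi * s) := by
    rw [Real.rpow_sub (by positivity), Real.rpow_one]
  rw [h4]
  field_simp
  ring

/-- The Chapman–Kolmogorov identity for the heat kernel. -/
theorem heatKernel_conv {s t : ℝ} (hs : 0 < s) (ht : 0 < t) (x : E3) :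
    ∫ y, heatKernel s y * heatKernel t (x - y) = heatKernel (s + t) x := by
  have h1 : ∀ y : E3, heatKernel s y * heatKernel t (x - y) =
      ((4 * Real.pi * s) ^ (-(3 / 2) : ℝ) * (4 * Real.pi * t) ^ (-(3 / 2) : ℝ) *
        Real.exp (-‖x‖ ^ 2 / (4 * (s + t)))) *
      Real.exp (-((s + t) / (4 * s * t)) * ‖y - (s / (s + t)) • x‖ ^ 2) := by
    intro y
    unfold heatKernel
    have h2 : -‖y‖ ^ 2 / (4 * s) + -‖x - y‖ ^ 2 / (4 * t) = -‖x‖ ^ 2 / (4 * (s + t)) +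
        -((s + t) / (4 * s * t)) * ‖y - (s / (s + t)) • x‖ ^ 2 := by
      rw [norm_sub_sq_real, norm_sub_sq_real, inner_smul_right, norm_smul, Real.norm_eq_abs,
        abs_of_pos (by positivity : 0 < s / (s + t)), real_inner_comm y x]
      field_simp
      ring
    calc _ = (4 * Real.pi * s) ^ (-(3 / 2) : ℝ) * (4 * Real.pi * t) ^ (-(3 / 2) : ℝ) *
          (Real.exp (-‖y‖ ^ 2 / (4 * s)) * Real.exp (-‖x - y‖ ^ 2 / (4 * t))) := by ring
      _ = _ := by rw [← Real.exp_add, h2, Real.exp_add]; ring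
  simp_rw [h1]
  rw [integral_const_mul, integral_sub_right_eq_self
    (fun y : E3 => Real.exp (-((s + t) / (4 * s * t)) * ‖y‖ ^ 2)),
    integral_gauss (by positivity)]
  unfold heatKernel
  have h3 : (4 * Real.pi * s) ^ (-(3 / 2) : ℝ) * (4 * Real.pi * t) ^ (-(3 / 2) : ℝ) *
      (Real.pi / ((s + t) / (4 * s * t))) ^ (3 / 2 : ℝ) = (4 * Real.pi * (s + t)) ^ (-(3 / 2) : ℝ) := by
    rw [Real.rpow_neg (by positivity), Real.rpow_neg (by positivity), Real.rpow_neg (by positivity),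
      ← Real.inv_rpow (by positivity), ← Real.inv_rpow (by positivity),
      ← Real.inv_rpow (by positivity), ← Real.mul_rpow (by positivity) (by positivity),
      ← Real.mul_rpow (by positivity) (by positivity)]
    congr 1
    field_simp
  rw [← h3]; ring

section Semigroup

variable {F : Type*} [NormedAddCommGroup F] [NormedSpace ℝ F] [CompleteSpace F] {f : E3 → F}

theorem cv_cv {K L : E3 → ℝ} (hK : Integrable K) (hL : Integrable L) (hf : IsBC f) (x : E3) :
    cv K (cv L f) x = cv (fun w => ∫ y, K y * L (w - y)) f x := by
  have h1 : ∀ y, K y • cv L f (x - y) = ∫ w, (K y * L (w - y)) • f (x - w) := by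
    intro y
    rw [cv_eq, ← integral_smul, ← integral_sub_right_eq_self _ y]
    refine integral_congr_ae (ae_of_all _ fun w => ?_)
    simp only [smul_smul]
    congr 2; abel
  rw [cv_eq, cv_eq]
  simp_rw [h1]
  rw [integral_integral_swap]
  · refine integral_congr_ae (ae_of_all _ fun w => ?_)
    simp only
    rw [integral_smul_const]
  · have h2 := (hK.convolution_integrand (ContinuousLinearMap.mul ℝ ℝ) hL).swap
    obtain ⟨M, hM⟩ := hf.bounded
    have h3 : Integrable (fun z : E3 × E3 => K z.1 * L (z.2 - z.1)) (volume.prod volume) := h2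
    exact h3.smul_of_top_left (f := fun z : E3 × E3 => f (x - z.2)) (memLp_top_of_bound
      (hf.continuous.comp (by fun_prop)).aestronglyMeasurable M (ae_of_all _ fun z => hM _))

theorem heat_semigroup {s t : ℝ} (hs : 0 < s) (ht : 0 < t) (hf : IsBC f) :
    cv (heatKernel s) (cv (heatKernel t) f) = cv (heatKernel (s + t)) f := by
  ext1 x
  rw [cv_cv (isKernel_heatKernel hs).integrable (isKernel_heatKernel ht).integrable hf]
  simp_rw [heatKernel_conv hs ht]

end Semigroup

/-! ### Scaling, decay and regularity of heat flows -/

/-- The parabolic dilation `s^(-(3+m)/2) K(x / √s)`, where `m` counts the derivatives in `K`. -/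
noncomputable def dil (m : ℕ) (s : ℝ) (K : E3 → ℝ) (x : E3) : ℝ :=
  (√s)⁻¹ ^ (3 + m) * K ((√s)⁻¹ • x)

theorem heatKernel_eq_dil {s : ℝ} (hs : 0 < s) : heatKernel s = dil 0 s (heatKernel 1) := by
  ext x
  unfold dil heatKernel
  have h1 : (4 * Real.pi * s) ^ (-(3 / 2) : ℝ) = (√s)⁻¹ ^ (3 + 0) * (4 * Real.pi * 1) ^ (-(3 / 2) : ℝ) := by
    rw [Real.mul_rpow (by positivity) hs.le, mul_one, mul_comm]
    congr 1
    rw [Real.sqrt_eq_rpow, ← Real.rpow_neg hs.le, ← Real.rpow_natCast, ← Real.rpow_mul hs.le]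
    norm_num
  have h2 : ‖(√s)⁻¹ • x‖ ^ 2 = s⁻¹ * ‖x‖ ^ 2 := by
    rw [norm_smul, mul_pow, Real.norm_eq_abs, sq_abs, inv_pow, Real.sq_sqrt hs.le]
  rw [h1, h2, mul_assoc]
  congr 3
  field_simp

theorem pd_dil (m : ℕ) (s : ℝ) {K : E3 → ℝ} (hK : Differentiable ℝ K) (i : Fin 3) :
    pd i (dil m s K) = dil (m + 1) s (pd i K) := by
  ext x
  unfold dil
  have h : DifferentiableAt ℝ (fun y : E3 => K ((√s)⁻¹ • y)) x :=
    (hK _).comp (f := fun y : E3 => (√s)⁻¹ • y) x (by fun_prop)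
  rw [pd_const_mul i _ h, pd_comp_smul]
  simp only [smul_eq_mul]; ring

theorem pd_heatKernel_eq_dil {s : ℝ} (hs : 0 < s) (i : Fin 3) :
    pd i (heatKernel s) = dil 1 s (pd i (heatKernel 1)) := by
  rw [heatKernel_eq_dil hs, pd_dil 0 s (isKernel_heatKernel one_pos).differentiable]

theorem pd_pd_heatKernel_eq_dil {s : ℝ} (hs : 0 < s) (i j : Fin 3) :
    pd i (pd j (heatKernel s)) = dil 2 s (pd i (pd j (heatKernel 1))) := by
  rw [pd_heatKernel_eq_dil hs, pd_dil 1 s ((isKernel_heatKernel one_pos).pd j).differentiable]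

theorem pd_pd_pd_heatKernel_eq_dil {s : ℝ} (hs : 0 < s) (i j k : Fin 3) :
    pd i (pd j (pd k (heatKernel s))) = dil 3 s (pd i (pd j (pd k (heatKernel 1)))) := by
  rw [pd_pd_heatKernel_eq_dil hs,
    pd_dil 2 s (((isKernel_heatKernel one_pos).pd k).pd j).differentiable]

theorem IsKernel.lap {K : E3 → ℝ} (hK : IsKernel K) : IsKernel (lap K) :=
  IsKernel.sum _ fun i _ => (hK.pd i).pd i

theorem lap_heatKernel_eq_dil {s : ℝ} (hs : 0 < s) :
    lap (heatKernel s) = dil 2 s (lap (heatKernel 1)) := by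
  ext x
  simp only [lap, pd_pd_heatKernel_eq_dil hs]
  simp only [dil, lap, Finset.mul_sum]

section

variable {F : Type*} [NormedAddCommGroup F] [NormedSpace ℝ F] {f : E3 → F}

theorem cv_dil (m : ℕ) {s : ℝ} (hs : 0 < s) (K : E3 → ℝ) (f : E3 → F) (x : E3) :
    cv (dil m s K) f x = (√s)⁻¹ ^ m • ∫ y, K y • f (x - √s • y) := by
  have hr : 0 < √s := Real.sqrt_pos.2 hs
  have h := Measure.integral_comp_inv_smul volume (fun y : E3 => K y • f (x - √s • y)) (√s)
  rw [cv_eq]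
  unfold dil
  simp only [mul_smul, pow_add]
  rw [integral_smul]
  simp_rw [smul_smul, mul_inv_cancel₀ hr.ne', one_smul] at h
  have h2 : ∫ y, (√s)⁻¹ ^ m • K ((√s)⁻¹ • y) • f (x - y) =
      (√s)⁻¹ ^ m • ∫ y, K ((√s)⁻¹ • y) • f (x - y) := integral_smul _ _
  rw [h2, h, smul_smul, smul_smul]
  congr 1
  rw [abs_of_pos (by positivity)]
  simp only [finrank_euclideanSpace, Fintype.card_fin]
  field_simp

theorem cv_heatKernel_eq {s : ℝ} (hs : 0 < s) (f : E3 → F) (x : E3) :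
    cv (heatKernel s) f x = ∫ y, heatKernel 1 y • f (x - √s • y) := by
  rw [heatKernel_eq_dil hs, cv_dil 0 hs]; simp

theorem norm_cv_dil_le (m : ℕ) {s : ℝ} (hs : 0 < s) {K : E3 → ℝ} (hK : Integrable K) {M : ℝ}
    (hM : ∀ x, ‖f x‖ ≤ M) (x : E3) :
    ‖cv (dil m s K) f x‖ ≤ (√s)⁻¹ ^ m * ((∫ y, |K y|) * M) := by
  rw [cv_dil m hs, norm_smul, Real.norm_eq_abs, abs_of_nonneg (by positivity), ← integral_mul_const]
  refine mul_le_mul_of_nonneg_left ?_ (by positivity)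
  refine norm_integral_le_of_norm_le (hK.abs.mul_const M) (ae_of_all _ fun y => ?_)
  rw [norm_smul, Real.norm_eq_abs]
  exact mul_le_mul_of_nonneg_left (hM _) (abs_nonneg _)

/-- Joint continuity of convolutions with dilated kernels in all parameters. -/
theorem continuous_dilated_conv {U : ℝ → E3 → F} (hU : Continuous fun z : ℝ × E3 => U z.1 z.2)
    {M : ℝ} (hM : ∀ t x, ‖U t x‖ ≤ M) {K : E3 → ℝ} (hK : Continuous K) (hKi : Integrable K) :
    Continuous fun z : ℝ × ℝ × E3 => ∫ y, K y • U z.2.1 (z.2.2 - √z.1 • y) := by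
  refine continuous_of_dominated (bound := fun y => |K y| * M) (fun z => ?_)
    (fun z => ae_of_all _ fun y => ?_) (hKi.abs.mul_const M) (ae_of_all _ fun y => ?_)
  · refine (hK.smul ?_).aestronglyMeasurable
    exact hU.comp (by fun_prop : Continuous fun y : E3 => (z.2.1, z.2.2 - √z.1 • y))
  · rw [norm_smul, Real.norm_eq_abs]
    exact mul_le_mul_of_nonneg_left (hM _ _) (abs_nonneg _)
  · refine continuous_const.smul ?_
    exact hU.comp (by fun_prop : Continuous fun z : ℝ × ℝ × E3 => (z.2.1, z.2.2 - √z.1 • y))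

theorem continuousOn_cv_dil {U : ℝ → E3 → F} (hU : Continuous fun z : ℝ × E3 => U z.1 z.2)
    {M : ℝ} (hM : ∀ t x, ‖U t x‖ ≤ M) (m : ℕ) {K : E3 → ℝ} (hK : Continuous K)
    (hKi : Integrable K) :
    ContinuousOn (fun z : ℝ × ℝ × E3 => cv (dil m z.1 K) (U z.2.1) z.2.2) (Ioi 0 ×ˢ univ) := by
  have h : ContinuousOn (fun z : ℝ × ℝ × E3 => (√z.1)⁻¹ ^ m •
      ∫ y, K y • U z.2.1 (z.2.2 - √z.1 • y)) (Ioi 0 ×ˢ univ) := by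
    refine ContinuousOn.smul (ContinuousOn.pow (ContinuousOn.inv₀ (by fun_prop) ?_) m)
      (continuous_dilated_conv hU hM hK hKi).continuousOn
    rintro ⟨s, t, x⟩ ⟨hs, -⟩
    exact (Real.sqrt_pos.2 hs).ne'
  refine h.congr ?_
  rintro ⟨s, t, x⟩ ⟨hs, -⟩
  exact cv_dil m hs K (U t) x

variable [CompleteSpace F]

theorem lap_cv {K : E3 → ℝ} (hK : IsKernel K) (hf : IsBC f) :
    lap (cv K f) = cv (lap K) f := by
  ext x
  simp only [lap, pd_cv hK hf, pd_cv (hK.pd _) hf]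
  unfold cv
  rw [← integral_finsetSum _ fun i _ => integrable_cv_integrand ((hK.pd i).pd i).integrable hf x]
  simp only [Finset.sum_smul, lap]

theorem wt_inv_smul_le {r R : ℝ} (hr : 0 < r) (hrR : r ≤ R) (x : E3) :
    wt (r⁻¹ • x) ≤ (1 + R) ^ 4 * wt x := by
  unfold wt
  rw [← div_eq_mul_inv, inv_eq_one_div, div_le_div_iff₀ (by positivity) (by positivity), one_mul,
    ← mul_pow]
  refine pow_le_pow_left₀ (by positivity) ?_ 4
  rw [norm_smul, norm_inv, Real.norm_eq_abs, abs_of_pos hr]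
  have h1 : ‖x‖ = r * (r⁻¹ * ‖x‖) := by field_simp
  have h2 : 0 ≤ r⁻¹ * ‖x‖ := by positivity
  have h3 : r * (r⁻¹ * ‖x‖) ≤ R * (r⁻¹ * ‖x‖) := mul_le_mul_of_nonneg_right hrR h2
  nlinarith

/-- The heat equation for the heat flow of a bounded continuous function. -/
theorem hasDerivAt_cv_heatKernel {s : ℝ} (hs : 0 < s) (hf : IsBC f) (x : E3) :
    HasDerivAt (fun s => cv (heatKernel s) f x) (cv (lap (heatKernel s)) f x) s := by
  obtain ⟨M, hM0, hM⟩ := hf.exists_bound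
  have hk := isKernel_heatKernel one_pos
  obtain ⟨C, hC0, hC⟩ := hk.lap.exists_abs_le
  have hk2 : ∀ r, 0 < r → Integrable (heatKernel r) := fun r hr => (isKernel_heatKernel hr).integrable
  refine (hasDerivAt_integral_of_dominated_loc_of_deriv_le (s := Ioo (s / 2) (2 * s))
    (F := fun r y => heatKernel r (x - y) • f y)
    (F' := fun r y => lap (heatKernel r) (x - y) • f y)
    (bound := fun y => (√(s / 2))⁻¹ ^ 5 * (C * ((1 + √(2 * s)) ^ 4 * wt (x - y))) * M)
    (Ioo_mem_nhds (by linarith) (by linarith)) ?_ ?_ ?_ ?_ ?_ ?_).2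
  · filter_upwards [Ioi_mem_nhds hs] with r hr
    exact (integrable_cv_integrand (hk2 r hr) hf x).aestronglyMeasurable
  · exact integrable_cv_integrand (hk2 s hs) hf x
  · exact (integrable_cv_integrand (isKernel_heatKernel hs).lap.integrable hf x).aestronglyMeasurable
  · refine ae_of_all _ fun y r hr => ?_
    have hr0 : 0 < r := lt_trans (by positivity) hr.1
    have hsq : 0 < √r := Real.sqrt_pos.2 hr0
    rw [norm_smul, Real.norm_eq_abs, lap_heatKernel_eq_dil hr0]
    unfold dil
    rw [abs_mul, abs_of_nonneg (by positivity : 0 ≤ (√r)⁻¹ ^ (3 + 2))]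
    have h1 : (√r)⁻¹ ^ (3 + 2) ≤ (√(s / 2))⁻¹ ^ 5 := by
      refine pow_le_pow_left₀ (by positivity) ?_ 5
      exact inv_anti₀ (Real.sqrt_pos.2 (by positivity)) (Real.sqrt_le_sqrt hr.1.le)
    have h2 : |lap (heatKernel 1) ((√r)⁻¹ • (x - y))| ≤ C * ((1 + √(2 * s)) ^ 4 * wt (x - y)) :=
      (hC _).trans (mul_le_mul_of_nonneg_left
        (wt_inv_smul_le hsq (Real.sqrt_le_sqrt hr.2.le) _) hC0)
    have h3 := wt_pos (x - y)
    gcongr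
    exact hM y
  · exact ((((integrable_wt.comp_sub_left x).const_mul _).const_mul C).const_mul _).mul_const M
  · refine ae_of_all _ fun y r hr => ?_
    have hr0 : 0 < r := lt_trans (by positivity) hr.1
    exact (hasDerivAt_heatKernel hr0 (x - y)).smul_const (f y)

theorem cv_pd_heatKernel_add {a b : ℝ} (ha : 0 < a) (hb : 0 < b) (hf : IsBC f) (i : Fin 3) :
    cv (pd i (heatKernel (a + b))) f = cv (heatKernel a) (cv (pd i (heatKernel b)) f) := by
  have hka := isKernel_heatKernel ha
  have hkb := isKernel_heatKernel hb
  have h := pd_cv_right hka (hf.cv hkb.integrable) (differentiable_cv hkb hf) (i := i)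
    (by rw [pd_cv hkb hf]; exact hf.cv (hkb.pd i).integrable)
  rw [heat_semigroup ha hb hf, pd_cv (isKernel_heatKernel (add_pos ha hb)) hf, pd_cv hkb hf] at h
  exact h

theorem cv_pd_pd_heatKernel_add {a b : ℝ} (ha : 0 < a) (hb : 0 < b) (hf : IsBC f) (i j : Fin 3) :
    cv (pd i (pd j (heatKernel (a + b)))) f =
      cv (heatKernel a) (cv (pd i (pd j (heatKernel b))) f) := by
  have hka := isKernel_heatKernel ha
  have hkb := isKernel_heatKernel hb
  have h := pd_cv_right hka (hf.cv (hkb.pd j).integrable) (differentiable_cv (hkb.pd j) hf) (i := i)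
    (by rw [pd_cv (hkb.pd j) hf]; exact hf.cv ((hkb.pd j).pd i).integrable)
  rw [← cv_pd_heatKernel_add ha hb hf,
    pd_cv ((isKernel_heatKernel (add_pos ha hb)).pd j) hf, pd_cv (hkb.pd j) hf] at h
  exact h

end

theorem lap_pd_comm {K : E3 → ℝ} (hK : ContDiff ℝ ∞ K) (i : Fin 3) :
    lap (pd i K) = pd i (lap K) := by
  ext x
  unfold lap
  have hd : ∀ k, ContDiff ℝ ∞ (pd k (pd k K)) := fun k => contDiff_pd (contDiff_pd hK k) k
  rw [pd_sum _ i fun k _ => (hd k).differentiable (by simp) x]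
  refine Finset.sum_congr rfl fun k _ => ?_
  rw [show pd k (pd i K) = pd i (pd k K) from funext fun y => pd_comm hK k i y,
    pd_comm (contDiff_pd hK k) k i]

theorem hasDerivAt_cv_pd_heatKernel {s : ℝ} (hs : 0 < s) {f : E3 → ℝ} (hf : IsBC f) (i : Fin 3)
    (x : E3) :
    HasDerivAt (fun s => cv (pd i (heatKernel s)) f x) (cv (pd i (lap (heatKernel s))) f x) s := by
  have h2 : 0 < s / 2 := by positivity
  have hk := isKernel_heatKernel h2
  have hks := isKernel_heatKernel hs
  have hg : IsBC (cv (pd i (heatKernel (s / 2))) f) := hf.cv (hk.pd i).integrable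
  have h := hasDerivAt_cv_heatKernel (s := s - s / 2) (by linarith) hg x
  have h3 := h.comp_sub_const s (s / 2)
  have h4 : cv (lap (heatKernel (s - s / 2))) (cv (pd i (heatKernel (s / 2))) f) x =
      cv (pd i (lap (heatKernel s))) f x := by
    rw [show s - s / 2 = s / 2 by ring, ← lap_cv hk hg, ← cv_pd_heatKernel_add h2 h2 hf, add_halves,
      lap_cv (hks.pd i) hf, lap_pd_comm hks.smooth]
  rw [h4] at h3
  refine h3.congr_of_eventuallyEq ?_
  filter_upwards [Ioi_mem_nhds (show s / 2 < s by linarith)] with r hr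
  rw [← cv_pd_heatKernel_add (sub_pos.2 hr) h2 hf]
  simp

theorem hasDerivAt_cv_lap_heatKernel {s : ℝ} (hs : 0 < s) {f : E3 → ℝ} (hf : IsBC f) (x : E3) :
    HasDerivAt (fun s => cv (lap (heatKernel s)) f x) (cv (lap (lap (heatKernel s))) f x) s := by
  have h2 : 0 < s / 2 := by positivity
  have hk := isKernel_heatKernel h2
  have hks := isKernel_heatKernel hs
  have hadd : ∀ a b, 0 < a → 0 < b → cv (lap (heatKernel (a + b))) f =
      cv (heatKernel a) (cv (lap (heatKernel b)) f) := by
    intro a b ha hb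
    have hkb := isKernel_heatKernel hb
    rw [← lap_cv (isKernel_heatKernel (add_pos ha hb)) hf, ← heat_semigroup ha hb hf]
    have h5 : lap (cv (heatKernel b) f) = fun x => ∑ i, cv (pd i (pd i (heatKernel b))) f x := by
      ext x; simp only [lap, pd_cv hkb hf, pd_cv (hkb.pd _) hf]
    rw [heat_semigroup ha hb hf, ← lap_cv hkb hf, h5]
    ext x
    rw [lap]
    simp only [pd_cv (isKernel_heatKernel (add_pos ha hb)) hf,
      pd_cv ((isKernel_heatKernel (add_pos ha hb)).pd _) hf, cv_pd_pd_heatKernel_add ha hb hf]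
    unfold cv
    simp only [Finset.smul_sum]
    exact (integral_finsetSum _ fun i _ => integrable_cv_integrand
      (isKernel_heatKernel ha).integrable (hf.cv ((hkb.pd i).pd i).integrable) x).symm
  have hg : IsBC (cv (lap (heatKernel (s / 2))) f) := hf.cv hk.lap.integrable
  have h := hasDerivAt_cv_heatKernel (s := s - s / 2) (by linarith) hg x
  have h3 := h.comp_sub_const s (s / 2)
  have h4 : cv (lap (heatKernel (s - s / 2))) (cv (lap (heatKernel (s / 2))) f) x =
      cv (lap (lap (heatKernel s))) f x := by
    rw [show s - s / 2 = s / 2 by ring, ← lap_cv hk hg, ← hadd _ _ h2 h2, add_halves,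
      lap_cv hks.lap hf]
  rw [h4] at h3
  refine h3.congr_of_eventuallyEq ?_
  filter_upwards [Ioi_mem_nhds (show s / 2 < s by linarith)] with r hr
  rw [← hadd _ _ (sub_pos.2 hr) h2]
  simp

/-! ### Heat flows of integrable functions -/

section Integrable

variable {K f g : E3 → ℝ}

theorem integrable_cv (hK : Integrable K) (hf : Integrable f) : Integrable (cv K f) := by
  have := hK.integrable_convolution (ContinuousLinearMap.mul ℝ ℝ) hf
  refine this.congr (ae_of_all _ fun x => ?_)
  rw [cv_eq]; rfl

/-- The heat flow is self-adjoint. -/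
theorem integral_cv_mul {s : ℝ} (hs : 0 < s) (hf : IsBC f) (hg : Integrable g) :
    ∫ x, cv (heatKernel s) f x * g x = ∫ x, f x * cv (heatKernel s) g x := by
  have hk := isKernel_heatKernel hs
  unfold cv
  simp_rw [← integral_mul_const, ← integral_const_mul]
  rw [integral_integral_swap]
  · refine integral_congr_ae (ae_of_all _ fun y => integral_congr_ae (ae_of_all _ fun x => ?_))
    simp only [smul_eq_mul]
    rw [← heatKernel_neg s (x - y), neg_sub]; ring
  · have h1 := (hg.convolution_integrand (ContinuousLinearMap.mul ℝ ℝ) hk.integrable).swap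
    have h2 : Integrable (fun z : E3 × E3 => g z.1 * heatKernel s (z.2 - z.1))
      (volume.prod volume) := h1
    obtain ⟨M, hM⟩ := hf.bounded
    refine (h2.smul_of_top_left (f := fun z : E3 × E3 => f z.2) (memLp_top_of_bound
      (hf.continuous.comp continuous_snd).aestronglyMeasurable M (ae_of_all _ fun z => hM _))).congr
      (ae_of_all _ fun z => ?_)
    simp only [Function.uncurry, smul_eq_mul, Pi.mul_apply]
    rw [← heatKernel_neg s (z.2 - z.1), neg_sub]; ring

/-- The heat flow of a square integrable function tends to zero at each point. -/
theorem tendsto_cv_heatKernel_atTop (hf2 : Integrable fun x => f x ^ 2) (x : E3) :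
    Tendsto (fun s => cv (heatKernel s) f x) atTop (nhds 0) := by
  have hI : 0 ≤ ∫ y, f y ^ 2 := integral_nonneg fun y => sq_nonneg _
  set I := ∫ y, f y ^ 2
  have key : ∀ δ : ℝ, 0 < δ → ∀ s : ℝ, 0 < s → |cv (heatKernel s) f x| ≤
      δ + (4 * Real.pi * s) ^ (-(3 / 2) : ℝ) * (δ⁻¹ * I) := by
    intro δ hδ s hs
    have hk := isKernel_heatKernel hs
    have hle : ∀ y, heatKernel s y ≤ (4 * Real.pi * s) ^ (-(3 / 2) : ℝ) := fun y => by
      unfold heatKernel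
      refine mul_le_of_le_one_right (by positivity) (Real.exp_le_one_iff.2 ?_)
      exact div_nonpos_of_nonpos_of_nonneg (by simp) (by positivity)
    have h1 : ∫ y, (heatKernel s (x - y) * δ +
        (4 * Real.pi * s) ^ (-(3 / 2) : ℝ) * (δ⁻¹ * f y ^ 2)) =
        δ + (4 * Real.pi * s) ^ (-(3 / 2) : ℝ) * (δ⁻¹ * I) := by
      rw [integral_add ((hk.integrable.comp_sub_left x).mul_const δ)
        ((hf2.const_mul _).const_mul _), integral_mul_const, integral_const_mul, integral_const_mul,
        integral_sub_left_eq_self (heatKernel s), integral_heatKernel hs, one_mul]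
    rw [← h1, ← Real.norm_eq_abs]
    refine norm_integral_le_of_norm_le (((hk.integrable.comp_sub_left x).mul_const δ).add
      ((hf2.const_mul _).const_mul _)) (ae_of_all _ fun y => ?_)
    rw [norm_smul, Real.norm_eq_abs, abs_of_pos (heatKernel_pos hs _), Real.norm_eq_abs]
    have h2 : |f y| ≤ δ + δ⁻¹ * f y ^ 2 := by
      rw [← sq_abs (f y), ← div_eq_inv_mul, ← sub_nonneg]
      have : δ + |f y| ^ 2 / δ - |f y| = ((δ - |f y| / 2) ^ 2 + 3 / 4 * |f y| ^ 2) / δ := by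
        field_simp; ring
      rw [this]; positivity
    calc heatKernel s (x - y) * |f y| ≤ heatKernel s (x - y) * (δ + δ⁻¹ * f y ^ 2) :=
          mul_le_mul_of_nonneg_left h2 (heatKernel_pos hs _).le
      _ = heatKernel s (x - y) * δ + heatKernel s (x - y) * (δ⁻¹ * f y ^ 2) := by ring
      _ ≤ _ := by gcongr; exact hle _
  rw [Metric.tendsto_atTop]
  intro ε hε
  have ht : Tendsto (fun s : ℝ => (4 * Real.pi * s) ^ (-(3 / 2) : ℝ) * ((ε / 2)⁻¹ * I)) atTop
      (nhds (0 * ((ε / 2)⁻¹ * I))) := by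
    refine Tendsto.mul_const _ ((tendsto_rpow_neg_atTop (by norm_num)).comp ?_)
    exact tendsto_id.const_mul_atTop (by positivity)
  rw [zero_mul] at ht
  obtain ⟨N, hN⟩ := (Metric.tendsto_atTop.1 ht) (ε / 2) (by positivity)
  refine ⟨max N 1, fun s hs => ?_⟩
  have h1 := hN s ((le_max_left _ _).trans hs)
  have h2 := key (ε / 2) (by positivity) s (lt_of_lt_of_le one_pos ((le_max_right _ _).trans hs))
  rw [dist_zero_right, Real.norm_eq_abs] at h1 ⊢
  linarith [le_abs_self ((4 * Real.pi * s) ^ (-(3 / 2) : ℝ) * ((ε / 2)⁻¹ * I))]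

end Integrable

/-! ### The Bellman function -/

section Bellman

/-- The Bellman function `30 y^(q') + x² (x^(q-1) + y)^((q-2)/(q-1))` with `q' = q / (q - 1)`. On
the open quadrant it is bounded by a multiple of `x^q + y^(q')`, while its Hessian dominates the
product of the two components of a vector. It is a variant of the function of Nazarov and Treil that
is smooth on the open quadrant. -/
noncomputable def bell (q x y : ℝ) : ℝ :=
  30 * y ^ (q / (q - 1)) + x ^ 2 * (x ^ (q - 1) + y) ^ ((q - 2) / (q - 1))

/-- The derivative of `bell` in its first variable. -/
noncomputable def bellX (q x y : ℝ) : ℝ :=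
  (2 * x + (q - 2) * x * x ^ (q - 1) / (x ^ (q - 1) + y)) *
    (x ^ (q - 1) + y) ^ ((q - 2) / (q - 1))

/-- The derivative of `bell` in its second variable. -/
noncomputable def bellY (q x y : ℝ) : ℝ :=
  30 * (q / (q - 1)) * (y ^ (q / (q - 1)) / y) +
    (q - 2) / (q - 1) * x ^ 2 / (x ^ (q - 1) + y) * (x ^ (q - 1) + y) ^ ((q - 2) / (q - 1))

/-- The second derivative of `bell` in its first variable. -/
noncomputable def bellXX (q x y : ℝ) : ℝ :=
  (2 + (q - 2) * (q + 2) * (x ^ (q - 1) / (x ^ (q - 1) + y)) -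
    (q - 2) * (x ^ (q - 1) / (x ^ (q - 1) + y)) ^ 2) * (x ^ (q - 1) + y) ^ ((q - 2) / (q - 1))

/-- The mixed second derivative of `bell`. -/
noncomputable def bellXY (q x y : ℝ) : ℝ :=
  (q - 2) / (q - 1) * (2 - x ^ (q - 1) / (x ^ (q - 1) + y)) *
    (x / (x ^ (q - 1) + y) * (x ^ (q - 1) + y) ^ ((q - 2) / (q - 1)))

/-- The second derivative of `bell` in its second variable. -/
noncomputable def bellYY (q x y : ℝ) : ℝ :=
  30 * (q / (q - 1) ^ 2) * (y ^ (q / (q - 1)) / y ^ 2) -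
    (q - 2) / (q - 1) ^ 2 * (x / (x ^ (q - 1) + y)) ^ 2 *
      (x ^ (q - 1) + y) ^ ((q - 2) / (q - 1))

variable {q : ℝ}

theorem hasDerivAt_rpow_of_pos {X : ℝ → ℝ} {X' τ : ℝ} (a : ℝ) (hX : HasDerivAt X X' τ)
    (h : 0 < X τ) : HasDerivAt (fun t => X t ^ a) (a * X τ ^ a / X τ * X') τ := by
  refine (hX.rpow_const (p := a) (Or.inl h.ne')).congr_deriv ?_
  rw [Real.rpow_sub h, Real.rpow_one]; ring

theorem hasDerivAt_bell (hq : 2 < q) {X Y : ℝ → ℝ} {X' Y' τ : ℝ} (hX : HasDerivAt X X' τ)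
    (hY : HasDerivAt Y Y' τ) (hx : 0 < X τ) (hy : 0 < Y τ) :
    HasDerivAt (fun t => bell q (X t) (Y t))
      (bellX q (X τ) (Y τ) * X' + bellY q (X τ) (Y τ) * Y') τ := by
  have hN : 0 < X τ ^ (q - 1) + Y τ := by positivity
  have h1 := (hasDerivAt_rpow_of_pos (q - 1) hX hx).add hY
  have h2 := hasDerivAt_rpow_of_pos ((q - 2) / (q - 1)) h1 hN
  have h3 := (hasDerivAt_rpow_of_pos (q / (q - 1)) hY hy).const_mul 30
  refine (h3.add ((hX.pow 2).mul h2)).congr_deriv ?_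
  have hq1 : q - 1 ≠ 0 := by linarith
  simp only [bellX, bellY, Pi.add_apply, Pi.pow_apply]
  generalize (X τ ^ (q - 1) + Y τ) ^ ((q - 2) / (q - 1)) = P
  generalize hN' : X τ ^ (q - 1) + Y τ = N at hN ⊢
  field_simp
  push_cast
  ring

theorem hasDerivAt_bellX (hq : 2 < q) {X Y : ℝ → ℝ} {X' Y' τ : ℝ} (hX : HasDerivAt X X' τ)
    (hY : HasDerivAt Y Y' τ) (hx : 0 < X τ) (hy : 0 < Y τ) :
    HasDerivAt (fun t => bellX q (X t) (Y t))
      (bellXX q (X τ) (Y τ) * X' + bellXY q (X τ) (Y τ) * Y') τ := by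
  have hN : 0 < X τ ^ (q - 1) + Y τ := by positivity
  have h0 := hasDerivAt_rpow_of_pos (q - 1) hX hx
  have h1 := h0.add hY
  have h2 := hasDerivAt_rpow_of_pos ((q - 2) / (q - 1)) h1 hN
  have h3 := (hX.const_mul 2).add (((hX.const_mul (q - 2)).mul h0).div h1 hN.ne')
  refine (h3.mul h2).congr_deriv ?_
  have hq1 : q - 1 ≠ 0 := by linarith
  simp only [bellXX, bellXY, Pi.add_apply, Pi.mul_apply, Pi.div_apply]
  generalize (X τ ^ (q - 1) + Y τ) ^ ((q - 2) / (q - 1)) = P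
  have hY' : Y τ = (X τ ^ (q - 1) + Y τ) - X τ ^ (q - 1) := by ring
  generalize hN' : X τ ^ (q - 1) + Y τ = N at hN ⊢
  field_simp
  ring

theorem hasDerivAt_bellY (hq : 2 < q) {X Y : ℝ → ℝ} {X' Y' τ : ℝ} (hX : HasDerivAt X X' τ)
    (hY : HasDerivAt Y Y' τ) (hx : 0 < X τ) (hy : 0 < Y τ) :
    HasDerivAt (fun t => bellY q (X t) (Y t))
      (bellXY q (X τ) (Y τ) * X' + bellYY q (X τ) (Y τ) * Y') τ := by
  have hN : 0 < X τ ^ (q - 1) + Y τ := by positivity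
  have h0 := hasDerivAt_rpow_of_pos (q - 1) hX hx
  have h1 := h0.add hY
  have h2 := hasDerivAt_rpow_of_pos ((q - 2) / (q - 1)) h1 hN
  have h3 := ((hasDerivAt_rpow_of_pos (q / (q - 1)) hY hy).div hY hy.ne').const_mul
    (30 * (q / (q - 1)))
  have h4 := ((hX.pow 2).const_mul ((q - 2) / (q - 1))).div h1 hN.ne'
  refine (h3.add (h4.mul h2)).congr_deriv ?_
  have hq1 : q - 1 ≠ 0 := by linarith
  simp only [bellYY, bellXY, Pi.add_apply, Pi.div_apply, Pi.pow_apply]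
  generalize (X τ ^ (q - 1) + Y τ) ^ ((q - 2) / (q - 1)) = P
  generalize hN' : X τ ^ (q - 1) + Y τ = N at hN ⊢
  field_simp
  push_cast
  ring

/-- The key convexity property: the Hessian of `bell` is bounded below by a diagonal form whose
entries have product `4`. -/
theorem bell_hessian (hq : 2 < q) (hq5 : q ≤ 5) {x y : ℝ} (hx : 0 < x) (hy : 0 < y) (ξ η : ℝ) :
    (x ^ (q - 1) + y) ^ ((q - 2) / (q - 1)) * ξ ^ 2 +
      4 * ((x ^ (q - 1) + y) ^ ((q - 2) / (q - 1)))⁻¹ * η ^ 2 ≤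
    bellXX q x y * ξ ^ 2 + 2 * bellXY q x y * ξ * η + bellYY q x y * η ^ 2 := by
  have hq1 : 0 < q - 1 := by linarith
  have hX : 0 < x ^ (q - 1) := by positivity
  have hN : 0 < x ^ (q - 1) + y := by positivity
  have hP : 0 < (x ^ (q - 1) + y) ^ ((q - 2) / (q - 1)) := by positivity
  -- this bounds the mixed derivative, and rests on `x ≤ (x^(q-1) + y)^(1/(q-1))`
  have hZ : x / (x ^ (q - 1) + y) * (x ^ (q - 1) + y) ^ ((q - 2) / (q - 1)) ≤ 1 := by
    have h1 : x ≤ (x ^ (q - 1) + y) ^ (1 / (q - 1)) := by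
      calc x = (x ^ (q - 1)) ^ (1 / (q - 1)) := by
            rw [← Real.rpow_mul hx.le]; field_simp; simp
        _ ≤ _ := Real.rpow_le_rpow hX.le (by linarith) (by positivity)
    have h2 : (x ^ (q - 1) + y) ^ (1 / (q - 1)) * (x ^ (q - 1) + y) ^ ((q - 2) / (q - 1)) =
        x ^ (q - 1) + y := by
      rw [← Real.rpow_add hN, ← add_div, show 1 + (q - 2) = q - 1 by ring, div_self hq1.ne',
        Real.rpow_one]
    rw [div_mul_eq_mul_div, div_le_one hN]
    exact (mul_le_mul_of_nonneg_right h1 hP.le).trans h2.le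
  have hyq : ((x ^ (q - 1) + y) ^ ((q - 2) / (q - 1)))⁻¹ ≤ y ^ (q / (q - 1)) / y ^ 2 := by
    have h1 : y ^ (q / (q - 1)) / y ^ 2 = (y ^ ((q - 2) / (q - 1)))⁻¹ := by
      rw [← Real.rpow_natCast y 2, ← Real.rpow_sub hy, ← Real.rpow_neg hy.le]
      congr 1; push_cast; field_simp; ring
    rw [h1]
    have : 0 ≤ (q - 2) / (q - 1) := by apply div_nonneg <;> linarith
    exact inv_anti₀ (by positivity) (Real.rpow_le_rpow hy.le (by linarith) this)
  have hρ1 : x ^ (q - 1) / (x ^ (q - 1) + y) ≤ 1 := by rw [div_le_one hN]; linarith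
  have hρ0 : 0 < x ^ (q - 1) / (x ^ (q - 1) + y) := by positivity
  have hz0 : 0 < x / (x ^ (q - 1) + y) := by positivity
  unfold bellXX bellXY bellYY
  generalize x ^ (q - 1) / (x ^ (q - 1) + y) = ρ at *
  generalize x / (x ^ (q - 1) + y) = z at *
  generalize (x ^ (q - 1) + y) ^ ((q - 2) / (q - 1)) = P at *
  generalize y ^ (q / (q - 1)) / y ^ 2 = w at *
  have hXX : 2 * P ≤ (2 + (q - 2) * (q + 2) * ρ - (q - 2) * ρ ^ 2) * P := by
    refine mul_le_mul_of_nonneg_right ?_ hP.le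
    have : 0 ≤ (q - 2) * ρ * ((q + 2) - ρ) :=
      mul_nonneg (mul_nonneg (by linarith) hρ0.le) (by linarith)
    nlinarith
  have ha1 : (q - 2) / (q - 1) ≤ 1 := by rw [div_le_one hq1]; linarith
  have ha0 : 0 ≤ (q - 2) / (q - 1) := by apply div_nonneg <;> linarith
  have hXY0 : 0 ≤ (q - 2) / (q - 1) * (2 - ρ) * (z * P) :=
    mul_nonneg (mul_nonneg ha0 (by linarith)) (by positivity)
  have hXY : (q - 2) / (q - 1) * (2 - ρ) * (z * P) ≤ 2 := by
    have h1 : (q - 2) / (q - 1) * (2 - ρ) ≤ 2 := by nlinarith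
    have h2 : 0 ≤ z * P := by positivity
    nlinarith [mul_nonneg ha0 (by linarith : 0 ≤ 2 - ρ)]
  have hYY : 8 * P⁻¹ ≤ 30 * (q / (q - 1) ^ 2) * w - (q - 2) / (q - 1) ^ 2 * z ^ 2 * P := by
    have h1 : z ^ 2 * P ≤ P⁻¹ := by
      rw [inv_eq_one_div, le_div_iff₀ hP]
      have : (z * P) ^ 2 ≤ 1 := pow_le_one₀ (by positivity) hZ
      nlinarith
    have h2 : (q - 2) / (q - 1) ^ 2 ≤ 1 / 4 := by
      rw [div_le_div_iff₀ (by positivity) (by norm_num)]; nlinarith [sq_nonneg (q - 3)]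
    have h2' : 0 ≤ (q - 2) / (q - 1) ^ 2 := div_nonneg (by linarith) (by positivity)
    -- the coefficient `30` in `bell` is chosen for this bound, and `q ≤ 5` enters only here
    have h3 : 33 / 4 ≤ 30 * (q / (q - 1) ^ 2) := by
      rw [← mul_div_assoc, div_le_div_iff₀ (by norm_num) (by positivity)]; nlinarith
    have h4 : (q - 2) / (q - 1) ^ 2 * z ^ 2 * P ≤ 1 / 4 * P⁻¹ := by
      rw [mul_assoc]; exact mul_le_mul h2 h1 (by positivity) (by norm_num)
    have h5 : 33 / 4 * P⁻¹ ≤ 30 * (q / (q - 1) ^ 2) * w :=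
      mul_le_mul h3 hyq (by positivity) (by positivity)
    linarith
  generalize (2 + (q - 2) * (q + 2) * ρ - (q - 2) * ρ ^ 2) * P = bxx at *
  generalize (q - 2) / (q - 1) * (2 - ρ) * (z * P) = bxy at *
  generalize 30 * (q / (q - 1) ^ 2) * w - (q - 2) / (q - 1) ^ 2 * z ^ 2 * P = byy at *
  have h1 : 2 * P * ξ ^ 2 ≤ bxx * ξ ^ 2 := mul_le_mul_of_nonneg_right hXX (sq_nonneg _)
  have h2 : 8 * P⁻¹ * η ^ 2 ≤ byy * η ^ 2 := mul_le_mul_of_nonneg_right hYY (sq_nonneg _)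
  have h3 : -(4 * (|ξ| * |η|)) ≤ 2 * bxy * ξ * η := by
    have h5 := neg_abs_le (2 * bxy * ξ * η)
    rw [show 2 * bxy * ξ * η = 2 * bxy * (ξ * η) by ring, abs_mul,
      abs_of_nonneg (by linarith : 0 ≤ 2 * bxy), abs_mul] at h5
    have : 0 ≤ |ξ| * |η| := by positivity
    nlinarith
  have h4 : 4 * (|ξ| * |η|) ≤ P * ξ ^ 2 + 4 * P⁻¹ * η ^ 2 := by
    have h6 : 0 ≤ (P * |ξ| - 2 * |η|) ^ 2 * P⁻¹ := by positivity
    have h7 : (P * |ξ| - 2 * |η|) ^ 2 * P⁻¹ =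
        P * |ξ| ^ 2 + 4 * P⁻¹ * |η| ^ 2 - 4 * (|ξ| * |η|) := by field_simp; ring
    rw [sq_abs, sq_abs] at h7
    linarith
  linarith

theorem bell_nonneg (q : ℝ) {x y : ℝ} (hx : 0 < x) (hy : 0 < y) : 0 ≤ bell q x y := by
  unfold bell; positivity

/-- The size of the Bellman function. The two cases in the proof are those in which `x^(q-1)`,
respectively `y`, is the larger summand in the second term of `bell`. -/
theorem bell_le (hq : 2 < q) {x y : ℝ} (hx : 0 < x) (hy : 0 < y) :
    bell q x y ≤ 32 * (x ^ q + y ^ (q / (q - 1))) := by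
  have hq1 : 0 < q - 1 := by linarith
  have ha1 : (q - 2) / (q - 1) ≤ 1 := by rw [div_le_one hq1]; linarith
  have ha0 : 0 ≤ (q - 2) / (q - 1) := by apply div_nonneg <;> linarith
  have hX : 0 < x ^ (q - 1) := by positivity
  have h2a : (2 : ℝ) ^ ((q - 2) / (q - 1)) ≤ 2 := by
    calc (2 : ℝ) ^ ((q - 2) / (q - 1)) ≤ 2 ^ (1 : ℝ) :=
          Real.rpow_le_rpow_of_exponent_le (by norm_num) ha1
      _ = 2 := Real.rpow_one _
  have hxq : 0 < x ^ q := by positivity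
  have hyq : 0 < y ^ (q / (q - 1)) := by positivity
  have key : x ^ 2 * (x ^ (q - 1) + y) ^ ((q - 2) / (q - 1)) ≤
      2 * (x ^ q + y ^ (q / (q - 1))) := by
    rcases le_total y (x ^ (q - 1)) with h | h
    · have h1 : (x ^ (q - 1) + y) ^ ((q - 2) / (q - 1)) ≤ 2 * x ^ (q - 2) := by
        calc _ ≤ (2 * x ^ (q - 1)) ^ ((q - 2) / (q - 1)) :=
              Real.rpow_le_rpow (by positivity) (by linarith) ha0
          _ = 2 ^ ((q - 2) / (q - 1)) * x ^ (q - 2) := by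
              rw [Real.mul_rpow (by norm_num) hX.le, ← Real.rpow_mul hx.le]
              congr 2; field_simp
          _ ≤ _ := mul_le_mul_of_nonneg_right h2a (by positivity)
      have h2 : x ^ 2 * x ^ (q - 2) = x ^ q := by
        rw [← Real.rpow_natCast x 2, ← Real.rpow_add hx]; congr 1; push_cast; ring
      nlinarith [mul_le_mul_of_nonneg_left h1 (sq_nonneg x)]
    · have h1 : (x ^ (q - 1) + y) ^ ((q - 2) / (q - 1)) ≤ 2 * y ^ ((q - 2) / (q - 1)) := by
        calc _ ≤ (2 * y) ^ ((q - 2) / (q - 1)) :=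
              Real.rpow_le_rpow (by positivity) (by linarith) ha0
          _ = 2 ^ ((q - 2) / (q - 1)) * y ^ ((q - 2) / (q - 1)) :=
              Real.mul_rpow (by norm_num) hy.le
          _ ≤ _ := mul_le_mul_of_nonneg_right h2a (by positivity)
      have h3 : x ^ 2 ≤ y ^ (2 / (q - 1)) := by
        calc x ^ 2 = (x ^ (q - 1)) ^ (2 / (q - 1)) := by
              rw [← Real.rpow_mul hx.le, mul_div_cancel₀ _ hq1.ne', ← Real.rpow_natCast]; norm_num
          _ ≤ _ := Real.rpow_le_rpow hX.le h (by positivity)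
      have h2 : y ^ (2 / (q - 1)) * y ^ ((q - 2) / (q - 1)) = y ^ (q / (q - 1)) := by
        rw [← Real.rpow_add hy]; congr 1; field_simp; ring
      calc _ ≤ y ^ (2 / (q - 1)) * (2 * y ^ ((q - 2) / (q - 1))) :=
            mul_le_mul h3 h1 (by positivity) (by positivity)
        _ = 2 * y ^ (q / (q - 1)) := by rw [← h2]; ring
        _ ≤ _ := by linarith
  unfold bell
  linarith

end Bellman

/-! ### Contractivity of the heat flow in `Lʳ` -/

/-- The heat flow of a nonnegative extended real valued function. -/
noncomputable def heatE (s : ℝ) (k : E3 → ℝ≥0∞) (x : E3) : ℝ≥0∞ :=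
  ∫⁻ y, ENNReal.ofReal (heatKernel s (x - y)) * k y

theorem continuous_heatKernel (s : ℝ) : Continuous (heatKernel s) := by
  unfold heatKernel; fun_prop

theorem lintegral_heatKernel {s : ℝ} (hs : 0 < s) (x : E3) :
    ∫⁻ y, ENNReal.ofReal (heatKernel s (x - y)) = 1 := by
  rw [← ofReal_integral_eq_lintegral_ofReal
    ((isKernel_heatKernel hs).integrable.comp_sub_left x)
    (ae_of_all _ fun y => (heatKernel_pos hs _).le), integral_sub_left_eq_self (heatKernel s),
    integral_heatKernel hs, ENNReal.ofReal_one]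

theorem enorm_cv_heatKernel_le {F : Type*} [NormedAddCommGroup F] [NormedSpace ℝ F] {s : ℝ}
    (hs : 0 < s) (h : E3 → F) (x : E3) :
    ‖cv (heatKernel s) h x‖ₑ ≤ heatE s (fun y => ‖h y‖ₑ) x := by
  refine (enorm_integral_le_lintegral_enorm _).trans_eq (lintegral_congr fun y => ?_)
  rw [enorm_smul, Real.enorm_eq_ofReal (heatKernel_pos hs _).le]

/-- Jensen's inequality for the heat kernel. -/
theorem heatE_rpow_le {s : ℝ} (hs : 0 < s) {k : E3 → ℝ≥0∞} (hk : AEMeasurable k) {r : ℝ}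
    (hr : 1 ≤ r) (x : E3) : heatE s k x ^ r ≤ heatE s (fun y => k y ^ r) x := by
  have hm : Measurable fun y => ENNReal.ofReal (heatKernel s (x - y)) :=
    ((continuous_heatKernel s).comp (continuous_const.sub continuous_id)).measurable.ennreal_ofReal
  set μ : Measure E3 := volume.withDensity fun y => ENNReal.ofReal (heatKernel s (x - y)) with hμ
  have hprob : IsProbabilityMeasure μ := ⟨by
    rw [hμ, withDensity_apply _ MeasurableSet.univ, Measure.restrict_univ,
      lintegral_heatKernel hs]⟩
  have hkμ : AEMeasurable k μ := hk.mono_ac (withDensity_absolutelyContinuous _ _)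
  have h1 := eLpNorm_le_eLpNorm_of_exponent_le (μ := μ) (p := 1) (q := ENNReal.ofReal r)
    (by simpa using hr) hkμ.aestronglyMeasurable
  have hr0 : 0 < r := by linarith
  rw [eLpNorm_one_eq_lintegral_enorm, eLpNorm_eq_lintegral_rpow_enorm_toReal (by simpa using hr0)
    ENNReal.ofReal_ne_top, ENNReal.toReal_ofReal hr0.le] at h1
  simp only [enorm_eq_self] at h1
  have h2 := ENNReal.rpow_le_rpow h1 hr0.le
  rw [← ENNReal.rpow_mul, one_div_mul_cancel hr0.ne', ENNReal.rpow_one,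
    lintegral_withDensity_eq_lintegral_mul₀ hm.aemeasurable hk,
    lintegral_withDensity_eq_lintegral_mul₀ hm.aemeasurable (hk.pow_const r)] at h2
  exact h2

theorem lintegral_heatE {s : ℝ} (hs : 0 < s) {k : E3 → ℝ≥0∞} (hk : AEMeasurable k) :
    ∫⁻ x, heatE s k x = ∫⁻ x, k x := by
  unfold heatE
  have hm : Measurable fun z : E3 × E3 => ENNReal.ofReal (heatKernel s (z.1 - z.2)) :=
    ((continuous_heatKernel s).comp (continuous_fst.sub continuous_snd)).measurable.ennreal_ofReal
  have hk2 : AEMeasurable (fun z : E3 × E3 => k z.2) (volume.prod volume) := hk.comp_snd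
  have hmk : AEMeasurable (Function.uncurry fun x y => ENNReal.ofReal (heatKernel s (x - y)) * k y)
      (volume.prod volume) := hm.aemeasurable.mul hk2
  rw [lintegral_lintegral_swap hmk]
  refine lintegral_congr fun y => ?_
  have hm2 : Measurable fun x : E3 => ENNReal.ofReal (heatKernel s (x - y)) :=
    ((continuous_heatKernel s).comp (continuous_id.sub continuous_const)).measurable.ennreal_ofReal
  rw [lintegral_mul_const _ hm2]
  have h : ∀ x, ENNReal.ofReal (heatKernel s (x - y)) = ENNReal.ofReal (heatKernel s (y - x)) :=
    fun x => by rw [← heatKernel_neg, neg_sub]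
  rw [lintegral_congr h, lintegral_heatKernel hs, one_mul]

theorem lintegral_heatE_rpow_le {s : ℝ} (hs : 0 < s) {k : E3 → ℝ≥0∞} (hk : AEMeasurable k)
    {r : ℝ} (hr : 1 ≤ r) : ∫⁻ x, heatE s k x ^ r ≤ ∫⁻ x, k x ^ r :=
  (lintegral_mono fun x => heatE_rpow_le hs hk hr x).trans_eq (lintegral_heatE hs (hk.pow_const r))

theorem lintegral_cv_rpow_le {F : Type*} [NormedAddCommGroup F] [NormedSpace ℝ F] {s : ℝ}
    (hs : 0 < s) {h : E3 → F} (hh : AEStronglyMeasurable h) {r : ℝ} (hr : 1 ≤ r) :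
    ∫⁻ x, ‖cv (heatKernel s) h x‖ₑ ^ r ≤ ∫⁻ x, ‖h x‖ₑ ^ r :=
  (lintegral_mono fun x => ENNReal.rpow_le_rpow (enorm_cv_heatKernel_le hs h x)
    (by linarith)).trans (lintegral_heatE_rpow_le hs hh.enorm hr)

/-! ### Cutoff functions -/

/-- A smooth bump function equal to one on the unit ball. -/
noncomputable def unitBump : ContDiffBump (0 : E3) := ⟨1, 2, one_pos, by norm_num⟩

/-- A smooth compactly supported function equal to one on the ball of radius `R`. -/
noncomputable def cutoff (R : ℝ) (x : E3) : ℝ := unitBump (R⁻¹ • x)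

theorem contDiff_cutoff (R : ℝ) : ContDiff ℝ ∞ (cutoff R) :=
  unitBump.contDiff.comp (contDiff_const_smul _)

theorem cutoff_nonneg (R : ℝ) (x : E3) : 0 ≤ cutoff R x := unitBump.nonneg

theorem cutoff_le_one (R : ℝ) (x : E3) : cutoff R x ≤ 1 := unitBump.le_one

theorem cutoff_eq_one {R : ℝ} (hR : 0 < R) {x : E3} (hx : ‖x‖ ≤ R) : cutoff R x = 1 := by
  refine unitBump.one_of_mem_closedBall ?_
  rw [mem_closedBall_zero_iff, norm_smul, norm_inv, Real.norm_eq_abs, abs_of_pos hR]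
  change R⁻¹ * ‖x‖ ≤ 1
  rw [← div_eq_inv_mul, div_le_one hR]; exact hx

theorem hasCompactSupport_cutoff {R : ℝ} (hR : 0 < R) : HasCompactSupport (cutoff R) :=
  unitBump.hasCompactSupport.comp_smul (inv_ne_zero hR.ne')

theorem pd_cutoff (R : ℝ) (i : Fin 3) (x : E3) :
    pd i (cutoff R) x = R⁻¹ * pd i unitBump (R⁻¹ • x) := pd_comp_smul _ i _ x

theorem pd_pd_cutoff (R : ℝ) (i j : Fin 3) (x : E3) :
    pd i (pd j (cutoff R)) x = R⁻¹ ^ 2 * pd i (pd j unitBump) (R⁻¹ • x) := by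
  have hd : Differentiable ℝ (pd j unitBump) :=
    (contDiff_pd unitBump.contDiff j).differentiable (by simp)
  have hd2 : DifferentiableAt ℝ (fun y => pd j unitBump (R⁻¹ • y)) x :=
    (hd _).comp (f := fun y : E3 => R⁻¹ • y) x (by fun_prop)
  rw [funext (pd_cutoff R j), pd_const_mul i _ hd2, pd_comp_smul]
  simp only [smul_eq_mul]; ring

theorem hasCompactSupport_pd {F : Type*} [NormedAddCommGroup F] [NormedSpace ℝ F] {f : E3 → F}
    (hf : HasCompactSupport f) (i : Fin 3) : HasCompactSupport (pd i f) :=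
  hf.fderiv_apply ℝ _

theorem exists_bound_pd_cutoff : ∃ C, 0 ≤ C ∧ ∀ R : ℝ, 0 < R → ∀ i x, |pd i (cutoff R) x| ≤ C / R := by
  have h : ∀ i, ∃ C, ∀ x, ‖pd i unitBump x‖ ≤ C := fun i =>
    (contDiff_pd unitBump.contDiff i).continuous.bounded_above_of_compact_support
      (hasCompactSupport_pd unitBump.hasCompactSupport i)
  choose C hC using h
  have hC0 : ∀ i, 0 ≤ C i := fun i => (norm_nonneg _).trans (hC i 0)
  refine ⟨∑ i, C i, Finset.sum_nonneg fun i _ => hC0 i, fun R hR i x => ?_⟩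
  rw [pd_cutoff, abs_mul, abs_of_pos (inv_pos.2 hR), ← div_eq_inv_mul]
  gcongr
  exact (hC i _).trans (Finset.single_le_sum (fun i _ => hC0 i) (Finset.mem_univ i))

theorem exists_bound_lap_cutoff : ∃ C, 0 ≤ C ∧ ∀ R : ℝ, 0 < R → ∀ x,
    |lap (cutoff R) x| ≤ C / R ^ 2 := by
  have h : ∀ i, ∃ C, ∀ x, ‖pd i (pd i unitBump) x‖ ≤ C := fun i =>
    (contDiff_pd (contDiff_pd unitBump.contDiff i) i).continuous.bounded_above_of_compact_support
      (hasCompactSupport_pd (hasCompactSupport_pd unitBump.hasCompactSupport i) i)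
  choose C hC using h
  have hC0 : ∀ i, 0 ≤ C i := fun i => (norm_nonneg _).trans (hC i 0)
  refine ⟨∑ i, C i, Finset.sum_nonneg fun i _ => hC0 i, fun R hR x => ?_⟩
  unfold lap
  simp only [pd_pd_cutoff]
  rw [← Finset.mul_sum, abs_mul, abs_of_pos (by positivity), inv_pow, ← div_eq_inv_mul]
  gcongr
  exact (Finset.abs_sum_le_sum_abs _ _).trans (Finset.sum_le_sum fun i _ => hC i _)

/-! ### The bilinear estimate for heat flows -/

theorem pd_eq_of_hasDerivAt {f : E3 → ℝ} {x : E3} {i : Fin 3} {f' : ℝ}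
    (hf : DifferentiableAt ℝ f x)
    (h : HasDerivAt (fun t : ℝ => f (x + t • EuclideanSpace.single i (1 : ℝ))) f' 0) :
    pd i f x = f' :=
  (hf.hasFDerivAt.hasLineDerivAt (EuclideanSpace.single i (1 : ℝ))).unique h

theorem hasDerivAt_line {f : E3 → ℝ} {x : E3} (hf : DifferentiableAt ℝ f x) (i : Fin 3) :
    HasDerivAt (fun t : ℝ => f (x + t • EuclideanSpace.single i (1 : ℝ))) (pd i f x) 0 :=
  hf.hasFDerivAt.hasLineDerivAt (EuclideanSpace.single i (1 : ℝ))

/-- A continuous function on a slab which vanishes off a compact set in space is integrable. -/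
theorem integrable_slab {h : ℝ × E3 → ℝ} {a b : ℝ} {K : Set E3} (hK : IsCompact K)
    (hc : ContinuousOn h (Icc a b ×ˢ univ)) (h0 : ∀ s x, x ∉ K → h (s, x) = 0) :
    Integrable h ((volume.restrict (Ioc a b)).prod volume) := by
  have h1 : IntegrableOn h (Icc a b ×ˢ K) (volume.prod volume) :=
    (hc.mono (prod_mono_right (subset_univ _))).integrableOn_compact (isCompact_Icc.prod hK)
  have h2 : IntegrableOn h (Icc a b ×ˢ univ) (volume.prod volume) :=
    h1.of_forall_sdiff_eq_zero (measurableSet_Icc.prod MeasurableSet.univ) fun z hz =>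
      h0 z.1 z.2 fun hzK => hz.2 ⟨hz.1.1, hzK⟩
  have h3 : (volume.restrict (Ioc a b)).prod (volume : Measure E3) =
      (volume.prod volume).restrict (Ioc a b ×ˢ univ) := by
    rw [← Measure.prod_restrict, Measure.restrict_univ]
  rw [h3]
  exact h2.mono_set (prod_mono_left Ioc_subset_Icc_self)

section BellmanFlow

variable {q : ℝ} {f g : E3 → ℝ}

theorem cv_heatKernel_pos {s : ℝ} (hs : 0 < s) (hf : IsBC f) (hf0 : ∀ x, 0 ≤ f x)
    (hfp : ∃ x, 0 < f x) (x : E3) : 0 < cv (heatKernel s) f x := by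
  unfold cv
  have hnn : ∀ y, 0 ≤ heatKernel s (x - y) • f y := fun y =>
    mul_nonneg (heatKernel_pos hs _).le (hf0 y)
  rw [integral_pos_iff_support_of_nonneg hnn
    (integrable_cv_integrand (isKernel_heatKernel hs).integrable hf x)]
  have hcont : Continuous fun y => heatKernel s (x - y) • f y :=
    ((continuous_heatKernel s).comp (continuous_const.sub continuous_id)).smul hf.continuous
  obtain ⟨y, hy⟩ := hfp
  refine (hcont.isOpen_support).measure_pos volume ⟨y, ?_⟩
  exact (mul_pos (heatKernel_pos hs _) hy).ne'

theorem differentiableAt_bell (q : ℝ) {a b : E3 → ℝ} {x : E3} (ha : DifferentiableAt ℝ a x)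
    (hb : DifferentiableAt ℝ b x) (ha0 : 0 < a x) (hb0 : 0 < b x) :
    DifferentiableAt ℝ (fun y => bell q (a y) (b y)) x ∧
    DifferentiableAt ℝ (fun y => bellX q (a y) (b y)) x ∧
    DifferentiableAt ℝ (fun y => bellY q (a y) (b y)) x := by
  have hN : 0 < a x ^ (q - 1) + b x := by positivity
  have h1 : DifferentiableAt ℝ (fun y => a y ^ (q - 1)) x := ha.rpow_const (Or.inl ha0.ne')
  have h2 : DifferentiableAt ℝ (fun y => a y ^ (q - 1) + b y) x := h1.add hb
  have h3 : DifferentiableAt ℝ (fun y => (a y ^ (q - 1) + b y) ^ ((q - 2) / (q - 1))) x :=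
    h2.rpow_const (Or.inl hN.ne')
  have h4 : DifferentiableAt ℝ (fun y => b y ^ (q / (q - 1))) x := hb.rpow_const (Or.inl hb0.ne')
  have hdiv : ∀ {n d : E3 → ℝ}, DifferentiableAt ℝ n x → DifferentiableAt ℝ d x → d x ≠ 0 →
      DifferentiableAt ℝ (fun y => n y / d y) x := fun hn hd h0 => by
    simp only [div_eq_mul_inv]
    exact hn.mul (hd.fun_inv h0)
  unfold bell bellX bellY
  refine ⟨?_, ?_, ?_⟩
  · exact (h4.const_mul _).add ((ha.pow 2).mul h3)
  · exact ((ha.const_mul 2).add (hdiv ((ha.const_mul _).mul h1) h2 hN.ne')).mul h3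
  · exact ((hdiv h4 hb hb0.ne').const_mul _).add ((hdiv ((ha.pow 2).const_mul _) h2 hN.ne').mul h3)

theorem continuousOn_bell {α : Type*} [TopologicalSpace α] {S : Set α} {a b : α → ℝ}
    (ha : ContinuousOn a S) (hb : ContinuousOn b S) (ha0 : ∀ z ∈ S, 0 < a z)
    (hb0 : ∀ z ∈ S, 0 < b z) (q : ℝ) :
    ContinuousOn (fun z => bellX q (a z) (b z)) S ∧ ContinuousOn (fun z => bellY q (a z) (b z)) S ∧
    ContinuousOn (fun z => bellXX q (a z) (b z)) S ∧
    ContinuousOn (fun z => bellXY q (a z) (b z)) S ∧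
    ContinuousOn (fun z => bellYY q (a z) (b z)) S := by
  have hN : ∀ z ∈ S, a z ^ (q - 1) + b z ≠ 0 := fun z hz => by
    have h1 := ha0 z hz
    have h2 := hb0 z hz
    positivity
  have h1 : ContinuousOn (fun z => a z ^ (q - 1)) S :=
    ha.rpow_const fun z hz => Or.inl (ha0 z hz).ne'
  have h2 : ContinuousOn (fun z => a z ^ (q - 1) + b z) S := h1.add hb
  have h3 : ContinuousOn (fun z => (a z ^ (q - 1) + b z) ^ ((q - 2) / (q - 1))) S :=
    h2.rpow_const fun z hz => Or.inl (hN z hz)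
  have h4 : ContinuousOn (fun z => b z ^ (q / (q - 1))) S :=
    hb.rpow_const fun z hz => Or.inl (hb0 z hz).ne'
  have h5 : ContinuousOn (fun z => a z ^ (q - 1) / (a z ^ (q - 1) + b z)) S := h1.div h2 hN
  have h6 : ContinuousOn (fun z => a z / (a z ^ (q - 1) + b z)) S := ha.div h2 hN
  unfold bellX bellY bellXX bellXY bellYY
  refine ⟨?_, ?_, ?_, ?_, ?_⟩
  · exact ((continuousOn_const.mul ha).add (((continuousOn_const.mul ha).mul h1).div h2 hN)).mul h3
  · exact (continuousOn_const.mul (h4.div hb fun z hz => (hb0 z hz).ne')).add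
      (((continuousOn_const.mul (ha.pow 2)).div h2 hN).mul h3)
  · exact ((continuousOn_const.add (continuousOn_const.mul h5)).sub
      (continuousOn_const.mul (h5.pow 2))).mul h3
  · exact (continuousOn_const.mul (continuousOn_const.sub h5)).mul (h6.mul h3)
  · exact (continuousOn_const.mul (h4.div (hb.pow 2) fun z hz => pow_ne_zero 2 (hb0 z hz).ne')).sub
      ((continuousOn_const.mul (h6.pow 2)).mul h3)

/-- The differential inequality `(∂ₛ - Δ) B(Pₛf, Pₛg) ≤ -4 |∂ₖPₛf| |∂ₗPₛg|` for the Bellman function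
`B`, integrated against a cutoff function. -/
theorem integral_cutoff_bell_le (hq : 2 < q) (hq5 : q ≤ 5) {s : ℝ} (hs : 0 < s) {χ : E3 → ℝ}
    (hχ : ContDiff ℝ ∞ χ) (hχc : HasCompactSupport χ) (hχ0 : ∀ x, 0 ≤ χ x)
    (hf : IsBC f) (hf0 : ∀ x, 0 ≤ f x) (hfp : ∃ x, 0 < f x)
    (hg : IsBC g) (hg0 : ∀ x, 0 ≤ g x) (hgp : ∃ x, 0 < g x) (k l : Fin 3) :
    ∫ x, χ x * (bellX q (cv (heatKernel s) f x) (cv (heatKernel s) g x) *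
          cv (lap (heatKernel s)) f x +
        bellY q (cv (heatKernel s) f x) (cv (heatKernel s) g x) * cv (lap (heatKernel s)) g x) ≤
      (∫ x, lap χ x * bell q (cv (heatKernel s) f x) (cv (heatKernel s) g x)) -
        4 * ∫ x, χ x * (|cv (pd k (heatKernel s)) f x| * |cv (pd l (heatKernel s)) g x|) := by
  have hK := isKernel_heatKernel hs
  set u := cv (heatKernel s) f with hu
  set v := cv (heatKernel s) g with hv
  have hu0 : ∀ x, 0 < u x := cv_heatKernel_pos hs hf hf0 hfp
  have hv0 : ∀ x, 0 < v x := cv_heatKernel_pos hs hg hg0 hgp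
  have hud : Differentiable ℝ u := differentiable_cv hK hf
  have hvd : Differentiable ℝ v := differentiable_cv hK hg
  have hui : ∀ i, pd i u = cv (pd i (heatKernel s)) f := fun i => pd_cv hK hf i
  have hvi : ∀ i, pd i v = cv (pd i (heatKernel s)) g := fun i => pd_cv hK hg i
  have huid : ∀ i, Differentiable ℝ (pd i u) := fun i => by
    rw [hui]; exact differentiable_cv (hK.pd i) hf
  have hvid : ∀ i, Differentiable ℝ (pd i v) := fun i => by
    rw [hvi]; exact differentiable_cv (hK.pd i) hg
  have huii : ∀ i, Continuous (pd i (pd i u)) := fun i => by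
    rw [hui, pd_cv (hK.pd i) hf]; exact (hf.cv ((hK.pd i).pd i).integrable).continuous
  have hvii : ∀ i, Continuous (pd i (pd i v)) := fun i => by
    rw [hvi, pd_cv (hK.pd i) hg]; exact (hg.cv ((hK.pd i).pd i).integrable).continuous
  obtain ⟨cX, cY, cXX, cXY, cYY⟩ := continuousOn_bell (S := univ) hud.continuous.continuousOn
    hvd.continuous.continuousOn (fun x _ => hu0 x) (fun x _ => hv0 x) q
  rw [continuousOn_univ] at cX cY cXX cXY cYY
  have hBd : ∀ x, _ := fun x => differentiableAt_bell q (hud x) (hvd x) (hu0 x) (hv0 x)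
  set Λ : E3 → ℝ := fun x => bell q (u x) (v x) with hΛ
  set m : Fin 3 → E3 → ℝ := fun i x => bellX q (u x) (v x) * pd i u x +
    bellY q (u x) (v x) * pd i v x with hm
  set Q : Fin 3 → E3 → ℝ := fun i x => bellXX q (u x) (v x) * (pd i u x) ^ 2 +
    2 * bellXY q (u x) (v x) * pd i u x * pd i v x + bellYY q (u x) (v x) * (pd i v x) ^ 2 with hQ
  have hpΛ : ∀ i, pd i Λ = m i := fun i => by
    ext x
    refine pd_eq_of_hasDerivAt (hBd x).1 ?_
    have := hasDerivAt_bell hq (hasDerivAt_line (hud x) i) (hasDerivAt_line (hvd x) i)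
      (by simpa using hu0 x) (by simpa using hv0 x)
    simpa using this
  have hmd : ∀ i, Differentiable ℝ (m i) := fun i x =>
    ((hBd x).2.1.mul (huid i x)).add ((hBd x).2.2.mul (hvid i x))
  have hpm : ∀ i x, pd i (m i) x = bellX q (u x) (v x) * pd i (pd i u) x +
      bellY q (u x) (v x) * pd i (pd i v) x + Q i x := fun i x => by
    refine pd_eq_of_hasDerivAt (hmd i x) ?_
    have h1 := hasDerivAt_bellX hq (hasDerivAt_line (hud x) i) (hasDerivAt_line (hvd x) i)
      (by simpa using hu0 x) (by simpa using hv0 x)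
    have h2 := hasDerivAt_bellY hq (hasDerivAt_line (hud x) i) (hasDerivAt_line (hvd x) i)
      (by simpa using hu0 x) (by simpa using hv0 x)
    refine ((h1.mul (hasDerivAt_line (huid i x) i)).add
      (h2.mul (hasDerivAt_line (hvid i x) i))).congr_deriv ?_
    simp only [zero_smul, add_zero, hQ]
    ring
  have hQc : ∀ i, Continuous (Q i) := fun i =>
    ((cXX.mul ((huid i).continuous.pow 2)).add (((continuous_const.mul cXY).mul
      (huid i).continuous).mul (hvid i).continuous)).add (cYY.mul ((hvid i).continuous.pow 2))
  have hpmc : ∀ i, Continuous (pd i (m i)) := fun i => by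
    rw [funext (hpm i)]
    exact ((cX.mul (huii i)).add (cY.mul (hvii i))).add (hQc i)
  have hΛd : Differentiable ℝ Λ := fun x => (hBd x).1
  have hint : ∀ {ψ h : E3 → ℝ}, Continuous ψ → HasCompactSupport ψ → Continuous h →
      Integrable fun x => ψ x * h x := fun h1 h2 h3 =>
    (h1.mul h3).integrable_of_hasCompactSupport h2.mul_right
  have hχi : ∀ i, ContDiff ℝ ∞ (pd i χ) := fun i => contDiff_pd hχ i
  have hχic : ∀ i, HasCompactSupport (pd i χ) := fun i => hasCompactSupport_pd hχc i
  have hibp : ∀ i, ∫ x, χ x * pd i (m i) x = ∫ x, pd i (pd i χ) x * Λ x := fun i => by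
    have e1 := integral_mul_fderiv_eq_neg_fderiv_mul_of_integrable (μ := volume) (f := χ)
      (g := m i) (v := EuclideanSpace.single i (1 : ℝ))
      (hint (hχi i).continuous (hχic i) (hmd i).continuous) (hint hχ.continuous hχc (hpmc i))
      (hint hχ.continuous hχc (hmd i).continuous) (fun x _ => hχ.differentiable (by simp) x)
      (fun x _ => hmd i x)
    have hpΛc : Continuous (pd i Λ) := by rw [hpΛ]; exact (hmd i).continuous
    have e2 := integral_mul_fderiv_eq_neg_fderiv_mul_of_integrable (μ := volume) (f := pd i χ)
      (g := Λ) (v := EuclideanSpace.single i (1 : ℝ))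
      (hint (contDiff_pd (hχi i) i).continuous (hasCompactSupport_pd (hχic i) i) hΛd.continuous)
      (hint (hχi i).continuous (hχic i) hpΛc)
      (hint (hχi i).continuous (hχic i) hΛd.continuous)
      (fun x _ => (hχi i).differentiable (by simp) x) (fun x _ => hΛd x)
    calc ∫ x, χ x * pd i (m i) x = - ∫ x, pd i χ x * m i x := e1
      _ = - ∫ x, pd i χ x * pd i Λ x := by rw [hpΛ]
      _ = ∫ x, pd i (pd i χ) x * Λ x := by
        rw [neg_eq_iff_eq_neg]; exact e2
  have hsplit : ∀ x, χ x * (bellX q (u x) (v x) * cv (lap (heatKernel s)) f x +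
      bellY q (u x) (v x) * cv (lap (heatKernel s)) g x) =
      (∑ i, χ x * pd i (m i) x) - χ x * ∑ i, Q i x := fun x => by
    simp only [hpm]
    rw [← lap_cv hK hf, ← lap_cv hK hg, ← hu, ← hv]
    simp only [lap, Fin.sum_univ_three]
    ring
  have hQ4 : ∀ x, 4 * (|cv (pd k (heatKernel s)) f x| * |cv (pd l (heatKernel s)) g x|) ≤
      ∑ i, Q i x := fun x => by
    rw [← hui, ← hvi]
    have hP : 0 < (u x ^ (q - 1) + v x) ^ ((q - 2) / (q - 1)) := by
      have := hu0 x; have := hv0 x; positivity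
    have hb := fun i => bell_hessian hq hq5 (hu0 x) (hv0 x) (pd i u x) (pd i v x)
    generalize (u x ^ (q - 1) + v x) ^ ((q - 2) / (q - 1)) = P at hP hb
    calc 4 * (|pd k u x| * |pd l v x|) ≤ P * (pd k u x) ^ 2 + 4 * P⁻¹ * (pd l v x) ^ 2 := by
          have h6 : 0 ≤ (P * |pd k u x| - 2 * |pd l v x|) ^ 2 * P⁻¹ := by positivity
          have h7 : (P * |pd k u x| - 2 * |pd l v x|) ^ 2 * P⁻¹ = P * |pd k u x| ^ 2 +
              4 * P⁻¹ * |pd l v x| ^ 2 - 4 * (|pd k u x| * |pd l v x|) := by field_simp; ring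
          rw [sq_abs, sq_abs] at h7
          linarith
      _ ≤ (∑ i, P * (pd i u x) ^ 2) + ∑ i, 4 * P⁻¹ * (pd i v x) ^ 2 := by
          refine add_le_add ?_ ?_
          · exact Finset.single_le_sum (f := fun i => P * (pd i u x) ^ 2)
              (fun i _ => by positivity) (Finset.mem_univ k)
          · exact Finset.single_le_sum (f := fun i => 4 * P⁻¹ * (pd i v x) ^ 2)
              (fun i _ => by positivity) (Finset.mem_univ l)
      _ ≤ ∑ i, Q i x := by
          rw [← Finset.sum_add_distrib]
          exact Finset.sum_le_sum fun i _ => hb i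
  have hQsc : Continuous fun x => ∑ i, Q i x := continuous_finsetSum _ fun i _ => hQc i
  have hwc : Continuous fun x => |cv (pd k (heatKernel s)) f x| * |cv (pd l (heatKernel s)) g x| := by
    rw [← hui, ← hvi]
    exact (huid k).continuous.abs.mul (hvid l).continuous.abs
  simp_rw [hsplit]
  rw [integral_sub (integrable_finsetSum _ fun i _ => hint hχ.continuous hχc (hpmc i))
    (hint hχ.continuous hχc hQsc), integral_finsetSum _ fun i _ => hint hχ.continuous hχc (hpmc i)]
  refine sub_le_sub (le_of_eq ?_) ?_
  · simp_rw [hibp, lap, Finset.sum_mul]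
    rw [integral_finsetSum _ fun i _ => hint (contDiff_pd (hχi i) i).continuous
      (hasCompactSupport_pd (hχic i) i) hΛd.continuous]
  · rw [← integral_const_mul]
    refine integral_mono ((hint hχ.continuous hχc hwc).const_mul 4) (hint hχ.continuous hχc hQsc)
      fun x => ?_
    have := mul_le_mul_of_nonneg_left (hQ4 x) (hχ0 x)
    simp only
    linarith

end BellmanFlow

section BilinearEstimate

variable {q : ℝ} {f g : E3 → ℝ}

theorem continuousOn_cv_heat (hf : IsBC f) (m : ℕ) {K : E3 → ℝ} (hK : IsKernel K)
    {L : ℝ → E3 → ℝ} (hL : ∀ s, 0 < s → L s = dil m s K) :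
    ContinuousOn (fun z : ℝ × E3 => cv (L z.1) f z.2) (Ioi 0 ×ˢ univ) := by
  obtain ⟨M, hM⟩ := hf.bounded
  have h := continuousOn_cv_dil (U := fun _ => f) (hf.continuous.comp continuous_snd)
    (fun _ x => hM x) m hK.continuous hK.integrable
  have h2 : ContinuousOn (fun z : ℝ × E3 => cv (dil m z.1 K) f z.2) (Ioi 0 ×ˢ univ) :=
    h.comp (f := fun z : ℝ × E3 => (z.1, (0 : ℝ), z.2)) (by fun_prop) fun z hz => ⟨hz.1, mem_univ _⟩
  exact h2.congr fun z hz => by simp only [hL z.1 hz.1]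

theorem IsBC.integrable_rpow (hf : IsBC f) (hfi : Integrable f) {r : ℝ} (hr : 1 ≤ r) :
    Integrable fun x => |f x| ^ r := by
  obtain ⟨M, hM0, hM⟩ := hf.exists_bound
  refine (hfi.abs.const_mul (M ^ (r - 1))).mono'
    (hf.continuous.abs.rpow_const fun x => Or.inr (by linarith)).aestronglyMeasurable
    (ae_of_all _ fun x => ?_)
  rw [Real.norm_of_nonneg (by positivity)]
  calc |f x| ^ r = |f x| ^ (r - 1) * |f x| := by
        rw [← Real.rpow_add_one' (abs_nonneg _) (by linarith)]; ring_nf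
    _ ≤ _ := by
        gcongr; exact hM x

theorem integral_cv_rpow_le {s : ℝ} (hs : 0 < s) (hf : IsBC f) (hfi : Integrable f) {r : ℝ}
    (hr : 1 ≤ r) : ∫ x, |cv (heatKernel s) f x| ^ r ≤ ∫ x, |f x| ^ r := by
  have hK := (isKernel_heatKernel hs).integrable
  have h1 := lintegral_cv_rpow_le hs hf.continuous.aestronglyMeasurable hr
  have h2 : ∀ {h : E3 → ℝ}, IsBC h → Integrable h → ∫⁻ x, ‖h x‖ₑ ^ r =
      ENNReal.ofReal (∫ x, |h x| ^ r) := fun {h} hh hhi => by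
    rw [ofReal_integral_eq_lintegral_ofReal (hh.integrable_rpow hhi hr)
      (ae_of_all _ fun x => by positivity)]
    refine lintegral_congr fun x => ?_
    rw [← ENNReal.ofReal_rpow_of_nonneg (abs_nonneg _) (by linarith), ← Real.norm_eq_abs,
      ofReal_norm]
  rw [h2 (hf.cv hK) (integrable_cv hK hfi), h2 hf hfi] at h1
  exact (ENNReal.ofReal_le_ofReal_iff (integral_nonneg fun x => by positivity)).1 h1

/-- The estimate for the bilinear heat flow on a bounded time interval and against a cutoff
function. -/
theorem integral_bilinear_slab_le (hq : 2 < q) (hq5 : q ≤ 5) {ε T : ℝ} (hε : 0 < ε) (hT : ε ≤ T)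
    {χ : E3 → ℝ} (hχ : ContDiff ℝ ∞ χ) (hχc : HasCompactSupport χ) (hχ0 : ∀ x, 0 ≤ χ x)
    (hχ1 : ∀ x, χ x ≤ 1) {c : ℝ} (hc0 : 0 ≤ c) (hc : ∀ x, |lap χ x| ≤ c)
    (hf : IsBC f) (hfi : Integrable f) (hf0 : ∀ x, 0 ≤ f x) (hfp : ∃ x, 0 < f x)
    (hg : IsBC g) (hgi : Integrable g) (hg0 : ∀ x, 0 ≤ g x) (hgp : ∃ x, 0 < g x) (k l : Fin 3) :
    Integrable (fun z : ℝ × E3 => χ z.2 *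
      (|cv (pd k (heatKernel z.1)) f z.2| * |cv (pd l (heatKernel z.1)) g z.2|))
      ((volume.restrict (Ioc ε T)).prod volume) ∧
    ∫ s in ε..T, ∫ x, χ x * (|cv (pd k (heatKernel s)) f x| * |cv (pd l (heatKernel s)) g x|) ≤
      8 * (1 + c * (T - ε)) * ((∫ x, |f x| ^ q) + ∫ x, |g x| ^ (q / (q - 1))) := by
  set A := (∫ x, |f x| ^ q) + ∫ x, |g x| ^ (q / (q - 1)) with hA
  have hA0 : 0 ≤ A := add_nonneg (integral_nonneg fun x => by positivity)
    (integral_nonneg fun x => by positivity)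
  have hq' : 1 ≤ q / (q - 1) := by rw [le_div_iff₀ (by linarith)]; linarith
  have hk1 := isKernel_heatKernel one_pos
  have hsub : Icc ε T ×ˢ (univ : Set E3) ⊆ Ioi 0 ×ˢ univ :=
    prod_mono_left fun s hs => lt_of_lt_of_le hε hs.1
  have cu := (continuousOn_cv_heat hf 0 hk1 fun s hs => heatKernel_eq_dil hs).mono hsub
  have cv' := (continuousOn_cv_heat hg 0 hk1 fun s hs => heatKernel_eq_dil hs).mono hsub
  have cuk := (continuousOn_cv_heat hf 1 (hk1.pd k) fun s hs => pd_heatKernel_eq_dil hs k).mono hsub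
  have cvl := (continuousOn_cv_heat hg 1 (hk1.pd l) fun s hs => pd_heatKernel_eq_dil hs l).mono hsub
  have cuL := (continuousOn_cv_heat hf 2 hk1.lap fun s hs => lap_heatKernel_eq_dil hs).mono hsub
  have cvL := (continuousOn_cv_heat hg 2 hk1.lap fun s hs => lap_heatKernel_eq_dil hs).mono hsub
  obtain ⟨cX, cY, -, -, -⟩ := continuousOn_bell cu cv'
    (fun z hz => cv_heatKernel_pos (hsub hz).1 hf hf0 hfp z.2)
    (fun z hz => cv_heatKernel_pos (hsub hz).1 hg hg0 hgp z.2) q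
  have cχ : ContinuousOn (fun z : ℝ × E3 => χ z.2) (Icc ε T ×ˢ univ) :=
    (hχ.continuous.comp continuous_snd).continuousOn
  have hχz : ∀ x, x ∉ tsupport χ → χ x = 0 := fun x hx => image_eq_zero_of_notMem_tsupport hx
  set w : ℝ → E3 → ℝ := fun s x =>
    χ x * (|cv (pd k (heatKernel s)) f x| * |cv (pd l (heatKernel s)) g x|) with hw
  set H : ℝ → E3 → ℝ := fun s x =>
    bellX q (cv (heatKernel s) f x) (cv (heatKernel s) g x) * cv (lap (heatKernel s)) f x +
    bellY q (cv (heatKernel s) f x) (cv (heatKernel s) g x) * cv (lap (heatKernel s)) g x with hH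
  have cH : ContinuousOn (fun z : ℝ × E3 => H z.1 z.2) (Icc ε T ×ˢ univ) :=
    (cX.mul cuL).add (cY.mul cvL)
  have iw : Integrable (fun z : ℝ × E3 => w z.1 z.2) ((volume.restrict (Ioc ε T)).prod volume) :=
    integrable_slab hχc (cχ.mul (cuk.abs.mul cvl.abs)) fun s x hx => by simp [hw, hχz x hx]
  have iH : Integrable (fun z : ℝ × E3 => χ z.2 * H z.1 z.2)
      ((volume.restrict (Ioc ε T)).prod volume) :=
    integrable_slab hχc (cχ.mul cH) fun s x hx => by simp [hχz x hx]
  refine ⟨iw, ?_⟩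
  set Λ : ℝ → E3 → ℝ := fun s x => bell q (cv (heatKernel s) f x) (cv (heatKernel s) g x) with hΛ
  have hpos : ∀ {s}, 0 < s → ∀ x, 0 < cv (heatKernel s) f x ∧ 0 < cv (heatKernel s) g x :=
    fun hs x => ⟨cv_heatKernel_pos hs hf hf0 hfp x, cv_heatKernel_pos hs hg hg0 hgp x⟩
  have hΛd : ∀ {s}, 0 < s → Continuous (Λ s) := fun {s} hs => by
    have hK := isKernel_heatKernel hs
    exact continuous_iff_continuousAt.2 fun x => (differentiableAt_bell q
      (differentiable_cv hK hf x) (differentiable_cv hK hg x)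
      (hpos hs x).1 (hpos hs x).2).1.continuousAt
  have hΛ0 : ∀ {s}, 0 < s → ∀ x, 0 ≤ Λ s x := fun hs x =>
    bell_nonneg q (hpos hs x).1 (hpos hs x).2
  have hΛle : ∀ {s}, 0 < s → ∀ x, Λ s x ≤
      32 * (|cv (heatKernel s) f x| ^ q + |cv (heatKernel s) g x| ^ (q / (q - 1))) := fun hs x => by
    rw [abs_of_pos (hpos hs x).1, abs_of_pos (hpos hs x).2]
    exact bell_le hq (hpos hs x).1 (hpos hs x).2
  have hdom : ∀ {s}, 0 < s → Integrable fun x =>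
      32 * (|cv (heatKernel s) f x| ^ q + |cv (heatKernel s) g x| ^ (q / (q - 1))) := fun hs => by
    have hK := (isKernel_heatKernel hs).integrable
    exact (((hf.cv hK).integrable_rpow (integrable_cv hK hfi) (by linarith)).add
      ((hg.cv hK).integrable_rpow (integrable_cv hK hgi) hq')).const_mul 32
  have hΛi : ∀ {s}, 0 < s → Integrable (Λ s) := fun hs =>
    (hdom hs).mono' (hΛd hs).aestronglyMeasurable (ae_of_all _ fun x => by
      rw [Real.norm_of_nonneg (hΛ0 hs x)]; exact hΛle hs x)
  have hΛA : ∀ {s}, 0 < s → ∫ x, Λ s x ≤ 32 * A := fun {s} hs => by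
    have hK := (isKernel_heatKernel hs).integrable
    refine (integral_mono (hΛi hs) (hdom hs) (hΛle hs)).trans ?_
    rw [integral_const_mul, integral_add
      ((hf.cv hK).integrable_rpow (integrable_cv hK hfi) (by linarith))
      ((hg.cv hK).integrable_rpow (integrable_cv hK hgi) hq')]
    exact mul_le_mul_of_nonneg_left (add_le_add (integral_cv_rpow_le hs hf hfi (by linarith))
      (integral_cv_rpow_le hs hg hgi hq')) (by norm_num)
  have hχΛ : ∀ {s}, 0 < s → Integrable fun x => χ x * Λ s x := fun hs =>
    (hχ.continuous.mul (hΛd hs)).integrable_of_hasCompactSupport hχc.mul_right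
  have hT0 : 0 < T := lt_of_lt_of_le hε hT
  have hftc : ∀ x, χ x * Λ T x - χ x * Λ ε x = ∫ s in ε..T, χ x * H s x := fun x => by
    rw [intervalIntegral.integral_const_mul, intervalIntegral.integral_eq_sub_of_hasDerivAt
      (f := fun s => Λ s x) (f' := fun s => H s x), mul_sub]
    · intro s hs
      rw [uIcc_of_le hT] at hs
      have hs0 : 0 < s := lt_of_lt_of_le hε hs.1
      exact hasDerivAt_bell hq (hasDerivAt_cv_heatKernel hs0 hf x) (hasDerivAt_cv_heatKernel hs0 hg x)
        (hpos hs0 x).1 (hpos hs0 x).2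
    · refine ContinuousOn.intervalIntegrable ?_
      rw [uIcc_of_le hT]
      exact cH.comp (f := fun s : ℝ => (s, x)) (by fun_prop) fun s hs => ⟨hs, mem_univ _⟩
  have hswap : (∫ x, χ x * Λ T x) - ∫ x, χ x * Λ ε x = ∫ s in ε..T, ∫ x, χ x * H s x := by
    rw [← integral_sub (hχΛ hT0) (hχΛ hε)]
    simp_rw [hftc, intervalIntegral.integral_of_le hT]
    rw [integral_integral_swap]
    exact iH.swap
  have hmono : ∫ s in ε..T, ∫ x, χ x * H s x ≤
      ∫ s in ε..T, (32 * A * c - 4 * ∫ x, w s x) := by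
    rw [intervalIntegral.integral_of_le hT, intervalIntegral.integral_of_le hT]
    refine setIntegral_mono_on iH.integral_prod_left
      ((integrable_const _).sub (iw.integral_prod_left.const_mul 4)) measurableSet_Ioc fun s hs => ?_
    have hs0 : 0 < s := lt_trans hε hs.1
    refine (integral_cutoff_bell_le hq hq5 hs0 hχ hχc hχ0 hf hf0 hfp hg hg0 hgp k l).trans ?_
    refine sub_le_sub_right ?_ _
    have h1 : ∀ x, lap χ x * Λ s x ≤ c * Λ s x := fun x =>
      mul_le_mul_of_nonneg_right ((le_abs_self _).trans (hc x)) (hΛ0 hs0 x)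
    have h2 : Integrable fun x => lap χ x * Λ s x := by
      have hlc : Continuous (lap χ) := continuous_finsetSum _ fun i _ =>
        (contDiff_pd (contDiff_pd hχ i) i).continuous
      exact ((hΛi hs0).bdd_mul (c := c) hlc.aestronglyMeasurable (ae_of_all _ hc))
    calc ∫ x, lap χ x * Λ s x ≤ ∫ x, c * Λ s x := integral_mono h2 ((hΛi hs0).const_mul c) h1
      _ = c * ∫ x, Λ s x := integral_const_mul _ _
      _ ≤ c * (32 * A) := mul_le_mul_of_nonneg_left (hΛA hs0) hc0
      _ = 32 * A * c := by ring
  have hwi : IntervalIntegrable (fun s => ∫ x, w s x) volume ε T := by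
    rw [intervalIntegrable_iff_integrableOn_Ioc_of_le hT]
    exact iw.integral_prod_left
  have e4 : ∫ s in ε..T, 4 * ∫ x, w s x = 4 * ∫ s in ε..T, ∫ x, w s x :=
    intervalIntegral.integral_const_mul _ _
  rw [intervalIntegral.integral_sub intervalIntegrable_const (hwi.const_mul 4), e4,
    intervalIntegral.integral_const, smul_eq_mul] at hmono
  change (∫ s in ε..T, ∫ x, w s x) ≤ _
  have hT1 : 0 ≤ ∫ x, χ x * Λ T x := integral_nonneg fun x => mul_nonneg (hχ0 x) (hΛ0 hT0 x)
  have hε1 : ∫ x, χ x * Λ ε x ≤ 32 * A :=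
    (integral_mono (hχΛ hε) (hΛi hε) fun x =>
      mul_le_of_le_one_left (hΛ0 hε x) (hχ1 x)).trans (hΛA hε)
  -- `4 ∬ w ≤ 32 A + 32 A c (T - ε)`
  nlinarith

/-- The bilinear estimate for nonnegative functions: the spatial integral of the Bellman function of
the two heat flows starts from at most `32 (‖f‖_q^q + ‖g‖_{q'}^{q'})` and decreases at least four
times as fast as the left-hand side accumulates. A nonnegative function that is not identically zero
has a positive heat flow, so that only the open quadrant enters. -/
theorem lintegral_bilinear_heat_le_of_nonneg (hq : 2 < q) (hq5 : q ≤ 5)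
    (hf : IsBC f) (hfi : Integrable f) (hf0 : ∀ x, 0 ≤ f x)
    (hg : IsBC g) (hgi : Integrable g) (hg0 : ∀ x, 0 ≤ g x) (k l : Fin 3) :
    ∫⁻ s in Ioi 0, ∫⁻ x, ‖cv (pd k (heatKernel s)) f x‖ₑ * ‖cv (pd l (heatKernel s)) g x‖ₑ ≤
      8 * ((∫⁻ x, ‖f x‖ₑ ^ q) + ∫⁻ x, ‖g x‖ₑ ^ (q / (q - 1))) := by
  have hzero : ∀ {h : E3 → ℝ}, (∀ x, 0 ≤ h x) → (¬ ∃ x, 0 < h x) → ∀ K x, cv K h x = 0 := by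
    intro h h0 hn K x
    push Not at hn
    have : h = 0 := funext fun y => le_antisymm (hn y) (h0 y)
    simp [cv, this]
  by_cases hfp : ∃ x, 0 < f x
  swap
  · simp [hzero hf0 hfp]
  by_cases hgp : ∃ x, 0 < g x
  swap
  · simp [hzero hg0 hgp]
  have hq' : 1 ≤ q / (q - 1) := by rw [le_div_iff₀ (by linarith)]; linarith
  have hk1 := isKernel_heatKernel one_pos
  obtain ⟨C, hC0, hC⟩ := exists_bound_lap_cutoff
  set A := (∫ x, |f x| ^ q) + ∫ x, |g x| ^ (q / (q - 1)) with hA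
  have hA0 : 0 ≤ A := add_nonneg (integral_nonneg fun x => by positivity)
    (integral_nonneg fun x => by positivity)
  have hAe : (∫⁻ x, ‖f x‖ₑ ^ q) + ∫⁻ x, ‖g x‖ₑ ^ (q / (q - 1)) = ENNReal.ofReal A := by
    have h2 : ∀ {h : E3 → ℝ} {r : ℝ}, 1 ≤ r → IsBC h → Integrable h → ∫⁻ x, ‖h x‖ₑ ^ r =
        ENNReal.ofReal (∫ x, |h x| ^ r) := fun {h r} hr hh hhi => by
      rw [ofReal_integral_eq_lintegral_ofReal (hh.integrable_rpow hhi hr)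
        (ae_of_all _ fun x => by positivity)]
      refine lintegral_congr fun x => ?_
      rw [← ENNReal.ofReal_rpow_of_nonneg (abs_nonneg _) (by linarith), ← Real.norm_eq_abs,
        ofReal_norm]
    rw [h2 (by linarith) hf hfi, h2 hq' hg hgi, ← ENNReal.ofReal_add
      (integral_nonneg fun x => by positivity) (integral_nonneg fun x => by positivity)]
  rw [hAe]
  set W : ℝ × E3 → ℝ := fun z =>
    |cv (pd k (heatKernel z.1)) f z.2| * |cv (pd l (heatKernel z.1)) g z.2| with hW
  have hW0 : ∀ z, 0 ≤ W z := fun z => by positivity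
  have cW : ContinuousOn W (Ioi 0 ×ˢ univ) :=
    (continuousOn_cv_heat hf 1 (hk1.pd k) fun s hs => pd_heatKernel_eq_dil hs k).abs.mul
    (continuousOn_cv_heat hg 1 (hk1.pd l) fun s hs => pd_heatKernel_eq_dil hs l).abs
  have hprod : ∀ S : Set ℝ, (volume.restrict S).prod (volume : Measure E3) =
      (volume.prod volume).restrict (S ×ˢ univ) := fun S => by
    rw [← Measure.prod_restrict, Measure.restrict_univ]
  have mW : AEMeasurable (fun z => ENNReal.ofReal (W z))
      ((volume.restrict (Ioi 0)).prod (volume : Measure E3)) := by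
    rw [hprod]
    exact (cW.aemeasurable (measurableSet_Ioi.prod MeasurableSet.univ)).ennreal_ofReal
  have h1 : ∫⁻ s in Ioi 0, ∫⁻ x, ‖cv (pd k (heatKernel s)) f x‖ₑ *
      ‖cv (pd l (heatKernel s)) g x‖ₑ =
      ∫⁻ z, ENNReal.ofReal (W z) ∂((volume.restrict (Ioi 0)).prod (volume : Measure E3)) := by
    rw [lintegral_prod _ mW]
    refine lintegral_congr fun s => lintegral_congr fun x => ?_
    rw [hW, ENNReal.ofReal_mul (abs_nonneg _), ← Real.norm_eq_abs, ← Real.norm_eq_abs, ofReal_norm,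
      ofReal_norm]
  rw [h1]
  -- exhaustion of the half space by the slabs `(1/n, n]` and the cutoffs at radius `n`
  set I : ℕ → ℝ × E3 → ℝ≥0∞ := fun n z =>
    (Ioc ((n : ℝ) + 1)⁻¹ (n + 1) ×ˢ (univ : Set E3)).indicator
      (fun z => ENNReal.ofReal (cutoff (n + 1) z.2 * W z)) z with hI
  have hbound : ∀ n, ∫⁻ z, I n z ∂((volume.restrict (Ioi 0)).prod (volume : Measure E3)) ≤
      ENNReal.ofReal (8 * (1 + C / (n + 1)) * A) := fun n => by
    have hn : (0 : ℝ) < (n : ℝ) + 1 := by positivity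
    have hn1 : ((n : ℝ) + 1)⁻¹ ≤ n + 1 :=
      (inv_le_one_of_one_le₀ (by linarith [n.cast_nonneg (α := ℝ)])).trans
        (by linarith [n.cast_nonneg (α := ℝ)])
    obtain ⟨hint, hle⟩ := integral_bilinear_slab_le hq hq5 (inv_pos.2 hn) hn1
      (contDiff_cutoff (n + 1)) (hasCompactSupport_cutoff hn) (cutoff_nonneg _) (cutoff_le_one _)
      (c := C / ((n : ℝ) + 1) ^ 2) (by positivity) (hC _ hn) hf hfi hf0 hfp hg hgi hg0 hgp k l
    have e1 : ∫⁻ z, I n z ∂((volume.restrict (Ioi 0)).prod (volume : Measure E3)) =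
        ∫⁻ z, ENNReal.ofReal (cutoff (n + 1) z.2 * W z)
          ∂((volume.restrict (Ioc ((n : ℝ) + 1)⁻¹ (n + 1))).prod (volume : Measure E3)) := by
      rw [lintegral_indicator (measurableSet_Ioc.prod MeasurableSet.univ), hprod, hprod,
        Measure.restrict_restrict (measurableSet_Ioc.prod MeasurableSet.univ), prod_inter_prod,
        inter_univ, inter_eq_left.2]
      exact fun s hs => lt_trans (inv_pos.2 hn) hs.1
    rw [e1, ← ofReal_integral_eq_lintegral_ofReal hint
      (ae_of_all _ fun z => mul_nonneg (cutoff_nonneg _ _) (hW0 z)), integral_prod _ hint,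
      ← intervalIntegral.integral_of_le hn1]
    refine ENNReal.ofReal_le_ofReal (hle.trans ?_)
    have h3 : C / ((n : ℝ) + 1) ^ 2 * (n + 1 - ((n : ℝ) + 1)⁻¹) ≤ C / (n + 1) := by
      calc _ ≤ C / ((n : ℝ) + 1) ^ 2 * (n + 1) := by
            gcongr; linarith [inv_pos.2 hn]
        _ = _ := by field_simp
    gcongr
  have hmeas : ∀ n, AEMeasurable (I n) ((volume.restrict (Ioi 0)).prod (volume : Measure E3)) :=
    fun n => by
    refine AEMeasurable.indicator ?_ (measurableSet_Ioc.prod MeasurableSet.univ)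
    rw [hprod]
    refine ContinuousOn.aemeasurable ?_ (measurableSet_Ioi.prod MeasurableSet.univ) |>.ennreal_ofReal
    exact (((contDiff_cutoff _).continuous.comp continuous_snd).continuousOn).mul cW
  have hlim : ∀ᵐ z ∂((volume.restrict (Ioi 0)).prod (volume : Measure E3)),
      ENNReal.ofReal (W z) ≤ liminf (fun n => I n z) atTop := by
    rw [hprod]
    refine (ae_restrict_mem (measurableSet_Ioi.prod MeasurableSet.univ)).mono fun z hz => ?_
    refine le_liminf_of_le (by isBoundedDefault) ?_
    obtain ⟨N1, hN1⟩ := exists_nat_gt (z.1⁻¹)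
    obtain ⟨N2, hN2⟩ := exists_nat_gt z.1
    obtain ⟨N3, hN3⟩ := exists_nat_gt ‖z.2‖
    filter_upwards [eventually_ge_atTop (max N1 (max N2 N3))] with n hn
    have g1 : (N1 : ℝ) ≤ n := by exact_mod_cast (le_max_left _ _).trans hn
    have g2 : (N2 : ℝ) ≤ n := by
      exact_mod_cast ((le_max_left _ _).trans (le_max_right _ _)).trans hn
    have g3 : (N3 : ℝ) ≤ n := by
      exact_mod_cast ((le_max_right _ _).trans (le_max_right _ _)).trans hn
    have hz0 : 0 < z.1 := hz.1
    have hmem : z ∈ Ioc ((n : ℝ) + 1)⁻¹ (n + 1) ×ˢ (univ : Set E3) := by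
      refine ⟨⟨?_, by linarith⟩, mem_univ _⟩
      rw [inv_lt_comm₀ (by positivity) hz0]; linarith
    rw [hI]
    simp only
    rw [indicator_of_mem hmem, cutoff_eq_one (by positivity) (by linarith), one_mul]
  have htend : Tendsto (fun n : ℕ => ENNReal.ofReal (8 * (1 + C / (n + 1)) * A)) atTop
      (nhds (ENNReal.ofReal (8 * (1 + 0) * A))) := by
    refine ENNReal.tendsto_ofReal (Tendsto.mul_const A (Tendsto.const_mul 8 (Tendsto.const_add 1 ?_)))
    exact tendsto_const_div_atTop_nhds_zero_nat C |>.comp (tendsto_add_atTop_nat 1) |>.congr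
      fun n => by simp
  calc _ ≤ ∫⁻ z, liminf (fun n => I n z) atTop
        ∂((volume.restrict (Ioi 0)).prod (volume : Measure E3)) := lintegral_mono_ae hlim
    _ ≤ liminf (fun n => ∫⁻ z, I n z ∂((volume.restrict (Ioi 0)).prod (volume : Measure E3))) atTop :=
        lintegral_liminf_le' hmeas
    _ ≤ liminf (fun n : ℕ => ENNReal.ofReal (8 * (1 + C / (n + 1)) * A)) atTop :=
        liminf_le_liminf (Eventually.of_forall hbound)
    _ = ENNReal.ofReal (8 * (1 + 0) * A) := htend.liminf_eq
    _ = 8 * ENNReal.ofReal A := by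
        rw [add_zero, mul_one, ENNReal.ofReal_mul (by norm_num)]; norm_num

/-- The bilinear estimate for heat flows; it is equivalent to the boundedness of second order Riesz
transforms on `L^q`. -/
theorem lintegral_bilinear_heat_le (hq : 2 < q) (hq5 : q ≤ 5)
    (hf : IsBC f) (hfi : Integrable f) (hg : IsBC g) (hgi : Integrable g) (k l : Fin 3) :
    ∫⁻ s in Ioi 0, ∫⁻ x, ‖cv (pd k (heatKernel s)) f x‖ₑ * ‖cv (pd l (heatKernel s)) g x‖ₑ ≤
      32 * ((∫⁻ x, ‖f x‖ₑ ^ q) + ∫⁻ x, ‖g x‖ₑ ^ (q / (q - 1))) := by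
  have hq' : 1 ≤ q / (q - 1) := by rw [le_div_iff₀ (by linarith)]; linarith
  have hk1 := isKernel_heatKernel one_pos
  -- splitting both functions into positive and negative parts costs a factor four
  have hpart : ∀ {h : E3 → ℝ}, IsBC h → Integrable h →
      (IsBC (fun x => max (h x) 0) ∧ Integrable fun x => max (h x) 0) := fun {h} hh hhi => by
    obtain ⟨M, hM0, hM⟩ := hh.exists_bound
    refine ⟨⟨hh.continuous.max continuous_const, M, fun x => ?_⟩, hhi.pos_part⟩
    rw [Real.norm_of_nonneg (le_max_right _ _)]
    exact max_le ((le_abs_self _).trans (hM x)) hM0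
  have hsplit : ∀ {h : E3 → ℝ}, IsBC h → Integrable h → ∀ {s : ℝ}, 0 < s → ∀ i x,
      ‖cv (pd i (heatKernel s)) h x‖ₑ ≤ ‖cv (pd i (heatKernel s)) (fun x => max (h x) 0) x‖ₑ +
        ‖cv (pd i (heatKernel s)) (fun x => max (-h x) 0) x‖ₑ := fun {h} hh hhi s hs i x => by
    have hK := ((isKernel_heatKernel hs).pd i).integrable
    have h1 : cv (pd i (heatKernel s)) h x = cv (pd i (heatKernel s)) (fun x => max (h x) 0) x -
        cv (pd i (heatKernel s)) (fun x => max (-h x) 0) x := by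
      unfold cv
      rw [← integral_sub (integrable_cv_integrand hK (hpart hh hhi).1 x)
        (integrable_cv_integrand hK (hpart hh.neg hhi.neg).1 x)]
      refine integral_congr_ae (ae_of_all _ fun y => ?_)
      simp only
      rw [← smul_sub]
      congr 1
      rcases le_total (h y) 0 with h0 | h0
      · rw [max_eq_right h0, max_eq_left (by linarith)]; ring
      · rw [max_eq_left h0, max_eq_right (by linarith)]; ring
    rw [h1]
    exact enorm_sub_le
  have hle : ∀ {h : E3 → ℝ} {r : ℝ}, 1 ≤ r → ∫⁻ x, ‖max (h x) 0‖ₑ ^ r ≤ ∫⁻ x, ‖h x‖ₑ ^ r :=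
    fun {h r} hr => lintegral_mono fun x => by
      refine ENNReal.rpow_le_rpow (enorm_le_iff_norm_le.2 ?_) (by linarith)
      rw [Real.norm_of_nonneg (le_max_right _ _)]
      exact max_le (le_abs_self _) (abs_nonneg _)
  have hmeas : ∀ {h : E3 → ℝ}, IsBC h → ∀ i, AEMeasurable (fun z : ℝ × E3 =>
      ‖cv (pd i (heatKernel z.1)) h z.2‖ₑ) ((volume.restrict (Ioi 0)).prod (volume : Measure E3)) := by
    intro h hh i
    have hprod : (volume.restrict (Ioi (0 : ℝ))).prod (volume : Measure E3) =
        (volume.prod volume).restrict (Ioi 0 ×ˢ univ) := by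
      rw [← Measure.prod_restrict, Measure.restrict_univ]
    rw [hprod]
    exact ((continuousOn_cv_heat hh 1 (hk1.pd i) fun s hs =>
      pd_heatKernel_eq_dil hs i).aemeasurable (measurableSet_Ioi.prod MeasurableSet.univ)).enorm
  have hmeas2 : ∀ {a b : E3 → ℝ}, IsBC a → IsBC b → AEMeasurable (fun z : ℝ × E3 =>
      ‖cv (pd k (heatKernel z.1)) a z.2‖ₑ * ‖cv (pd l (heatKernel z.1)) b z.2‖ₑ)
      ((volume.restrict (Ioi 0)).prod (volume : Measure E3)) :=
    fun ha hb => (hmeas ha k).mul (hmeas hb l)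
  have key : ∀ {a b : E3 → ℝ}, IsBC a → Integrable a → IsBC b → Integrable b →
      (∀ x, 0 ≤ a x) → (∀ x, 0 ≤ b x) → (∫⁻ x, ‖a x‖ₑ ^ q) ≤ ∫⁻ x, ‖f x‖ₑ ^ q →
      (∫⁻ x, ‖b x‖ₑ ^ (q / (q - 1))) ≤ ∫⁻ x, ‖g x‖ₑ ^ (q / (q - 1)) →
      ∫⁻ z, ‖cv (pd k (heatKernel z.1)) a z.2‖ₑ * ‖cv (pd l (heatKernel z.1)) b z.2‖ₑ
        ∂((volume.restrict (Ioi 0)).prod (volume : Measure E3)) ≤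
      8 * ((∫⁻ x, ‖f x‖ₑ ^ q) + ∫⁻ x, ‖g x‖ₑ ^ (q / (q - 1))) := by
    intro a b ha hai hb hbi ha0 hb0 h1 h2
    rw [lintegral_prod _ (hmeas2 ha hb)]
    refine (lintegral_bilinear_heat_le_of_nonneg hq hq5 ha hai ha0 hb hbi hb0 k l).trans ?_
    gcongr
  have hfP := hpart hf hfi
  have hfN := hpart hf.neg hfi.neg
  have hgP := hpart hg hgi
  have hgN := hpart hg.neg hgi.neg
  have hnf : ∫⁻ x, ‖max (-f x) 0‖ₑ ^ q ≤ ∫⁻ x, ‖f x‖ₑ ^ q := by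
    simpa using hle (h := fun x => -f x) (r := q) (by linarith)
  have hng : ∫⁻ x, ‖max (-g x) 0‖ₑ ^ (q / (q - 1)) ≤ ∫⁻ x, ‖g x‖ₑ ^ (q / (q - 1)) := by
    simpa using hle (h := fun x => -g x) (r := q / (q - 1)) hq'
  have k1 := key hfP.1 hfP.2 hgP.1 hgP.2 (fun x => le_max_right _ _) (fun x => le_max_right _ _)
    (hle (by linarith)) (hle hq')
  have k2 := key hfP.1 hfP.2 hgN.1 hgN.2 (fun x => le_max_right _ _) (fun x => le_max_right _ _)
    (hle (by linarith)) hng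
  have k3 := key hfN.1 hfN.2 hgP.1 hgP.2 (fun x => le_max_right _ _) (fun x => le_max_right _ _)
    hnf (hle hq')
  have k4 := key hfN.1 hfN.2 hgN.1 hgN.2 (fun x => le_max_right _ _) (fun x => le_max_right _ _)
    hnf hng
  have m1 := hmeas2 hfP.1 hgP.1
  have m3 := hmeas2 hfN.1 hgP.1
  have hsum := add_le_add (add_le_add k1 k2) (add_le_add k3 k4)
  rw [← lintegral_add_left' m1, ← lintegral_add_left' m3,
    ← lintegral_add_left' (by exact m1.add (hmeas2 hfP.1 hgN.1))] at hsum
  have hfin : ∫⁻ s in Ioi 0, ∫⁻ x, ‖cv (pd k (heatKernel s)) f x‖ₑ *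
      ‖cv (pd l (heatKernel s)) g x‖ₑ =
      ∫⁻ z, ‖cv (pd k (heatKernel z.1)) f z.2‖ₑ * ‖cv (pd l (heatKernel z.1)) g z.2‖ₑ
        ∂((volume.restrict (Ioi 0)).prod (volume : Measure E3)) :=
    (lintegral_prod _ (hmeas2 hf hg)).symm
  rw [hfin]
  refine le_trans (lintegral_mono_ae ?_) (hsum.trans_eq (by ring))
  have hprod : (volume.restrict (Ioi (0 : ℝ))).prod (volume : Measure E3) =
      (volume.prod volume).restrict (Ioi 0 ×ˢ univ) := by
    rw [← Measure.prod_restrict, Measure.restrict_univ]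
  rw [hprod]
  refine (ae_restrict_mem (measurableSet_Ioi.prod MeasurableSet.univ)).mono fun z hz => ?_
  refine (mul_le_mul' (hsplit hf hfi hz.1 k z.2) (hsplit hg hgi hz.1 l z.2)).trans_eq ?_
  ring

end BilinearEstimate

/-! ### From distributional solutions to evolution identities -/

section DuBoisReymond

/-- The lemma of du Bois-Reymond: a continuous function `g` on `[a, b]` whose distributional
derivative is the continuous function `h` satisfies `g t - g a = ∫ₐᵗ h`. -/
theorem sub_eq_integral_of_forall_test {a b : ℝ} {g h : ℝ → ℝ} (hg : Continuous g)
    (hh : Continuous h)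
    (H : ∀ θ : ℝ → ℝ, ContDiff ℝ ∞ θ → HasCompactSupport θ → tsupport θ ⊆ Ioo a b →
      ∫ t in a..b, (deriv θ t * g t + θ t * h t) = 0) {t : ℝ} (ht : t ∈ Icc a b) :
    g t - g a = ∫ s in a..t, h s := by
  rcases eq_or_lt_of_le (ht.1.trans ht.2) with hab | hab
  · have : t = a := le_antisymm (ht.2.trans hab.symm.le) ht.1
    simp [this]
  set w : ℝ → ℝ := fun t => g t - ∫ s in a..t, h s with hw
  have hwd : Continuous w := hg.sub (intervalIntegral.continuous_primitive
    (fun _ _ => hh.intervalIntegrable _ _) a)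
  have hmul : ∀ {f₁ f₂ : ℝ → ℝ}, Continuous f₁ → Continuous f₂ →
      IntervalIntegrable (fun t => f₁ t * f₂ t) volume a b :=
    fun h h' => (h.mul h').intervalIntegrable _ _
  -- integration by parts turns the hypothesis into `∫ θ' w = 0`
  have h1 : ∀ θ : ℝ → ℝ, ContDiff ℝ ∞ θ → HasCompactSupport θ → tsupport θ ⊆ Ioo a b →
      ∫ t in a..b, deriv θ t * w t = 0 := by
    intro θ hθ hθc hθs
    have hθd : ∀ t, HasDerivAt θ (deriv θ t) t := fun t =>
      (hθ.differentiable (by simp) t).hasDerivAt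
    have hθ' : Continuous (deriv θ) := hθ.continuous_deriv (by simp)
    have hθa : θ a = 0 := image_eq_zero_of_notMem_tsupport fun h => (hθs h).1.false
    have hθb : θ b = 0 := image_eq_zero_of_notMem_tsupport fun h => (hθs h).2.false
    have hp : ∀ t, HasDerivAt (fun t => ∫ s in a..t, h s) (h t) t := fun t =>
      intervalIntegral.integral_hasDerivAt_right (hh.intervalIntegrable _ _)
        (hh.stronglyMeasurableAtFilter _ _) hh.continuousAt
    have hibp := intervalIntegral.integral_mul_deriv_eq_deriv_mul (a := a) (b := b)
      (fun t _ => hp t) (fun t _ => hθd t) (hh.intervalIntegrable _ _)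
      (hθ'.intervalIntegrable _ _)
    rw [hθa, hθb, mul_zero, mul_zero, sub_zero, zero_sub] at hibp
    have hcp : Continuous fun t => ∫ s in a..t, h s :=
      intervalIntegral.continuous_primitive (fun _ _ => hh.intervalIntegrable _ _) a
    have h2 := H θ hθ hθc hθs
    rw [intervalIntegral.integral_add (hmul hθ' hg) (hmul hθ.continuous hh)] at h2
    have h3 : ∫ t in a..b, deriv θ t * w t = (∫ t in a..b, deriv θ t * g t) -
        ∫ t in a..b, (∫ s in a..t, h s) * deriv θ t := by
      rw [← intervalIntegral.integral_sub (hmul hθ' hg) (hmul hcp hθ')]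
      refine intervalIntegral.integral_congr fun t _ => ?_
      simp only [hw]; ring
    rw [h3, hibp, ← h2, sub_neg_eq_add]
    congr 1
    exact intervalIntegral.integral_congr fun t _ => mul_comm _ _
  -- primitives of test functions of mean zero are test functions
  have h2 : ∀ ψ : ℝ → ℝ, ContDiff ℝ ∞ ψ → HasCompactSupport ψ → tsupport ψ ⊆ Ioo a b →
      ∫ t in a..b, ψ t = 0 → ∫ t in a..b, ψ t * w t = 0 := by
    intro ψ hψ hψc hψs hψ0
    obtain ⟨c, d, hac, hdb, hcd⟩ : ∃ c d, a < c ∧ d < b ∧ tsupport ψ ⊆ Icc c d := by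
      rcases (tsupport ψ).eq_empty_or_nonempty with he | hne
      · exact ⟨a + 1, b - 1, by linarith, by linarith, by simp [he]⟩
      · obtain ⟨c, hc, hc'⟩ := hψc.isCompact.exists_isLeast hne
        obtain ⟨d, hd, hd'⟩ := hψc.isCompact.exists_isGreatest hne
        exact ⟨c, d, (hψs hc).1, (hψs hd).2, fun t ht => ⟨hc' ht, hd' ht⟩⟩
    have hz : ∀ s, s ∉ Icc c d → ψ s = 0 := fun s hs =>
      image_eq_zero_of_notMem_tsupport fun h => hs (hcd h)
    set θ : ℝ → ℝ := fun t => ∫ s in a..t, ψ s with hθ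
    have hd : ∀ t, HasDerivAt θ (ψ t) t := fun t =>
      intervalIntegral.integral_hasDerivAt_right (hψ.continuous.intervalIntegrable _ _)
        (hψ.continuous.stronglyMeasurableAtFilter _ _) hψ.continuous.continuousAt
    have hderiv : deriv θ = ψ := funext fun t => (hd t).deriv
    have hsupp : tsupport θ ⊆ Icc c d := by
      refine closure_minimal (fun t ht => ?_) isClosed_Icc
      by_contra hn
      refine ht ?_
      rcases lt_or_ge t c with h | h
      · refine intervalIntegral.integral_zero_ae (ae_of_all _ fun s hs => hz s fun hs' => ?_)
        rcases hs with ⟨_, hs2⟩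
        have := max_lt hac h
        linarith [hs'.1]
      · have hdt : d < t := by
          by_contra hdt
          exact hn ⟨h, not_lt.1 hdt⟩
        have := intervalIntegral.integral_add_adjacent_intervals (a := a) (b := t) (c := b)
          (hψ.continuous.intervalIntegrable (μ := volume) _ _)
          (hψ.continuous.intervalIntegrable _ _)
        rw [hψ0, intervalIntegral.integral_zero_ae (a := t) (ae_of_all _ fun s hs => hz s
          fun hs' => ?_), add_zero] at this
        · exact this
        · rcases hs with ⟨hs1, _⟩
          have := lt_min hdt hdb
          linarith [hs'.2]
    have := h1 θ (contDiff_infty_iff_deriv.2 ⟨fun t => (hd t).differentiableAt, by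
      rwa [hderiv]⟩) (isCompact_Icc.of_isClosed_subset (isClosed_tsupport _) hsupp)
      (hsupp.trans fun s hs => ⟨hac.trans_le hs.1, hs.2.trans_lt hdb⟩)
    rwa [hderiv] at this
  obtain ⟨ψ₀, hψ₀, hψ₀c, hψ₀s, hψ₀1⟩ : ∃ ψ : ℝ → ℝ, ContDiff ℝ ∞ ψ ∧ HasCompactSupport ψ ∧
      tsupport ψ ⊆ Ioo a b ∧ ∫ t in a..b, ψ t = 1 := by
    let B : ContDiffBump ((a + b) / 2) := ⟨(b - a) / 8, (b - a) / 4, by linarith, by linarith⟩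
    have hs : tsupport (B.normed volume) ⊆ Ioo a b := by
      rw [B.tsupport_normed_eq]
      intro t ht
      rw [Metric.mem_closedBall, Real.dist_eq] at ht
      have := abs_le.1 ht
      simp only [B] at this
      constructor <;> linarith [this.1, this.2]
    refine ⟨B.normed volume, B.contDiff_normed, B.hasCompactSupport_normed, hs, ?_⟩
    rw [intervalIntegral.integral_of_le hab.le, setIntegral_eq_integral_of_forall_compl_eq_zero,
      B.integral_normed]
    intro t ht
    exact image_eq_zero_of_notMem_tsupport fun h => ht ⟨(hs h).1, (hs h).2.le⟩
  set c := ∫ t in a..b, ψ₀ t * w t with hc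
  have h3 : ∀ᵐ t, t ∈ Ioo a b → w t - c = 0 := by
    refine isOpen_Ioo.ae_eq_zero_of_integral_contDiff_smul_eq_zero
      ((hwd.sub continuous_const).locallyIntegrable.locallyIntegrableOn _) ?_
    intro ψ hψ hψc hψs
    have hi : ∫ t, ψ t • (w t - c) = ∫ t in a..b, ψ t * (w t - c) := by
      rw [intervalIntegral.integral_of_le hab.le, setIntegral_eq_integral_of_forall_compl_eq_zero]
      · rfl
      intro t ht
      rw [image_eq_zero_of_notMem_tsupport fun h => ht ⟨(hψs h).1, (hψs h).2.le⟩, zero_mul]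
    set m := ∫ t in a..b, ψ t with hm
    have hmψ : Continuous fun t => m * ψ₀ t := continuous_const.mul hψ₀.continuous
    have h4 := h2 (fun t => ψ t - m * ψ₀ t) (hψ.sub (contDiff_const.mul hψ₀))
      (hψc.sub (hψ₀c.mul_left)) ?_ ?_
    · rw [hi]
      simp only [sub_mul] at h4
      rw [intervalIntegral.integral_sub (hmul hψ.continuous hwd)
        (hmul hmψ hwd)] at h4
      simp only [mul_sub, mul_assoc] at h4 ⊢
      rw [intervalIntegral.integral_const_mul] at h4
      rw [intervalIntegral.integral_sub (hmul hψ.continuous hwd)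
        (hmul hψ.continuous continuous_const), intervalIntegral.integral_mul_const]
      exact h4
    · refine (closure_mono (Function.support_sub _ _)).trans ?_
      rw [closure_union]
      exact union_subset hψs ((closure_mono (Function.support_mul_subset_right _ _)).trans hψ₀s)
    · rw [intervalIntegral.integral_sub (hψ.continuous.intervalIntegrable _ _)
        (hmψ.intervalIntegrable _ _),
        intervalIntegral.integral_const_mul, hψ₀1, mul_one, sub_self]
  have h4 : EqOn w (fun _ => c) (Icc a b) := by
    have h5 : EqOn w (fun _ => c) (Ioo a b) :=
      Measure.eqOn_open_of_ae_eq (μ := volume) (by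
        rw [Filter.EventuallyEq, ae_restrict_iff' measurableSet_Ioo]
        exact h3.mono fun t h ht => sub_eq_zero.1 (h ht)) isOpen_Ioo hwd.continuousOn
        continuousOn_const
    have := h5.closure hwd continuous_const
    rwa [closure_Ioo hab.ne] at this
  have h5 := (h4 ht).trans (h4 (left_mem_Icc.2 hab.le)).symm
  simp only [hw, intervalIntegral.integral_same, sub_zero] at h5
  linarith

end DuBoisReymond

section Testing

theorem laplacian_eq_lap {F : Type*} [NormedAddCommGroup F] [NormedSpace ℝ F] {f : E3 → F}
    (hf : ContDiff ℝ ∞ f) : Laplacian.laplacian f = lap f := by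
  rw [InnerProductSpace.laplacian_eq_iteratedFDeriv_orthonormalBasis f
    (EuclideanSpace.basisFun (Fin 3) ℝ)]
  ext x
  refine Finset.sum_congr rfl fun i _ => ?_
  have h1 : DifferentiableAt ℝ (fderiv ℝ f) x :=
    (hf.fderiv_right (m := ∞) (by simp)).differentiable (by simp) x
  rw [iteratedFDeriv_two_apply]
  simp only [EuclideanSpace.basisFun_apply, Matrix.cons_val_zero, Matrix.cons_val_one]
  exact (pd_clm_comp (ContinuousLinearMap.apply ℝ F (EuclideanSpace.single i (1 : ℝ) : E3)) i
    h1).symm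

theorem continuous_integral_mul {W : ℝ → E3 → ℝ} (hW : Continuous fun z : ℝ × E3 => W z.1 z.2)
    {M : ℝ} (hM : ∀ t x, |W t x| ≤ M) {h : E3 → ℝ} (hh : Integrable h) :
    Continuous fun t => ∫ x, W t x * h x := by
  have hWt : ∀ t, Continuous (W t) := fun t => hW.comp (Continuous.prodMk_right t)
  refine continuous_of_dominated (bound := fun x => M * |h x|)
    (fun t => (hWt t).aestronglyMeasurable.mul hh.aestronglyMeasurable)
    (fun t => ae_of_all _ fun x => ?_) (hh.abs.const_mul M) (ae_of_all _ fun x => ?_)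
  · rw [norm_mul]
    exact mul_le_mul_of_nonneg_right (hM t x) (norm_nonneg _)
  · exact (hW.comp (Continuous.prodMk_left x)).mul continuous_const

/-- The properties of a smooth bounded Leray-Hopf solution used for the evolution of its heat
mollifications: the momentum equation is tested with time independent fields and integrated in
time. The field is defined for all times, but solves the equation on `[a, b]` only. -/
structure IsFlow (a b : ℝ) (U : ℝ → E3 → E3) : Prop where
  continuous : Continuous fun z : ℝ × E3 => U z.1 z.2
  bounded : ∃ M, ∀ t x, ‖U t x‖ ≤ M
  sq_integrable : ∃ A, ∀ t, Integrable (fun x => ‖U t x‖ ^ 2) ∧ ∫ x, ‖U t x‖ ^ 2 ≤ A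
  div_free : ∀ t, ∀ η : E3 → ℝ, ContDiff ℝ ∞ η → HasCompactSupport η →
    ∫ x, ∑ i : Fin 3, U t x i * pd i η x = 0
  momentum : ∀ Φ : Fin 3 → E3 → ℝ, (∀ l, ContDiff ℝ ∞ (Φ l)) → (∀ l, HasCompactSupport (Φ l)) →
    (∀ x, ∑ l : Fin 3, pd l (Φ l) x = 0) → ∀ t ∈ Icc a b,
    (∫ x, ∑ l : Fin 3, U t x l * Φ l x) - ∫ x, ∑ l : Fin 3, U a x l * Φ l x =
      ∫ s in a..t, ∫ x, (∑ l : Fin 3, U s x l * lap (Φ l) x +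
        ∑ i : Fin 3, ∑ j : Fin 3, U s x i * U s x j * pd i (Φ j) x)

theorem continuous_coord_comp {U : ℝ → E3 → E3} (hU : Continuous fun z : ℝ × E3 => U z.1 z.2)
    (l : Fin 3) : Continuous fun z : ℝ × E3 => U z.1 z.2 l :=
  (EuclideanSpace.proj l : E3 →L[ℝ] ℝ).continuous.comp hU

theorem contDiff_lap {F : Type*} [NormedAddCommGroup F] [NormedSpace ℝ F] {f : E3 → F}
    (hf : ContDiff ℝ ∞ f) : ContDiff ℝ ∞ (lap f) :=
  ContDiff.sum fun i _ => contDiff_pd (contDiff_pd hf i) i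

theorem hasCompactSupport_lap {f : E3 → ℝ} (hf : HasCompactSupport f) :
    HasCompactSupport (lap f) := by
  unfold lap
  simp only [Fin.sum_univ_three]
  have := fun i => hasCompactSupport_pd (hasCompactSupport_pd hf i) i
  exact ((this 0).add (this 1)).add (this 2)

/-- The support of the product of a compactly supported function of time and a compactly
supported function of space. -/
theorem isTest_mul {a b : ℝ} {θ : ℝ → ℝ} {η : E3 → ℝ} (hθ : ContDiff ℝ ∞ θ)
    (hθc : HasCompactSupport θ) (hθs : tsupport θ ⊆ Ioo a b) (hη : ContDiff ℝ ∞ η)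
    (hηc : HasCompactSupport η) : IsTest a b fun t x => θ t * η x := by
  have hsub : tsupport (fun z : ℝ × E3 => θ z.1 * η z.2) ⊆ tsupport θ ×ˢ tsupport η := by
    refine closure_minimal (fun z hz => ?_) ((isClosed_tsupport _).prod (isClosed_tsupport _))
    exact ⟨subset_tsupport _ (left_ne_zero_of_mul hz), subset_tsupport _ (right_ne_zero_of_mul hz)⟩
  refine ⟨(hθ.comp contDiff_fst).mul (hη.comp contDiff_snd), ?_, ?_⟩
  · exact (hθc.isCompact.prod hηc.isCompact).of_isClosed_subset (isClosed_tsupport _) hsub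
  · exact hsub.trans (prod_mono hθs (subset_univ _))

theorem IsTest.pi {a b : ℝ} {φ : Fin 3 → ℝ → E3 → ℝ} (h : ∀ l, IsTest a b (φ l)) :
    IsTest a b fun t x => (WithLp.toLp 2 fun l => φ l t x : E3) := by
  have hsub : tsupport (fun z : ℝ × E3 => (WithLp.toLp 2 fun l => φ l z.1 z.2 : E3)) ⊆
      ⋃ l, tsupport fun z : ℝ × E3 => φ l z.1 z.2 := by
    refine closure_minimal (fun z hz => ?_) (isClosed_iUnion_of_finite fun l => isClosed_tsupport _)
    by_contra hn
    simp only [mem_iUnion, not_exists] at hn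
    refine hz ?_
    ext l
    exact image_eq_zero_of_notMem_tsupport (f := fun z : ℝ × E3 => φ l z.1 z.2) (hn l)
  refine ⟨contDiff_euclidean.2 fun l => (h l).smooth, ?_, ?_⟩
  · exact (isCompact_iUnion fun l => (h l).compact.isCompact).of_isClosed_subset
      (isClosed_tsupport _) hsub
  · exact hsub.trans (iUnion_subset fun l => (h l).support)

theorem lap_apply {v : E3 → E3} (hv : ContDiff ℝ ∞ v) (x : E3) (k : Fin 3) :
    lap v x k = lap (fun y => v y k) x := by
  have h1 : ∀ i, pd i (fun y => v y k) = fun y => pd i v y k := fun i => funext fun y =>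
    pd_apply i k (hv.differentiable (by simp) y)
  simp only [lap, h1]
  rw [WithLp.ofLp_sum, Finset.sum_apply]
  exact Finset.sum_congr rfl fun i _ =>
    (pd_apply i k ((contDiff_pd hv i).differentiable (by simp) x)).symm

theorem lap_const_mul {f : E3 → ℝ} (hf : ContDiff ℝ ∞ f) (c : ℝ) (x : E3) :
    lap (fun y => c * f y) x = c * lap f x := by
  have h1 : ∀ i, pd i (fun y => c * f y) = fun y => c * pd i f y := fun i => funext fun y =>
    pd_const_mul i c (hf.differentiable (by simp) y)
  simp only [lap, h1, Finset.mul_sum]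
  exact Finset.sum_congr rfl fun i _ =>
    pd_const_mul i c ((contDiff_pd hf i).differentiable (by simp) x)

/-- A continuous function on `[a, b]` all of whose integrals against test functions vanish is zero
on `[a, b]`. -/
theorem eq_zero_of_forall_test {a b : ℝ} (hab : a < b) {g : ℝ → ℝ} (hg : Continuous g)
    (H : ∀ θ : ℝ → ℝ, ContDiff ℝ ∞ θ → HasCompactSupport θ → tsupport θ ⊆ Ioo a b →
      ∫ t in a..b, θ t * g t = 0) {t : ℝ} (ht : t ∈ Icc a b) : g t = 0 := by
  have h3 : ∀ᵐ t, t ∈ Ioo a b → g t = 0 := by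
    refine isOpen_Ioo.ae_eq_zero_of_integral_contDiff_smul_eq_zero
      (hg.locallyIntegrable.locallyIntegrableOn _) fun ψ hψ hψc hψs => ?_
    rw [← H ψ hψ hψc hψs, intervalIntegral.integral_of_le hab.le,
      setIntegral_eq_integral_of_forall_compl_eq_zero]
    · rfl
    intro t ht
    rw [image_eq_zero_of_notMem_tsupport fun h => ht ⟨(hψs h).1, (hψs h).2.le⟩, zero_mul]
  have h5 : EqOn g (fun _ => 0) (Ioo a b) :=
    Measure.eqOn_open_of_ae_eq (μ := volume) (by
      rw [Filter.EventuallyEq, ae_restrict_iff' measurableSet_Ioo]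
      exact h3) isOpen_Ioo hg.continuousOn continuousOn_const
  have := h5.closure hg continuous_const
  rw [closure_Ioo hab.ne] at this
  exact this ht

/-- Continued by its values at `a` and `b`, a smooth bounded Leray-Hopf solution is a flow. Test
functions `θ(t) Φ(x)` reduce the equation to a statement on the distributional derivative of a
continuous function of time. -/
theorem IsSmoothBoundedLerayHopf.isFlow {a b : ℝ} {u : ℝ → E3 → E3} (hab : a < b)
    (hu : IsSmoothBoundedLerayHopf a b u) : IsFlow a b fun t => u (projIcc a b hab.le t) := by
  set U : ℝ → E3 → E3 := fun t => u (projIcc a b hab.le t) with hU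
  have hcont : Continuous fun z : ℝ × E3 => U z.1 z.2 :=
    hu.smooth.continuousOn.comp_continuous
      (f := fun z : ℝ × E3 => ((projIcc a b hab.le z.1 : ℝ), z.2))
      ((continuous_subtype_val.comp (continuous_projIcc.comp continuous_fst)).prodMk continuous_snd)
      fun z => ⟨(projIcc a b hab.le z.1).2, mem_univ _⟩
  obtain ⟨M, hM⟩ := hu.bounded
  have hbd : ∀ t x, ‖U t x‖ ≤ M := fun t x => hM _ (projIcc a b hab.le t).2 x
  have hUu : ∀ t ∈ Icc a b, U t = u t := fun t ht => by rw [hU]; simp only [projIcc_of_mem _ ht]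
  have hc := continuous_coord_comp hcont
  have hcb : ∀ l t x, |U t x l| ≤ M := fun l t x => (PiLp.norm_apply_le (U t x) l).trans (hbd t x)
  have hM0 : 0 ≤ M := (norm_nonneg _).trans (hbd 0 0)
  have hc2 : ∀ i j, Continuous fun z : ℝ × E3 => U z.1 z.2 i * U z.1 z.2 j :=
    fun i j => (hc i).mul (hc j)
  have hcb2 : ∀ i j t x, |U t x i * U t x j| ≤ M * M := fun i j t x => by
    rw [abs_mul]; exact mul_le_mul (hcb i t x) (hcb j t x) (abs_nonneg _) hM0
  have hint : ∀ {h : E3 → ℝ}, ContDiff ℝ ∞ h → HasCompactSupport h → Integrable h :=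
    fun h1 h2 => h1.continuous.integrable_of_hasCompactSupport h2
  have hint1 : ∀ l t {h : E3 → ℝ}, Integrable h → Integrable fun x => U t x l * h x :=
    fun l t h hh => hh.bdd_mul (c := M)
      ((hc l).comp (Continuous.prodMk_right t)).aestronglyMeasurable (ae_of_all _ (hcb l t))
  have hint2 : ∀ i j t {h : E3 → ℝ}, Integrable h → Integrable fun x => U t x i * U t x j * h x :=
    fun i j t h hh => hh.bdd_mul (c := M * M)
      ((hc2 i j).comp (Continuous.prodMk_right t)).aestronglyMeasurable (ae_of_all _ (hcb2 i j t))
  refine ⟨hcont, ⟨M, hbd⟩, ?_, ?_, ?_⟩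
  · have hA : ∫⁻ x, ‖u a x‖ₑ ^ 2 ≠ ⊤ := by
      have := (hu.memLp_two a (left_mem_Icc.2 hab.le)).2
      have h2 := (eLpNorm_lt_top_iff_lintegral_rpow_enorm_lt_top two_ne_zero
        ENNReal.ofNat_ne_top).1 this
      simpa using h2.ne
    refine ⟨(∫⁻ x, ‖u a x‖ₑ ^ 2).toReal, fun t => ?_⟩
    have ht := (projIcc a b hab.le t).2
    have hm : AEStronglyMeasurable (fun x => ‖U t x‖ ^ 2) :=
      ((hcont.comp (Continuous.prodMk_right t)).norm.pow 2).aestronglyMeasurable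
    have h1 : Integrable fun x => ‖U t x‖ ^ 2 := (hu.memLp_two _ ht).integrable_norm_pow two_ne_zero
    refine ⟨h1, ?_⟩
    rw [integral_eq_lintegral_of_nonneg_ae (ae_of_all _ fun x => by positivity) hm]
    refine ENNReal.toReal_mono hA ?_
    refine le_trans (le_of_eq ?_) (le_self_add.trans (hu.energy _ ht))
    refine lintegral_congr fun x => ?_
    rw [ENNReal.ofReal_pow (norm_nonneg _), ofReal_norm]
  · intro t η hη hηc
    have hD : Continuous fun t => ∫ x, ∑ i : Fin 3, U t x i * pd i η x := by
      have : ∀ t, ∫ x, ∑ i : Fin 3, U t x i * pd i η x =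
          ∑ i : Fin 3, ∫ x, U t x i * pd i η x := fun t =>
        integral_finsetSum _ fun i _ => hint1 i t
          (hint (contDiff_pd hη i) (hasCompactSupport_pd hηc i))
      simp only [this]
      exact continuous_finsetSum _ fun i _ => continuous_integral_mul (hc i) (hcb i)
        (hint (contDiff_pd hη i) (hasCompactSupport_pd hηc i))
    have key : ∀ t ∈ Icc a b, ∫ x, ∑ i : Fin 3, U t x i * pd i η x = 0 := fun t ht => by
      refine eq_zero_of_forall_test hab hD (fun θ hθ hθc hθs => ?_) ht
      rw [← hu.equation.div_free _ (isTest_mul hθ hθc hθs hη hηc)]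
      refine intervalIntegral.integral_congr fun t ht => ?_
      rw [uIcc_of_le hab.le] at ht
      simp only
      rw [← integral_const_mul]
      refine integral_congr_ae (ae_of_all _ fun x => ?_)
      simp only [Finset.mul_sum, hUu t ht]
      refine Finset.sum_congr rfl fun i _ => ?_
      rw [pd_const_mul i _ (hη.differentiable (by simp) x)]
      ring
    have hp := (projIcc a b hab.le t).2
    have := key _ hp
    rwa [hUu _ hp] at this
  · intro Φ hΦ hΦc hdiv t ht
    have hA : ∀ t, ∫ x, ∑ l : Fin 3, U t x l * Φ l x = ∑ l : Fin 3, ∫ x, U t x l * Φ l x :=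
      fun t => integral_finsetSum _ fun l _ => hint1 l t (hint (hΦ l) (hΦc l))
    have hL : ∀ l, Integrable (lap (Φ l)) := fun l =>
      hint (contDiff_lap (hΦ l)) (hasCompactSupport_lap (hΦc l))
    have hP : ∀ i j, Integrable (pd i (Φ j)) := fun i j =>
      hint (contDiff_pd (hΦ j) i) (hasCompactSupport_pd (hΦc j) i)
    have hI1 : ∀ s, Integrable fun x => ∑ l : Fin 3, U s x l * lap (Φ l) x := fun s =>
      integrable_finsetSum _ fun l _ => hint1 l s (hL l)
    have hI2' : ∀ s i, Integrable fun x => ∑ j : Fin 3, U s x i * U s x j * pd i (Φ j) x :=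
      fun s i => integrable_finsetSum _ fun j _ => hint2 i j s (hP i j)
    have hI2 : ∀ s, Integrable fun x => ∑ i : Fin 3, ∑ j : Fin 3,
        U s x i * U s x j * pd i (Φ j) x := fun s => integrable_finsetSum _ fun i _ => hI2' s i
    have hB : ∀ s, ∫ x, (∑ l : Fin 3, U s x l * lap (Φ l) x +
        ∑ i : Fin 3, ∑ j : Fin 3, U s x i * U s x j * pd i (Φ j) x) =
        (∑ l : Fin 3, ∫ x, U s x l * lap (Φ l) x) +
          ∑ i : Fin 3, ∑ j : Fin 3, ∫ x, U s x i * U s x j * pd i (Φ j) x := fun s => by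
      rw [integral_add (hI1 s) (hI2 s), integral_finsetSum _ fun l _ => hint1 l s (hL l),
        integral_finsetSum _ fun i _ => hI2' s i]
      congr 1
      exact Finset.sum_congr rfl fun i _ => integral_finsetSum _ fun j _ => hint2 i j s (hP i j)
    refine sub_eq_integral_of_forall_test (b := b)
      (g := fun t => ∫ x, ∑ l : Fin 3, U t x l * Φ l x)
      (h := fun s => ∫ x, (∑ l : Fin 3, U s x l * lap (Φ l) x +
        ∑ i : Fin 3, ∑ j : Fin 3, U s x i * U s x j * pd i (Φ j) x)) ?_ ?_ ?_ ht
    · simp only [hA]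
      exact continuous_finsetSum _ fun l _ => continuous_integral_mul (hc l) (hcb l)
        (hint (hΦ l) (hΦc l))
    · simp only [hB]
      exact (continuous_finsetSum _ fun l _ => continuous_integral_mul (hc l) (hcb l) (hL l)).add
        (continuous_finsetSum _ fun i _ => continuous_finsetSum _ fun j _ =>
          continuous_integral_mul (hc2 i j) (hcb2 i j) (hP i j))
    · intro θ hθ hθc hθs
      have htest := IsTest.pi fun l => isTest_mul hθ hθc hθs (hΦ l) (hΦc l)
      have hcd : ∀ t, ContDiff ℝ ∞ fun x => (WithLp.toLp 2 fun l => θ t * Φ l x : E3) := fun t =>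
        contDiff_euclidean.2 fun l => contDiff_const.mul (hΦ l)
      have hpd : ∀ t x i j, pd i (fun x => (WithLp.toLp 2 fun l => θ t * Φ l x : E3)) x j =
          θ t * pd i (Φ j) x := fun t x i j => by
        rw [← pd_apply i j ((hcd t).differentiable (by simp) x)]
        exact pd_const_mul i _ ((hΦ j).differentiable (by simp) x)
      rw [← hu.equation.momentum _ htest fun t x => by
        simp only [divergence, hpd, ← Finset.mul_sum, hdiv, mul_zero]]
      refine intervalIntegral.integral_congr fun t ht => ?_
      rw [uIcc_of_le hab.le] at ht
      simp only
      rw [← integral_const_mul, ← integral_const_mul, ← integral_add]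
      · refine integral_congr_ae (ae_of_all _ fun x => ?_)
        have hder : deriv (fun s => (WithLp.toLp 2 fun l => θ s * Φ l x : E3)) t =
            WithLp.toLp 2 fun l => deriv θ t * Φ l x := by
          refine HasDerivAt.deriv ?_
          have := ((hθ.differentiable (by simp) t).hasDerivAt).smul_const
            (WithLp.toLp 2 fun l => Φ l x : E3)
          exact this
        have hlap : ∀ l, lap (fun x => (WithLp.toLp 2 fun l => θ t * Φ l x : E3)) x l =
            θ t * lap (Φ l) x := fun l => by
          rw [lap_apply (hcd t)]; exact lap_const_mul (hΦ l) _ _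
        beta_reduce
        rw [hder, laplacian_eq_lap (hcd t)]
        simp only [hpd, hUu t ht, PiLp.inner_apply, hlap, mul_add, Finset.mul_sum,
          RCLike.inner_apply, conj_trivial, add_assoc]
        congr 1
        · exact Finset.sum_congr rfl fun i _ => by ring
        congr 1
        · exact Finset.sum_congr rfl fun i _ => by ring
        · exact Finset.sum_congr rfl fun i _ => Finset.sum_congr rfl fun j _ => by ring
      · exact (integrable_finsetSum _ fun l _ => hint1 l t (hint (hΦ l) (hΦc l))).const_mul _
      · exact ((hI1 t).add (hI2 t)).const_mul _

end Testing

/-! ### Testing the equation with kernels -/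

section KernelApproximation

/-- Approximation of a function of rapid decay by smooth functions: locally the approximations
become equal to the function, and all their derivatives decay uniformly like `wt`. -/
structure KernelApprox (h : ℕ → E3 → ℝ) (k : E3 → ℝ) : Prop where
  smooth : ∀ n, ContDiff ℝ ∞ (h n)
  eventuallyEq : ∀ x, ∀ᶠ n in atTop, h n =ᶠ[nhds x] k
  decay : ∀ m : ℕ, ∃ C, ∀ n x, ‖iteratedFDeriv ℝ m (h n) x‖ ≤ C * wt x

namespace KernelApprox

variable {h g : ℕ → E3 → ℝ} {k l : E3 → ℝ}

theorem pd (H : KernelApprox h k) (i : Fin 3) : KernelApprox (fun n => pd i (h n)) (pd i k) where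
  smooth n := contDiff_pd (H.smooth n) i
  eventuallyEq x := (H.eventuallyEq x).mono fun n hn => hn.fderiv.mono fun y hy => by
    change fderiv ℝ (h n) y _ = fderiv ℝ k y _
    rw [hy]
  decay m := by
    obtain ⟨C, hC⟩ := H.decay (m + 1)
    exact ⟨C, fun n x => (norm_iteratedFDeriv_pd_le (H.smooth n) i m x).trans (hC n x)⟩

theorem add (H : KernelApprox h k) (G : KernelApprox g l) :
    KernelApprox (fun n x => h n x + g n x) (fun x => k x + l x) where
  smooth n := (H.smooth n).add (G.smooth n)
  eventuallyEq x := ((H.eventuallyEq x).and (G.eventuallyEq x)).mono fun n hn => hn.1.add hn.2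
  decay m := by
    obtain ⟨C, hC⟩ := H.decay m
    obtain ⟨D, hD⟩ := G.decay m
    refine ⟨C + D, fun n x => ?_⟩
    rw [show (fun y => h n y + g n y) = h n + g n from rfl, iteratedFDeriv_add_apply
      ((H.smooth n).contDiffAt.of_le (by exact_mod_cast le_top))
      ((G.smooth n).contDiffAt.of_le (by exact_mod_cast le_top)), add_mul]
    exact (norm_add_le _ _).trans (add_le_add (hC n x) (hD n x))

theorem lap (H : KernelApprox h k) : KernelApprox (fun n => lap (h n)) (lap k) := by
  have := (((H.pd 0).pd 0).add ((H.pd 1).pd 1)).add ((H.pd 2).pd 2)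
  unfold NavierStokes.lap
  simpa only [Fin.sum_univ_three] using this

theorem exists_bound (H : KernelApprox h k) : ∃ C, 0 ≤ C ∧ ∀ n x, |h n x| ≤ C * wt x := by
  obtain ⟨C, hC⟩ := H.decay 0
  refine ⟨|C|, abs_nonneg _, fun n x => ?_⟩
  have := hC n x
  rw [norm_iteratedFDeriv_zero, Real.norm_eq_abs] at this
  exact this.trans (mul_le_mul_of_nonneg_right (le_abs_self C) (wt_pos x).le)

theorem integrable (H : KernelApprox h k) (n : ℕ) : Integrable (h n) := by
  obtain ⟨C, hC0, hC⟩ := H.exists_bound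
  exact (integrable_wt.const_mul C).mono' (H.smooth n).continuous.aestronglyMeasurable
    (ae_of_all _ fun x => hC n x)

theorem tendsto_integral (H : KernelApprox h k) {f : E3 → ℝ} (hf : IsBC f) :
    Tendsto (fun n => ∫ x, f x * h n x) atTop (nhds (∫ x, f x * k x)) := by
  obtain ⟨C, hC0, hC⟩ := H.exists_bound
  obtain ⟨M, hM0, hM⟩ := hf.exists_bound
  refine tendsto_integral_of_dominated_convergence (fun x => M * (C * wt x))
    (fun n => (hf.continuous.mul (H.smooth n).continuous).aestronglyMeasurable)
    ((integrable_wt.const_mul C).const_mul M) (fun n => ae_of_all _ fun x => ?_)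
    (ae_of_all _ fun x => ?_)
  · rw [norm_mul]
    exact mul_le_mul (hM x) (hC n x) (abs_nonneg _) hM0
  · refine tendsto_const_nhds.congr' ?_
    filter_upwards [H.eventuallyEq x] with n hn
    rw [hn.eq_of_nhds]

theorem exists_integral_bound (H : KernelApprox h k) {M : ℝ} (hM0 : 0 ≤ M) :
    ∃ B, ∀ f : E3 → ℝ, (∀ x, |f x| ≤ M) → ∀ n, |∫ x, f x * h n x| ≤ B := by
  obtain ⟨C, hC0, hC⟩ := H.exists_bound
  refine ⟨∫ x, M * (C * wt x), fun f hM n => ?_⟩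
  rw [← Real.norm_eq_abs]
  refine norm_integral_le_of_norm_le ((integrable_wt.const_mul C).const_mul M)
    (ae_of_all _ fun x => ?_)
  rw [norm_mul]
  exact mul_le_mul (hM x) (hC n x) (abs_nonneg _) hM0

end KernelApprox

theorem exists_bound_iteratedFDeriv_cutoff (m : ℕ) :
    ∃ C, 0 ≤ C ∧ ∀ R : ℝ, 1 ≤ R → ∀ x, ‖iteratedFDeriv ℝ m (cutoff R) x‖ ≤ C := by
  have hu := contDiff_cutoff 1
  have hc : HasCompactSupport (iteratedFDeriv ℝ m (cutoff 1)) :=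
    (hasCompactSupport_cutoff one_pos).iteratedFDeriv (𝕜 := ℝ) m
  obtain ⟨C, hC⟩ := (hu.continuous_iteratedFDeriv (m := m)
    (by exact_mod_cast le_top)).bounded_above_of_compact_support hc
  refine ⟨C, (norm_nonneg _).trans (hC (0 : E3)), fun R hR x => ?_⟩
  have h1 : cutoff R = fun x => cutoff 1 (R⁻¹ • x) := by
    funext x; simp [cutoff]
  rw [h1, iteratedFDeriv_comp_const_smul _ (hu.of_le (by exact_mod_cast le_top))]
  rw [norm_smul, norm_pow, Real.norm_eq_abs, abs_of_pos (by positivity)]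
  refine (mul_le_of_le_one_left (norm_nonneg _) (pow_le_one₀ (by positivity)
    (inv_le_one_of_one_le₀ hR))).trans (hC _)

/-- Cutting off a kernel is an approximation: all derivatives of the cutoff at radius `R ≥ 1` are
bounded independently of `R`. -/
theorem IsKernel.kernelApprox {K : E3 → ℝ} (hK : IsKernel K) :
    KernelApprox (fun n x => cutoff (n + 1) x * K x) K where
  smooth n := (contDiff_cutoff _).mul hK.smooth
  eventuallyEq x := by
    obtain ⟨N, hN⟩ := exists_nat_gt ‖x‖
    filter_upwards [eventually_ge_atTop N] with n hn
    have hopen : IsOpen {y : E3 | ‖y‖ < n + 1} := isOpen_lt continuous_norm continuous_const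
    have hn' : (N : ℝ) ≤ n := by exact_mod_cast hn
    filter_upwards [hopen.mem_nhds (show ‖x‖ < n + 1 by linarith)] with y hy
    rw [cutoff_eq_one (by positivity) (le_of_lt hy), one_mul]
  decay m := by
    choose C hC0 hC using exists_bound_iteratedFDeriv_cutoff
    choose D hD using hK.decay
    refine ⟨∑ j ∈ Finset.range (m + 1), (m.choose j : ℝ) * C j * D (m - j), fun n x => ?_⟩
    refine (norm_iteratedFDeriv_mul_le (N := ∞) (contDiff_cutoff _) hK.smooth x
      (by exact_mod_cast le_top)).trans ?_
    rw [Finset.sum_mul]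
    refine Finset.sum_le_sum fun j _ => ?_
    rw [mul_assoc _ (D (m - j)) (wt x)]
    gcongr
    · exact mul_nonneg (by positivity) (hC0 j)
    · exact hC j _ (by linarith [n.cast_nonneg (α := ℝ)]) x
    · exact hD _ x

end KernelApproximation

section KernelTesting

variable {a b : ℝ} {U : ℝ → E3 → E3}

namespace IsFlow

theorem isBC (hU : IsFlow a b U) (t : ℝ) : IsBC (U t) := by
  obtain ⟨M, hM⟩ := hU.bounded
  exact ⟨hU.continuous.comp (Continuous.prodMk_right t), M, hM t⟩

theorem isBC_coord (hU : IsFlow a b U) (t : ℝ) (k : Fin 3) : IsBC fun x => U t x k :=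
  (hU.isBC t).apply k

theorem isBC_coord_mul (hU : IsFlow a b U) (t : ℝ) (i j : Fin 3) :
    IsBC fun x => U t x i * U t x j :=
  (hU.isBC_coord t i).mul (hU.isBC_coord t j)

theorem continuous_coord (hU : IsFlow a b U) (k : Fin 3) :
    Continuous fun z : ℝ × E3 => U z.1 z.2 k := continuous_coord_comp hU.continuous k

theorem continuous_coord_mul (hU : IsFlow a b U) (i j : Fin 3) :
    Continuous fun z : ℝ × E3 => U z.1 z.2 i * U z.1 z.2 j :=
  (hU.continuous_coord i).mul (hU.continuous_coord j)

theorem exists_bound (hU : IsFlow a b U) : ∃ M, 0 ≤ M ∧ (∀ t x, ‖U t x‖ ≤ M) ∧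
    (∀ k t x, |U t x k| ≤ M) ∧ ∀ i j t x, |U t x i * U t x j| ≤ M * M := by
  obtain ⟨M, hM⟩ := hU.bounded
  have hM0 : 0 ≤ M := (norm_nonneg _).trans (hM 0 0)
  have hc : ∀ k t x, |U t x k| ≤ M := fun k t x => (PiLp.norm_apply_le (U t x) k).trans (hM t x)
  refine ⟨M, hM0, hM, hc, fun i j t x => ?_⟩
  rw [abs_mul]
  exact mul_le_mul (hc i t x) (hc j t x) (abs_nonneg _) hM0

theorem integrable_coord_mul (hU : IsFlow a b U) {h : E3 → ℝ} (hh : Integrable h) (t : ℝ)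
    (k : Fin 3) : Integrable fun x => U t x k * h x := by
  simpa only [mul_comm] using (hU.isBC_coord t k).integrable_mul hh

theorem integrable_coord_mul_mul (hU : IsFlow a b U) {h : E3 → ℝ} (hh : Integrable h) (t : ℝ)
    (i j : Fin 3) : Integrable fun x => U t x i * U t x j * h x := by
  simpa only [mul_comm] using (hU.isBC_coord_mul t i j).integrable_mul hh

/-- The momentum equation tested with the divergence-free field `∇∂ₖη - eₖ Δη`. -/
theorem integral_coord_mul_lap_of_hasCompactSupport (hU : IsFlow a b U) {η : E3 → ℝ}
    (hη : ContDiff ℝ ∞ η) (hηc : HasCompactSupport η) (k : Fin 3) {t : ℝ} (ht : t ∈ Icc a b) :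
    (∫ x, U t x k * lap η x) - ∫ x, U a x k * lap η x =
      ∫ s in a..t, ((∫ x, U s x k * lap (lap η) x) +
        (∑ i : Fin 3, ∫ x, U s x i * U s x k * pd i (lap η) x) -
        ∑ i : Fin 3, ∑ j : Fin 3, ∫ x, U s x i * U s x j * pd i (pd j (pd k η)) x) := by
  have hint : ∀ {h : E3 → ℝ}, ContDiff ℝ ∞ h → HasCompactSupport h → Integrable h :=
    fun h1 h2 => h1.continuous.integrable_of_hasCompactSupport h2
  have hl := contDiff_lap hη
  have hlc := hasCompactSupport_lap hηc
  have hk := contDiff_pd hη k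
  have hkc := hasCompactSupport_pd hηc k
  have hd : ∀ {h : E3 → ℝ}, ContDiff ℝ ∞ h → Differentiable ℝ h :=
    fun h => h.differentiable (by simp)
  set Φ : Fin 3 → E3 → ℝ := fun l x => pd l (pd k η) x - (if l = k then 1 else 0) * lap η x with hΦ
  have hcs : ∀ l, HasCompactSupport (Φ l) := fun l =>
    (hasCompactSupport_pd hkc l).sub hlc.mul_left
  have hcd : ∀ l, ContDiff ℝ ∞ (Φ l) := fun l => (contDiff_pd hk l).sub (contDiff_const.mul hl)
  have hpd : ∀ i l, pd i (Φ l) = fun x => pd i (pd l (pd k η)) x -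
      (if l = k then 1 else 0) * pd i (lap η) x := fun i l => funext fun x => by
    rw [hΦ]
    simp only
    rw [pd_sub i (hd (contDiff_pd hk l) x) ((hd hl x).const_mul _), pd_const_mul i _ (hd hl x)]
  have hlapk : ∀ l, lap (pd l (pd k η)) = pd l (pd k (lap η)) := fun l => by
    rw [lap_pd_comm hk, lap_pd_comm hη]
  have hlap : ∀ l x, lap (Φ l) x = pd l (pd k (lap η)) x -
      (if l = k then 1 else 0) * lap (lap η) x := fun l x => by
    rw [← hlapk]
    have : ∀ i, pd i (fun x => pd i (pd l (pd k η)) x - (if l = k then 1 else 0) * pd i (lap η) x) x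
        = pd i (pd i (pd l (pd k η))) x - (if l = k then 1 else 0) * pd i (pd i (lap η)) x :=
      fun i => by
      rw [pd_sub i (hd (contDiff_pd (contDiff_pd hk l) i) x) ((hd (contDiff_pd hl i) x).const_mul _),
        pd_const_mul i _ (hd (contDiff_pd hl i) x)]
    rw [show lap (Φ l) x = ∑ i, pd i (pd i (Φ l)) x from rfl,
      show lap (pd l (pd k η)) x = ∑ i, pd i (pd i (pd l (pd k η))) x from rfl,
      show lap (lap η) x = ∑ i, pd i (pd i (lap η)) x from rfl]
    simp only [hpd, this, Finset.sum_sub_distrib, Finset.mul_sum]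
  have hdiv : ∀ x, ∑ l : Fin 3, pd l (Φ l) x = 0 := fun x => by
    simp only [hpd, Finset.sum_sub_distrib, ite_mul, one_mul, zero_mul, Finset.sum_ite_eq',
      Finset.mem_univ, if_true]
    rw [← lap_pd_comm hη]
    simp [lap]
  have h0 : ∀ t, ∫ x, ∑ l : Fin 3, U t x l * Φ l x = - ∫ x, U t x k * lap η x := fun t => by
    have : ∀ x, ∑ l : Fin 3, U t x l * Φ l x =
        (∑ l : Fin 3, U t x l * pd l (pd k η) x) - U t x k * lap η x := fun x => by
      simp only [hΦ, mul_sub, Finset.sum_sub_distrib, ite_mul, one_mul, zero_mul, mul_ite, mul_zero,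
        Finset.sum_ite_eq', Finset.mem_univ, if_true]
    simp only [this]
    rw [integral_sub, hU.div_free t _ hk hkc, zero_sub]
    · exact integrable_finsetSum _ fun l _ => hU.integrable_coord_mul
        (hint (contDiff_pd hk l) (hasCompactSupport_pd hkc l)) t l
    · exact hU.integrable_coord_mul (hint hl hlc) t k
  have h1 := hU.momentum Φ hcd hcs hdiv t ht
  rw [h0, h0] at h1
  rw [← neg_inj, ← intervalIntegral.integral_neg]
  convert h1 using 1
  · ring
  refine intervalIntegral.integral_congr fun s _ => ?_
  have i1 := fun l => hU.integrable_coord_mul (hint (contDiff_pd (contDiff_pd hl k) l)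
    (hasCompactSupport_pd (hasCompactSupport_pd hlc k) l)) s l
  have i2 := hU.integrable_coord_mul (hint (contDiff_lap hl) (hasCompactSupport_lap hlc)) s k
  have i3 := fun i j => hU.integrable_coord_mul_mul (hint (contDiff_pd (contDiff_pd hk j) i)
    (hasCompactSupport_pd (hasCompactSupport_pd hkc j) i)) s i j
  have i4 := fun i => hU.integrable_coord_mul_mul (hint (contDiff_pd hl i)
    (hasCompactSupport_pd hlc i)) s i k
  have : ∀ x, (∑ l : Fin 3, U s x l * lap (Φ l) x +
      ∑ i : Fin 3, ∑ j : Fin 3, U s x i * U s x j * pd i (Φ j) x) =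
      ((∑ l : Fin 3, U s x l * pd l (pd k (lap η)) x) - U s x k * lap (lap η) x) +
      ((∑ i : Fin 3, ∑ j : Fin 3, U s x i * U s x j * pd i (pd j (pd k η)) x) -
        ∑ i : Fin 3, U s x i * U s x k * pd i (lap η) x) := fun x => by
    simp only [hlap, hpd, mul_sub, Finset.sum_sub_distrib, ite_mul, one_mul, zero_mul, mul_ite,
      mul_zero, Finset.sum_ite_eq', Finset.mem_univ, if_true]
  simp only [this]
  have j1 := integrable_finsetSum Finset.univ fun l _ => i1 l
  have j3 := integrable_finsetSum Finset.univ fun i _ =>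
    integrable_finsetSum Finset.univ fun j _ => i3 i j
  have j4 := integrable_finsetSum Finset.univ fun i _ => i4 i
  have hsplit : ∀ {f₁ f₂ f₃ f₄ : E3 → ℝ}, Integrable f₁ → Integrable f₂ → Integrable f₃ →
      Integrable f₄ → ∫ x, (f₁ x - f₂ x + (f₃ x - f₄ x)) =
      (∫ x, f₁ x) - (∫ x, f₂ x) + ((∫ x, f₃ x) - ∫ x, f₄ x) := fun h₁ h₂ h₃ h₄ => by
    rw [← integral_sub h₁ h₂, ← integral_sub h₃ h₄]
    exact integral_add (h₁.sub h₂) (h₃.sub h₄)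
  rw [hsplit j1 i2 j3 j4,
    hU.div_free s _ (contDiff_pd hl k) (hasCompactSupport_pd hlc k),
    integral_finsetSum _ fun i _ => i4 i,
    integral_finsetSum _ fun i _ => integrable_finsetSum Finset.univ fun j _ => i3 i j]
  simp only [integral_finsetSum _ fun j _ => i3 _ j]
  ring

/-- The test fields `∇∂ₖη - eₖ Δη` are admissible for kernels `η` without compact support. -/
theorem integral_coord_mul_lap (hU : IsFlow a b U) {η : E3 → ℝ}
    (hη : IsKernel η) (k : Fin 3) {t : ℝ} (ht : t ∈ Icc a b) :
    (∫ x, U t x k * lap η x) - ∫ x, U a x k * lap η x =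
      ∫ s in a..t, ((∫ x, U s x k * lap (lap η) x) +
        (∑ i : Fin 3, ∫ x, U s x i * U s x k * pd i (lap η) x) -
        ∑ i : Fin 3, ∑ j : Fin 3, ∫ x, U s x i * U s x j * pd i (pd j (pd k η)) x) := by
  obtain ⟨M, hM0, hM, hM1, hM2⟩ := hU.exists_bound
  have hA := hη.kernelApprox
  have hMM : 0 ≤ M * M := mul_nonneg hM0 hM0
  obtain ⟨B1, hB1⟩ := hA.lap.lap.exists_integral_bound hM0
  choose B2 hB2 using fun i => (hA.lap.pd i).exists_integral_bound hMM
  choose B3 hB3 using fun i j => (((hA.pd k).pd j).pd i).exists_integral_bound hMM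
  have hL := ((hA.lap).tendsto_integral (hU.isBC_coord t k)).sub
    ((hA.lap).tendsto_integral (hU.isBC_coord a k))
  refine tendsto_nhds_unique hL ?_
  have hR := intervalIntegral.tendsto_integral_filter_of_dominated_convergence (μ := volume)
    (a := a) (b := t) (l := atTop)
    (F := fun (n : ℕ) s =>
      (∫ x, U s x k * lap (lap (fun x => cutoff (n + 1) x * η x)) x) +
        (∑ i : Fin 3, ∫ x, U s x i * U s x k * pd i (lap (fun x => cutoff (n + 1) x * η x)) x) -
        ∑ i : Fin 3, ∑ j : Fin 3, ∫ x, U s x i * U s x j *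
          pd i (pd j (pd k (fun x => cutoff (n + 1) x * η x))) x)
    (f := fun s => (∫ x, U s x k * lap (lap η) x) +
        (∑ i : Fin 3, ∫ x, U s x i * U s x k * pd i (lap η) x) -
        ∑ i : Fin 3, ∑ j : Fin 3, ∫ x, U s x i * U s x j * pd i (pd j (pd k η)) x)
    (fun _ => B1 + (∑ i, B2 i) + ∑ i, ∑ j, B3 i j) ?_ ?_ ?_ ?_
  · refine hR.congr fun n => ?_
    exact (hU.integral_coord_mul_lap_of_hasCompactSupport (hA.smooth n)
      (hasCompactSupport_cutoff (by positivity)).mul_right k ht).symm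
  · refine Eventually.of_forall fun n => Continuous.aestronglyMeasurable ?_
    exact ((continuous_integral_mul (hU.continuous_coord k) (hM1 k) (hA.lap.lap.integrable n)).add
      (continuous_finsetSum _ fun i _ => continuous_integral_mul (hU.continuous_coord_mul i k)
        (hM2 i k) ((hA.lap.pd i).integrable n))).sub
      (continuous_finsetSum _ fun i _ => continuous_finsetSum _ fun j _ =>
        continuous_integral_mul (hU.continuous_coord_mul i j)
        (hM2 i j) ((((hA.pd k).pd j).pd i).integrable n))
  · refine Eventually.of_forall fun n => ae_of_all _ fun s _ => ?_
    refine (norm_sub_le _ _).trans (add_le_add ((norm_add_le _ _).trans (add_le_add ?_ ?_)) ?_)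
    · exact hB1 _ (hM1 k s) n
    · exact (norm_sum_le _ _).trans (Finset.sum_le_sum fun i _ => hB2 i _ (hM2 i k s) n)
    · exact (norm_sum_le _ _).trans (Finset.sum_le_sum fun i _ =>
        (norm_sum_le _ _).trans (Finset.sum_le_sum fun j _ => hB3 i j _ (hM2 i j s) n))
  · exact intervalIntegrable_const
  · refine ae_of_all _ fun s _ => ?_
    exact ((hA.lap.lap.tendsto_integral (hU.isBC_coord s k)).add
      (tendsto_finsetSum _ fun i _ => (hA.lap.pd i).tendsto_integral (hU.isBC_coord_mul s i k))).sub
      (tendsto_finsetSum _ fun i _ => tendsto_finsetSum _ fun j _ =>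
        (((hA.pd k).pd j).pd i).tendsto_integral (hU.isBC_coord_mul s i j))

/-- The evolution of `Δ K * uₖ`, from the test field built on `η = K (x - ·)`. The odd order
derivatives change sign under the reflection. -/
theorem cv_lap_sub (hU : IsFlow a b U) {K : E3 → ℝ} (hK : IsKernel K) (k : Fin 3) (x : E3)
    {t : ℝ} (ht : t ∈ Icc a b) :
    cv (lap K) (fun y => U t y k) x - cv (lap K) (fun y => U a y k) x =
      ∫ s in a..t, (cv (lap (lap K)) (fun y => U s y k) x -
        (∑ i : Fin 3, cv (pd i (lap K)) (fun y => U s y i * U s y k) x) +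
        ∑ i : Fin 3, ∑ j : Fin 3, cv (pd i (pd j (pd k K))) (fun y => U s y i * U s y j) x) := by
  have hp : ∀ (L : E3 → ℝ) i, pd i (fun y => L (x - y)) = fun y => (-1) * pd i L (x - y) :=
    fun L i => funext fun y => by rw [pd_comp_const_sub]; ring
  have hd : ∀ {L : E3 → ℝ}, IsKernel L → Differentiable ℝ fun y => L (x - y) :=
    fun hL => (hL.comp_const_sub x).differentiable
  have hp2 : ∀ {L : E3 → ℝ}, IsKernel L → ∀ i j,
      pd i (pd j (fun y => L (x - y))) = fun y => pd i (pd j L) (x - y) := fun {L} hL i j => by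
    rw [hp]
    funext y
    rw [pd_const_mul i _ (hd (hL.pd j) y), hp]
    ring
  have hl : ∀ {L : E3 → ℝ}, IsKernel L → lap (fun y => L (x - y)) = fun y => lap L (x - y) :=
    fun {L} hL => by funext y; simp only [lap, hp2 hL]
  have hc : ∀ (f : E3 → ℝ) (L : E3 → ℝ), ∫ y, f y * L (x - y) = cv L f x := fun f L =>
    integral_congr_ae (ae_of_all _ fun y => mul_comm _ _)
  have h := hU.integral_coord_mul_lap (hK.comp_const_sub x) k ht
  rw [hl hK, hl hK.lap] at h
  rw [hc, hc] at h
  rw [h]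
  refine intervalIntegral.integral_congr fun s _ => ?_
  simp only
  have e1 : ∀ i, ∫ y, U s y i * U s y k * pd i (fun y => lap K (x - y)) y =
      - cv (pd i (lap K)) (fun y => U s y i * U s y k) x := fun i => by
    rw [hp, ← hc, ← integral_neg]
    exact integral_congr_ae (ae_of_all _ fun y => by ring)
  have e2 : ∀ i j, ∫ y, U s y i * U s y j * pd i (pd j (pd k (fun y => K (x - y)))) y =
      - cv (pd i (pd j (pd k K))) (fun y => U s y i * U s y j) x := fun i j => by
    rw [hp2 hK j k, hp, ← hc, ← integral_neg]
    exact integral_congr_ae (ae_of_all _ fun y => by ring)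
  rw [hc]
  simp only [e1, e2, Finset.sum_neg_distrib]
  ring

end IsFlow

end KernelTesting

/-! ### The equation for the mollified velocity -/

section MollifiedEquation

/-- The third order term `∂ᵢ∂ⱼ∂ₖ Pₛ (uᵢuⱼ)`, summed over `i` and `j`. -/
noncomputable def tripleTerm (U : ℝ → E3 → E3) (k : Fin 3) (s τ : ℝ) (x : E3) : ℝ :=
  ∑ i : Fin 3, ∑ j : Fin 3, cv (pd i (pd j (pd k (heatKernel s)))) (fun y => U τ y i * U τ y j) x

/-- The gradient of the pressure mollified by the heat kernel at time `ε`. As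
`-Δπ = ∑ ∂ᵢ∂ⱼ(uᵢuⱼ)` and `(-Δ)⁻¹ = ∫₀^∞ Pₛ ds`, it is `∫_ε^∞ ∑ ∂ₖ∂ᵢ∂ⱼ Pₛ (uᵢuⱼ) ds`. -/
noncomputable def pressureGrad (U : ℝ → E3 → E3) (ε : ℝ) (k : Fin 3) (τ : ℝ) (x : E3) : ℝ :=
  ∫ s in Ioi ε, tripleTerm U k s τ x

theorem integrableOn_inv_sqrt_pow_three {ε : ℝ} (hε : 0 < ε) :
    IntegrableOn (fun s : ℝ => (√s)⁻¹ ^ 3) (Ioi ε) := by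
  refine (integrableOn_Ioi_rpow_of_lt (a := -(3 / 2)) (by norm_num) hε).congr_fun ?_
    measurableSet_Ioi
  intro s hs
  have hs0 : 0 < s := lt_trans hε hs
  simp only
  rw [Real.rpow_neg hs0.le, inv_pow, Real.sqrt_eq_rpow, ← Real.rpow_natCast, ← Real.rpow_mul hs0.le]
  norm_num

theorem tendsto_inv_sqrt_pow {m : ℕ} (hm : m ≠ 0) :
    Tendsto (fun s : ℝ => (√s)⁻¹ ^ m) atTop (nhds 0) := by
  have h := (tendsto_inv_atTop_zero.comp Real.tendsto_sqrt_atTop).pow m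
  rwa [zero_pow hm] at h

variable {a b : ℝ} {U : ℝ → E3 → E3}

namespace IsFlow

theorem continuousOn_tripleTerm (hU : IsFlow a b U) (k : Fin 3) :
    ContinuousOn (fun z : ℝ × ℝ × E3 => tripleTerm U k z.1 z.2.1 z.2.2) (Ioi 0 ×ˢ univ) := by
  obtain ⟨M, hM0, hM, hM1, hM2⟩ := hU.exists_bound
  refine continuousOn_finsetSum _ fun i _ => continuousOn_finsetSum _ fun j _ => ?_
  have hK := (((isKernel_heatKernel one_pos).pd k).pd j).pd i
  refine (continuousOn_cv_dil (hU.continuous_coord_mul i j) (hM2 i j) 3 hK.continuous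
    hK.integrable).congr fun z hz => ?_
  rw [pd_pd_pd_heatKernel_eq_dil hz.1]

/-- Parabolic scaling of the third derivatives of the heat kernel; the exponent makes the integral in
`pressureGrad` converge at infinity. -/
theorem exists_tripleTerm_bound (hU : IsFlow a b U) : ∃ C, 0 ≤ C ∧ ∀ k s τ x, 0 < s →
    |tripleTerm U k s τ x| ≤ C * (√s)⁻¹ ^ 3 := by
  obtain ⟨M, hM0, hM, hM1, hM2⟩ := hU.exists_bound
  have hK := fun k i j => (((isKernel_heatKernel one_pos).pd k).pd j).pd i
  have hN : ∀ k i j, 0 ≤ ∫ y, |pd i (pd j (pd k (heatKernel 1))) y| := fun k i j =>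
    integral_nonneg fun y => abs_nonneg _
  refine ⟨∑ k, ∑ i, ∑ j, (∫ y, |pd i (pd j (pd k (heatKernel 1))) y|) * (M * M),
    Finset.sum_nonneg fun k _ => Finset.sum_nonneg fun i _ => Finset.sum_nonneg fun j _ =>
      mul_nonneg (hN k i j) (mul_nonneg hM0 hM0), fun k s τ x hs => ?_⟩
  have h1 : |tripleTerm U k s τ x| ≤
      ∑ i, ∑ j, (√s)⁻¹ ^ 3 * ((∫ y, |pd i (pd j (pd k (heatKernel 1))) y|) * (M * M)) := by
    refine (Finset.abs_sum_le_sum_abs _ _).trans (Finset.sum_le_sum fun i _ =>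
      (Finset.abs_sum_le_sum_abs _ _).trans (Finset.sum_le_sum fun j _ => ?_))
    rw [pd_pd_pd_heatKernel_eq_dil hs, ← Real.norm_eq_abs]
    exact norm_cv_dil_le 3 hs (hK k i j).integrable (hM2 i j τ) x
  refine h1.trans ?_
  simp only [← Finset.mul_sum]
  rw [mul_comm]
  refine mul_le_mul_of_nonneg_right ?_ (by positivity)
  exact Finset.single_le_sum (f := fun k => ∑ i, ∑ j,
    (∫ y, |pd i (pd j (pd k (heatKernel 1))) y|) * (M * M)) (fun k _ => Finset.sum_nonneg fun i _ =>
      Finset.sum_nonneg fun j _ => mul_nonneg (hN k i j) (mul_nonneg hM0 hM0)) (Finset.mem_univ k)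

theorem continuousOn_tripleTerm_left (hU : IsFlow a b U) (k : Fin 3) (τ : ℝ) (x : E3) :
    ContinuousOn (fun s => tripleTerm U k s τ x) (Ioi 0) :=
  (hU.continuousOn_tripleTerm k).comp (f := fun s => (s, τ, x)) (by fun_prop)
    fun s hs => ⟨hs, mem_univ _⟩

theorem integrableOn_tripleTerm (hU : IsFlow a b U) {ε : ℝ} (hε : 0 < ε) (k : Fin 3) (τ : ℝ)
    (x : E3) : IntegrableOn (fun s => tripleTerm U k s τ x) (Ioi ε) := by
  obtain ⟨C, hC0, hC⟩ := hU.exists_tripleTerm_bound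
  refine ((integrableOn_inv_sqrt_pow_three hε).const_mul C).mono' ?_ ?_
  · exact ((hU.continuousOn_tripleTerm_left k τ x).mono
      (Ioi_subset_Ioi hε.le)).aestronglyMeasurable measurableSet_Ioi
  · exact (ae_restrict_mem measurableSet_Ioi).mono fun s hs => hC k s τ x (lt_trans hε hs)

theorem continuous_pressureGrad (hU : IsFlow a b U) {ε : ℝ} (hε : 0 < ε) (k : Fin 3) :
    Continuous fun z : ℝ × E3 => pressureGrad U ε k z.1 z.2 := by
  obtain ⟨C, hC0, hC⟩ := hU.exists_tripleTerm_bound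
  refine continuous_of_dominated (bound := fun s => C * (√s)⁻¹ ^ 3)
    (fun z => (hU.integrableOn_tripleTerm hε k z.1 z.2).aestronglyMeasurable)
    (fun z => (ae_restrict_mem measurableSet_Ioi).mono fun s hs => hC k s z.1 z.2 (lt_trans hε hs))
    ((integrableOn_inv_sqrt_pow_three hε).const_mul C)
    ((ae_restrict_mem measurableSet_Ioi).mono fun s hs => ?_)
  have h := (hU.continuousOn_tripleTerm k).comp (f := fun z : ℝ × E3 => (s, z)) (s := univ)
    (by fun_prop) fun z _ => ⟨lt_trans hε hs, mem_univ _⟩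
  exact continuousOn_univ.1 h

theorem exists_pressureGrad_bound (hU : IsFlow a b U) {ε : ℝ} (hε : 0 < ε) :
    ∃ C, 0 ≤ C ∧ ∀ k τ x, |pressureGrad U ε k τ x| ≤ C := by
  obtain ⟨C, hC0, hC⟩ := hU.exists_tripleTerm_bound
  refine ⟨∫ s in Ioi ε, C * (√s)⁻¹ ^ 3, integral_nonneg fun s => by positivity, fun k τ x => ?_⟩
  rw [← Real.norm_eq_abs]
  exact norm_integral_le_of_norm_le ((integrableOn_inv_sqrt_pow_three hε).const_mul C)
    ((ae_restrict_mem measurableSet_Ioi).mono fun s hs => hC k s τ x (lt_trans hε hs))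

/-- Continuity of a heat flow in its parameter. -/
theorem continuousOn_cv_heat_time {W : ℝ → E3 → ℝ} (hW : Continuous fun z : ℝ × E3 => W z.1 z.2)
    {M : ℝ} (hM : ∀ t x, |W t x| ≤ M) (m : ℕ) {K : E3 → ℝ} (hK : IsKernel K) {L : ℝ → E3 → ℝ}
    (hL : ∀ s, 0 < s → L s = dil m s K) (x : E3) :
    ContinuousOn (fun z : ℝ × ℝ => cv (L z.1) (W z.2) x) (Ioi 0 ×ˢ univ) := by
  have h := (continuousOn_cv_dil hW hM m hK.continuous hK.integrable).comp
    (f := fun z : ℝ × ℝ => (z.1, z.2, x)) (s := Ioi 0 ×ˢ univ) (by fun_prop)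
    fun z hz => ⟨hz.1, mem_univ _⟩
  exact h.congr fun z hz => by simp only [Function.comp, hL z.1 hz.1]

/-- The identity `cv_lap_sub` for the heat kernels at the times `s ∈ (ε, T)`, integrated in `s`. As
`Δ Pₛ = ∂ₛ Pₛ`, all terms except the pressure become differences of their values at `T` and `ε`. -/
theorem sub_eq_integral_of_lt (hU : IsFlow a b U) {ε T : ℝ} (hε : 0 < ε) (hT : ε ≤ T) (k : Fin 3)
    (x : E3) {t : ℝ} (ht : t ∈ Icc a b) :
    (cv (heatKernel T) (fun y => U t y k) x - cv (heatKernel ε) (fun y => U t y k) x) -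
      (cv (heatKernel T) (fun y => U a y k) x - cv (heatKernel ε) (fun y => U a y k) x) =
    ∫ τ in a..t, ((cv (lap (heatKernel T)) (fun y => U τ y k) x -
        cv (lap (heatKernel ε)) (fun y => U τ y k) x) -
      (∑ i : Fin 3, (cv (pd i (heatKernel T)) (fun y => U τ y i * U τ y k) x -
        cv (pd i (heatKernel ε)) (fun y => U τ y i * U τ y k) x)) +
      ∫ s in ε..T, tripleTerm U k s τ x) := by
  obtain ⟨M, hM0, hM, hM1, hM2⟩ := hU.exists_bound
  have hk1 := isKernel_heatKernel one_pos
  have hpos : ∀ s ∈ uIcc ε T, 0 < s := fun s hs => by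
    rw [uIcc_of_le hT] at hs; exact lt_of_lt_of_le hε hs.1
  have hsub : uIcc ε T ⊆ Ioi 0 := hpos
  have hsubI : Icc ε T ⊆ Ioi 0 := fun s hs => lt_of_lt_of_le hε hs.1
  have slice : ∀ {f : ℝ × ℝ → ℝ}, ContinuousOn f (Ioi 0 ×ˢ univ) → ∀ τ,
      ContinuousOn (fun s => f (s, τ)) (uIcc ε T) := fun hf τ =>
    hf.comp (f := fun s => (s, τ)) (by fun_prop) fun s hs => ⟨hsub hs, mem_univ _⟩
  -- the Laplacian and the second order Laplacian of the kernels as dilations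
  have c1 := continuousOn_cv_heat_time (hU.continuous_coord k) (hM1 k) 2 hk1.lap
    (fun s hs => lap_heatKernel_eq_dil hs) x
  have hll : ∀ s, 0 < s → lap (lap (heatKernel s)) = dil 4 s (lap (lap (heatKernel 1))) := by
    intro s hs
    have hdl : lap (dil 2 s (lap (heatKernel 1))) = dil 4 s (lap (lap (heatKernel 1))) := by
      ext y
      have e : ∀ i, pd i (pd i (dil 2 s (lap (heatKernel 1)))) =
          dil 4 s (pd i (pd i (lap (heatKernel 1)))) := fun i => by
        rw [pd_dil 2 s hk1.lap.differentiable, pd_dil 3 s (hk1.lap.pd i).differentiable]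
      rw [show lap (dil 2 s (lap (heatKernel 1))) y =
        ∑ i, pd i (pd i (dil 2 s (lap (heatKernel 1)))) y from rfl]
      simp only [e, dil, ← Finset.mul_sum]
      rfl
    rw [lap_heatKernel_eq_dil hs, hdl]
  have c2 := continuousOn_cv_heat_time (hU.continuous_coord k) (hM1 k) 4 hk1.lap.lap hll x
  have hpl : ∀ i s, 0 < s → pd i (lap (heatKernel s)) = dil 3 s (pd i (lap (heatKernel 1))) :=
    fun i s hs => by rw [lap_heatKernel_eq_dil hs, pd_dil 2 s hk1.lap.differentiable]
  have c3 := fun i => continuousOn_cv_heat_time (hU.continuous_coord_mul i k) (hM2 i k) 3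
    (hk1.lap.pd i) (hpl i) x
  have c4 : ContinuousOn (fun z : ℝ × ℝ => tripleTerm U k z.1 z.2 x) (Ioi 0 ×ˢ univ) :=
    (hU.continuousOn_tripleTerm k).comp (f := fun z : ℝ × ℝ => (z.1, z.2, x)) (by fun_prop)
      fun z hz => ⟨hz.1, mem_univ _⟩
  have d1 : ∀ τ, ∫ s in ε..T, cv (lap (heatKernel s)) (fun y => U τ y k) x =
      cv (heatKernel T) (fun y => U τ y k) x - cv (heatKernel ε) (fun y => U τ y k) x := fun τ =>
    intervalIntegral.integral_eq_sub_of_hasDerivAt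
      (fun s hs => hasDerivAt_cv_heatKernel (hpos s hs) (hU.isBC_coord τ k) x)
      (slice c1 τ).intervalIntegrable
  have d2 : ∀ τ, ∫ s in ε..T, cv (lap (lap (heatKernel s))) (fun y => U τ y k) x =
      cv (lap (heatKernel T)) (fun y => U τ y k) x -
        cv (lap (heatKernel ε)) (fun y => U τ y k) x := fun τ =>
    intervalIntegral.integral_eq_sub_of_hasDerivAt
      (fun s hs => hasDerivAt_cv_lap_heatKernel (hpos s hs) (hU.isBC_coord τ k) x)
      (slice c2 τ).intervalIntegrable
  have d3 : ∀ i τ, ∫ s in ε..T, cv (pd i (lap (heatKernel s))) (fun y => U τ y i * U τ y k) x =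
      cv (pd i (heatKernel T)) (fun y => U τ y i * U τ y k) x -
        cv (pd i (heatKernel ε)) (fun y => U τ y i * U τ y k) x := fun i τ =>
    intervalIntegral.integral_eq_sub_of_hasDerivAt
      (fun s hs => hasDerivAt_cv_pd_heatKernel (hpos s hs) (hU.isBC_coord_mul τ i k) i x)
      (slice (c3 i) τ).intervalIntegrable
  set Z : ℝ → ℝ → ℝ := fun s τ => cv (lap (lap (heatKernel s))) (fun y => U τ y k) x -
    (∑ i : Fin 3, cv (pd i (lap (heatKernel s))) (fun y => U τ y i * U τ y k) x) +
      tripleTerm U k s τ x with hZ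
  have cZ : ContinuousOn (fun z : ℝ × ℝ => Z z.1 z.2) (Ioi 0 ×ˢ univ) :=
    (c2.sub (continuousOn_finsetSum _ fun i _ => c3 i)).add c4
  have hmain : ∫ s in ε..T, (cv (lap (heatKernel s)) (fun y => U t y k) x -
      cv (lap (heatKernel s)) (fun y => U a y k) x) = ∫ s in ε..T, ∫ τ in a..t, Z s τ :=
    intervalIntegral.integral_congr fun s hs =>
      hU.cv_lap_sub (isKernel_heatKernel (hpos s hs)) k x ht
  rw [intervalIntegral.integral_sub (slice c1 t).intervalIntegrable
    (slice c1 a).intervalIntegrable, d1, d1] at hmain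
  rw [hmain, intervalIntegral_intervalIntegral_swap]
  · refine intervalIntegral.integral_congr fun τ _ => ?_
    have i2 : IntervalIntegrable (fun s => cv (lap (lap (heatKernel s))) (fun y => U τ y k) x)
      volume ε T := (slice c2 τ).intervalIntegrable
    have i3 : ∀ i, IntervalIntegrable (fun s => cv (pd i (lap (heatKernel s)))
      (fun y => U τ y i * U τ y k) x) volume ε T := fun i => (slice (c3 i) τ).intervalIntegrable
    have i3' : IntervalIntegrable (fun s => ∑ i : Fin 3, cv (pd i (lap (heatKernel s)))
      (fun y => U τ y i * U τ y k) x) volume ε T :=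
      (slice (continuousOn_finsetSum _ fun i _ => c3 i) τ).intervalIntegrable
    have i4 : IntervalIntegrable (fun s => tripleTerm U k s τ x) volume ε T :=
      (slice c4 τ).intervalIntegrable
    simp only [hZ]
    rw [intervalIntegral.integral_add (i2.sub i3') i4, intervalIntegral.integral_sub i2 i3',
      intervalIntegral.integral_finsetSum fun i _ => i3 i, d2]
    simp only [d3]
  · have : IntegrableOn (fun z : ℝ × ℝ => Z z.1 z.2) (Icc ε T ×ˢ uIcc a t) := by
      refine ContinuousOn.integrableOn_compact (isCompact_Icc.prod isCompact_uIcc) (cZ.mono ?_)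
      exact prod_mono hsubI (subset_univ _)
    rw [uIoc_of_le hT]
    exact this.mono_set (prod_mono Ioc_subset_Icc_self uIoc_subset_uIcc)

/-- The equation for the mollified velocity, as the limit `T → ∞` of `sub_eq_integral_of_lt`: the
terms at time `T` decay, the velocity itself because it is square integrable. -/
theorem sub_eq_integral (hU : IsFlow a b U) {ε : ℝ} (hε : 0 < ε) (k : Fin 3)
    (x : E3) {t : ℝ} (ht : t ∈ Icc a b) :
    cv (heatKernel ε) (fun y => U t y k) x - cv (heatKernel ε) (fun y => U a y k) x =
    ∫ τ in a..t, (cv (lap (heatKernel ε)) (fun y => U τ y k) x -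
      (∑ i : Fin 3, cv (pd i (heatKernel ε)) (fun y => U τ y i * U τ y k) x) -
      pressureGrad U ε k τ x) := by
  obtain ⟨M, hM0, hM, hM1, hM2⟩ := hU.exists_bound
  obtain ⟨C, hC0, hC⟩ := hU.exists_tripleTerm_bound
  obtain ⟨A, hA⟩ := hU.sq_integrable
  have hk1 := isKernel_heatKernel one_pos
  have hsq : ∀ t, Integrable fun y => U t y k ^ 2 := fun t =>
    (hA t).1.mono' ((hU.isBC_coord t k).continuous.pow 2).aestronglyMeasurable
      (ae_of_all _ fun y => by
        rw [norm_pow]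
        exact pow_le_pow_left₀ (norm_nonneg _) (PiLp.norm_apply_le (U t y) k) 2)
  have hL := ((tendsto_cv_heatKernel_atTop (hsq t) x).sub_const
    (cv (heatKernel ε) (fun y => U t y k) x)).sub ((tendsto_cv_heatKernel_atTop (hsq a) x).sub_const
    (cv (heatKernel ε) (fun y => U a y k) x))
  have b1 : ∀ {T}, 0 < T → ∀ τ, |cv (lap (heatKernel T)) (fun y => U τ y k) x| ≤
      (√T)⁻¹ ^ 2 * ((∫ y, |lap (heatKernel 1) y|) * M) := fun hT τ => by
    rw [lap_heatKernel_eq_dil hT, ← Real.norm_eq_abs]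
    exact norm_cv_dil_le 2 hT hk1.lap.integrable (hM1 k τ) x
  have b2 : ∀ {T}, 0 < T → ∀ i τ, |cv (pd i (heatKernel T)) (fun y => U τ y i * U τ y k) x| ≤
      (√T)⁻¹ ^ 1 * ((∫ y, |pd i (heatKernel 1) y|) * (M * M)) := fun hT i τ => by
    rw [pd_heatKernel_eq_dil hT, ← Real.norm_eq_abs]
    exact norm_cv_dil_le 1 hT (hk1.pd i).integrable (hM2 i k τ) x
  have t1 : ∀ τ, Tendsto (fun T => cv (lap (heatKernel T)) (fun y => U τ y k) x) atTop (nhds 0) :=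
    fun τ => by
    refine squeeze_zero_norm' ((eventually_gt_atTop 0).mono fun T hT => b1 hT τ) ?_
    simpa using (tendsto_inv_sqrt_pow two_ne_zero).mul_const ((∫ y, |lap (heatKernel 1) y|) * M)
  have t2 : ∀ i τ, Tendsto (fun T => cv (pd i (heatKernel T)) (fun y => U τ y i * U τ y k) x)
      atTop (nhds 0) := fun i τ => by
    refine squeeze_zero_norm' ((eventually_gt_atTop 0).mono fun T hT => b2 hT i τ) ?_
    simpa using (tendsto_inv_sqrt_pow one_ne_zero).mul_const
      ((∫ y, |pd i (heatKernel 1) y|) * (M * M))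
  have hR := intervalIntegral.tendsto_integral_filter_of_dominated_convergence (μ := volume)
    (a := a) (b := t) (l := atTop)
    (F := fun T τ => (cv (lap (heatKernel T)) (fun y => U τ y k) x -
        cv (lap (heatKernel ε)) (fun y => U τ y k) x) -
      (∑ i : Fin 3, (cv (pd i (heatKernel T)) (fun y => U τ y i * U τ y k) x -
        cv (pd i (heatKernel ε)) (fun y => U τ y i * U τ y k) x)) +
      ∫ s in ε..T, tripleTerm U k s τ x)
    (f := fun τ => (0 - cv (lap (heatKernel ε)) (fun y => U τ y k) x) -
      (∑ i : Fin 3, (0 - cv (pd i (heatKernel ε)) (fun y => U τ y i * U τ y k) x)) +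
      pressureGrad U ε k τ x)
    (fun _ => ((√ε)⁻¹ ^ 2 * ((∫ y, |lap (heatKernel 1) y|) * M) +
        (√ε)⁻¹ ^ 2 * ((∫ y, |lap (heatKernel 1) y|) * M)) +
      (∑ i : Fin 3, ((√ε)⁻¹ ^ 1 * ((∫ y, |pd i (heatKernel 1) y|) * (M * M)) +
        (√ε)⁻¹ ^ 1 * ((∫ y, |pd i (heatKernel 1) y|) * (M * M)))) +
      ∫ s in Ioi ε, C * (√s)⁻¹ ^ 3) ?_ ?_ ?_ ?_
  · have hR2 := hR.congr' ((eventually_ge_atTop ε).mono fun T hT =>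
      (hU.sub_eq_integral_of_lt hε hT k x ht).symm)
    have := tendsto_nhds_unique hL hR2
    rw [← neg_inj, ← intervalIntegral.integral_neg]
    simp only [zero_sub, neg_sub_neg] at this
    rw [neg_sub, this]
    refine intervalIntegral.integral_congr fun τ _ => ?_
    simp only [Finset.sum_neg_distrib]
    ring
  · refine (eventually_ge_atTop ε).mono fun T hT => ?_
    have hT0 : 0 < T := lt_of_lt_of_le hε hT
    have slice2 : ∀ {f : ℝ × ℝ → ℝ}, ContinuousOn f (Ioi 0 ×ˢ univ) → ∀ {s}, 0 < s →
        Continuous (fun τ => f (s, τ)) := fun hf s hs =>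
      continuousOn_univ.1 (hf.comp (f := fun τ => (s, τ)) (by fun_prop)
        fun τ _ => ⟨hs, mem_univ _⟩)
    have c1 := continuousOn_cv_heat_time (hU.continuous_coord k) (hM1 k) 2 hk1.lap
      (fun s hs => lap_heatKernel_eq_dil hs) x
    have c3 := fun i => continuousOn_cv_heat_time (hU.continuous_coord_mul i k) (hM2 i k) 1
      (hk1.pd i) (fun s hs => pd_heatKernel_eq_dil hs i) x
    refine Continuous.aestronglyMeasurable ?_
    refine (((slice2 c1 hT0).sub (slice2 c1 hε)).sub (continuous_finsetSum _ fun i _ =>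
      (slice2 (c3 i) hT0).sub (slice2 (c3 i) hε))).add ?_
    simp only [intervalIntegral.integral_of_le hT]
    refine continuous_of_dominated (bound := fun s => C * (√s)⁻¹ ^ 3)
      (fun τ => ((hU.integrableOn_tripleTerm hε k τ x).mono_set
        Ioc_subset_Ioi_self).aestronglyMeasurable)
      (fun τ => (ae_restrict_mem measurableSet_Ioc).mono fun s hs => hC k s τ x (lt_trans hε hs.1))
      (((integrableOn_inv_sqrt_pow_three hε).mono_set Ioc_subset_Ioi_self).const_mul C)
      ((ae_restrict_mem measurableSet_Ioc).mono fun s hs => ?_)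
    have h := (hU.continuousOn_tripleTerm k).comp (f := fun τ : ℝ => (s, τ, x)) (s := univ)
      (by fun_prop) fun z _ => ⟨lt_trans hε hs.1, mem_univ _⟩
    exact continuousOn_univ.1 h
  · refine (eventually_ge_atTop ε).mono fun T hT => ae_of_all _ fun τ _ => ?_
    have hT0 : 0 < T := lt_of_lt_of_le hε hT
    have hinv : (√T)⁻¹ ≤ (√ε)⁻¹ := inv_anti₀ (Real.sqrt_pos.2 hε) (Real.sqrt_le_sqrt hT)
    have hm : ∀ m : ℕ, (√T)⁻¹ ^ m ≤ (√ε)⁻¹ ^ m := fun m =>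
      pow_le_pow_left₀ (by positivity) hinv m
    refine (norm_add_le _ _).trans (add_le_add ((norm_sub_le _ _).trans (add_le_add
      ((norm_sub_le _ _).trans (add_le_add ?_ ?_)) ?_)) ?_)
    · exact (b1 hT0 τ).trans (mul_le_mul_of_nonneg_right (hm 2)
        (mul_nonneg (integral_nonneg fun _ => abs_nonneg _) hM0))
    · exact b1 hε τ
    · refine (norm_sum_le _ _).trans (Finset.sum_le_sum fun i _ =>
        (norm_sub_le _ _).trans (add_le_add ?_ ?_))
      · exact (b2 hT0 i τ).trans (mul_le_mul_of_nonneg_right (hm 1)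
          (mul_nonneg (integral_nonneg fun _ => abs_nonneg _) (mul_nonneg hM0 hM0)))
      · exact b2 hε i τ
    · rw [intervalIntegral.integral_of_le hT]
      refine (norm_integral_le_of_norm_le
        (((integrableOn_inv_sqrt_pow_three hε).mono_set Ioc_subset_Ioi_self).const_mul C)
        ((ae_restrict_mem measurableSet_Ioc).mono fun s hs =>
          hC k s τ x (lt_trans hε hs.1))).trans ?_
      exact setIntegral_mono_set ((integrableOn_inv_sqrt_pow_three hε).const_mul C)
        (ae_of_all _ fun s => by positivity) (LE.le.eventuallyLE Ioc_subset_Ioi_self)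
  · exact intervalIntegrable_const
  · refine ae_of_all _ fun τ _ => ?_
    exact (((t1 τ).sub_const _).sub (tendsto_finsetSum _ fun i _ => (t2 i τ).sub_const _)).add
      (intervalIntegral_tendsto_integral_Ioi ε (hU.integrableOn_tripleTerm hε k τ x) tendsto_id)

end IsFlow

end MollifiedEquation

/-! ### The field `|v|^(p-2) v` -/

section PowerNonlinearity

/-- A bounded `C¹` vector field with bounded derivatives that is square integrable. -/
structure IsNice (v : E3 → E3) : Prop where
  contDiff : ContDiff ℝ 1 v
  bounded : IsBC v
  bounded_pd : ∀ i, IsBC (pd i v)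
  sq_integrable : Integrable fun x => ‖v x‖ ^ 2

/-- The components of the field `|v|^(p-2) v`. -/
noncomputable def powField (p : ℝ) (v : E3 → E3) (k : Fin 3) (x : E3) : ℝ :=
  ‖v x‖ ^ (p - 2) * v x k

variable {v : E3 → E3} {p : ℝ}

theorem hasFDerivAt_norm_rpow_comp {r : ℝ} (hr : 1 < r) {x : E3} (hv : DifferentiableAt ℝ v x) :
    HasFDerivAt (fun y => ‖v y‖ ^ r)
      (((r * ‖v x‖ ^ (r - 2)) • innerSL ℝ (v x)).comp (fderiv ℝ v x)) x :=
  (hasFDerivAt_norm_rpow (v x) hr).comp x hv.hasFDerivAt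

theorem pd_norm_rpow {r : ℝ} (hr : 1 < r) {x : E3} (hv : DifferentiableAt ℝ v x) (i : Fin 3) :
    pd i (fun y => ‖v y‖ ^ r) x = r * ‖v x‖ ^ (r - 2) * inner ℝ (v x) (pd i v x) := by
  rw [pd, (hasFDerivAt_norm_rpow_comp hr hv).fderiv]
  simp [pd]

theorem pd_powField (hp : 4 ≤ p) {x : E3} (hv : DifferentiableAt ℝ v x) (i k : Fin 3) :
    pd i (powField p v k) x = ‖v x‖ ^ (p - 2) * pd i v x k +
      (p - 2) * ‖v x‖ ^ (p - 4) * inner ℝ (v x) (pd i v x) * v x k := by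
  have h1 := (hasFDerivAt_norm_rpow_comp (r := p - 2) (by linarith) hv).differentiableAt
  have h2 : DifferentiableAt ℝ (fun y => v y k) x :=
    (EuclideanSpace.proj k : E3 →L[ℝ] ℝ).differentiableAt.comp x hv
  unfold powField
  rw [pd_mul i h1 h2, pd_norm_rpow (by linarith) hv, pd_apply i k hv,
    show p - 2 - 2 = p - 4 by ring]
  ring

theorem norm_rpow_sub_two (hp : 4 ≤ p) (y : E3) : ‖y‖ ^ (p - 2) = ‖y‖ ^ (p - 4) * ‖y‖ ^ 2 := by
  rw [← Real.rpow_natCast, ← Real.rpow_add_of_nonneg (norm_nonneg _) (by linarith) (by norm_num)]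
  congr 1; push_cast; ring

theorem abs_pd_powField_le (hp : 4 ≤ p) {x : E3} (hv : DifferentiableAt ℝ v x) (i k : Fin 3) :
    |pd i (powField p v k) x| ≤ (p - 1) * (‖v x‖ ^ (p - 2) * ‖pd i v x‖) := by
  rw [pd_powField hp hv]
  have h1 : |‖v x‖ ^ (p - 2) * pd i v x k| ≤ ‖v x‖ ^ (p - 2) * ‖pd i v x‖ := by
    rw [abs_mul, abs_of_nonneg (by positivity)]
    exact mul_le_mul_of_nonneg_left (PiLp.norm_apply_le (pd i v x) k) (by positivity)
  have h2 : |(p - 2) * ‖v x‖ ^ (p - 4) * inner ℝ (v x) (pd i v x) * v x k| ≤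
      (p - 2) * (‖v x‖ ^ (p - 2) * ‖pd i v x‖) := by
    have hp2 : 0 ≤ p - 2 := by linarith
    rw [abs_mul, abs_mul, abs_of_nonneg (by positivity), norm_rpow_sub_two hp]
    calc (p - 2) * ‖v x‖ ^ (p - 4) * |inner ℝ (v x) (pd i v x)| * |v x k|
        ≤ (p - 2) * ‖v x‖ ^ (p - 4) * (‖v x‖ * ‖pd i v x‖) * ‖v x‖ := by
          gcongr
          · exact abs_real_inner_le_norm _ _
          · exact PiLp.norm_apply_le (v x) k
      _ = _ := by ring
  refine (abs_add_le _ _).trans ((add_le_add h1 h2).trans_eq (by ring))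

theorem sum_pd_powField_mul (hp : 4 ≤ p) {x : E3} (hv : DifferentiableAt ℝ v x) (i : Fin 3) :
    ∑ k : Fin 3, pd i (powField p v k) x * pd i v x k =
      ‖v x‖ ^ (p - 2) * ‖pd i v x‖ ^ 2 +
        (p - 2) * ‖v x‖ ^ (p - 4) * inner ℝ (v x) (pd i v x) ^ 2 := by
  simp only [pd_powField hp hv]
  have h1 : ‖pd i v x‖ ^ 2 = ∑ k : Fin 3, pd i v x k * pd i v x k := by
    rw [EuclideanSpace.norm_sq_eq]
    exact Finset.sum_congr rfl fun k _ => by rw [Real.norm_eq_abs, sq_abs, sq]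
  have h2 : inner ℝ (v x) (pd i v x) = ∑ k : Fin 3, v x k * pd i v x k := by
    rw [PiLp.inner_apply]
    exact Finset.sum_congr rfl fun k _ => by simp [mul_comm]
  simp only [add_mul, Finset.sum_add_distrib]
  rw [h1, Finset.mul_sum, sq, ← mul_assoc _ (inner ℝ (v x) (pd i v x))]
  congr 1
  · exact Finset.sum_congr rfl fun k _ => by ring
  · generalize (p - 2) * ‖v x‖ ^ (p - 4) * inner ℝ (v x) (pd i v x) = c
    rw [h2, Finset.mul_sum]
    exact Finset.sum_congr rfl fun k _ => by ring

theorem abs_powField_le (hp : 4 ≤ p) (k : Fin 3) (x : E3) :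
    |powField p v k x| ≤ ‖v x‖ ^ (p - 1) := by
  unfold powField
  rw [abs_mul, abs_of_nonneg (by positivity)]
  calc ‖v x‖ ^ (p - 2) * |v x k| ≤ ‖v x‖ ^ (p - 2) * ‖v x‖ := by
        gcongr; exact PiLp.norm_apply_le (v x) k
    _ = _ := by
        rw [← Real.rpow_add_one' (norm_nonneg _) (by linarith)]; congr 1; ring

theorem norm_rpow_le {M r : ℝ} (hr : 2 ≤ r) {y : E3} (hM : ‖y‖ ≤ M) :
    ‖y‖ ^ r ≤ M ^ (r - 2) * ‖y‖ ^ 2 := by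
  calc ‖y‖ ^ r = ‖y‖ ^ (r - 2) * ‖y‖ ^ 2 := by
        rw [← Real.rpow_natCast, ← Real.rpow_add_of_nonneg (norm_nonneg _) (by linarith)
          (by norm_num)]
        congr 1; push_cast; ring
    _ ≤ _ := by gcongr

namespace IsNice

theorem differentiable (hv : IsNice v) : Differentiable ℝ v := hv.contDiff.differentiable one_ne_zero

theorem continuous (hv : IsNice v) : Continuous v := hv.contDiff.continuous

theorem exists_bound (hv : IsNice v) : ∃ M, 0 ≤ M ∧ (∀ x, ‖v x‖ ≤ M) ∧
    ∀ i x, ‖pd i v x‖ ≤ M := by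
  obtain ⟨M, hM0, hM⟩ := hv.bounded.exists_bound
  choose N hN0 hN using fun i => (hv.bounded_pd i).exists_bound
  refine ⟨M + ∑ i, N i, add_nonneg hM0 (Finset.sum_nonneg fun i _ => hN0 i), fun x => ?_,
    fun i x => ?_⟩
  · exact (hM x).trans (le_add_of_nonneg_right (Finset.sum_nonneg fun i _ => hN0 i))
  · exact (hN i x).trans (le_add_of_nonneg_of_le hM0
      (Finset.single_le_sum (fun i _ => hN0 i) (Finset.mem_univ i)))

theorem continuous_rpow (hv : IsNice v) {r : ℝ} (hr : 0 ≤ r) : Continuous fun x => ‖v x‖ ^ r :=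
  hv.continuous.norm.rpow_const fun _ => Or.inr hr

theorem integrable_rpow (hv : IsNice v) {r : ℝ} (hr : 2 ≤ r) : Integrable fun x => ‖v x‖ ^ r := by
  obtain ⟨M, hM0, hM, -⟩ := hv.exists_bound
  refine (hv.sq_integrable.const_mul (M ^ (r - 2))).mono'
    (hv.continuous_rpow (by linarith)).aestronglyMeasurable (ae_of_all _ fun x => ?_)
  rw [Real.norm_of_nonneg (by positivity)]
  exact norm_rpow_le hr (hM x)

theorem continuous_powField (hv : IsNice v) (hp : 4 ≤ p) (k : Fin 3) :
    Continuous (powField p v k) :=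
  (hv.continuous_rpow (by linarith)).mul (hv.bounded.apply k).continuous

theorem differentiable_powField (hv : IsNice v) (hp : 4 ≤ p) (k : Fin 3) :
    Differentiable ℝ (powField p v k) := fun x =>
  (hasFDerivAt_norm_rpow_comp (r := p - 2) (by linarith) (hv.differentiable x)).differentiableAt.mul
    ((EuclideanSpace.proj k : E3 →L[ℝ] ℝ).differentiableAt.comp x (hv.differentiable x))

theorem continuous_pd_powField (hv : IsNice v) (hp : 4 ≤ p) (i k : Fin 3) :
    Continuous (pd i (powField p v k)) := by
  rw [funext fun x => pd_powField hp (hv.differentiable x) i k]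
  have c1 := (hv.bounded_pd i).continuous
  exact ((hv.continuous_rpow (by linarith)).mul ((hv.bounded_pd i).apply k).continuous).add
    (((continuous_const.mul (hv.continuous_rpow (by linarith))).mul
      (hv.continuous.inner c1)).mul (hv.bounded.apply k).continuous)

theorem integrable_powField (hv : IsNice v) (hp : 4 ≤ p) (k : Fin 3) :
    Integrable (powField p v k) :=
  (hv.integrable_rpow (by linarith)).mono' (hv.continuous_powField hp k).aestronglyMeasurable
    (ae_of_all _ fun x => abs_powField_le hp k x)

theorem exists_pd_powField_bound (hv : IsNice v) (hp : 4 ≤ p) : ∃ N, 0 ≤ N ∧ ∀ i k x,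
    |pd i (powField p v k) x| ≤ N * ‖v x‖ ^ (p - 2) := by
  obtain ⟨M, hM0, hM, hM1⟩ := hv.exists_bound
  have hp1 : 0 ≤ p - 1 := by linarith
  refine ⟨(p - 1) * M, by positivity, fun i k x => ?_⟩
  refine (abs_pd_powField_le hp (hv.differentiable x) i k).trans ?_
  rw [mul_assoc, mul_comm M]
  gcongr
  exact hM1 i x

theorem integrable_pd_powField (hv : IsNice v) (hp : 4 ≤ p) (i k : Fin 3) :
    Integrable (pd i (powField p v k)) := by
  obtain ⟨N, hN0, hN⟩ := hv.exists_pd_powField_bound hp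
  exact ((hv.integrable_rpow (r := p - 2) (by linarith)).const_mul N).mono'
    (hv.continuous_pd_powField hp i k).aestronglyMeasurable (ae_of_all _ fun x => hN i k x)

theorem isBC_pd_powField (hv : IsNice v) (hp : 4 ≤ p) (i k : Fin 3) :
    IsBC (pd i (powField p v k)) := by
  obtain ⟨N, hN0, hN⟩ := hv.exists_pd_powField_bound hp
  obtain ⟨M, hM0, hM, hM1⟩ := hv.exists_bound
  refine ⟨hv.continuous_pd_powField hp i k, N * M ^ (p - 2), fun x => (hN i k x).trans ?_⟩
  gcongr
  · linarith
  · exact hM x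

/-- Integration by parts against a bounded function with bounded derivatives. -/
theorem integral_powField_mul_pd (hv : IsNice v) (hp : 4 ≤ p) {w : E3 → ℝ} (hw : IsBC w)
    (hwd : Differentiable ℝ w) {i : Fin 3} (hw' : IsBC (pd i w)) (k : Fin 3) :
    ∫ x, powField p v k x * pd i w x = - ∫ x, pd i (powField p v k) x * w x :=
  integral_mul_fderiv_eq_neg_fderiv_mul_of_integrable
    (hw.integrable_mul (hv.integrable_pd_powField hp i k))
    (hw'.integrable_mul (hv.integrable_powField hp k))
    (hw.integrable_mul (hv.integrable_powField hp k))
    (fun x _ => hv.differentiable_powField hp k x) fun x _ => hwd x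

end IsNice

end PowerNonlinearity

/-! ### Estimates for the nonlinear terms at a fixed time -/

section NonlinearTerms

variable {a b : ℝ} {U : ℝ → E3 → E3} {v : E3 → E3} {p : ℝ}

/-- The divergence of the field `|v|^(p-2) v`. -/
noncomputable def powDiv (p : ℝ) (v : E3 → E3) (x : E3) : ℝ := ∑ k : Fin 3, pd k (powField p v k) x

/-- A pointwise bound for all first derivatives of `|v|^(p-2) v`. -/
noncomputable def powGrad (p : ℝ) (v : E3 → E3) (x : E3) : ℝ :=
  (p - 1) * ∑ i : Fin 3, ‖v x‖ ^ (p - 2) * ‖pd i v x‖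

theorem abs_pd_powField_le_powGrad (hv : IsNice v) (hp : 4 ≤ p) (i k : Fin 3) (x : E3) :
    |pd i (powField p v k) x| ≤ powGrad p v x := by
  refine (abs_pd_powField_le hp (hv.differentiable x) i k).trans ?_
  exact mul_le_mul_of_nonneg_left (Finset.single_le_sum
    (f := fun i => ‖v x‖ ^ (p - 2) * ‖pd i v x‖) (fun i _ => by positivity) (Finset.mem_univ i))
    (by linarith)

theorem abs_powDiv_le_powGrad (hv : IsNice v) (hp : 4 ≤ p) (x : E3) :
    |powDiv p v x| ≤ powGrad p v x := by
  refine (Finset.abs_sum_le_sum_abs _ _).trans ?_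
  rw [powGrad, Finset.mul_sum]
  exact Finset.sum_le_sum fun i _ => abs_pd_powField_le hp (hv.differentiable x) i i

theorem isBC_powDiv (hv : IsNice v) (hp : 4 ≤ p) : IsBC (powDiv p v) :=
  IsBC.sum _ fun k _ => hv.isBC_pd_powField hp k k

theorem integrable_powDiv (hv : IsNice v) (hp : 4 ≤ p) : Integrable (powDiv p v) :=
  integrable_finsetSum _ fun k _ => hv.integrable_pd_powField hp k k

/-- One derivative is moved to `|v|^(p-2) v`, which produces its divergence, and the semigroup
property splits the remaining second order term into two first order terms. -/
theorem integral_powField_mul_cv_pd_pd_pd (hv : IsNice v) (hp : 4 ≤ p) {f : E3 → ℝ} (hf : IsBC f)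
    {r : ℝ} (hr : 0 < r) (i j : Fin 3) :
    ∑ k : Fin 3, ∫ x, powField p v k x * cv (pd i (pd j (pd k (heatKernel (r + r))))) f x =
      ∫ x, cv (pd i (heatKernel r)) (powDiv p v) x * cv (pd j (heatKernel r)) f x := by
  have hK := isKernel_heatKernel hr
  have hK2 := isKernel_heatKernel (add_pos hr hr)
  have hg := integrable_powDiv hv hp
  have hgb := isBC_powDiv hv hp
  set W := cv (pd i (pd j (heatKernel (r + r)))) f with hW
  have hWb : IsBC W := hf.cv ((hK2.pd j).pd i).integrable
  have hWd : Differentiable ℝ W := differentiable_cv ((hK2.pd j).pd i) hf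
  have hWp : ∀ k, pd k W = cv (pd i (pd j (pd k (heatKernel (r + r))))) f := fun k => by
    rw [hW, pd_cv ((hK2.pd j).pd i) hf]
    congr 1
    funext x
    rw [pd_comm (hK2.pd j).smooth k i, show pd k (pd j (heatKernel (r + r))) =
      pd j (pd k (heatKernel (r + r))) from funext fun y => pd_comm hK2.smooth k j y]
  have h1 : ∀ k, ∫ x, powField p v k x * cv (pd i (pd j (pd k (heatKernel (r + r))))) f x =
      - ∫ x, pd k (powField p v k) x * W x := fun k => by
    rw [← hWp]
    refine hv.integral_powField_mul_pd hp hWb hWd ?_ k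
    rw [hWp]
    exact hf.cv (((hK2.pd k).pd j).pd i).integrable
  simp only [h1, Finset.sum_neg_distrib]
  rw [← integral_finsetSum _ fun k _ => hWb.integrable_mul (hv.integrable_pd_powField hp k k)]
  simp only [← Finset.sum_mul]
  set w := cv (pd j (heatKernel r)) f with hw
  have hwb : IsBC w := hf.cv (hK.pd j).integrable
  have hwp : pd i w = cv (pd i (pd j (heatKernel r))) f := pd_cv (hK.pd j) hf i
  have hwpb : IsBC (pd i w) := by
    rw [hwp]; exact hf.cv ((hK.pd j).pd i).integrable
  have h2 : W = cv (heatKernel r) (pd i w) := by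
    rw [hW, hwp, cv_pd_pd_heatKernel_add hr hr hf]
  have h3 : ∫ x, powDiv p v x * W x = ∫ x, cv (heatKernel r) (powDiv p v) x * pd i w x := by
    rw [h2]
    have := integral_cv_mul hr hwpb hg
    simp only [mul_comm] at this ⊢
    exact this
  change -∫ x, powDiv p v x * W x = _
  rw [h3]
  have h4 : ∫ x, cv (heatKernel r) (powDiv p v) x * pd i w x =
      - ∫ x, pd i (cv (heatKernel r) (powDiv p v)) x * w x := by
    have hgi := integrable_cv hK.integrable hg
    have hpg : pd i (cv (heatKernel r) (powDiv p v)) = cv (pd i (heatKernel r)) (powDiv p v) :=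
      pd_cv hK hgb i
    have hgi' : Integrable (pd i (cv (heatKernel r) (powDiv p v))) := by
      rw [hpg]; exact integrable_cv (hK.pd i).integrable hg
    exact integral_mul_fderiv_eq_neg_fderiv_mul_of_integrable (hwb.integrable_mul hgi')
      (hwpb.integrable_mul hgi) (hwb.integrable_mul hgi) (fun x _ => differentiable_cv hK hgb x)
      (fun x _ => differentiable_cv (hK.pd j) hf x)
  rw [h4, neg_neg, pd_cv hK hgb]

theorem lintegral_Ioi_comp_half (φ : ℝ → ℝ≥0∞) :
    ∫⁻ s in Ioi 0, φ (s / 2) = 2 * ∫⁻ r in Ioi 0, φ r := by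
  have himg : (fun r : ℝ => 2 * r) '' Ioi 0 = Ioi 0 := by
    ext s
    simp only [mem_image, mem_Ioi]
    exact ⟨fun ⟨r, hr, h⟩ => by linarith, fun h => ⟨s / 2, by linarith, by ring⟩⟩
  have h := lintegral_image_eq_lintegral_abs_deriv_mul (s := Ioi (0 : ℝ)) (f := fun r => 2 * r)
    (f' := fun _ => 2) measurableSet_Ioi
    (fun r _ => by simpa using ((hasDerivAt_id r).const_mul 2).hasDerivWithinAt)
    (fun x _ y _ h => by simpa using h) fun s => φ (s / 2)
  rw [himg] at h
  rw [h]
  simp only [mul_div_cancel_left₀ _ (two_ne_zero' ℝ)]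
  rw [lintegral_const_mul' _ _ ENNReal.ofReal_ne_top]
  norm_num

namespace IsFlow

/-- The pressure term of the energy balance in the form to which the bilinear estimate applies. -/
theorem integral_powField_mul_pressureGrad (hU : IsFlow a b U) (hv : IsNice v) (hp : 4 ≤ p)
    {ε : ℝ} (hε : 0 < ε) (τ : ℝ) :
    ∑ k : Fin 3, ∫ x, powField p v k x * pressureGrad U ε k τ x =
      ∫ s in Ioi ε, ∑ i : Fin 3, ∑ j : Fin 3, ∫ x, cv (pd i (heatKernel (s / 2))) (powDiv p v) x *
        cv (pd j (heatKernel (s / 2))) (fun y => U τ y i * U τ y j) x := by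
  obtain ⟨C, hC0, hC⟩ := hU.exists_tripleTerm_bound
  have hint : ∀ k, Integrable (fun z : E3 × ℝ => powField p v k z.1 * tripleTerm U k z.2 τ z.1)
      (volume.prod (volume.restrict (Ioi ε))) := fun k => by
    refine (((hv.integrable_powField hp k).norm).mul_prod
      ((integrableOn_inv_sqrt_pow_three hε).const_mul C)).mono' ?_ ?_
    · have hc : ContinuousOn (fun z : E3 × ℝ => powField p v k z.1 * tripleTerm U k z.2 τ z.1)
          (univ ×ˢ Ioi ε) := by
        refine ((hv.continuous_powField hp k).comp continuous_fst).continuousOn.mul ?_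
        exact (hU.continuousOn_tripleTerm k).comp (f := fun z : E3 × ℝ => (z.2, τ, z.1))
          (by fun_prop) fun z hz => ⟨lt_trans hε hz.2, mem_univ _⟩
      have := hc.aestronglyMeasurable (μ := volume.prod volume)
        (MeasurableSet.univ.prod measurableSet_Ioi)
      rwa [← Measure.prod_restrict, Measure.restrict_univ] at this
    · have : ∀ᵐ z ∂(volume.prod (volume.restrict (Ioi ε)) : Measure (E3 × ℝ)), z.2 ∈ Ioi ε :=
        Measure.quasiMeasurePreserving_snd.ae (ae_restrict_mem measurableSet_Ioi)
      refine this.mono fun z hz => ?_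
      rw [norm_mul]
      exact mul_le_mul_of_nonneg_left (hC k z.2 τ z.1 (lt_trans hε hz)) (norm_nonneg _)
  have h1 : ∀ k, ∫ x, powField p v k x * pressureGrad U ε k τ x =
      ∫ s in Ioi ε, ∫ x, powField p v k x * tripleTerm U k s τ x := fun k => by
    rw [← integral_integral_swap (hint k)]
    refine integral_congr_ae (ae_of_all _ fun x => ?_)
    simp only [pressureGrad]
    rw [← integral_const_mul]
  simp only [h1]
  rw [← integral_finsetSum _ fun k _ => (hint k).integral_prod_right]
  refine setIntegral_congr_fun measurableSet_Ioi fun s hs => ?_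
  have hs0 : 0 < s / 2 := half_pos (lt_trans hε hs)
  have hs' : 0 < s := lt_trans hε hs
  have hti : ∀ k i j, Integrable fun x => powField p v k x *
      cv (pd i (pd j (pd k (heatKernel s)))) (fun y => U τ y i * U τ y j) x := fun k i j =>
    ((hU.isBC_coord_mul τ i j).cv
      ((((isKernel_heatKernel hs').pd k).pd j).pd i).integrable).integrable_mul
      (hv.integrable_powField hp k)
  have h2 : ∀ k, ∫ x, powField p v k x * tripleTerm U k s τ x = ∑ i : Fin 3, ∑ j : Fin 3,
      ∫ x, powField p v k x *
        cv (pd i (pd j (pd k (heatKernel s)))) (fun y => U τ y i * U τ y j) x := fun k => by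
    simp only [tripleTerm, Finset.mul_sum]
    rw [integral_finsetSum _ fun i _ => integrable_finsetSum _ fun j _ => hti k i j]
    exact Finset.sum_congr rfl fun i _ => integral_finsetSum _ fun j _ => hti k i j
  simp only [h2]
  rw [Finset.sum_comm]
  refine Finset.sum_congr rfl fun i _ => ?_
  rw [Finset.sum_comm]
  refine Finset.sum_congr rfl fun j _ => ?_
  have := integral_powField_mul_cv_pd_pd_pd hv hp (hU.isBC_coord_mul τ i j) hs0 i j
  rwa [add_halves] at this

theorem integrable_coord_mul_coord (hU : IsFlow a b U) (τ : ℝ) (i j : Fin 3) :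
    Integrable fun x => U τ x i * U τ x j := by
  obtain ⟨A, hA⟩ := hU.sq_integrable
  refine (hA τ).1.mono' (hU.isBC_coord_mul τ i j).continuous.aestronglyMeasurable
    (ae_of_all _ fun x => ?_)
  rw [norm_mul, sq]
  exact mul_le_mul (PiLp.norm_apply_le (U τ x) i) (PiLp.norm_apply_le (U τ x) j) (norm_nonneg _)
    (norm_nonneg _)

end IsFlow

/-- The bilinear estimate for `c f` and `c⁻¹ g`. The parameter `c` stays free at this stage: it is
optimised only after the integration in time, so that Hölder's inequality results in space-time. -/
theorem lintegral_bilinear_heat_le_scaled {q : ℝ} (hq : 2 < q) (hq5 : q ≤ 5) {f g : E3 → ℝ}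
    (hf : IsBC f) (hfi : Integrable f) (hg : IsBC g) (hgi : Integrable g) (k l : Fin 3)
    {c : ℝ} (hc : 0 < c) :
    ∫⁻ s in Ioi 0, ∫⁻ x, ‖cv (pd k (heatKernel s)) g x‖ₑ * ‖cv (pd l (heatKernel s)) f x‖ₑ ≤
      32 * (ENNReal.ofReal (c ^ q) * (∫⁻ x, ‖f x‖ₑ ^ q) +
        ENNReal.ofReal (c⁻¹ ^ (q / (q - 1))) * ∫⁻ x, ‖g x‖ₑ ^ (q / (q - 1))) := by
  have hq' : 0 ≤ q / (q - 1) := div_nonneg (by linarith) (by linarith)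
  have hcv : ∀ (c : ℝ) (K h : E3 → ℝ) x, cv K (fun y => c * h y) x = c * cv K h x :=
    fun c K h x => by
    unfold cv
    rw [← integral_const_mul]
    exact integral_congr_ae (ae_of_all _ fun y => by simp only [smul_eq_mul]; ring)
  have hbc : ∀ (c : ℝ) {h : E3 → ℝ}, IsBC h → IsBC fun y => c * h y := fun c h hh =>
    IsBC.mul ⟨continuous_const, |c|, fun _ => le_rfl⟩ hh
  have h := lintegral_bilinear_heat_le hq hq5 (hbc c hf) (hfi.const_mul c) (hbc c⁻¹ hg)
    (hgi.const_mul c⁻¹) l k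
  have hpow : ∀ {c : ℝ} (h : E3 → ℝ) {r : ℝ}, 0 < c → 0 ≤ r → ∫⁻ x, ‖c * h x‖ₑ ^ r =
      ENNReal.ofReal (c ^ r) * ∫⁻ x, ‖h x‖ₑ ^ r := fun {c} h r hc hr => by
    rw [← lintegral_const_mul' _ _ ENNReal.ofReal_ne_top]
    refine lintegral_congr fun x => ?_
    rw [enorm_mul, ENNReal.mul_rpow_of_nonneg _ _ hr, Real.enorm_eq_ofReal hc.le,
      ENNReal.ofReal_rpow_of_nonneg hc.le hr]
  rw [hpow f hc (by linarith), hpow g (inv_pos.2 hc) hq'] at h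
  refine le_trans (le_of_eq ?_) h
  refine lintegral_congr fun s => lintegral_congr fun x => ?_
  rw [hcv, hcv, enorm_mul, enorm_mul, Real.enorm_eq_ofReal hc.le,
    Real.enorm_eq_ofReal (inv_pos.2 hc).le]
  have : ENNReal.ofReal c * ENNReal.ofReal c⁻¹ = 1 := by
    rw [← ENNReal.ofReal_mul hc.le, mul_inv_cancel₀ hc.ne', ENNReal.ofReal_one]
  calc ‖cv (pd k (heatKernel s)) g x‖ₑ * ‖cv (pd l (heatKernel s)) f x‖ₑ =
      (ENNReal.ofReal c * ENNReal.ofReal c⁻¹) * (‖cv (pd k (heatKernel s)) g x‖ₑ *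
        ‖cv (pd l (heatKernel s)) f x‖ₑ) := by rw [this, one_mul]
    _ = _ := by ring

/-- Young's inequality for `c f` and `c⁻¹ g`, the counterpart of `lintegral_bilinear_heat_le_scaled` for
the term without pressure. -/
theorem lintegral_enorm_mul_le_scaled {q : ℝ} (hq : 2 < q) {f g : E3 → ℝ}
    (hf : AEStronglyMeasurable f) {c : ℝ} (hc : 0 < c) :
    ∫⁻ x, ‖g x‖ₑ * ‖f x‖ₑ ≤
      ENNReal.ofReal (c ^ q) * (∫⁻ x, ‖f x‖ₑ ^ q) +
        ENNReal.ofReal (c⁻¹ ^ (q / (q - 1))) * ∫⁻ x, ‖g x‖ₑ ^ (q / (q - 1)) := by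
  have hq' : 1 ≤ q / (q - 1) := by rw [le_div_iff₀ (by linarith)]; linarith
  have hconj : q.HolderConjugate (q / (q - 1)) := Real.HolderConjugate.conjExponent (by linarith)
  rw [← lintegral_const_mul' _ _ ENNReal.ofReal_ne_top,
    ← lintegral_const_mul' _ _ ENNReal.ofReal_ne_top,
    ← lintegral_add_left' ((hf.enorm.pow_const q).const_mul _)]
  refine lintegral_mono fun x => ?_
  have hone : ENNReal.ofReal c * ENNReal.ofReal c⁻¹ = 1 := by
    rw [← ENNReal.ofReal_mul hc.le, mul_inv_cancel₀ hc.ne', ENNReal.ofReal_one]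
  have hdiv : ∀ {y : ℝ≥0∞} {r : ℝ}, 1 ≤ r → y / ENNReal.ofReal r ≤ y := fun {y r} hr =>
    ENNReal.div_le_of_le_mul (le_mul_of_one_le_right' (by simpa using ENNReal.ofReal_le_ofReal hr))
  calc ‖g x‖ₑ * ‖f x‖ₑ = (ENNReal.ofReal c * ‖f x‖ₑ) * (ENNReal.ofReal c⁻¹ * ‖g x‖ₑ) := by
        calc ‖g x‖ₑ * ‖f x‖ₑ = (ENNReal.ofReal c * ENNReal.ofReal c⁻¹) * (‖g x‖ₑ * ‖f x‖ₑ) := by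
              rw [hone, one_mul]
          _ = _ := by ring
    _ ≤ _ := ENNReal.young_inequality _ _ hconj
    _ ≤ _ := by
      refine add_le_add ((hdiv (by linarith)).trans_eq ?_) ((hdiv hq').trans_eq ?_)
      · rw [ENNReal.mul_rpow_of_nonneg _ _ (by linarith), ENNReal.ofReal_rpow_of_nonneg hc.le
          (by linarith)]
      · rw [ENNReal.mul_rpow_of_nonneg _ _ (by linarith), ENNReal.ofReal_rpow_of_nonneg
          (inv_pos.2 hc).le (by linarith)]

/-- The contribution of the nonlinearity to the energy balance at a fixed time. There are nine
terms without pressure, and nine pressure terms that carry the constant `32` and a factor `2` from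
the substitution `s = 2r`; `600` is an upper bound for `9 + 9 * 64`. -/
theorem IsFlow.enorm_nonlinear_le (hU : IsFlow a b U) (hv : IsNice v) (hp : 4 ≤ p)
    {ε : ℝ} (hε : 0 < ε) (τ : ℝ) {q : ℝ} (hq : 2 < q) (hq5 : q ≤ 5) {c : ℝ} (hc : 0 < c) :
    ‖(∑ i : Fin 3, ∑ k : Fin 3, ∫ x, pd i (powField p v k) x *
        cv (heatKernel ε) (fun y => U τ y i * U τ y k) x) -
      ∑ k : Fin 3, ∫ x, powField p v k x * pressureGrad U ε k τ x‖ₑ ≤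
    600 * (ENNReal.ofReal (c ^ q) * (∫⁻ x, ‖U τ x‖ₑ ^ (2 * q)) +
        ENNReal.ofReal (c⁻¹ ^ (q / (q - 1))) * ∫⁻ x, ENNReal.ofReal (powGrad p v x) ^ (q / (q - 1))) := by
  have hq' : 1 ≤ q / (q - 1) := by rw [le_div_iff₀ (by linarith)]; linarith
  set R := ENNReal.ofReal (c ^ q) * (∫⁻ x, ‖U τ x‖ₑ ^ (2 * q)) +
    ENNReal.ofReal (c⁻¹ ^ (q / (q - 1))) * ∫⁻ x, ENNReal.ofReal (powGrad p v x) ^ (q / (q - 1))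
    with hR
  have hf : ∀ i j, ∫⁻ x, ‖U τ x i * U τ x j‖ₑ ^ q ≤ ∫⁻ x, ‖U τ x‖ₑ ^ (2 * q) := fun i j => by
    refine lintegral_mono fun x => ?_
    rw [ENNReal.rpow_mul]
    refine ENNReal.rpow_le_rpow ?_ (by linarith)
    rw [enorm_mul, ENNReal.rpow_two, sq]
    exact mul_le_mul' (enorm_le_iff_norm_le.2 (PiLp.norm_apply_le (U τ x) i))
      (enorm_le_iff_norm_le.2 (PiLp.norm_apply_le (U τ x) j))
  have hle : ∀ {y z : ℝ}, |y| ≤ z → ‖y‖ₑ ≤ ENNReal.ofReal z := fun {y z} h => by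
    rw [← ofReal_norm]; exact ENNReal.ofReal_le_ofReal h
  have hA : ∀ i k, ‖∫ x, pd i (powField p v k) x *
      cv (heatKernel ε) (fun y => U τ y i * U τ y k) x‖ₑ ≤ R := fun i k => by
    refine (enorm_integral_le_lintegral_enorm _).trans ?_
    simp only [enorm_mul]
    refine (lintegral_enorm_mul_le_scaled hq ((hU.isBC_coord_mul τ i k).cv
      (isKernel_heatKernel hε).integrable).continuous.aestronglyMeasurable hc).trans ?_
    rw [hR]
    refine add_le_add (mul_le_mul' le_rfl ((lintegral_cv_rpow_le hε
        (hU.isBC_coord_mul τ i k).continuous.aestronglyMeasurable (by linarith)).trans (hf i k)))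
      (mul_le_mul' le_rfl (lintegral_mono fun x => ENNReal.rpow_le_rpow
        (hle (abs_pd_powField_le_powGrad hv hp i k x)) (by linarith)))
  have hB : ‖∑ k : Fin 3, ∫ x, powField p v k x * pressureGrad U ε k τ x‖ₑ ≤
      ∑ i : Fin 3, ∑ j : Fin 3, 64 * R := by
    rw [hU.integral_powField_mul_pressureGrad hv hp hε]
    refine (enorm_integral_le_lintegral_enorm _).trans ?_
    set φ : Fin 3 → Fin 3 → ℝ → ℝ≥0∞ := fun i j r => ∫⁻ x,
      ‖cv (pd i (heatKernel r)) (powDiv p v) x‖ₑ *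
        ‖cv (pd j (heatKernel r)) (fun y => U τ y i * U τ y j) x‖ₑ with hφ
    have hk1 := isKernel_heatKernel one_pos
    have hφm : ∀ i j, AEMeasurable (fun s => φ i j (s / 2)) (volume.restrict (Ioi 0)) := fun i j => by
      have hc : ∀ (l : Fin 3) {h : E3 → ℝ}, IsBC h → ContinuousOn
          (fun z : ℝ × E3 => cv (pd l (heatKernel (z.1 / 2))) h z.2) (Ioi 0 ×ˢ univ) := fun l h hh =>
        (continuousOn_cv_heat hh 1 (hk1.pd l) fun s hs => pd_heatKernel_eq_dil hs l).comp
          (f := fun z : ℝ × E3 => (z.1 / 2, z.2)) (by fun_prop)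
          fun z hz => ⟨show 0 < z.1 / 2 from half_pos hz.1, mem_univ _⟩
      have hm : ∀ (l : Fin 3) {h : E3 → ℝ}, IsBC h → AEMeasurable
          (fun z : ℝ × E3 => ‖cv (pd l (heatKernel (z.1 / 2))) h z.2‖ₑ)
          ((volume.restrict (Ioi 0)).prod volume) := fun l h hh => by
        have := ((hc l hh).aemeasurable (μ := volume.prod volume)
          (measurableSet_Ioi.prod MeasurableSet.univ)).enorm
        rwa [← Measure.prod_restrict, Measure.restrict_univ] at this
      exact ((hm i (isBC_powDiv hv hp)).mul (hm j (hU.isBC_coord_mul τ i j))).lintegral_prod_right'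
    calc _ ≤ ∫⁻ s in Ioi ε, ∑ i, ∑ j, φ i j (s / 2) := by
          refine lintegral_mono fun s => (enorm_sum_le _ _).trans (Finset.sum_le_sum fun i _ =>
            (enorm_sum_le _ _).trans (Finset.sum_le_sum fun j _ => ?_))
          refine (enorm_integral_le_lintegral_enorm _).trans_eq ?_
          simp only [enorm_mul, hφ]
      _ ≤ ∫⁻ s in Ioi 0, ∑ i, ∑ j, φ i j (s / 2) :=
          lintegral_mono_set (Ioi_subset_Ioi hε.le)
      _ = ∑ i, ∑ j, ∫⁻ s in Ioi 0, φ i j (s / 2) := by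
          rw [lintegral_finsetSum' _ fun i _ => Finset.aemeasurable_fun_sum _ fun j _ => hφm i j]
          exact Finset.sum_congr rfl fun i _ => lintegral_finsetSum' _ fun j _ => hφm i j
      _ ≤ _ := by
          refine Finset.sum_le_sum fun i _ => Finset.sum_le_sum fun j _ => ?_
          rw [lintegral_Ioi_comp_half]
          have h := lintegral_bilinear_heat_le_scaled hq hq5 (hU.isBC_coord_mul τ i j)
            (hU.integrable_coord_mul_coord τ i j) (isBC_powDiv hv hp) (integrable_powDiv hv hp)
            i j hc
          calc _ ≤ 2 * (32 * R) := by
                refine mul_le_mul' le_rfl (h.trans (mul_le_mul' le_rfl ?_))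
                refine add_le_add (mul_le_mul' le_rfl (hf i j)) (mul_le_mul' le_rfl
                  (lintegral_mono fun x => ENNReal.rpow_le_rpow
                    (hle (abs_powDiv_le_powGrad hv hp x)) (by linarith)))
            _ = 64 * R := by rw [← mul_assoc]; norm_num
  refine enorm_sub_le.trans ((add_le_add ((enorm_sum_le _ _).trans (Finset.sum_le_sum fun i _ =>
    (enorm_sum_le _ _).trans (Finset.sum_le_sum fun k _ => hA i k))) hB).trans ?_)
  simp only [Finset.sum_const, Finset.card_univ, Fintype.card_fin, nsmul_eq_mul]
  calc _ = (585 : ℝ≥0∞) * R := by push_cast; ring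
    _ ≤ _ := by gcongr; norm_num

end NonlinearTerms

/-! ### The energy balance of the mollified velocity -/

section EnergyBalance

variable {a b : ℝ} {U : ℝ → E3 → E3} {p ε : ℝ}

/-- The density of the dissipation of the `L^p` energy, divided by `p`. -/
noncomputable def dissDensity (p : ℝ) (v : E3 → E3) (x : E3) : ℝ :=
  ∑ i : Fin 3, (‖v x‖ ^ (p - 2) * ‖pd i v x‖ ^ 2 +
    (p - 2) * ‖v x‖ ^ (p - 4) * inner ℝ (v x) (pd i v x) ^ 2)

theorem dissDensity_nonneg (hp : 4 ≤ p) (v : E3 → E3) (x : E3) : 0 ≤ dissDensity p v x := by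
  have : 0 ≤ p - 2 := by linarith
  exact Finset.sum_nonneg fun i _ => by positivity

/-- The time derivative of the `k`-th component of the mollified velocity. -/
noncomputable def mollRhs (U : ℝ → E3 → E3) (ε : ℝ) (k : Fin 3) (τ : ℝ) (x : E3) : ℝ :=
  cv (lap (heatKernel ε)) (fun y => U τ y k) x -
    (∑ i : Fin 3, cv (pd i (heatKernel ε)) (fun y => U τ y i * U τ y k) x) - pressureGrad U ε k τ x

/-- The contribution of the nonlinearity to the balance of the `L^p` energy of the mollified
velocity, divided by `p`. -/
noncomputable def nonlinearTerm (p : ℝ) (U : ℝ → E3 → E3) (ε τ : ℝ) : ℝ :=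
  (∑ i : Fin 3, ∑ k : Fin 3, ∫ x, pd i (powField p (cv (heatKernel ε) (U τ)) k) x *
    cv (heatKernel ε) (fun y => U τ y i * U τ y k) x) -
  ∑ k : Fin 3, ∫ x, powField p (cv (heatKernel ε) (U τ)) k x * pressureGrad U ε k τ x

namespace IsFlow

theorem lintegral_enorm_sq_le (hU : IsFlow a b U) : ∃ A : ℝ, ∀ t, ∫⁻ x, ‖U t x‖ₑ ^ (2 : ℝ) ≤
    ENNReal.ofReal A := by
  obtain ⟨A, hA⟩ := hU.sq_integrable
  refine ⟨A, fun t => ?_⟩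
  have := ENNReal.ofReal_le_ofReal (hA t).2
  rw [ofReal_integral_eq_lintegral_ofReal (hA t).1 (ae_of_all _ fun x => by positivity)] at this
  refine le_trans (le_of_eq (lintegral_congr fun x => ?_)) this
  rw [ENNReal.ofReal_pow (norm_nonneg _), ofReal_norm, ENNReal.rpow_two]

theorem continuous_moll_dil (hU : IsFlow a b U) (hε : 0 < ε) (m : ℕ) {K : E3 → ℝ}
    (hK : IsKernel K) : Continuous fun z : ℝ × E3 => cv (dil m ε K) (U z.1) z.2 := by
  obtain ⟨M, hM⟩ := hU.bounded
  have h := (continuousOn_cv_dil hU.continuous hM m hK.continuous hK.integrable).comp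
    (f := fun z : ℝ × E3 => (ε, z)) (s := univ) (by fun_prop) fun z _ => ⟨hε, mem_univ _⟩
  exact continuousOn_univ.1 h

theorem continuous_cv_dil {W : ℝ → E3 → ℝ} (hW : Continuous fun z : ℝ × E3 => W z.1 z.2) {M : ℝ}
    (hM : ∀ t x, |W t x| ≤ M) (hε : 0 < ε) (m : ℕ) {K : E3 → ℝ}
    (hK : IsKernel K) : Continuous fun z : ℝ × E3 => cv (dil m ε K) (W z.1) z.2 := by
  have h := (continuousOn_cv_dil hW hM m hK.continuous hK.integrable).comp
    (f := fun z : ℝ × E3 => (ε, z)) (s := univ) (by fun_prop) fun z _ => ⟨hε, mem_univ _⟩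
  exact continuousOn_univ.1 h

theorem continuous_moll (hU : IsFlow a b U) (hε : 0 < ε) :
    Continuous fun z : ℝ × E3 => cv (heatKernel ε) (U z.1) z.2 := by
  rw [heatKernel_eq_dil hε]
  exact hU.continuous_moll_dil hε 0 (isKernel_heatKernel one_pos)

theorem pd_moll (hU : IsFlow a b U) (hε : 0 < ε) (i : Fin 3) (τ : ℝ) :
    pd i (cv (heatKernel ε) (U τ)) = cv (pd i (heatKernel ε)) (U τ) :=
  pd_cv (isKernel_heatKernel hε) (hU.isBC τ) i

theorem continuous_pd_moll (hU : IsFlow a b U) (hε : 0 < ε) (i : Fin 3) :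
    Continuous fun z : ℝ × E3 => pd i (cv (heatKernel ε) (U z.1)) z.2 := by
  simp only [hU.pd_moll hε, pd_heatKernel_eq_dil hε]
  exact hU.continuous_moll_dil hε 1 ((isKernel_heatKernel one_pos).pd i)

theorem moll_apply (hU : IsFlow a b U) (hε : 0 < ε) (τ : ℝ) (x : E3) (k : Fin 3) :
    cv (heatKernel ε) (U τ) x k = cv (heatKernel ε) (fun y => U τ y k) x :=
  cv_apply (F := E3) k (integrable_cv_integrand (isKernel_heatKernel hε).integrable (hU.isBC τ) x)

theorem lintegral_moll_le (hU : IsFlow a b U) (hε : 0 < ε) (τ : ℝ) {r : ℝ} (hr : 1 ≤ r) :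
    ∫⁻ x, ‖cv (heatKernel ε) (U τ) x‖ₑ ^ r ≤ ∫⁻ x, ‖U τ x‖ₑ ^ r :=
  lintegral_cv_rpow_le hε (hU.isBC τ).continuous.aestronglyMeasurable hr

theorem isNice_moll (hU : IsFlow a b U) (hε : 0 < ε) (τ : ℝ) :
    IsNice (cv (heatKernel ε) (U τ)) := by
  have hK := isKernel_heatKernel hε
  refine ⟨contDiff_cv hK (hU.isBC τ), (hU.isBC τ).cv hK.integrable, fun i => ?_, ?_⟩
  · rw [hU.pd_moll hε]
    exact (hU.isBC τ).cv (hK.pd i).integrable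
  · obtain ⟨A, hA⟩ := hU.lintegral_enorm_sq_le
    have hc : Continuous (cv (heatKernel ε) (U τ)) := ((hU.isBC τ).cv hK.integrable).continuous
    refine ⟨(hc.norm.pow 2).aestronglyMeasurable, ?_⟩
    refine lt_of_le_of_lt (le_of_eq (lintegral_congr fun x => ?_))
      (((hU.lintegral_moll_le hε τ one_le_two).trans (hA τ)).trans_lt ENNReal.ofReal_lt_top)
    rw [enorm_pow, enorm_norm, ENNReal.rpow_two]

theorem exists_moll_bound (hU : IsFlow a b U) (hε : 0 < ε) : ∃ M, 0 ≤ M ∧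
    (∀ τ x, ‖cv (heatKernel ε) (U τ) x‖ ≤ M) ∧
    ∀ i τ x, ‖pd i (cv (heatKernel ε) (U τ)) x‖ ≤ M := by
  obtain ⟨M, hM0, hM, -⟩ := hU.exists_bound
  have hK := isKernel_heatKernel hε
  have hn : ∀ i, 0 ≤ (∫ y, |pd i (heatKernel ε) y|) * M := fun i =>
    mul_nonneg (integral_nonneg fun y => abs_nonneg _) hM0
  have hn0 : 0 ≤ (∫ y, |heatKernel ε y|) * M :=
    mul_nonneg (integral_nonneg fun y => abs_nonneg _) hM0
  refine ⟨(∫ y, |heatKernel ε y|) * M + ∑ i, (∫ y, |pd i (heatKernel ε) y|) * M,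
    add_nonneg hn0 (Finset.sum_nonneg fun i _ => hn i), fun τ x => ?_, fun i τ x => ?_⟩
  · exact (norm_cv_le hK.integrable (hM τ) x).trans
      (le_add_of_nonneg_right (Finset.sum_nonneg fun i _ => hn i))
  · rw [hU.pd_moll hε]
    exact (norm_cv_le (hK.pd i).integrable (hM τ) x).trans (le_add_of_nonneg_of_le hn0
      (Finset.single_le_sum (fun i _ => hn i) (Finset.mem_univ i)))

theorem continuous_mollRhs (hU : IsFlow a b U) (hε : 0 < ε) (k : Fin 3) :
    Continuous fun z : ℝ × E3 => mollRhs U ε k z.1 z.2 := by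
  obtain ⟨M, hM0, hM, hM1, hM2⟩ := hU.exists_bound
  have hk1 := isKernel_heatKernel one_pos
  have h1 : Continuous fun z : ℝ × E3 => cv (lap (heatKernel ε)) (fun y => U z.1 y k) z.2 := by
    rw [lap_heatKernel_eq_dil hε]
    have := continuous_cv_dil (W := fun t y => U t y k) (hU.continuous_coord k) (hM1 k) hε 2 hk1.lap
    exact this
  have h2 : ∀ i, Continuous fun z : ℝ × E3 =>
      cv (pd i (heatKernel ε)) (fun y => U z.1 y i * U z.1 y k) z.2 := fun i => by
    rw [pd_heatKernel_eq_dil hε]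
    have := continuous_cv_dil (W := fun t y => U t y i * U t y k) (hU.continuous_coord_mul i k)
      (hM2 i k) hε 1 (hk1.pd i)
    exact this
  exact (h1.sub (continuous_finsetSum _ fun i _ => h2 i)).sub (hU.continuous_pressureGrad hε k)

theorem exists_mollRhs_bound (hU : IsFlow a b U) (hε : 0 < ε) :
    ∃ C, 0 ≤ C ∧ ∀ k τ x, |mollRhs U ε k τ x| ≤ C := by
  obtain ⟨M, hM0, hM, hM1, hM2⟩ := hU.exists_bound
  obtain ⟨C, hC0, hC⟩ := hU.exists_pressureGrad_bound hε
  have hK := isKernel_heatKernel hε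
  refine ⟨(∫ y, |lap (heatKernel ε) y|) * M + (∑ i, (∫ y, |pd i (heatKernel ε) y|) * (M * M)) + C,
    ?_, fun k τ x => ?_⟩
  · have h1 : 0 ≤ ∫ y, |lap (heatKernel ε) y| := integral_nonneg fun _ => abs_nonneg _
    have h2 : ∀ i, 0 ≤ ∫ y, |pd i (heatKernel ε) y| := fun i => integral_nonneg fun _ => abs_nonneg _
    have h3 : 0 ≤ ∑ i, (∫ y, |pd i (heatKernel ε) y|) * (M * M) :=
      Finset.sum_nonneg fun i _ => mul_nonneg (h2 i) (mul_nonneg hM0 hM0)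
    positivity
  · rw [← Real.norm_eq_abs]
    refine (norm_sub_le _ _).trans (add_le_add ((norm_sub_le _ _).trans (add_le_add ?_ ?_)) ?_)
    · exact norm_cv_le hK.lap.integrable (fun y => hM1 k τ y) x
    · exact (norm_sum_le _ _).trans (Finset.sum_le_sum fun i _ =>
        norm_cv_le (hK.pd i).integrable (fun y => hM2 i k τ y) x)
    · exact hC k τ x

/-- The evolution of `|v|^p` at a point, by the chain rule. -/
theorem norm_rpow_moll_sub (hU : IsFlow a b U) (hε : 0 < ε) (hp : 4 ≤ p) (x : E3) {t : ℝ}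
    (ht : t ∈ Icc a b) :
    ‖cv (heatKernel ε) (U t) x‖ ^ p - ‖cv (heatKernel ε) (U a) x‖ ^ p =
      ∫ τ in a..t, p * ∑ k : Fin 3, powField p (cv (heatKernel ε) (U τ)) k x *
        mollRhs U ε k τ x := by
  have hR : ∀ k, Continuous fun τ => mollRhs U ε k τ x := fun k =>
    by
    have := (hU.continuous_mollRhs hε k).along_fst (y := x)
    exact this
  -- `y` agrees with the mollified velocity on `[a, b]`, but is differentiable at all times
  set y : ℝ → E3 := fun t => ∑ k : Fin 3, (cv (heatKernel ε) (U a) x k +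
    ∫ τ in a..t, mollRhs U ε k τ x) • EuclideanSpace.single k (1 : ℝ) with hy
  have hyk : ∀ t k, y t k = cv (heatKernel ε) (U a) x k + ∫ τ in a..t, mollRhs U ε k τ x :=
    fun t k => by simp [hy, Finset.sum_apply, Pi.single_apply]
  have hyv : ∀ t ∈ Icc a b, y t = cv (heatKernel ε) (U t) x := fun t ht => by
    ext k
    rw [hyk, hU.moll_apply hε, hU.moll_apply hε]
    have := hU.sub_eq_integral hε k x ht
    simp only [mollRhs]
    rw [← this]; ring
  have hyd : ∀ t, HasDerivAt y (∑ k : Fin 3, mollRhs U ε k t x •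
      EuclideanSpace.single k (1 : ℝ)) t := fun t => by
    refine HasDerivAt.fun_sum fun k _ => ?_
    refine HasDerivAt.smul_const ?_ _
    exact (intervalIntegral.integral_hasDerivAt_right ((hR k).intervalIntegrable _ _)
      ((hR k).stronglyMeasurableAtFilter _ _) (hR k).continuousAt).const_add _
  have hNd : ∀ t, HasDerivAt (fun t => ‖y t‖ ^ p) (p * ‖y t‖ ^ (p - 2) *
      ∑ k : Fin 3, y t k * mollRhs U ε k t x) t := fun t => by
    have h := (hasFDerivAt_norm_rpow (y t) (p := p) (by linarith)).comp_hasDerivAt t (hyd t)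
    refine HasDerivAt.congr_deriv h ?_
    rw [_root_.smul_apply, innerSL_apply_apply, smul_eq_mul, inner_sum]
    congr 1
    refine Finset.sum_congr rfl fun k _ => ?_
    rw [inner_smul_right, EuclideanSpace.inner_single_right]
    simp [mul_comm]
  have hyc : Continuous y := continuous_iff_continuousAt.2 fun t => (hyd t).continuousAt
  have hint := intervalIntegral.integral_eq_sub_of_hasDerivAt (a := a) (b := t)
    (fun t _ => hNd t) ?_
  · rw [hyv t ht, hyv a (left_mem_Icc.2 (ht.1.trans ht.2))] at hint
    rw [← hint]
    refine intervalIntegral.integral_congr fun τ hτ => ?_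
    rw [uIcc_of_le ht.1] at hτ
    simp only [powField]
    rw [← hyv τ ⟨hτ.1, hτ.2.trans ht.2⟩, mul_assoc, Finset.mul_sum]
    congr 1
    exact Finset.sum_congr rfl fun k _ => by ring
  · refine Continuous.intervalIntegrable ?_ _ _
    refine (continuous_const.mul (hyc.norm.rpow_const fun _ => Or.inr (by linarith))).mul ?_
    exact continuous_finsetSum _ fun k _ =>
      ((EuclideanSpace.proj k : E3 →L[ℝ] ℝ).continuous.comp hyc).mul (hR k)

/-- Functions dominated by the square of the mollified velocity are integrable in space-time. -/
theorem integrable_of_le_moll_sq (hU : IsFlow a b U) (hε : 0 < ε) {h : ℝ × E3 → ℝ}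
    (hc : Continuous h) {C : ℝ} (hh : ∀ z, |h z| ≤ C * ‖cv (heatKernel ε) (U z.1) z.2‖ ^ 2)
    (t : ℝ) : Integrable h ((volume.restrict (Ioc a t)).prod volume) := by
  have hmc := hU.continuous_moll hε
  have h1 : Integrable (fun z : ℝ × E3 => ‖cv (heatKernel ε) (U z.1) z.2‖ ^ 2)
      ((volume.restrict (Ioc a t)).prod volume) := by
    refine ⟨(hmc.norm.pow 2).aestronglyMeasurable, ?_⟩
    obtain ⟨A, hA⟩ := hU.lintegral_enorm_sq_le
    have hm : AEMeasurable (fun z : ℝ × E3 => ‖‖cv (heatKernel ε) (U z.1) z.2‖ ^ 2‖ₑ)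
      ((volume.restrict (Ioc a t)).prod volume) := (hmc.norm.pow 2).measurable.enorm.aemeasurable
    rw [hasFiniteIntegral_iff_enorm, lintegral_prod _ hm]
    calc _ ≤ ∫⁻ τ in Ioc a t, ENNReal.ofReal A := by
          refine lintegral_mono fun τ => le_trans (le_of_eq (lintegral_congr fun x => ?_))
            ((hU.lintegral_moll_le hε τ one_le_two).trans (hA τ))
          rw [enorm_pow, enorm_norm, ENNReal.rpow_two]
      _ < ⊤ := by
          rw [lintegral_const]
          exact ENNReal.mul_lt_top ENNReal.ofReal_lt_top (by simp)
  exact (h1.const_mul C).mono' hc.aestronglyMeasurable (ae_of_all _ hh)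

theorem continuous_powField_moll (hU : IsFlow a b U) (hε : 0 < ε) (hp : 4 ≤ p) (k : Fin 3) :
    Continuous fun z : ℝ × E3 => powField p (cv (heatKernel ε) (U z.1)) k z.2 :=
  ((hU.continuous_moll hε).norm.rpow_const fun _ => Or.inr (by linarith)).mul
    ((EuclideanSpace.proj k : E3 →L[ℝ] ℝ).continuous.comp (hU.continuous_moll hε))

theorem continuous_dissDensity_moll (hU : IsFlow a b U) (hε : 0 < ε) (hp : 4 ≤ p) :
    Continuous fun z : ℝ × E3 => dissDensity p (cv (heatKernel ε) (U z.1)) z.2 := by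
  have hc := hU.continuous_moll hε
  refine continuous_finsetSum _ fun i _ => ?_
  have hd := hU.continuous_pd_moll hε i
  exact ((hc.norm.rpow_const fun _ => Or.inr (by linarith)).mul (hd.norm.pow 2)).add
    ((continuous_const.mul (hc.norm.rpow_const fun _ => Or.inr (by linarith))).mul
      ((hc.inner hd).pow 2))

theorem dissDensity_le (hp : 4 ≤ p) {v : E3 → E3} {x : E3} {M : ℝ}
    (hM : ‖v x‖ ≤ M) (hM' : ∀ i, ‖pd i v x‖ ≤ M) :
    dissDensity p v x ≤ 3 * (p - 1) * (M ^ (p - 4) * M ^ 2) * ‖v x‖ ^ 2 := by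
  have hM0 : 0 ≤ M := (norm_nonneg _).trans hM
  have hp2 : 0 ≤ p - 2 := by linarith
  have : ∀ i, ‖v x‖ ^ (p - 2) * ‖pd i v x‖ ^ 2 +
      (p - 2) * ‖v x‖ ^ (p - 4) * inner ℝ (v x) (pd i v x) ^ 2 ≤
      (p - 1) * (M ^ (p - 4) * M ^ 2) * ‖v x‖ ^ 2 := fun i => by
    have h1 : inner ℝ (v x) (pd i v x) ^ 2 ≤ (‖v x‖ * ‖pd i v x‖) ^ 2 := by
      rw [← sq_abs]
      exact pow_le_pow_left₀ (abs_nonneg _) (abs_real_inner_le_norm _ _) 2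
    have h2 : ‖v x‖ ^ (p - 4) ≤ M ^ (p - 4) := Real.rpow_le_rpow (norm_nonneg _) hM (by linarith)
    have h3 : ‖pd i v x‖ ^ 2 ≤ M ^ 2 := pow_le_pow_left₀ (norm_nonneg _) (hM' i) 2
    calc _ ≤ ‖v x‖ ^ (p - 2) * ‖pd i v x‖ ^ 2 +
        (p - 2) * ‖v x‖ ^ (p - 4) * (‖v x‖ * ‖pd i v x‖) ^ 2 := by gcongr
      _ = (p - 1) * (‖v x‖ ^ (p - 4) * ‖pd i v x‖ ^ 2) * ‖v x‖ ^ 2 := by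
          rw [norm_rpow_sub_two hp]; ring
      _ ≤ _ := by
          have : 0 ≤ p - 1 := by linarith
          gcongr
  refine (Finset.sum_le_sum fun i _ => this i).trans_eq ?_
  simp only [Finset.sum_const, Finset.card_univ, Fintype.card_fin, nsmul_eq_mul]
  push_cast; ring

/-- Integration by parts in space: the right-hand side of the mollified equation tested with
`|v|^(p-2) v`. -/
theorem integral_powField_mul_mollRhs (hU : IsFlow a b U) (hε : 0 < ε) (hp : 4 ≤ p) (τ : ℝ) :
    ∫ x, ∑ k : Fin 3, powField p (cv (heatKernel ε) (U τ)) k x * mollRhs U ε k τ x =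
      nonlinearTerm p U ε τ - ∫ x, dissDensity p (cv (heatKernel ε) (U τ)) x := by
  have hK := isKernel_heatKernel hε
  have hv := hU.isNice_moll hε τ
  set v := cv (heatKernel ε) (U τ) with hvdef
  obtain ⟨C, hC0, hC⟩ := hU.exists_pressureGrad_bound hε
  have hf := hU.isBC_coord τ
  have hff := hU.isBC_coord_mul τ
  have hvk : ∀ k, cv (heatKernel ε) (fun y => U τ y k) = fun x => v x k := fun k =>
    funext fun x => (hU.moll_apply hε τ x k).symm
  have iF := fun k => hv.integrable_powField hp k
  have hpg : ∀ k, IsBC (pressureGrad U ε k τ) := fun k => by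
    have hc := (hU.continuous_pressureGrad hε k).along_snd (x := τ)
    exact ⟨hc, C, fun x => hC k τ x⟩
  have i1 : ∀ k i, Integrable fun x => powField p v k x *
      cv (pd i (pd i (heatKernel ε))) (fun y => U τ y k) x := fun k i =>
    ((hf k).cv ((hK.pd i).pd i).integrable).integrable_mul (iF k)
  have i2 : ∀ k i, Integrable fun x => powField p v k x *
      cv (pd i (heatKernel ε)) (fun y => U τ y i * U τ y k) x := fun k i =>
    ((hff i k).cv (hK.pd i).integrable).integrable_mul (iF k)
  have i3 : ∀ k, Integrable fun x => powField p v k x * pressureGrad U ε k τ x := fun k =>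
    (hpg k).integrable_mul (iF k)
  have e1 : ∀ k i, ∫ x, powField p v k x * cv (pd i (pd i (heatKernel ε))) (fun y => U τ y k) x =
      - ∫ x, pd i (powField p v k) x * pd i v x k := fun k i => by
    have hw : pd i (cv (heatKernel ε) (fun y => U τ y k)) = fun x => pd i v x k := by
      rw [hvk]; exact funext fun x => pd_apply i k (hv.differentiable x)
    have hw2 : pd i (fun x => pd i v x k) = cv (pd i (pd i (heatKernel ε))) (fun y => U τ y k) := by
      rw [← hw, pd_cv hK (hf k), pd_cv (hK.pd i) (hf k)]
    have hw3 : (fun x => pd i v x k) = cv (pd i (heatKernel ε)) (fun y => U τ y k) := by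
      rw [← hw, pd_cv hK (hf k)]
    rw [← hw2]
    refine hv.integral_powField_mul_pd hp ((hv.bounded_pd i).apply k) ?_ ?_ k
    · rw [hw3]; exact differentiable_cv (hK.pd i) (hf k)
    · rw [hw2]; exact (hf k).cv ((hK.pd i).pd i).integrable
  have e2 : ∀ k i, ∫ x, powField p v k x * cv (pd i (heatKernel ε)) (fun y => U τ y i * U τ y k) x =
      - ∫ x, pd i (powField p v k) x * cv (heatKernel ε) (fun y => U τ y i * U τ y k) x :=
    fun k i => by
    rw [← pd_cv hK (hff i k)]
    refine hv.integral_powField_mul_pd hp ((hff i k).cv hK.integrable)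
      (differentiable_cv hK (hff i k)) ?_ k
    rw [pd_cv hK (hff i k)]
    exact (hff i k).cv (hK.pd i).integrable
  have hlap : ∀ k x, cv (lap (heatKernel ε)) (fun y => U τ y k) x =
      ∑ i : Fin 3, cv (pd i (pd i (heatKernel ε))) (fun y => U τ y k) x := fun k x => by
    rw [← lap_cv hK (hf k)]
    refine Finset.sum_congr rfl fun i _ => ?_
    rw [pd_cv hK (hf k), pd_cv (hK.pd i) (hf k)]
  have expand : ∀ k, ∫ x, powField p v k x * mollRhs U ε k τ x =
      (-∑ i : Fin 3, ∫ x, pd i (powField p v k) x * pd i v x k) +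
      (∑ i : Fin 3, ∫ x, pd i (powField p v k) x *
        cv (heatKernel ε) (fun y => U τ y i * U τ y k) x) -
      ∫ x, powField p v k x * pressureGrad U ε k τ x := fun k => by
    simp only [mollRhs, hlap, mul_sub, Finset.mul_sum]
    have s1 := integrable_finsetSum Finset.univ fun i _ => i1 k i
    have s2 := integrable_finsetSum Finset.univ fun i _ => i2 k i
    rw [integral_sub (by exact s1.sub s2) (i3 k), integral_sub s1 s2,
      integral_finsetSum _ fun i _ => i1 k i, integral_finsetSum _ fun i _ => i2 k i]
    simp only [e1, e2, Finset.sum_neg_distrib]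
    ring
  have hi : ∀ k, Integrable fun x => powField p v k x * mollRhs U ε k τ x := fun k => by
    obtain ⟨C, hC0, hC⟩ := hU.exists_mollRhs_bound hε
    have hc := (hU.continuous_mollRhs hε k).along_snd (x := τ)
    exact IsBC.integrable_mul (f := mollRhs U ε k τ) ⟨hc, C, fun x => hC k τ x⟩ (iF k)
  have i5 : ∀ i k, Integrable fun x => pd i (powField p v k) x * pd i v x k := fun i k =>
    ((hv.bounded_pd i).apply k).integrable_mul (hv.integrable_pd_powField hp i k)
  have hD : ∫ x, dissDensity p v x =
      ∑ k : Fin 3, ∑ i : Fin 3, ∫ x, pd i (powField p v k) x * pd i v x k := by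
    rw [Finset.sum_comm]
    have : ∀ x, dissDensity p v x = ∑ i : Fin 3, ∑ k : Fin 3,
        pd i (powField p v k) x * pd i v x k := fun x =>
      Finset.sum_congr rfl fun i _ => (sum_pd_powField_mul hp (hv.differentiable x) i).symm
    simp only [this]
    rw [integral_finsetSum _ fun i _ => integrable_finsetSum _ fun k _ => i5 i k]
    exact Finset.sum_congr rfl fun i _ => integral_finsetSum _ fun k _ => i5 i k
  rw [integral_finsetSum _ fun k _ => hi k, hD, nonlinearTerm,
    Finset.sum_comm (f := fun i k => ∫ x, pd i (powField p v k) x *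
      cv (heatKernel ε) (fun y => U τ y i * U τ y k) x)]
  simp only [expand, Finset.sum_add_distrib, Finset.sum_sub_distrib, Finset.sum_neg_distrib]
  ring

/-- The balance of the `L^p` energy of the mollified velocity. -/
theorem energy_balance (hU : IsFlow a b U) (hε : 0 < ε) (hp : 4 ≤ p) {t : ℝ} (ht : t ∈ Icc a b) :
    (∫ x, ‖cv (heatKernel ε) (U t) x‖ ^ p) +
      p * ∫ τ in a..t, ∫ x, dissDensity p (cv (heatKernel ε) (U τ)) x =
    (∫ x, ‖cv (heatKernel ε) (U a) x‖ ^ p) + p * ∫ τ in a..t, nonlinearTerm p U ε τ := by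
  obtain ⟨M, hM0, hM, hM'⟩ := hU.exists_moll_bound hε
  obtain ⟨C, hC0, hC⟩ := hU.exists_mollRhs_bound hε
  have iD : Integrable (fun z : ℝ × E3 => dissDensity p (cv (heatKernel ε) (U z.1)) z.2)
      ((volume.restrict (Ioc a t)).prod volume) :=
    hU.integrable_of_le_moll_sq hε (hU.continuous_dissDensity_moll hε hp) (fun z => by
      rw [abs_of_nonneg (dissDensity_nonneg hp _ _)]
      exact dissDensity_le hp (hM z.1 z.2) fun i => hM' i z.1 z.2) t
  set S : ℝ → E3 → ℝ := fun τ x => ∑ k : Fin 3, powField p (cv (heatKernel ε) (U τ)) k x *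
    mollRhs U ε k τ x with hS
  have cS : Continuous fun z : ℝ × E3 => S z.1 z.2 := continuous_finsetSum _ fun k _ =>
    (hU.continuous_powField_moll hε hp k).mul (hU.continuous_mollRhs hε k)
  have iS : Integrable (fun z : ℝ × E3 => S z.1 z.2) ((volume.restrict (Ioc a t)).prod volume) := by
    refine hU.integrable_of_le_moll_sq hε cS (C := ∑ _k : Fin 3, M ^ (p - 1 - 2) * C) (fun z => ?_) t
    refine (Finset.abs_sum_le_sum_abs _ _).trans ?_
    rw [Finset.sum_mul]
    refine Finset.sum_le_sum fun k _ => ?_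
    rw [abs_mul]
    calc _ ≤ ‖cv (heatKernel ε) (U z.1) z.2‖ ^ (p - 1) * C :=
          mul_le_mul (abs_powField_le hp k _) (hC k _ _) (abs_nonneg _) (by positivity)
      _ ≤ (M ^ (p - 1 - 2) * ‖cv (heatKernel ε) (U z.1) z.2‖ ^ 2) * C :=
          mul_le_mul_of_nonneg_right (norm_rpow_le (by linarith) (hM z.1 z.2)) hC0
      _ = _ := by ring
  have hat := ht.1
  have jS : IntervalIntegrable (fun τ => ∫ x, S τ x) volume a t := by
    rw [intervalIntegrable_iff_integrableOn_Ioc_of_le hat]; exact iS.integral_prod_left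
  have jD : IntervalIntegrable (fun τ => ∫ x, dissDensity p (cv (heatKernel ε) (U τ)) x)
      volume a t := by
    rw [intervalIntegrable_iff_integrableOn_Ioc_of_le hat]; exact iD.integral_prod_left
  have hmain : (∫ x, ‖cv (heatKernel ε) (U t) x‖ ^ p) - ∫ x, ‖cv (heatKernel ε) (U a) x‖ ^ p =
      p * ∫ τ in a..t, ∫ x, S τ x := by
    rw [← integral_sub ((hU.isNice_moll hε t).integrable_rpow (by linarith))
      ((hU.isNice_moll hε a).integrable_rpow (by linarith))]
    simp only [fun x => hU.norm_rpow_moll_sub hε hp x ht, intervalIntegral.integral_const_mul]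
    rw [integral_const_mul]
    congr 1
    simp only [intervalIntegral.integral_of_le hat]
    exact (integral_integral_swap iS).symm
  have hsp : ∀ τ, nonlinearTerm p U ε τ =
      (∫ x, S τ x) + ∫ x, dissDensity p (cv (heatKernel ε) (U τ)) x := fun τ => by
    rw [hU.integral_powField_mul_mollRhs hε hp τ]; ring
  simp only [hsp]
  rw [intervalIntegral.integral_add jS jD]
  linarith

end IsFlow

end EnergyBalance

/-! ### The quadratic inequality for the mollified energy -/

section RealInequalities

/-- Optimisation over the scaling parameter turns Young's inequality into Hölder's. -/
theorem le_two_mul_rpow_of_forall_scaling {q q' : ℝ} (hq : q.HolderConjugate q') {z K α β : ℝ}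
    (hK : 0 ≤ K) (hα : 0 ≤ α) (hβ : 0 ≤ β)
    (h : ∀ c : ℝ, 0 < c → z ≤ K * (c ^ q * α + c⁻¹ ^ q' * β)) :
    z ≤ 2 * K * (α ^ (1 / q) * β ^ (1 / q')) := by
  have hq0 := hq.pos
  have hq0' := hq.symm.pos
  -- `δ` keeps the coefficients positive, so that `c = exp ((B - A) / (q q'))` balances the terms
  have key : ∀ δ : ℝ, 0 < δ → z ≤ 2 * K * ((α + δ) ^ (1 / q) * (β + δ) ^ (1 / q')) := by
    intro δ hδ
    have hA : α + δ = Real.exp (Real.log (α + δ)) := (Real.exp_log (by linarith)).symm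
    have hB : β + δ = Real.exp (Real.log (β + δ)) := (Real.exp_log (by linarith)).symm
    set A := Real.log (α + δ)
    set B := Real.log (β + δ)
    have hsum : q⁻¹ + q'⁻¹ = 1 := hq.inv_add_inv_eq_one
    have e1 : Real.exp ((B - A) / (q * q')) ^ q * (α + δ) =
        (α + δ) ^ (1 / q) * (β + δ) ^ (1 / q') := by
      rw [hA, hB, ← Real.exp_mul, ← Real.exp_mul, ← Real.exp_mul, ← Real.exp_add, ← Real.exp_add]
      congr 1
      have : (B - A) / (q * q') * q = (B - A) * q'⁻¹ := by field_simp
      rw [this, one_div, one_div]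
      linear_combination (-A) * hsum
    have e2 : (Real.exp ((B - A) / (q * q')))⁻¹ ^ q' * (β + δ) =
        (α + δ) ^ (1 / q) * (β + δ) ^ (1 / q') := by
      rw [hA, hB, ← Real.exp_neg, ← Real.exp_mul, ← Real.exp_mul, ← Real.exp_mul, ← Real.exp_add,
        ← Real.exp_add]
      congr 1
      have : -((B - A) / (q * q')) * q' = -(B - A) * q⁻¹ := by field_simp
      rw [this, one_div, one_div]
      linear_combination (-B) * hsum
    have := h _ (Real.exp_pos ((B - A) / (q * q')))
    calc z ≤ _ := this
      _ ≤ K * (Real.exp ((B - A) / (q * q')) ^ q * (α + δ) +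
          (Real.exp ((B - A) / (q * q')))⁻¹ ^ q' * (β + δ)) := by
          gcongr <;> linarith
      _ = _ := by rw [e1, e2]; ring
  have hlim : Tendsto (fun δ : ℝ => 2 * K * ((α + δ) ^ (1 / q) * (β + δ) ^ (1 / q')))
      (nhdsWithin 0 (Ioi 0)) (nhds (2 * K * ((α + 0) ^ (1 / q) * (β + 0) ^ (1 / q')))) := by
    refine (Continuous.tendsto ?_ 0).mono_left nhdsWithin_le_nhds
    exact continuous_const.mul
      (((continuous_const.add continuous_id).rpow_const fun _ => Or.inr (by positivity)).mul
        ((continuous_const.add continuous_id).rpow_const fun _ => Or.inr (by positivity)))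
  have := ge_of_tendsto hlim (eventually_nhdsWithin_of_forall fun δ hδ => key δ hδ)
  simpa using this

theorem ennreal_le_two_mul_rpow_of_forall_scaling {q q' : ℝ} (hq : q.HolderConjugate q')
    {z K α β : ℝ≥0∞} (hK : K ≠ ⊤) (hα : α ≠ ⊤) (hβ : β ≠ ⊤)
    (h : ∀ c : ℝ, 0 < c → z ≤ K * (ENNReal.ofReal (c ^ q) * α + ENNReal.ofReal (c⁻¹ ^ q') * β)) :
    z ≤ 2 * K * (α ^ (1 / q) * β ^ (1 / q')) := by
  lift K to NNReal using hK
  lift α to NNReal using hα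
  lift β to NNReal using hβ
  have hzt : z ≠ ⊤ := fun hz => by
    have := h 1 one_pos
    rw [hz, top_le_iff] at this
    exact ENNReal.mul_ne_top (by simp) (by simp) this
  lift z to NNReal using hzt
  have hq0 : 0 ≤ 1 / q := by have := hq.pos; positivity
  have hq0' : 0 ≤ 1 / q' := by have := hq.symm.pos; positivity
  have := le_two_mul_rpow_of_forall_scaling hq (z := z) K.2 α.2 β.2 fun c hc => by
    have h := h c hc
    rw [← ENNReal.ofReal_coe_nnreal (p := α), ← ENNReal.ofReal_coe_nnreal (p := β),
      ← ENNReal.ofReal_coe_nnreal (p := K), ← ENNReal.ofReal_coe_nnreal (p := z),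
      ← ENNReal.ofReal_mul (by positivity), ← ENNReal.ofReal_mul (by positivity),
      ← ENNReal.ofReal_add (by positivity) (by positivity), ← ENNReal.ofReal_mul (by positivity),
      ENNReal.ofReal_le_ofReal_iff (by positivity)] at h
    exact h
  rw [← ENNReal.coe_rpow_of_nonneg _ hq0, ← ENNReal.coe_rpow_of_nonneg _ hq0']
  exact_mod_cast this

/-- The solution set of `x ≤ A + B √x` is an interval. -/
theorem exists_le_iff_le_add_mul_sqrt {A B : ℝ} (hA : 0 ≤ A) (hB : 0 ≤ B) :
    ∃ Y : ℝ, 0 ≤ Y ∧ ∀ x, 0 ≤ x → (x ≤ A + B * √x ↔ x ≤ Y) := by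
  set d := √(B ^ 2 + 4 * A)
  have hd : d ^ 2 = B ^ 2 + 4 * A := Real.sq_sqrt (by positivity)
  have hd0 : 0 ≤ d := Real.sqrt_nonneg _
  have hBd : B ≤ d := Real.le_sqrt_of_sq_le (by linarith)
  refine ⟨((B + d) / 2) ^ 2, by positivity, fun x hx => ?_⟩
  obtain ⟨y, hy0, rfl⟩ : ∃ y, 0 ≤ y ∧ x = y ^ 2 := ⟨√x, Real.sqrt_nonneg _, (Real.sq_sqrt hx).symm⟩
  rw [Real.sqrt_sq hy0, pow_le_pow_iff_left₀ hy0 (by positivity) two_ne_zero]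
  have hfac : (A + B * y) - y ^ 2 = ((B + d) / 2 - y) * (y + (d - B) / 2) := by
    linear_combination (-1 / 4 : ℝ) * hd
  constructor
  · intro h
    by_contra! hc
    have : ((B + d) / 2 - y) * (y + (d - B) / 2) < 0 :=
      mul_neg_of_neg_of_pos (by linarith) (by linarith)
    linarith
  · intro h
    have : 0 ≤ ((B + d) / 2 - y) * (y + (d - B) / 2) :=
      mul_nonneg (by linarith) (by linarith)
    linarith

theorem exists_le_iff_le_add_mul_rpow_half {A B : ℝ≥0∞} (hA : A ≠ ⊤) (hB : B ≠ ⊤) :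
    ∃ Y : ℝ≥0∞, Y ≠ ⊤ ∧ ∀ x, x ≠ ⊤ → (x ≤ A + B * x ^ (1 / 2 : ℝ) ↔ x ≤ Y) := by
  lift A to NNReal using hA
  lift B to NNReal using hB
  obtain ⟨Y, hY0, hY⟩ := exists_le_iff_le_add_mul_sqrt A.2 B.2
  refine ⟨ENNReal.ofReal Y, ENNReal.ofReal_ne_top, fun x hx => ?_⟩
  lift x to NNReal using hx
  rw [← ENNReal.ofReal_coe_nnreal (p := x), ENNReal.ofReal_le_ofReal_iff hY0,
    ← hY x x.2, ENNReal.ofReal_coe_nnreal, ← ENNReal.coe_rpow_of_nonneg _ (by norm_num),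
    Real.sqrt_eq_rpow]
  norm_cast

end RealInequalities

section MollifiedEnergy

variable {a b : ℝ} {U : ℝ → E3 → E3} {p ε : ℝ}

/-- The derivatives of `|v|^(p-2) v` are controlled by the square root of the dissipation. The
constant `2` is a bound for `√3`, from the sum over the three partial derivatives. -/
theorem powGrad_le {v : E3 → E3} (hp : 4 ≤ p) (x : E3) :
    powGrad p v x ≤ 2 * (p - 1) * (‖v x‖ ^ (p / 2 - 1) * √(dissDensity p v x)) := by
  have hp2 : 0 ≤ p - 2 := by linarith
  have hp1 : 0 ≤ p - 1 := by linarith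
  have h1 : ∑ i : Fin 3, (‖v x‖ ^ (p / 2 - 1) * ‖pd i v x‖) ^ 2 ≤ dissDensity p v x := by
    refine Finset.sum_le_sum fun i _ => ?_
    have : ‖v x‖ ^ (p - 2) = (‖v x‖ ^ (p / 2 - 1)) ^ 2 := by
      rw [← Real.rpow_natCast, ← Real.rpow_mul (norm_nonneg _)]
      congr 1; push_cast; ring
    rw [mul_pow, ← this]
    exact le_add_of_nonneg_right (by positivity)
  have h2 : ∑ i : Fin 3, ‖v x‖ ^ (p / 2 - 1) * ‖pd i v x‖ ≤ 2 * √(dissDensity p v x) := by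
    refine le_trans ?_ (mul_le_mul_of_nonneg_left (Real.sqrt_le_sqrt h1) zero_le_two)
    refine abs_le_of_sq_le_sq' ?_ (by positivity) |>.2
    rw [mul_pow, Real.sq_sqrt (Finset.sum_nonneg fun i _ => sq_nonneg _)]
    have := sq_sum_le_card_mul_sum_sq (s := Finset.univ)
      (f := fun i : Fin 3 => ‖v x‖ ^ (p / 2 - 1) * ‖pd i v x‖)
    simp only [Finset.card_univ, Fintype.card_fin, Nat.cast_ofNat] at this
    have h0 : 0 ≤ ∑ i : Fin 3, (‖v x‖ ^ (p / 2 - 1) * ‖pd i v x‖) ^ 2 :=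
      Finset.sum_nonneg fun i _ => sq_nonneg _
    linarith
  calc powGrad p v x =
      (p - 1) * (‖v x‖ ^ (p / 2 - 1) * ∑ i : Fin 3, ‖v x‖ ^ (p / 2 - 1) * ‖pd i v x‖) := by
        unfold powGrad
        congr 1
        rw [Finset.mul_sum]
        refine Finset.sum_congr rfl fun i _ => ?_
        rw [← mul_assoc, ← Real.rpow_add_of_nonneg (norm_nonneg _) (by linarith) (by linarith)]
        congr 2; ring
    _ ≤ (p - 1) * (‖v x‖ ^ (p / 2 - 1) * (2 * √(dissDensity p v x))) := by gcongr
    _ = _ := by ring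

/-- The exponents are those of Hölder's inequality between `L^(5p/3)` and `L²`. -/
theorem ofReal_powGrad_rpow_le {v : E3 → E3} (hp : 4 ≤ p) (x : E3) :
    ENNReal.ofReal (powGrad p v x) ^ (5 * p / (4 * p - 3)) ≤
      ENNReal.ofReal (2 * (p - 1)) ^ (5 * p / (4 * p - 3)) *
        ((‖v x‖ₑ ^ (5 * p / 3)) ^ (3 * (p - 2) / (2 * (4 * p - 3))) *
          ENNReal.ofReal (dissDensity p v x) ^ (5 * p / (2 * (4 * p - 3)))) := by
  have h4 : 0 < 4 * p - 3 := by linarith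
  have hD := dissDensity_nonneg hp v x
  have hp1 : 0 ≤ 2 * (p - 1) := by linarith
  have hp2 : 0 ≤ p - 2 := by linarith
  have hq : 0 ≤ 5 * p / (4 * p - 3) := by have : 0 ≤ p := by linarith
                                          positivity
  refine (ENNReal.rpow_le_rpow (ENNReal.ofReal_le_ofReal (powGrad_le hp x)) hq).trans_eq ?_
  rw [ENNReal.ofReal_mul hp1, ENNReal.mul_rpow_of_nonneg _ _ hq]
  congr 1
  rw [ENNReal.ofReal_mul (by positivity), ENNReal.mul_rpow_of_nonneg _ _ hq, Real.sqrt_eq_rpow,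
    ← ENNReal.ofReal_rpow_of_nonneg hD (by norm_num),
    ← ENNReal.ofReal_rpow_of_nonneg (norm_nonneg _) (by linarith), ofReal_norm,
    ← ENNReal.rpow_mul, ← ENNReal.rpow_mul, ← ENNReal.rpow_mul]
  congr 2
  · field_simp
  · field_simp

namespace IsFlow

theorem integrable_dissDensity_moll (hU : IsFlow a b U) (hε : 0 < ε) (hp : 4 ≤ p) (t : ℝ) :
    Integrable (fun z : ℝ × E3 => dissDensity p (cv (heatKernel ε) (U z.1)) z.2)
      ((volume.restrict (Ioc a t)).prod volume) := by
  obtain ⟨M, hM0, hM, hM'⟩ := hU.exists_moll_bound hε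
  exact hU.integrable_of_le_moll_sq hε (hU.continuous_dissDensity_moll hε hp) (fun z => by
    rw [abs_of_nonneg (dissDensity_nonneg hp _ _)]
    exact dissDensity_le hp (hM z.1 z.2) fun i => hM' i z.1 z.2) t

/-- The `L^p` energy of the mollified velocity at time `t`. -/
noncomputable def _root_.NavierStokes.mollEnergy (p a t ε : ℝ) (U : ℝ → E3 → E3) : ℝ≥0∞ :=
  (∫⁻ x, ‖cv (heatKernel ε) (U t) x‖ₑ ^ p) + ENNReal.ofReal p *
    ∫⁻ τ in Ioc a t, ∫⁻ x, ENNReal.ofReal (dissDensity p (cv (heatKernel ε) (U τ)) x)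

theorem lintegral_rpow_eq (hU : IsFlow a b U) (hε : 0 < ε) (hp : 2 ≤ p) (t : ℝ) :
    ∫⁻ x, ‖cv (heatKernel ε) (U t) x‖ₑ ^ p =
      ENNReal.ofReal (∫ x, ‖cv (heatKernel ε) (U t) x‖ ^ p) := by
  rw [ofReal_integral_eq_lintegral_ofReal ((hU.isNice_moll hε t).integrable_rpow hp)
    (ae_of_all _ fun x => by positivity)]
  refine lintegral_congr fun x => ?_
  rw [← ofReal_norm, ENNReal.ofReal_rpow_of_nonneg (norm_nonneg _) (by linarith)]

/-- The energy in terms of Bochner integrals, as it occurs in `energy_balance`; in particular it is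
finite. -/
theorem mollEnergy_eq (hU : IsFlow a b U) (hε : 0 < ε) (hp : 4 ≤ p) {t : ℝ} (ht : a ≤ t) :
    mollEnergy p a t ε U = ENNReal.ofReal ((∫ x, ‖cv (heatKernel ε) (U t) x‖ ^ p) +
      p * ∫ τ in a..t, ∫ x, dissDensity p (cv (heatKernel ε) (U τ)) x) := by
  have iD := hU.integrable_dissDensity_moll hε hp t
  have hD : 0 ≤ ∫ τ in a..t, ∫ x, dissDensity p (cv (heatKernel ε) (U τ)) x :=
    intervalIntegral.integral_nonneg ht fun τ _ =>
      integral_nonneg fun x => dissDensity_nonneg hp _ x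
  rw [ENNReal.ofReal_add (integral_nonneg fun x => by positivity)
    (mul_nonneg (by linarith) hD), ENNReal.ofReal_mul (by linarith), mollEnergy,
    hU.lintegral_rpow_eq hε (by linarith), intervalIntegral.integral_of_le ht]
  congr 2
  rw [← integral_prod _ iD, ofReal_integral_eq_lintegral_ofReal iD
    (ae_of_all _ fun z => dissDensity_nonneg hp _ _), lintegral_prod]
  exact (hU.continuous_dissDensity_moll hε hp).measurable.ennreal_ofReal.aemeasurable

/-- The energy balance as an upper bound; the mollification does not increase the initial norm. -/
theorem mollEnergy_le (hU : IsFlow a b U) (hε : 0 < ε) (hp : 4 ≤ p) {t : ℝ} (ht : t ∈ Icc a b) :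
    mollEnergy p a t ε U ≤ (∫⁻ x, ‖U a x‖ₑ ^ p) +
      ENNReal.ofReal p * ∫⁻ τ in Ioc a t, ‖nonlinearTerm p U ε τ‖ₑ := by
  rw [hU.mollEnergy_eq hε hp ht.1, hU.energy_balance hε hp ht]
  refine ENNReal.ofReal_add_le.trans (add_le_add ?_ ?_)
  · rw [← hU.lintegral_rpow_eq hε (by linarith)]
    exact hU.lintegral_moll_le hε a (by linarith)
  · rw [ENNReal.ofReal_mul (by linarith), intervalIntegral.integral_of_le ht.1]
    exact mul_le_mul' le_rfl (((ENNReal.ofReal_le_ofReal (le_abs_self _)).trans_eq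
      (by rw [← Real.norm_eq_abs, ofReal_norm])).trans (enorm_integral_le_lintegral_enorm _))

theorem lintegral_space_time_rpow_lt_top (hU : IsFlow a b U) {r : ℝ} (hr : 2 ≤ r) (t : ℝ) :
    ∫⁻ τ in Ioc a t, ∫⁻ x, ‖U τ x‖ₑ ^ r < ⊤ := by
  obtain ⟨A, hA⟩ := hU.lintegral_enorm_sq_le
  obtain ⟨M, hM0, hM, -⟩ := hU.exists_bound
  calc _ ≤ ∫⁻ τ in Ioc a t, ENNReal.ofReal (M ^ (r - 2)) * ENNReal.ofReal A := by
        refine lintegral_mono fun τ => ?_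
        refine le_trans ?_ (mul_le_mul' le_rfl (hA τ))
        rw [← lintegral_const_mul' _ _ ENNReal.ofReal_ne_top]
        refine lintegral_mono fun x => ?_
        rw [← ofReal_norm, ENNReal.ofReal_rpow_of_nonneg (norm_nonneg _) (by linarith),
          ENNReal.ofReal_rpow_of_nonneg (norm_nonneg _) (by norm_num),
          ← ENNReal.ofReal_mul (by positivity), Real.rpow_two]
        exact ENNReal.ofReal_le_ofReal (norm_rpow_le hr (hM τ x))
    _ < ⊤ := by
        rw [lintegral_const]
        exact ENNReal.mul_lt_top (ENNReal.mul_lt_top ENNReal.ofReal_lt_top ENNReal.ofReal_lt_top)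
          (by simp)

theorem lintegral_Ioc_mono {t : ℝ} (ht : t ∈ Icc a b) (φ : ℝ → ℝ≥0∞) :
    ∫⁻ τ in Ioc a t, φ τ ≤ ∫⁻ τ in Ioc a b, φ τ :=
  lintegral_mono_set (Ioc_subset_Ioc_right ht.2)

/-- Interpolation of the space-time `L^(10p/(p+3))` norm between `L⁵` and `L^(5p/3)`. -/
theorem lintegral_rpow_interpolate (hU : IsFlow a b U) (hp : 4 ≤ p) (t : ℝ) :
    ∫⁻ τ in Ioc a t, ∫⁻ x, ‖U τ x‖ₑ ^ (2 * (5 * p / (p + 3))) ≤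
      (∫⁻ τ in Ioc a t, ∫⁻ x, ‖U τ x‖ₑ ^ (5 : ℝ)) ^ (p / (p + 3)) *
        (∫⁻ τ in Ioc a t, ∫⁻ x, ‖U τ x‖ₑ ^ (5 * p / 3)) ^ (3 / (p + 3)) := by
  have hm : ∀ r : ℝ, AEMeasurable (fun z : ℝ × E3 => ‖U z.1 z.2‖ₑ ^ r)
      ((volume.restrict (Ioc a t)).prod volume) := fun r =>
    (hU.continuous.measurable.enorm.pow_const r).aemeasurable
  rw [← lintegral_prod _ (hm _), ← lintegral_prod _ (hm _), ← lintegral_prod _ (hm _)]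
  have hp3 : 0 < p + 3 := by linarith
  refine le_trans (lintegral_mono fun z => le_of_eq ?_)
    (ENNReal.lintegral_mul_norm_pow_le (hm 5) (hm _) (p := p / (p + 3)) (q := 3 / (p + 3))
      (by positivity) (by positivity) (by field_simp))
  rw [← ENNReal.rpow_mul, ← ENNReal.rpow_mul,
    ← ENNReal.rpow_add_of_nonneg _ _ (by positivity) (by positivity)]
  congr 1
  field_simp; ring

/-- Hölder's inequality in space-time between `‖v‖_{5p/3}` and the dissipation. The exponent
`5p/(4p-3)` is conjugate to `5p/(p+3)`. -/
theorem lintegral_powGrad_le (hU : IsFlow a b U) (hε : 0 < ε) (hp : 4 ≤ p) (t : ℝ) :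
    ∫⁻ τ in Ioc a t, ∫⁻ x,
        ENNReal.ofReal (powGrad p (cv (heatKernel ε) (U τ)) x) ^ (5 * p / (4 * p - 3)) ≤
      ENNReal.ofReal (2 * (p - 1)) ^ (5 * p / (4 * p - 3)) *
        ((∫⁻ τ in Ioc a t, ∫⁻ x, ‖U τ x‖ₑ ^ (5 * p / 3)) ^ (3 * (p - 2) / (2 * (4 * p - 3))) *
          (∫⁻ τ in Ioc a t, ∫⁻ x, ENNReal.ofReal (dissDensity p (cv (heatKernel ε) (U τ)) x)) ^
            (5 * p / (2 * (4 * p - 3)))) := by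
  have hp3 : 0 < 4 * p - 3 := by linarith
  have hp3' : p * 4 - 3 ≠ 0 := by linarith
  have hp2 : 0 ≤ p - 2 := by linarith
  have hm1 : AEMeasurable (fun z : ℝ × E3 => ‖cv (heatKernel ε) (U z.1) z.2‖ₑ ^ (5 * p / 3))
      ((volume.restrict (Ioc a t)).prod volume) :=
    ((hU.continuous_moll hε).measurable.enorm.pow_const _).aemeasurable
  have hm2 : AEMeasurable (fun z : ℝ × E3 => ENNReal.ofReal
      (dissDensity p (cv (heatKernel ε) (U z.1)) z.2))
      ((volume.restrict (Ioc a t)).prod volume) :=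
    (hU.continuous_dissDensity_moll hε hp).measurable.ennreal_ofReal.aemeasurable
  have hctop : ENNReal.ofReal (2 * (p - 1)) ^ (5 * p / (4 * p - 3)) ≠ ⊤ :=
    ENNReal.rpow_ne_top_of_nonneg (by positivity) ENNReal.ofReal_ne_top
  refine (lintegral_mono fun τ => lintegral_mono fun x => ofReal_powGrad_rpow_le hp x).trans ?_
  simp only [lintegral_const_mul' _ _ hctop]
  refine mul_le_mul' le_rfl ?_
  rw [← lintegral_prod _ hm2,
    ← lintegral_prod (fun z : ℝ × E3 => (‖cv (heatKernel ε) (U z.1) z.2‖ₑ ^ (5 * p / 3)) ^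
      (3 * (p - 2) / (2 * (4 * p - 3))) * ENNReal.ofReal
        (dissDensity p (cv (heatKernel ε) (U z.1)) z.2) ^ (5 * p / (2 * (4 * p - 3))))
      ((hm1.pow_const _).mul (hm2.pow_const _))]
  refine (ENNReal.lintegral_mul_norm_pow_le hm1 hm2 (by positivity) (by positivity)
    (by field_simp; ring)).trans (mul_le_mul' (ENNReal.rpow_le_rpow ?_ (by positivity)) le_rfl)
  rw [lintegral_prod _ hm1]
  exact lintegral_mono fun τ => hU.lintegral_moll_le hε τ (by linarith)

/-- Hölder's inequality for the nonlinear term. The norms of `u` in the two factors combine to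
`‖u‖₅` and `‖u‖_{5p/3}^{p/2}`. The constant `2400` is `600` from the bound at fixed time, times `2`
from the optimisation over the scaling and `2` from `powGrad_le`. -/
theorem lintegral_nonlinearTerm_le (hU : IsFlow a b U) (hε : 0 < ε) (hp : 4 ≤ p) (t : ℝ) :
    ∫⁻ τ in Ioc a t, ‖nonlinearTerm p U ε τ‖ₑ ≤ ENNReal.ofReal (2400 * (p - 1)) *
      ((∫⁻ τ in Ioc a t, ∫⁻ x, ‖U τ x‖ₑ ^ (5 : ℝ)) ^ (1 / 5 : ℝ) *
      (∫⁻ τ in Ioc a t, ∫⁻ x, ‖U τ x‖ₑ ^ (5 * p / 3)) ^ (3 / 10 : ℝ) *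
      (∫⁻ τ in Ioc a t, ∫⁻ x, ENNReal.ofReal (dissDensity p (cv (heatKernel ε) (U τ)) x)) ^
        (1 / 2 : ℝ)) := by
  have hp3 : 0 < p + 3 := by linarith
  have hp4 : 0 < 4 * p - 3 := by linarith
  have hp4' : p * 4 - 3 ≠ 0 := by linarith
  have hp2 : 0 ≤ p - 2 := by linarith
  have hp1 : 0 ≤ p - 1 := by linarith
  have hp0 : 0 < p := by linarith
  have hq2 : 2 < 5 * p / (p + 3) := by rw [lt_div_iff₀ hp3]; linarith
  have hq5 : 5 * p / (p + 3) ≤ 5 := by rw [div_le_iff₀ hp3]; linarith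
  have hqq : 5 * p / (p + 3) / (5 * p / (p + 3) - 1) = 5 * p / (4 * p - 3) := by
    rw [show 5 * p / (p + 3) - 1 = (4 * p - 3) / (p + 3) by field_simp; ring]
    field_simp
  have hconj : (5 * p / (p + 3)).HolderConjugate (5 * p / (4 * p - 3)) := by
    rw [← hqq]; exact Real.HolderConjugate.conjExponent (by linarith)
  have iD : ∫⁻ τ in Ioc a t, ∫⁻ x, ENNReal.ofReal (dissDensity p (cv (heatKernel ε) (U τ)) x) ≠ ⊤ := by
    have h := hU.integrable_dissDensity_moll hε hp t
    rw [← lintegral_prod (fun z : ℝ × E3 =>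
      ENNReal.ofReal (dissDensity p (cv (heatKernel ε) (U z.1)) z.2))
      (hU.continuous_dissDensity_moll hε hp).measurable.ennreal_ofReal.aemeasurable]
    exact h.lintegral_lt_top.ne
  have hα := hU.lintegral_rpow_interpolate hp t
  have hβ := hU.lintegral_powGrad_le hε hp t
  have hF := (hU.lintegral_space_time_rpow_lt_top (r := 5) (by norm_num) t).ne
  have hY := (hU.lintegral_space_time_rpow_lt_top (r := 5 * p / 3) (by linarith) t).ne
  set α := ∫⁻ τ in Ioc a t, ∫⁻ x, ‖U τ x‖ₑ ^ (2 * (5 * p / (p + 3))) with hαdef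
  set β := ∫⁻ τ in Ioc a t, ∫⁻ x,
        ENNReal.ofReal (powGrad p (cv (heatKernel ε) (U τ)) x) ^ (5 * p / (4 * p - 3)) with hβdef
  set F := ∫⁻ τ in Ioc a t, ∫⁻ x, ‖U τ x‖ₑ ^ (5 : ℝ)
  set Y := ∫⁻ τ in Ioc a t, ∫⁻ x, ‖U τ x‖ₑ ^ (5 * p / 3)
  set D := ∫⁻ τ in Ioc a t, ∫⁻ x, ENNReal.ofReal (dissDensity p (cv (heatKernel ε) (U τ)) x)
  have hαt : α ≠ ⊤ := ne_top_of_le_ne_top (ENNReal.mul_ne_top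
    (ENNReal.rpow_ne_top_of_nonneg (by positivity) hF)
    (ENNReal.rpow_ne_top_of_nonneg (by positivity) hY)) hα
  have hβt : β ≠ ⊤ := ne_top_of_le_ne_top (ENNReal.mul_ne_top
    (ENNReal.rpow_ne_top_of_nonneg (by positivity) ENNReal.ofReal_ne_top) (ENNReal.mul_ne_top
    (ENNReal.rpow_ne_top_of_nonneg (by positivity) hY)
    (ENNReal.rpow_ne_top_of_nonneg (by positivity) iD))) hβ
  have key : ∫⁻ τ in Ioc a t, ‖nonlinearTerm p U ε τ‖ₑ ≤ 2 * 600 *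
      (α ^ (1 / (5 * p / (p + 3))) * β ^ (1 / (5 * p / (4 * p - 3)))) := by
    refine ennreal_le_two_mul_rpow_of_forall_scaling hconj (by norm_num) hαt hβt fun c hc => ?_
    have hmeas : Measurable fun τ => ∫⁻ x, ‖U τ x‖ₑ ^ (2 * (5 * p / (p + 3))) :=
      (hU.continuous.measurable.enorm.pow_const _).lintegral_prod_right'
    calc _ ≤ ∫⁻ τ in Ioc a t, 600 * (ENNReal.ofReal (c ^ (5 * p / (p + 3))) *
          (∫⁻ x, ‖U τ x‖ₑ ^ (2 * (5 * p / (p + 3)))) +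
          ENNReal.ofReal (c⁻¹ ^ (5 * p / (4 * p - 3))) * ∫⁻ x, ENNReal.ofReal
            (powGrad p (cv (heatKernel ε) (U τ)) x) ^ (5 * p / (4 * p - 3))) := by
          refine lintegral_mono fun τ => ?_
          have := hU.enorm_nonlinear_le (hU.isNice_moll hε τ) hp hε τ hq2 hq5 hc
          rw [hqq] at this
          exact this
      _ = _ := by
          rw [lintegral_const_mul' _ _ (by norm_num),
            lintegral_add_left (hmeas.const_mul _), lintegral_const_mul' _ _ ENNReal.ofReal_ne_top,
            lintegral_const_mul' _ _ ENNReal.ofReal_ne_top]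
  refine key.trans ?_
  have h1 : α ^ (1 / (5 * p / (p + 3))) ≤ F ^ (1 / 5 : ℝ) * Y ^ (3 / (5 * p)) := by
    refine (ENNReal.rpow_le_rpow hα (by positivity)).trans_eq ?_
    rw [ENNReal.mul_rpow_of_nonneg _ _ (by positivity), ← ENNReal.rpow_mul, ← ENNReal.rpow_mul]
    congr 2 <;> field_simp
  have h2 : β ^ (1 / (5 * p / (4 * p - 3))) ≤ ENNReal.ofReal (2 * (p - 1)) *
      (Y ^ (3 * (p - 2) / (10 * p)) * D ^ (1 / 2 : ℝ)) := by
    refine (ENNReal.rpow_le_rpow hβ (by positivity)).trans_eq ?_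
    rw [ENNReal.mul_rpow_of_nonneg _ _ (by positivity), ENNReal.mul_rpow_of_nonneg _ _
      (by positivity), ← ENNReal.rpow_mul, ← ENNReal.rpow_mul, ← ENNReal.rpow_mul]
    rw [show 5 * p / (4 * p - 3) * (1 / (5 * p / (4 * p - 3))) = 1 by field_simp, ENNReal.rpow_one]
    congr 3
    · field_simp; ring
    · field_simp
  calc 2 * 600 * (α ^ (1 / (5 * p / (p + 3))) * β ^ (1 / (5 * p / (4 * p - 3)))) ≤
      2 * 600 * (F ^ (1 / 5 : ℝ) * Y ^ (3 / (5 * p)) * (ENNReal.ofReal (2 * (p - 1)) *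
      (Y ^ (3 * (p - 2) / (10 * p)) * D ^ (1 / 2 : ℝ)))) :=
        mul_le_mul' le_rfl (mul_le_mul' h1 h2)
    _ = (1200 * ENNReal.ofReal (2 * (p - 1))) * (F ^ (1 / 5 : ℝ) * (Y ^ (3 / (5 * p)) *
      Y ^ (3 * (p - 2) / (10 * p))) * D ^ (1 / 2 : ℝ)) := by
        rw [show (2 * 600 : ℝ≥0∞) = 1200 by norm_num]; ring
    _ = _ := by
        rw [← ENNReal.rpow_add_of_nonneg _ _ (by positivity) (by positivity)]
        congr 3
        · rw [show (1200 : ℝ≥0∞) = ENNReal.ofReal 1200 by simp, ← ENNReal.ofReal_mul (by norm_num)]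
          congr 1; ring
        · congr 1; field_simp; ring

/-- The quadratic inequality for the `L^p` energy of the mollified velocity, with coefficients that
do not depend on the mollification. -/
theorem mollEnergy_le_add_mul_rpow_half (hU : IsFlow a b U) (hε : 0 < ε) (hp : 4 ≤ p) {t : ℝ}
    (ht : t ∈ Icc a b) :
    mollEnergy p a t ε U ≤ (∫⁻ x, ‖U a x‖ₑ ^ p) + ENNReal.ofReal (2400 * p ^ (3 / 2 : ℝ)) *
      ((∫⁻ τ in Ioc a b, ∫⁻ x, ‖U τ x‖ₑ ^ (5 : ℝ)) ^ (1 / 5 : ℝ) *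
      (∫⁻ τ in Ioc a b, ∫⁻ x, ‖U τ x‖ₑ ^ (5 * p / 3)) ^ (3 / 10 : ℝ)) *
      mollEnergy p a t ε U ^ (1 / 2 : ℝ) := by
  have hp0 : 0 < p := by linarith
  refine (hU.mollEnergy_le hε hp ht).trans (add_le_add le_rfl ?_)
  set D := ∫⁻ τ in Ioc a t, ∫⁻ x, ENNReal.ofReal (dissDensity p (cv (heatKernel ε) (U τ)) x)
    with hD
  have hDle : ENNReal.ofReal (p ^ (1 / 2 : ℝ)) * D ^ (1 / 2 : ℝ) ≤
      mollEnergy p a t ε U ^ (1 / 2 : ℝ) := by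
    rw [← ENNReal.ofReal_rpow_of_pos hp0, ← ENNReal.mul_rpow_of_nonneg _ _ (by norm_num)]
    exact ENNReal.rpow_le_rpow le_add_self (by norm_num)
  refine (mul_le_mul' le_rfl (hU.lintegral_nonlinearTerm_le hε hp t)).trans ?_
  set F := ∫⁻ τ in Ioc a b, ∫⁻ x, ‖U τ x‖ₑ ^ (5 : ℝ)
  set Y := ∫⁻ τ in Ioc a b, ∫⁻ x, ‖U τ x‖ₑ ^ (5 * p / 3)
  calc _ ≤ ENNReal.ofReal p * (ENNReal.ofReal (2400 * (p - 1)) *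
        (F ^ (1 / 5 : ℝ) * Y ^ (3 / 10 : ℝ) * D ^ (1 / 2 : ℝ))) := by
        refine mul_le_mul' le_rfl (mul_le_mul' le_rfl (mul_le_mul' (mul_le_mul'
          (ENNReal.rpow_le_rpow (lintegral_Ioc_mono ht _) (by norm_num))
          (ENNReal.rpow_le_rpow (lintegral_Ioc_mono ht _) (by norm_num))) le_rfl))
    _ = ENNReal.ofReal (p * (2400 * (p - 1))) *
        (F ^ (1 / 5 : ℝ) * Y ^ (3 / 10 : ℝ) * D ^ (1 / 2 : ℝ)) := by
        rw [ENNReal.ofReal_mul hp0.le]; ring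
    _ ≤ ENNReal.ofReal (2400 * p ^ (3 / 2 : ℝ) * p ^ (1 / 2 : ℝ)) *
        (F ^ (1 / 5 : ℝ) * Y ^ (3 / 10 : ℝ) * D ^ (1 / 2 : ℝ)) := by
        refine mul_le_mul' (ENNReal.ofReal_le_ofReal ?_) le_rfl
        rw [mul_assoc, ← Real.rpow_add hp0, show (3 / 2 + 1 / 2 : ℝ) = 2 by norm_num, Real.rpow_two]
        nlinarith
    _ = ENNReal.ofReal (2400 * p ^ (3 / 2 : ℝ)) * (F ^ (1 / 5 : ℝ) * Y ^ (3 / 10 : ℝ)) *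
        (ENNReal.ofReal (p ^ (1 / 2 : ℝ)) * D ^ (1 / 2 : ℝ)) := by
        rw [ENNReal.ofReal_mul (by positivity)]; ring
    _ ≤ _ := mul_le_mul' le_rfl hDle

end IsFlow

end MollifiedEnergy

/-! ### Removal of the mollification -/

section Approximation

variable {F : Type*} [NormedAddCommGroup F] [NormedSpace ℝ F] {f : E3 → F}

theorem norm_sq_mul_heatKernel_one_le (y : E3) :
    ‖y‖ ^ 2 * heatKernel 1 y ≤ 8 * (2 : ℝ) ^ (3 / 2 : ℝ) * heatKernel 2 y := by
  have h1 : ‖y‖ ^ 2 ≤ 8 * Real.exp (‖y‖ ^ 2 / 8) := by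
    have := Real.add_one_le_exp (‖y‖ ^ 2 / 8)
    linarith
  have h2 : (4 * Real.pi * 1) ^ (-(3 / 2) : ℝ) =
      (2 : ℝ) ^ (3 / 2 : ℝ) * (4 * Real.pi * 2) ^ (-(3 / 2) : ℝ) := by
    rw [Real.mul_rpow (x := 4 * Real.pi) (y := 2) (by positivity) (by norm_num), mul_left_comm,
      ← Real.rpow_add two_pos]
    norm_num
  unfold heatKernel
  rw [h2]
  calc _ ≤ (8 * Real.exp (‖y‖ ^ 2 / 8)) * ((2 : ℝ) ^ (3 / 2 : ℝ) *
        (4 * Real.pi * 2) ^ (-(3 / 2) : ℝ) * Real.exp (-‖y‖ ^ 2 / (4 * 1))) := by gcongr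
    _ = 8 * (2 : ℝ) ^ (3 / 2 : ℝ) * (4 * Real.pi * 2) ^ (-(3 / 2) : ℝ) *
        (Real.exp (‖y‖ ^ 2 / 8) * Real.exp (-‖y‖ ^ 2 / (4 * 1))) := by ring
    _ = 8 * (2 : ℝ) ^ (3 / 2 : ℝ) * (4 * Real.pi * 2) ^ (-(3 / 2) : ℝ) *
        Real.exp (-‖y‖ ^ 2 / (4 * 2)) := by
        rw [← Real.exp_add]; congr 2; ring
    _ = _ := by ring

theorem integrable_norm_sq_mul_heatKernel : Integrable fun y : E3 => ‖y‖ ^ 2 * heatKernel 1 y := by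
  refine ((isKernel_heatKernel two_pos).integrable.const_mul (8 * (2 : ℝ) ^ (3 / 2 : ℝ))).mono'
    (((continuous_norm.pow 2).mul
      (isKernel_heatKernel one_pos).continuous).aestronglyMeasurable) (ae_of_all _ fun y => ?_)
  rw [Real.norm_of_nonneg (mul_nonneg (by positivity) (heatKernel_pos one_pos y).le)]
  exact norm_sq_mul_heatKernel_one_le y

theorem abs_pd_heatKernel_mul_norm_le (i : Fin 3) (y : E3) :
    |pd i (heatKernel 1) y| * ‖y‖ ≤ ‖y‖ ^ 2 * heatKernel 1 y := by
  have h0 := (heatKernel_pos one_pos y).le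
  rw [pd_heatKernel, abs_mul, abs_mul, abs_of_nonneg h0]
  have h1 : |y i| ≤ ‖y‖ := PiLp.norm_apply_le y i
  calc _ = (1 / 2) * (|y i| * heatKernel 1 y) * ‖y‖ := by norm_num [abs_of_pos]
    _ ≤ (1 / 2) * (‖y‖ * heatKernel 1 y) * ‖y‖ := by gcongr
    _ ≤ _ := by nlinarith [mul_nonneg (sq_nonneg ‖y‖) h0]

theorem integrable_pd_heatKernel_mul_norm (i : Fin 3) :
    Integrable fun y : E3 => |pd i (heatKernel 1) y| * ‖y‖ := by
  refine integrable_norm_sq_mul_heatKernel.mono'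
    ((((isKernel_heatKernel one_pos).pd i).continuous.abs.mul
      continuous_norm).aestronglyMeasurable) (ae_of_all _ fun y => ?_)
  rw [Real.norm_of_nonneg (by positivity)]
  exact abs_pd_heatKernel_mul_norm_le i y

theorem integrable_heatKernel_mul_norm : Integrable fun y : E3 => heatKernel 1 y * ‖y‖ := by
  refine (integrable_norm_sq_mul_heatKernel.add (isKernel_heatKernel one_pos).integrable).mono'
    (((isKernel_heatKernel one_pos).continuous.mul
      continuous_norm).aestronglyMeasurable) (ae_of_all _ fun y => ?_)
  have h0 := (heatKernel_pos one_pos y).le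
  rw [Real.norm_of_nonneg (by positivity), Pi.add_apply]
  nlinarith [sq_nonneg (‖y‖ - 1), mul_nonneg h0 (sq_nonneg (‖y‖ - 1))]

theorem integral_pd_heatKernel (i : Fin 3) : ∫ y, pd i (heatKernel 1) y = 0 := by
  have h := integral_neg_eq_self (fun y : E3 => pd i (heatKernel 1) y) volume
  have h2 : ∀ y : E3, pd i (heatKernel 1) (-y) = - pd i (heatKernel 1) y := fun y => by
    rw [pd_heatKernel, pd_heatKernel, heatKernel_neg]; simp
  simp only [h2, integral_neg] at h
  linarith

/-- The first moments of the derivatives of the heat kernel. The weight `wt` has no integrable first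
moment; the exponential decay is used instead. -/
theorem integral_pd_heatKernel_smul [CompleteSpace F] (i : Fin 3) (L : E3 →L[ℝ] F) :
    ∫ y, pd i (heatKernel 1) y • L y = - L (EuclideanSpace.single i 1) := by
  have hK := isKernel_heatKernel one_pos
  have hb : ∀ {k : E3 → ℝ}, Continuous k → Integrable (fun y => |k y| * ‖y‖) →
      Integrable fun y => k y • L y := fun {k} hk hi => by
    refine (hi.const_mul ‖L‖).mono' (hk.smul L.continuous).aestronglyMeasurable
      (ae_of_all _ fun y => ?_)
    rw [norm_smul, Real.norm_eq_abs]
    calc |k y| * ‖L y‖ ≤ |k y| * (‖L‖ * ‖y‖) := by gcongr; exact L.le_opNorm y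
      _ = _ := by ring
  have h := integral_smul_fderiv_eq_neg_fderiv_smul_of_integrable (μ := (volume : Measure E3))
    (f := heatKernel 1) (g := L) (v := EuclideanSpace.single i 1) (𝕜 := ℝ) ?_ ?_ ?_ ?_ ?_
  · simp only [ContinuousLinearMap.fderiv] at h
    rw [integral_smul_const, integral_heatKernel one_pos, one_smul] at h
    rw [h, neg_neg]
    rfl
  · exact hb (hK.pd i).continuous (integrable_pd_heatKernel_mul_norm i)
  · simp only [ContinuousLinearMap.fderiv]
    exact hK.integrable.smul_const _
  · refine hb hK.continuous ?_
    simpa only [abs_of_pos (heatKernel_pos one_pos _)] using integrable_heatKernel_mul_norm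
  · exact fun x _ => (hK.smooth.differentiable (by simp)) x
  · exact fun x _ => L.differentiableAt

/-- The heat semigroup is continuous at time `0`. -/
theorem tendsto_cv_heatKernel (hf : IsBC f) (x : E3) {ε : ℕ → ℝ} (hε : ∀ n, 0 < ε n)
    (hε0 : Tendsto ε atTop (nhds 0)) [CompleteSpace F] :
    Tendsto (fun n => cv (heatKernel (ε n)) f x) atTop (nhds (f x)) := by
  obtain ⟨M, hM⟩ := hf.bounded
  have hK := isKernel_heatKernel one_pos
  have hs : Tendsto (fun n => √(ε n)) atTop (nhds 0) := by
    simpa using hε0.sqrt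
  have h1 : ∫ y, heatKernel 1 y • f x = f x := by
    rw [integral_smul_const, integral_heatKernel one_pos, one_smul]
  rw [← h1]
  simp only [fun n => cv_heatKernel_eq (hε n) f x]
  refine tendsto_integral_of_dominated_convergence (fun y => heatKernel 1 y * M) (fun n => ?_)
    (hK.integrable.mul_const M) (fun n => ae_of_all _ fun y => ?_) (ae_of_all _ fun y => ?_)
  · exact (hK.continuous.smul (hf.continuous.comp (by fun_prop))).aestronglyMeasurable
  · rw [norm_smul, Real.norm_of_nonneg (heatKernel_pos one_pos y).le]
    exact mul_le_mul_of_nonneg_left (hM _) (heatKernel_pos one_pos y).le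
  · refine Tendsto.const_smul ?_ _
    refine (hf.continuous.tendsto x).comp ?_
    simpa using (tendsto_const_nhds (x := x)).sub (hs.smul_const y)

/-- For a bounded function, differentiability at a point gives a linear bound of the increments from
that point that holds globally. -/
theorem exists_norm_sub_le (hf : IsBC f) {x : E3} (hd : DifferentiableAt ℝ f x) :
    ∃ C, 0 ≤ C ∧ ∀ y, ‖f y - f x‖ ≤ C * ‖y - x‖ := by
  obtain ⟨M, hM0, hM⟩ := hf.exists_bound
  obtain ⟨c, hc⟩ := hd.isBigO_sub.bound
  obtain ⟨r, hr, hball⟩ := Metric.eventually_nhds_iff.1 hc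
  refine ⟨|c| + 2 * M / r, by positivity, fun y => ?_⟩
  by_cases hy : dist y x < r
  · refine (hball hy).trans (mul_le_mul_of_nonneg_right ?_ (norm_nonneg _))
    exact (le_abs_self c).trans (le_add_of_nonneg_right (by positivity))
  · rw [dist_eq_norm, not_lt] at hy
    calc ‖f y - f x‖ ≤ ‖f y‖ + ‖f x‖ := norm_sub_le _ _
      _ ≤ 2 * M := by linarith [hM y, hM x]
      _ = 2 * M / r * r := by field_simp
      _ ≤ (|c| + 2 * M / r) * ‖y - x‖ := by
          gcongr
          exact le_add_of_nonneg_left (abs_nonneg _)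

/-- The derivatives of a bounded function are approximated by those of its mollifications: since
the derivative of the kernel has mean zero, only difference quotients enter, and these are bounded
linearly at a point of differentiability. -/
theorem tendsto_cv_pd_heatKernel [CompleteSpace F] (hf : IsBC f) {x : E3}
    (hd : DifferentiableAt ℝ f x) (i : Fin 3) {ε : ℕ → ℝ} (hε : ∀ n, 0 < ε n)
    (hε0 : Tendsto ε atTop (nhds 0)) :
    Tendsto (fun n => cv (pd i (heatKernel (ε n))) f x) atTop (nhds (pd i f x)) := by
  obtain ⟨C, hC0, hC⟩ := exists_norm_sub_le hf hd
  have hK := (isKernel_heatKernel one_pos).pd i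
  have hs : Tendsto (fun n => √(ε n)) atTop (nhds 0) := by
    simpa using hε0.sqrt
  have hpos : ∀ n, 0 < √(ε n) := fun n => Real.sqrt_pos.2 (hε n)
  have hlim : pd i f x = ∫ y, pd i (heatKernel 1) y • fderiv ℝ f x (-y) := by
    simp only [map_neg, smul_neg]
    rw [integral_neg, integral_pd_heatKernel_smul, neg_neg]
    rfl
  have hcv : ∀ n, cv (pd i (heatKernel (ε n))) f x =
      ∫ y, pd i (heatKernel 1) y • ((√(ε n))⁻¹ • (f (x + ((√(ε n))⁻¹)⁻¹ • (-y)) - f x)) := fun n => by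
    have e : ∀ y, pd i (heatKernel 1) y • ((√(ε n))⁻¹ • (f (x + ((√(ε n))⁻¹)⁻¹ • (-y)) - f x)) =
        (√(ε n))⁻¹ • (pd i (heatKernel 1) y • f (x - √(ε n) • y) -
          pd i (heatKernel 1) y • f x) := fun y => by
      rw [inv_inv, smul_neg, ← sub_eq_add_neg, smul_comm, smul_sub]
    have hi1 : Integrable fun y => pd i (heatKernel 1) y • f (x - √(ε n) • y) := by
      obtain ⟨M, hM⟩ := hf.bounded
      exact IsBC.integrable_smul (f := fun y => f (x - √(ε n) • y))
        ⟨hf.continuous.comp (by fun_prop), M, fun y => hM _⟩ hK.integrable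
    simp only [e]
    rw [integral_smul, integral_sub hi1 (hK.integrable.smul_const _), integral_smul_const,
      integral_pd_heatKernel, zero_smul, sub_zero, pd_heatKernel_eq_dil (hε n), cv_dil 1 (hε n),
      pow_one]
  rw [hlim]
  simp only [hcv]
  refine tendsto_integral_of_dominated_convergence
    (fun y => C * (|pd i (heatKernel 1) y| * ‖y‖)) (fun n => ?_)
    ((integrable_pd_heatKernel_mul_norm i).const_mul C) (fun n => ae_of_all _ fun y => ?_)
    (ae_of_all _ fun y => ?_)
  · refine (hK.continuous.smul (continuous_const.smul
      ((hf.continuous.comp ?_).sub continuous_const))).aestronglyMeasurable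
    fun_prop
  · rw [norm_smul, norm_smul, Real.norm_eq_abs, Real.norm_of_nonneg (by positivity)]
    have h := hC (x + ((√(ε n))⁻¹)⁻¹ • (-y))
    rw [add_sub_cancel_left, inv_inv, norm_smul, norm_neg, Real.norm_of_nonneg (hpos n).le] at h
    rw [inv_inv]
    calc _ ≤ |pd i (heatKernel 1) y| * ((√(ε n))⁻¹ * (C * (√(ε n) * ‖y‖))) := by gcongr
      _ = C * (|pd i (heatKernel 1) y| * ‖y‖) * ((√(ε n))⁻¹ * √(ε n)) := by ring
      _ = _ := by rw [inv_mul_cancel₀ (hpos n).ne', mul_one]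
  · refine Tendsto.const_smul ?_ _
    refine hd.hasFDerivAt.lim (-y) (c := fun n => (√(ε n))⁻¹) ?_
    have : Tendsto (fun n => (√(ε n))⁻¹) atTop atTop :=
      tendsto_inv_nhdsGT_zero.comp (tendsto_nhdsWithin_iff.2
        ⟨hs, Eventually.of_forall fun n => hpos n⟩)
    exact tendsto_norm_atTop_atTop.comp this

end Approximation

theorem lintegral_le_liminf_of_tendsto {α : Type*} [MeasurableSpace α] {μ : Measure α}
    {φ : ℕ → α → ℝ≥0∞} {ψ : α → ℝ≥0∞} (hm : ∀ n, Measurable (φ n))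
    (h : ∀ x, Tendsto (fun n => φ n x) atTop (nhds (ψ x))) :
    ∫⁻ x, ψ x ∂μ ≤ liminf (fun n => ∫⁻ x, φ n x ∂μ) atTop := by
  refine le_trans (le_of_eq (lintegral_congr fun x => ?_)) (lintegral_liminf_le hm)
  exact (h x).liminf_eq.symm

/-- Lower limits may be taken separately in the two summands of a bounded sum. -/
theorem add_const_mul_le_of_liminf {A B c Y : ℝ≥0∞} {α β : ℕ → ℝ≥0∞}
    (hA : A ≤ liminf α atTop) (hB : B ≤ liminf β atTop) (h : ∀ n, α n + c * β n ≤ Y) :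
    A + c * B ≤ Y := by
  refine (add_le_add hA (mul_le_mul' le_rfl hB)).trans ?_
  rw [liminf_eq_iSup_iInf_of_nat, liminf_eq_iSup_iInf_of_nat, ENNReal.mul_iSup,
    ENNReal.iSup_add_iSup_of_monotone]
  · refine iSup_le fun n => le_trans (add_le_add (iInf₂_le n le_rfl)
      (mul_le_mul' le_rfl (iInf₂_le n le_rfl))) (h n)
  · exact fun m n hmn => le_iInf₂ fun i hi => iInf₂_le i (hmn.trans hi)
  · exact fun m n hmn => mul_le_mul' le_rfl (le_iInf₂ fun i hi => iInf₂_le i (hmn.trans hi))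

section Limit

variable {a b : ℝ} {p : ℝ}

theorem tendsto_dissDensity (hp : 4 ≤ p) {v : ℕ → E3 → E3} {w : E3 → E3} {x : E3}
    (hv : Tendsto (fun n => v n x) atTop (nhds (w x)))
    (hd : ∀ i, Tendsto (fun n => pd i (v n) x) atTop (nhds (pd i w x))) :
    Tendsto (fun n => dissDensity p (v n) x) atTop (nhds (dissDensity p w x)) := by
  unfold dissDensity
  refine tendsto_finsetSum _ fun i _ => ?_
  have h1 : Tendsto (fun n => ‖v n x‖ ^ (p - 2)) atTop (nhds (‖w x‖ ^ (p - 2))) :=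
    hv.norm.rpow_const (Or.inr (by linarith))
  have h2 : Tendsto (fun n => ‖v n x‖ ^ (p - 4)) atTop (nhds (‖w x‖ ^ (p - 4))) :=
    hv.norm.rpow_const (Or.inr (by linarith))
  have h3 : Tendsto (fun n => inner ℝ (v n x) (pd i (v n) x)) atTop
      (nhds (inner ℝ (w x) (pd i w x))) := hv.inner (hd i)
  exact (h1.mul ((hd i).norm.pow 2)).add ((h2.const_mul (p - 2)).mul (h3.pow 2))

/-- Bounds for the mollified energy pass to the limit by Fatou's lemma. -/
theorem IsFlow.limit_energy_le {U : ℝ → E3 → E3} (hU : IsFlow a b U) (hp : 4 ≤ p) {t : ℝ}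
    (hd : ∀ τ, Differentiable ℝ (U τ)) {Y : ℝ≥0∞}
    (hY : ∀ ε : ℝ, 0 < ε → mollEnergy p a t ε U ≤ Y) :
    (∫⁻ x, ‖U t x‖ₑ ^ p) + ENNReal.ofReal p *
      ∫⁻ τ in Ioc a t, ∫⁻ x, ENNReal.ofReal (dissDensity p (U τ) x) ≤ Y := by
  set ε : ℕ → ℝ := fun n => 1 / ((n : ℝ) + 1) with hεdef
  have hε : ∀ n, 0 < ε n := fun n => by positivity
  have hε0 : Tendsto ε atTop (nhds 0) := tendsto_one_div_add_atTop_nhds_zero_nat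
  have hv : ∀ τ x, Tendsto (fun n => cv (heatKernel (ε n)) (U τ) x) atTop (nhds (U τ x)) :=
    fun τ x => tendsto_cv_heatKernel (hU.isBC τ) x hε hε0
  have hdv : ∀ τ x i, Tendsto (fun n => pd i (cv (heatKernel (ε n)) (U τ)) x) atTop
      (nhds (pd i (U τ) x)) := fun τ x i => by
    simp only [fun n => hU.pd_moll (hε n) i τ]
    exact tendsto_cv_pd_heatKernel (hU.isBC τ) (hd τ x) i hε hε0
  have hdd : ∀ τ x, Tendsto (fun n => ENNReal.ofReal
      (dissDensity p (cv (heatKernel (ε n)) (U τ)) x)) atTop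
      (nhds (ENNReal.ofReal (dissDensity p (U τ) x))) := fun τ x =>
    ENNReal.tendsto_ofReal (tendsto_dissDensity hp (hv τ x) (hdv τ x))
  have hcd : ∀ n, Measurable fun z : ℝ × E3 =>
      ENNReal.ofReal (dissDensity p (cv (heatKernel (ε n)) (U z.1)) z.2) := fun n =>
    (hU.continuous_dissDensity_moll (hε n) hp).measurable.ennreal_ofReal
  refine add_const_mul_le_of_liminf (α := fun n => ∫⁻ x, ‖cv (heatKernel (ε n)) (U t) x‖ₑ ^ p)
    (β := fun n => ∫⁻ τ in Ioc a t, ∫⁻ x, ENNReal.ofReal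
      (dissDensity p (cv (heatKernel (ε n)) (U τ)) x)) ?_ ?_ fun n => hY _ (hε n)
  · refine lintegral_le_liminf_of_tendsto (fun n => ?_) fun x => ?_
    · exact ((hU.isNice_moll (hε n) t).continuous.measurable.enorm.pow_const p)
    · exact ((hv t x).enorm).ennrpow_const p
  · have h1 : ∀ τ, ∫⁻ x, ENNReal.ofReal (dissDensity p (U τ) x) ≤ liminf (fun n => ∫⁻ x,
        ENNReal.ofReal (dissDensity p (cv (heatKernel (ε n)) (U τ)) x)) atTop := fun τ => by
      have hm : ∀ n, Measurable fun x => ENNReal.ofReal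
          (dissDensity p (cv (heatKernel (ε n)) (U τ)) x) := fun n => by
        have := (hU.continuous_dissDensity_moll (hε n) hp).along_snd (x := τ)
        exact this.measurable.ennreal_ofReal
      exact lintegral_le_liminf_of_tendsto hm fun x => hdd τ x
    exact (lintegral_mono h1).trans (lintegral_liminf_le fun n => (hcd n).lintegral_prod_right')

/-- The two densities in `dissipation` add up to `p` times `dissDensity`. -/
theorem dissipation_density_eq (hp : 4 ≤ p) {v : E3 → E3} {x : E3} (hv : DifferentiableAt ℝ v x) :
    ENNReal.ofReal p * (gradSq v x * ‖v x‖ₑ ^ (p - 2)) +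
      ENNReal.ofReal (4 * (p - 2) / p) * gradSq (fun y => ‖v y‖ ^ (p / 2)) x =
    ENNReal.ofReal p * ENNReal.ofReal (dissDensity p v x) := by
  have hp0 : 0 < p := by linarith
  have hp2 : 0 ≤ p - 2 := by linarith
  have hg : ∀ {F : Type} [NormedAddCommGroup F] [NormedSpace ℝ F] (f : E3 → F),
      gradSq f x = ENNReal.ofReal (∑ i : Fin 3, ‖pd i f x‖ ^ 2) := fun f => by
    rw [ENNReal.ofReal_sum_of_nonneg fun i _ => sq_nonneg _]
    exact Finset.sum_congr rfl fun i _ => by rw [ENNReal.ofReal_pow (norm_nonneg _), ofReal_norm]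
  rw [hg, hg, ← ofReal_norm (v x), ENNReal.ofReal_rpow_of_nonneg (norm_nonneg _) hp2,
    ← ENNReal.ofReal_mul (Finset.sum_nonneg fun i _ => sq_nonneg _),
    ← ENNReal.ofReal_mul hp0.le, ← ENNReal.ofReal_mul (by positivity),
    ← ENNReal.ofReal_mul hp0.le, ← ENNReal.ofReal_add (by positivity) (by positivity)]
  congr 1
  have h1 : ∀ i, ‖pd i (fun y => ‖v y‖ ^ (p / 2)) x‖ ^ 2 =
      (p ^ 2 / 4) * (‖v x‖ ^ (p - 4) * inner ℝ (v x) (pd i v x) ^ 2) := fun i => by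
    rw [pd_norm_rpow (by linarith) hv, Real.norm_eq_abs, sq_abs, mul_pow, mul_pow]
    have : ‖v x‖ ^ (p - 4) = (‖v x‖ ^ (p / 2 - 2)) ^ 2 := by
      rw [← Real.rpow_natCast, ← Real.rpow_mul (norm_nonneg _)]
      congr 1; push_cast; ring
    rw [this]; ring
  simp only [h1, dissDensity, Finset.mul_sum, Finset.sum_mul, ← Finset.sum_add_distrib]
  refine Finset.sum_congr rfl fun i _ => ?_
  field_simp

/-- Only an upper bound for `dissipation` is needed, for which the superadditivity of the lower
integral is enough; the densities need not be known to be measurable. -/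
theorem dissipation_le (hp : 4 ≤ p) {v : ℝ → E3 → E3} {t : ℝ}
    (hv : ∀ τ ∈ Ioo a t, Differentiable ℝ (v τ)) :
    dissipation p a t v ≤ ENNReal.ofReal p *
      ∫⁻ τ in Ioo a t, ∫⁻ x, ENNReal.ofReal (dissDensity p (v τ) x) := by
  unfold dissipation
  simp only [← lintegral_const_mul' _ _ ENNReal.ofReal_ne_top]
  refine (le_lintegral_add _ _).trans (setLIntegral_mono' measurableSet_Ioo fun τ hτ => ?_)
  refine (le_lintegral_add _ _).trans (lintegral_mono fun x => ?_)
  exact (dissipation_density_eq hp (hv τ hτ x)).le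

theorem IsSmoothBoundedLerayHopf.contDiff {u : ℝ → E3 → E3}
    (hu : IsSmoothBoundedLerayHopf a b u) {t : ℝ} (ht : t ∈ Icc a b) : ContDiff ℝ ∞ (u t) := by
  rw [← contDiffOn_univ]
  exact hu.smooth.comp (f := fun x : E3 => (t, x)) (by fun_prop) fun x _ => ⟨ht, mem_univ _⟩

/-- The quadratic inequality for the running `L^p` energy. It does not pass to limits and suprema
directly, but the equivalent bound by the largest solution of the quadratic inequality does. -/
theorem IsSmoothBoundedLerayHopf.energy_le {u : ℝ → E3 → E3} (hab : a < b)
    (hu : IsSmoothBoundedLerayHopf a b u) (hp : 4 ≤ p) {E : ℝ≥0∞}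
    (hE : E = ⨆ s ∈ Icc a b, ((∫⁻ x, ‖u s x‖ₑ ^ p) + dissipation p a s u)) :
    E ≠ ⊤ ∧ E ≤ (∫⁻ x, ‖u a x‖ₑ ^ p) + ENNReal.ofReal (2400 * p ^ (3 / 2 : ℝ)) *
      ((∫⁻ τ in Ioo a b, ∫⁻ x, ‖u τ x‖ₑ ^ (5 : ℝ)) ^ (1 / 5 : ℝ) *
      (∫⁻ τ in Ioo a b, ∫⁻ x, ‖u τ x‖ₑ ^ (5 * p / 3)) ^ (3 / 10 : ℝ)) * E ^ (1 / 2 : ℝ) := by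
  have hU := hu.isFlow hab
  set U : ℝ → E3 → E3 := fun t => u (projIcc a b hab.le t) with hUdef
  have hUu : ∀ t ∈ Icc a b, U t = u t := fun t ht => by rw [hUdef]; simp only [projIcc_of_mem _ ht]
  have hd : ∀ τ, Differentiable ℝ (U τ) := fun τ =>
    (hu.contDiff (projIcc a b hab.le τ).2).differentiable (by simp)
  have hI : ∀ {t : ℝ} (ht : t ∈ Icc a b) (φ : (E3 → E3) → ℝ≥0∞),
      ∫⁻ τ in Ioc a t, φ (U τ) = ∫⁻ τ in Ioo a t, φ (u τ) := fun {t} ht φ => by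
    rw [← setLIntegral_congr (Ioo_ae_eq_Ioc)]
    exact setLIntegral_congr_fun measurableSet_Ioo fun τ hτ => by
      simp only [hUu τ ⟨hτ.1.le, hτ.2.le.trans ht.2⟩]
  have hb := right_mem_Icc.2 hab.le
  rw [← hUu a (left_mem_Icc.2 hab.le), ← hI hb fun w => ∫⁻ x, ‖w x‖ₑ ^ (5 : ℝ),
    ← hI hb fun w => ∫⁻ x, ‖w x‖ₑ ^ (5 * p / 3)]
  set B := ENNReal.ofReal (2400 * p ^ (3 / 2 : ℝ)) *
      ((∫⁻ τ in Ioc a b, ∫⁻ x, ‖U τ x‖ₑ ^ (5 : ℝ)) ^ (1 / 5 : ℝ) *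
      (∫⁻ τ in Ioc a b, ∫⁻ x, ‖U τ x‖ₑ ^ (5 * p / 3)) ^ (3 / 10 : ℝ)) with hB
  have hBt : B ≠ ⊤ := ENNReal.mul_ne_top ENNReal.ofReal_ne_top (ENNReal.mul_ne_top
    (ENNReal.rpow_ne_top_of_nonneg (by norm_num)
      (hU.lintegral_space_time_rpow_lt_top (by norm_num) b).ne)
    (ENNReal.rpow_ne_top_of_nonneg (by norm_num)
      (hU.lintegral_space_time_rpow_lt_top (by linarith) b).ne))
  have hAt : ∫⁻ x, ‖U a x‖ₑ ^ p ≠ ⊤ := by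
    obtain ⟨A, hA⟩ := hU.lintegral_enorm_sq_le
    obtain ⟨M, hM0, hM, -⟩ := hU.exists_bound
    refine ((lintegral_mono fun x => ?_).trans_lt (b := ∫⁻ x, ENNReal.ofReal (M ^ (p - 2)) *
      ‖U a x‖ₑ ^ (2 : ℝ)) ?_).ne
    · rw [← ofReal_norm, ENNReal.ofReal_rpow_of_nonneg (norm_nonneg _) (by linarith),
        ENNReal.ofReal_rpow_of_nonneg (norm_nonneg _) (by norm_num),
        ← ENNReal.ofReal_mul (by positivity), Real.rpow_two]
      exact ENNReal.ofReal_le_ofReal (norm_rpow_le (by linarith) (hM a x))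
    · rw [lintegral_const_mul' _ _ ENNReal.ofReal_ne_top]
      exact ENNReal.mul_lt_top ENNReal.ofReal_lt_top ((hA a).trans_lt ENNReal.ofReal_lt_top)
  obtain ⟨Y, hYt, hY⟩ := exists_le_iff_le_add_mul_rpow_half hAt hBt
  have hEY : E ≤ Y := by
    rw [hE]
    refine iSup₂_le fun s hs => ?_
    refine le_trans ?_ (hU.limit_energy_le hp (t := s) hd fun ε hε => ?_)
    · rw [← hUu s hs, hI hs fun w => ∫⁻ x, ENNReal.ofReal (dissDensity p w x)]
      refine add_le_add le_rfl (dissipation_le hp fun τ hτ => ?_)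
      rw [← hUu τ ⟨hτ.1.le, hτ.2.le.trans hs.2⟩]
      exact hd τ
    · refine (hY _ ?_).1 (hU.mollEnergy_le_add_mul_rpow_half hε hp hs)
      rw [hU.mollEnergy_eq hε hp hs.1]
      exact ENNReal.ofReal_ne_top
  have hEt : E ≠ ⊤ := ne_top_of_le_ne_top hYt hEY
  exact ⟨hEt, (hY E hEt).2 hEY⟩

end Limit

/-! ### Sobolev's inequality -/

section Sobolev

theorem enorm_fderiv_sq_le (f : E3 → ℝ) (x : E3) : ‖fderiv ℝ f x‖ₑ ^ 2 ≤ 3 * gradSq f x := by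
  have h2 : ‖fderiv ℝ f x‖ ^ 2 ≤ 3 * ∑ i : Fin 3, ‖pd i f x‖ ^ 2 := by
    refine (pow_le_pow_left₀ (norm_nonneg _) (norm_fderiv_le_sum_pd f x) 2).trans ?_
    simpa using sq_sum_le_card_mul_sum_sq (s := Finset.univ) (f := fun i : Fin 3 => ‖pd i f x‖)
  have h3 := ENNReal.ofReal_le_ofReal h2
  rw [ENNReal.ofReal_pow (norm_nonneg _), ofReal_norm, ENNReal.ofReal_mul (by norm_num),
    ENNReal.ofReal_sum_of_nonneg fun i _ => sq_nonneg _] at h3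
  refine h3.trans_eq ?_
  unfold gradSq
  rw [ENNReal.ofReal_ofNat]
  congr 1
  exact Finset.sum_congr rfl fun i _ => by rw [ENNReal.ofReal_pow (norm_nonneg _), ofReal_norm]

theorem gradSq_mul_le {χ w : E3 → ℝ} {x : E3} (hχ : DifferentiableAt ℝ χ x)
    (hw : DifferentiableAt ℝ w x) (h1 : |χ x| ≤ 1) {c : ℝ} (hc : ∀ i, |pd i χ x| ≤ c) :
    gradSq (fun y => χ y * w y) x ≤ 2 * gradSq w x + ENNReal.ofReal (6 * c ^ 2) * ‖w x‖ₑ ^ 2 := by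
  have hc0 : 0 ≤ c := (abs_nonneg _).trans (hc 0)
  have h : ∀ i, ‖pd i (fun y => χ y * w y) x‖ₑ ^ 2 ≤
      2 * ‖pd i w x‖ₑ ^ 2 + ENNReal.ofReal (2 * c ^ 2) * ‖w x‖ₑ ^ 2 := fun i => by
    have hr : ‖pd i (fun y => χ y * w y) x‖ ^ 2 ≤ 2 * ‖pd i w x‖ ^ 2 + 2 * c ^ 2 * ‖w x‖ ^ 2 := by
      rw [pd_mul i hχ hw]
      have e1 : ‖pd i χ x * w x‖ ≤ c * ‖w x‖ := by
        rw [norm_mul]; exact mul_le_mul_of_nonneg_right (hc i) (norm_nonneg _)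
      have e2 : ‖χ x * pd i w x‖ ≤ ‖pd i w x‖ := by
        rw [norm_mul]; exact mul_le_of_le_one_left (norm_nonneg _) h1
      have e3 : ‖pd i χ x * w x + χ x * pd i w x‖ ≤ c * ‖w x‖ + ‖pd i w x‖ :=
        (norm_add_le _ _).trans (add_le_add e1 e2)
      have e5 : (c * ‖w x‖ + ‖pd i w x‖) ^ 2 ≤ 2 * ‖pd i w x‖ ^ 2 + 2 * c ^ 2 * ‖w x‖ ^ 2 := by
        nlinarith [sq_nonneg (c * ‖w x‖ - ‖pd i w x‖)]
      exact (pow_le_pow_left₀ (norm_nonneg _) e3 2).trans e5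
    have := ENNReal.ofReal_le_ofReal hr
    rwa [ENNReal.ofReal_add (by positivity) (by positivity), ENNReal.ofReal_mul (p := 2) (by norm_num),
      ENNReal.ofReal_mul (p := 2 * c ^ 2) (by positivity), ENNReal.ofReal_pow (norm_nonneg _),
      ENNReal.ofReal_pow (norm_nonneg _), ENNReal.ofReal_pow (norm_nonneg _), ofReal_norm,
      ofReal_norm, ofReal_norm, ENNReal.ofReal_ofNat] at this
  refine (Finset.sum_le_sum fun i _ => h i).trans_eq ?_
  rw [Finset.sum_add_distrib, ← Finset.mul_sum]
  simp only [Finset.sum_const, Finset.card_univ, Fintype.card_fin, nsmul_eq_mul]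
  rw [← mul_assoc]
  congr 2
  rw [show 6 * c ^ 2 = 3 * (2 * c ^ 2) by ring, ENNReal.ofReal_mul (p := 3) (by norm_num)]
  simp

/-- The Sobolev inequality `‖w‖₆² ≤ K ‖∇w‖₂²`, with compact support replaced by square
integrability. -/
theorem exists_sobolev : ∃ K : NNReal, K ≠ 0 ∧ ∀ w : E3 → ℝ, ContDiff ℝ 1 w →
    ∫⁻ x, ‖w x‖ₑ ^ (2 : ℝ) ≠ ⊤ →
    (∫⁻ x, ‖w x‖ₑ ^ (6 : ℝ)) ^ (1 / 3 : ℝ) ≤ K * ∫⁻ x, gradSq w x := by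
  set k := SNormLESNormFDerivOfEqConst ℝ (volume : Measure E3) ((2 : NNReal) : ℝ) with hk
  have hcpt : ∀ f : E3 → ℝ, ContDiff ℝ 1 f → HasCompactSupport f →
      (∫⁻ x, ‖f x‖ₑ ^ (6 : ℝ)) ^ (1 / 3 : ℝ) ≤ 3 * (k : ℝ≥0∞) ^ 2 * ∫⁻ x, gradSq f x := by
    intro f hf hfc
    have h := eLpNorm_le_eLpNorm_fderiv_of_eq (μ := (volume : Measure E3)) hf hfc
      (p := 2) (p' := 6) one_le_two (by simp) (by simp; norm_num)
    rw [← hk, eLpNorm_nnreal_eq_lintegral (by norm_num), eLpNorm_nnreal_eq_lintegral (by norm_num)]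
      at h
    have h2 := ENNReal.rpow_le_rpow h (z := 2) (by norm_num)
    rw [← ENNReal.rpow_mul, ENNReal.mul_rpow_of_nonneg _ _ (by norm_num), ← ENNReal.rpow_mul] at h2
    rw [show (1 / ((6 : NNReal) : ℝ) * 2) = 1 / 3 by norm_num,
      show (1 / ((2 : NNReal) : ℝ) * 2) = 1 by norm_num, ENNReal.rpow_one] at h2
    simp only [NNReal.coe_ofNat, ENNReal.rpow_two] at h2
    refine h2.trans ?_
    rw [mul_comm 3, mul_assoc]
    refine mul_le_mul' le_rfl ?_
    rw [← lintegral_const_mul' _ _ (by norm_num)]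
    exact lintegral_mono fun x => enorm_fderiv_sq_le f x
  -- the cutoff at radius `R` costs `6 (c / R)² ‖w‖₂²`, which tends to zero
  obtain ⟨c, hc0, hc⟩ := exists_bound_pd_cutoff
  refine ⟨6 * k ^ 2 + 1, by positivity, fun w hw hw2 => ?_⟩
  set G := ∫⁻ x, gradSq w x
  set W := ∫⁻ x, ‖w x‖ₑ ^ (2 : ℝ)
  have hR : ∀ n : ℕ, 0 < (n : ℝ) + 1 := fun n => by positivity
  have hn : ∀ n : ℕ, ∫⁻ x, ‖cutoff (n + 1) x * w x‖ₑ ^ (6 : ℝ) ≤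
      (3 * (k : ℝ≥0∞) ^ 2 * (2 * G + ENNReal.ofReal (6 * (c / (n + 1)) ^ 2) * W)) ^ (3 : ℝ) := by
    intro n
    have hχ := contDiff_cutoff ((n : ℝ) + 1)
    have h := hcpt (fun x => cutoff (n + 1) x * w x)
      ((hχ.of_le (by exact_mod_cast le_top)).mul hw) ((hasCompactSupport_cutoff (hR n)).mul_right)
    have h3 := ENNReal.rpow_le_rpow h (z := 3) (by norm_num)
    rw [← ENNReal.rpow_mul, show (1 / 3 * 3 : ℝ) = 1 by norm_num, ENNReal.rpow_one] at h3
    refine h3.trans (ENNReal.rpow_le_rpow (mul_le_mul' le_rfl ?_) (by norm_num))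
    have hm : Measurable fun x => ENNReal.ofReal (6 * (c / (n + 1)) ^ 2) * ‖w x‖ₑ ^ (2 : ℝ) :=
      (hw.continuous.measurable.enorm.pow_const _).const_mul _
    calc _ ≤ ∫⁻ x, (2 * gradSq w x +
          ENNReal.ofReal (6 * (c / (n + 1)) ^ 2) * ‖w x‖ₑ ^ (2 : ℝ)) := by
          refine lintegral_mono fun x => ?_
          rw [ENNReal.rpow_two]
          exact gradSq_mul_le (hχ.differentiable (by simp) x) (hw.differentiable one_ne_zero x)
            (abs_le.2 ⟨by linarith [cutoff_nonneg ((n : ℝ) + 1) x], cutoff_le_one _ x⟩)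
            fun i => hc _ (hR n) i x
      _ = _ := by
          rw [lintegral_add_right _ hm, lintegral_const_mul' _ _ (by norm_num),
            lintegral_const_mul' _ _ ENNReal.ofReal_ne_top]
  have hlim : Tendsto (fun n : ℕ =>
      (3 * (k : ℝ≥0∞) ^ 2 * (2 * G + ENNReal.ofReal (6 * (c / (n + 1)) ^ 2) * W)) ^ (3 : ℝ)) atTop
      (nhds ((3 * (k : ℝ≥0∞) ^ 2 * (2 * G + 0)) ^ (3 : ℝ))) := by
    refine Tendsto.ennrpow_const _ (ENNReal.Tendsto.const_mul ?_ (Or.inr (by finiteness)))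
    refine tendsto_const_nhds.add ?_
    have h0 : Tendsto (fun n : ℕ => 6 * (c / ((n : ℝ) + 1)) ^ 2) atTop (nhds (6 * (c * 0) ^ 2)) := by
      refine ((Tendsto.const_mul c ?_).pow 2).const_mul 6
      simpa using tendsto_one_div_add_atTop_nhds_zero_nat (𝕜 := ℝ)
    have h1 := ENNReal.Tendsto.mul_const (ENNReal.tendsto_ofReal h0) (b := W) (Or.inr hw2)
    simpa using h1
  have hF : ∫⁻ x, ‖w x‖ₑ ^ (6 : ℝ) ≤ (3 * (k : ℝ≥0∞) ^ 2 * (2 * G + 0)) ^ (3 : ℝ) := by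
    refine le_trans (lintegral_le_liminf_of_tendsto
      (φ := fun (n : ℕ) x => ‖cutoff (n + 1) x * w x‖ₑ ^ (6 : ℝ)) (fun n => ?_) fun x => ?_)
      ((liminf_le_liminf (Eventually.of_forall hn)).trans_eq hlim.liminf_eq)
    · exact ((contDiff_cutoff _).continuous.mul hw.continuous).measurable.enorm.pow_const _
    · refine tendsto_const_nhds.congr' ?_
      obtain ⟨N, hN⟩ := exists_nat_ge ‖x‖
      filter_upwards [eventually_ge_atTop N] with n hn
      have : (N : ℝ) ≤ n := by exact_mod_cast hn
      rw [cutoff_eq_one (hR n) (by linarith), one_mul]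
  have h := ENNReal.rpow_le_rpow hF (z := 1 / 3) (by norm_num)
  rw [← ENNReal.rpow_mul, show (3 * (1 / 3) : ℝ) = 1 by norm_num, ENNReal.rpow_one, add_zero] at h
  refine h.trans ?_
  push_cast
  calc 3 * (k : ℝ≥0∞) ^ 2 * (2 * G) = (6 * (k : ℝ≥0∞) ^ 2) * G := by ring
    _ ≤ _ := mul_le_mul' le_self_add le_rfl

/-- The Gagliardo-Nirenberg interpolation inequality for `|v|^(p/2)` at a fixed time. -/
theorem lintegral_rpow_le_of_sobolev {K : NNReal} (hK : ∀ w : E3 → ℝ, ContDiff ℝ 1 w →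
    ∫⁻ x, ‖w x‖ₑ ^ (2 : ℝ) ≠ ⊤ →
    (∫⁻ x, ‖w x‖ₑ ^ (6 : ℝ)) ^ (1 / 3 : ℝ) ≤ K * ∫⁻ x, gradSq w x) {p : ℝ} (hp : 4 ≤ p)
    {v : E3 → E3} (hv : ContDiff ℝ 1 v) {E : ℝ≥0∞} (hEt : E ≠ ⊤) (hE : ∫⁻ x, ‖v x‖ₑ ^ p ≤ E) :
    ∫⁻ x, ‖v x‖ₑ ^ (5 * p / 3) ≤
      E ^ (2 / 3 : ℝ) * (K * ∫⁻ x, gradSq (fun y => ‖v y‖ ^ (p / 2)) x) := by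
  have hpow : ∀ (r : ℝ), 0 ≤ r → ∀ x, ‖‖v x‖ ^ (p / 2)‖ₑ ^ r = ‖v x‖ₑ ^ (p / 2 * r) := fun r hr x => by
    rw [Real.enorm_rpow_of_nonneg (norm_nonneg _) (by linarith), enorm_norm, ENNReal.rpow_mul]
  have hw : ContDiff ℝ 1 fun y => ‖v y‖ ^ (p / 2) := (contDiff_norm_rpow (by linarith)).comp hv
  have hw2 : ∫⁻ x, ‖‖v x‖ ^ (p / 2)‖ₑ ^ (2 : ℝ) = ∫⁻ x, ‖v x‖ₑ ^ p :=
    lintegral_congr fun x => by rw [hpow _ (by norm_num)]; congr 1; ring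
  have hm : ∀ r : ℝ, AEMeasurable fun x => ‖v x‖ₑ ^ r := fun r =>
    (hv.continuous.measurable.enorm.pow_const r).aemeasurable
  calc ∫⁻ x, ‖v x‖ₑ ^ (5 * p / 3) =
      ∫⁻ x, (‖v x‖ₑ ^ p) ^ (2 / 3 : ℝ) * (‖v x‖ₑ ^ (p / 2 * 6)) ^ (1 / 3 : ℝ) := by
        refine lintegral_congr fun x => ?_
        rw [← ENNReal.rpow_mul, ← ENNReal.rpow_mul,
          ← ENNReal.rpow_add_of_nonneg _ _ (by linarith) (by linarith)]
        congr 1; ring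
    _ ≤ (∫⁻ x, ‖v x‖ₑ ^ p) ^ (2 / 3 : ℝ) * (∫⁻ x, ‖v x‖ₑ ^ (p / 2 * 6)) ^ (1 / 3 : ℝ) :=
        ENNReal.lintegral_mul_norm_pow_le (hm _) (hm _) (by norm_num) (by norm_num) (by norm_num)
    _ ≤ _ := by
        refine mul_le_mul' (ENNReal.rpow_le_rpow hE (by norm_num)) ?_
        have h := hK _ hw (by rw [hw2]; exact ne_top_of_le_ne_top hEt hE)
        simp only [hpow 6 (by norm_num)] at h
        exact h

end Sobolev

/-! ### The energy inequality -/

section Conclusion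

variable {a b p : ℝ} {u : ℝ → E3 → E3}

/-- The energy inequality with the `L^(5p/3)` norm bounded by the energy itself, which is possible by
Sobolev's inequality. -/
theorem exists_const_energy_le : ∃ c : ℝ, 0 < c ∧ ∀ {a b p : ℝ} {u : ℝ → E3 → E3}, a < b → 4 ≤ p →
    IsSmoothBoundedLerayHopf a b u → ∀ {E : ℝ≥0∞},
    E = (⨆ s ∈ Icc a b, ((∫⁻ x, ‖u s x‖ₑ ^ p) + dissipation p a s u)) →
    E ≠ ⊤ ∧ E ≤ (∫⁻ x, ‖u a x‖ₑ ^ p) + ENNReal.ofReal (c * p ^ (3 / 2 : ℝ)) *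
      (∫⁻ τ in Ioo a b, ∫⁻ x, ‖u τ x‖ₑ ^ (5 : ℝ)) ^ (1 / 5 : ℝ) * E := by
  obtain ⟨K, hK0, hK⟩ := exists_sobolev
  have hKr : 0 < (K : ℝ) ^ (3 / 10 : ℝ) :=
    Real.rpow_pos_of_pos (NNReal.coe_pos.2 (pos_iff_ne_zero.2 hK0)) _
  refine ⟨2400 * (K : ℝ) ^ (3 / 10 : ℝ), by positivity, fun {a b p u} hab hp hu {E} hE => ?_⟩
  obtain ⟨hEt, hle⟩ := hu.energy_le hab hp hE
  refine ⟨hEt, hle.trans (add_le_add le_rfl ?_)⟩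
  have hs : ∀ s ∈ Icc a b, (∫⁻ x, ‖u s x‖ₑ ^ p) + dissipation p a s u ≤ E := fun s hs => by
    rw [hE]; exact le_iSup₂ (f := fun s (_ : s ∈ Icc a b) =>
      (∫⁻ x, ‖u s x‖ₑ ^ p) + dissipation p a s u) s hs
  have hG : ∫⁻ τ in Ioo a b, ∫⁻ x, gradSq (fun y => ‖u τ y‖ ^ (p / 2)) x ≤ E := by
    refine le_trans ?_ ((le_add_self.trans (le_add_self)).trans (hs b (right_mem_Icc.2 hab.le)))
    refine le_mul_of_one_le_left' ?_
    rw [← ENNReal.ofReal_one]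
    refine ENNReal.ofReal_le_ofReal ?_
    rw [le_div_iff₀ (by linarith)]
    linarith
  have hY : ∫⁻ τ in Ioo a b, ∫⁻ x, ‖u τ x‖ₑ ^ (5 * p / 3) ≤ K * E ^ (5 / 3 : ℝ) := by
    calc _ ≤ ∫⁻ τ in Ioo a b, E ^ (2 / 3 : ℝ) *
          (K * ∫⁻ x, gradSq (fun y => ‖u τ y‖ ^ (p / 2)) x) := by
          refine setLIntegral_mono' measurableSet_Ioo fun τ hτ => ?_
          have hτ' : τ ∈ Icc a b := ⟨hτ.1.le, hτ.2.le⟩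
          exact lintegral_rpow_le_of_sobolev hK hp
            ((hu.contDiff hτ').of_le (by exact_mod_cast le_top)) hEt (le_self_add.trans (hs τ hτ'))
      _ = E ^ (2 / 3 : ℝ) * (K * ∫⁻ τ in Ioo a b, ∫⁻ x, gradSq (fun y => ‖u τ y‖ ^ (p / 2)) x) := by
          rw [lintegral_const_mul' _ _ (ENNReal.rpow_ne_top_of_nonneg (by norm_num) hEt),
            lintegral_const_mul' _ _ ENNReal.coe_ne_top]
      _ ≤ E ^ (2 / 3 : ℝ) * (K * E) := mul_le_mul' le_rfl (mul_le_mul' le_rfl hG)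
      _ = K * (E ^ (2 / 3 : ℝ) * E ^ (1 : ℝ)) := by rw [ENNReal.rpow_one]; ring
      _ = _ := by
          rw [← ENNReal.rpow_add_of_nonneg _ _ (by norm_num) (by norm_num)]
          norm_num
  have hY' : (∫⁻ τ in Ioo a b, ∫⁻ x, ‖u τ x‖ₑ ^ (5 * p / 3)) ^ (3 / 10 : ℝ) ≤
      ENNReal.ofReal ((K : ℝ) ^ (3 / 10 : ℝ)) * E ^ (1 / 2 : ℝ) := by
    refine (ENNReal.rpow_le_rpow hY (by norm_num)).trans_eq ?_
    rw [ENNReal.mul_rpow_of_nonneg _ _ (by norm_num), ← ENNReal.rpow_mul,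
      ← ENNReal.ofReal_rpow_of_nonneg K.coe_nonneg (by norm_num), ENNReal.ofReal_coe_nnreal]
    norm_num
  set F := (∫⁻ τ in Ioo a b, ∫⁻ x, ‖u τ x‖ₑ ^ (5 : ℝ)) ^ (1 / 5 : ℝ)
  calc _ ≤ ENNReal.ofReal (2400 * p ^ (3 / 2 : ℝ)) *
        (F * (ENNReal.ofReal ((K : ℝ) ^ (3 / 10 : ℝ)) * E ^ (1 / 2 : ℝ))) * E ^ (1 / 2 : ℝ) :=
        mul_le_mul' (mul_le_mul' le_rfl (mul_le_mul' le_rfl hY')) le_rfl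
    _ = (ENNReal.ofReal (2400 * p ^ (3 / 2 : ℝ)) * ENNReal.ofReal ((K : ℝ) ^ (3 / 10 : ℝ))) * F *
        (E ^ (1 / 2 : ℝ) * E ^ (1 / 2 : ℝ)) := by ring
    _ = _ := by
        have hp0 : 0 ≤ p := by linarith
        rw [← ENNReal.rpow_add_of_nonneg _ _ (by norm_num) (by norm_num), add_halves,
          ENNReal.rpow_one, ← ENNReal.ofReal_mul (by positivity)]
        congr 3; ring

theorem l5Norm_eq {a S : ℝ} (hu : IsSmoothBoundedLerayHopf a (a + S) u) :
    l5Norm a S u = (∫⁻ τ in Ioo a (a + S), ∫⁻ x, ‖u τ x‖ₑ ^ (5 : ℝ)) ^ (1 / 5 : ℝ) := by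
  have hm : AEMeasurable (fun z : ℝ × E3 => u z.1 z.2)
      ((volume.restrict (Ioo a (a + S))).prod volume) := by
    have := (hu.smooth.continuousOn.mono (prod_mono_left Ioo_subset_Icc_self)).aemeasurable
      (μ := volume.prod volume) (measurableSet_Ioo.prod MeasurableSet.univ)
    rwa [← Measure.prod_restrict, Measure.restrict_univ] at this
  unfold l5Norm
  rw [eLpNorm_eq_lintegral_rpow_enorm_toReal (by norm_num) (by norm_num)]
  simp only [ENNReal.toReal_ofNat]
  rw [lintegral_prod _ (hm.enorm.pow_const _)]

theorem l5Norm_lt_top {a S : ℝ} (hS : 0 < S) (hu : IsSmoothBoundedLerayHopf a (a + S) u) :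
    l5Norm a S u < ⊤ := by
  have hab : a < a + S := by linarith
  have hU := hu.isFlow hab
  rw [l5Norm_eq hu]
  refine ENNReal.rpow_lt_top_of_nonneg (by norm_num) ?_
  have h := hU.lintegral_space_time_rpow_lt_top (r := 5) (by norm_num) (a + S)
  rw [← setLIntegral_congr Ioo_ae_eq_Ioc] at h
  refine (lt_of_le_of_lt (le_of_eq ?_) h).ne
  exact setLIntegral_congr_fun measurableSet_Ioo fun τ hτ => by
    simp only [projIcc_of_mem hab.le ⟨hτ.1.le, hτ.2.le⟩]

theorem dissipation_mono {s t : ℝ} (h : s ≤ t) : dissipation p a s u ≤ dissipation p a t u :=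
  add_le_add (mul_le_mul' le_rfl (lintegral_mono_set (Ioo_subset_Ioo_right h)))
    (mul_le_mul' le_rfl (lintegral_mono_set (Ioo_subset_Ioo_right h)))

theorem lpEnergyRunning_le_lpEnergy {a S : ℝ} : lpEnergyRunning p a S u ≤ lpEnergy p a S u :=
  iSup₂_le fun s hs => add_le_add
    (le_iSup₂ (f := fun s (_ : s ∈ Icc a (a + S)) => ∫⁻ x, ‖u s x‖ₑ ^ p) s hs)
    (dissipation_mono hs.2)

theorem lpEnergy_le_two_mul {a S : ℝ} (hS : 0 ≤ S) :
    lpEnergy p a S u ≤ 2 * lpEnergyRunning p a S u := by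
  have h : ∀ s ∈ Icc a (a + S), (∫⁻ x, ‖u s x‖ₑ ^ p) + dissipation p a s u ≤
      lpEnergyRunning p a S u := fun s hs =>
    le_iSup₂ (f := fun s (_ : s ∈ Icc a (a + S)) =>
      (∫⁻ x, ‖u s x‖ₑ ^ p) + dissipation p a s u) s hs
  rw [two_mul]
  exact add_le_add (iSup₂_le fun s hs => le_self_add.trans (h s hs))
    (le_add_self.trans (h (a + S) ⟨by linarith, le_rfl⟩))

theorem eLpNorm_ofReal_rpow (hp : 0 < p) (v : E3 → E3) :
    eLpNorm v (ENNReal.ofReal p) volume ^ p = ∫⁻ x, ‖v x‖ₑ ^ p := by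
  rw [eLpNorm_eq_lintegral_rpow_enorm_toReal (by simpa using hp) ENNReal.ofReal_ne_top,
    ENNReal.toReal_ofReal hp.le, ← ENNReal.rpow_mul, one_div, inv_mul_cancel₀ hp.ne',
    ENNReal.rpow_one]

end Conclusion

end NavierStokes

theorem proposition2p2 :
    ∃ (c : ℝ) (C : ℝ → ℝ), 0 < c ∧ (∀ p : ℝ, 4 ≤ p → 0 < C p) ∧
      C ~[atTop] (fun p : ℝ => c * p ^ (3 / 2 : ℝ)) ∧
      ∀ (t₁ S p : ℝ), 0 < S → 4 ≤ p →
        ∀ u : ℝ → NavierStokes.E3 → NavierStokes.E3,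
          NavierStokes.IsSmoothBoundedLerayHopf t₁ (t₁ + S) u →
          MemLp (u t₁) 2 volume → MemLp (u t₁) (ENNReal.ofReal p) volume →
          NavierStokes.l5Norm t₁ S u < ⊤ ∧
          NavierStokes.lpEnergy p t₁ S u < ⊤ ∧
          NavierStokes.lpEnergyRunning p t₁ S u ≤
            eLpNorm (u t₁) (ENNReal.ofReal p) volume ^ p
              + ENNReal.ofReal (C p) * NavierStokes.l5Norm t₁ S u
                * NavierStokes.lpEnergyRunning p t₁ S u ∧
          NavierStokes.lpEnergy p t₁ S u ≤
            2 * eLpNorm (u t₁) (ENNReal.ofReal p) volume ^ p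
              + ENNReal.ofReal (C p) * NavierStokes.l5Norm t₁ S u
                * NavierStokes.lpEnergy p t₁ S u := by
  obtain ⟨c, hc0, hc⟩ := NavierStokes.exists_const_energy_le
  -- the factor `2` absorbs the comparison of the two energies in the last inequality
  refine ⟨2 * c, fun p => 2 * c * p ^ (3 / 2 : ℝ), by positivity, fun p hp => ?_,
    IsEquivalent.refl, fun t₁ S p hS hp u hu _ _ => ?_⟩
  · have : 0 < p := by linarith
    positivity
  have hp0 : 0 < p := by linarith
  obtain ⟨hEt, hE⟩ := hc (by linarith) hp hu
    (E := NavierStokes.lpEnergyRunning p t₁ S u) rfl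
  have hle := NavierStokes.lpEnergyRunning_le_lpEnergy (p := p) (a := t₁) (S := S) (u := u)
  have hle2 := NavierStokes.lpEnergy_le_two_mul (p := p) (a := t₁) (u := u) hS.le
  rw [← NavierStokes.l5Norm_eq hu, ← NavierStokes.eLpNorm_ofReal_rpow hp0] at hE
  have hC : 2 * ENNReal.ofReal (c * p ^ (3 / 2 : ℝ)) =
      ENNReal.ofReal (2 * c * p ^ (3 / 2 : ℝ)) := by
    rw [mul_assoc, ENNReal.ofReal_mul (p := 2) (by norm_num), ENNReal.ofReal_ofNat]
  refine ⟨NavierStokes.l5Norm_lt_top hS hu, hle2.trans_lt ?_, ?_, ?_⟩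
  · exact ENNReal.mul_lt_top (by norm_num) hEt.lt_top
  · refine hE.trans (add_le_add le_rfl (mul_le_mul' (mul_le_mul' ?_ le_rfl) le_rfl))
    rw [← hC]
    exact le_mul_of_one_le_left' one_le_two
  · calc NavierStokes.lpEnergy p t₁ S u ≤ 2 * NavierStokes.lpEnergyRunning p t₁ S u := hle2
      _ ≤ 2 * (eLpNorm (u t₁) (ENNReal.ofReal p) volume ^ p +
          ENNReal.ofReal (c * p ^ (3 / 2 : ℝ)) * NavierStokes.l5Norm t₁ S u *
            NavierStokes.lpEnergyRunning p t₁ S u) := mul_le_mul' le_rfl hE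
      _ ≤ 2 * (eLpNorm (u t₁) (ENNReal.ofReal p) volume ^ p +
          ENNReal.ofReal (c * p ^ (3 / 2 : ℝ)) * NavierStokes.l5Norm t₁ S u *
            NavierStokes.lpEnergy p t₁ S u) :=
          mul_le_mul' le_rfl (add_le_add le_rfl (mul_le_mul' le_rfl hle))
      _ = _ := by rw [← hC]; ring
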